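/- Let $\nu$ be a Lévy measure on $\mathbb R$, i.e. a Borel measure with $\nu(\{0\})=0$ and $\int_{\mathbb R} 1\wedge z^2\,\nu(dz)<\infty$ (no other condition is imposed on $\nu$), and put $\mu_0=\nu(\mathbb R\setminus[-1,1])$, $\mu_2=\int_{|z|\le 1}z^2\,\nu(dz)$. Let $H^m$ be the Sobolev space of functions in $L_2(\mathbb R)$ with distributional derivatives up to order $m$ in $L_2(\mathbb R)$, $\|g\|_{H^m}^2=\sum_{j\le m}\|\partial_x^jg\|_{L_2}^2$; pointwise values of elements of $H^m$, $m\ge1$, are those of the continuous representative. Let $(\cdot,\cdot)$ denote the $L_2(\mathbb R)$ pairing. Let $T>0$, let $m\ge 4$ be an integer and $K$ a constant. Assume: (i) $a,b,c:[0,T]\times\mathbb R\to\mathbb R$ are measurable; $b$, $c$ and $a$, together with their derivatives in $x$ up to order $m$ and up to order $\max(m,2)$ respectively, are continuous in $x$ and bounded in magnitude by $K$, uniformly in $t\in[0,T]$; (ii) $\psi\in H^m$, $f:[0,T]\to H^m$ is measurable, and $\mathcal K_m^2:=\|\psi\|_{H^m}^2+\int_0^T\|f_t\|_{H^m}^2\,dt<\infty$;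 (iii) $a_t(x)\ge 0$ for all $(t,x)$ (so the equation may degenerate). Let $u$ be the solution of $$du_t=\big[(L_t+J)u_t+f_t\big]\,dt,\qquad u_0=\psi,$$ $$L_t\phi=a_t\phi''+b_t\phi'+c_t\phi,\qquad J\phi(x)=\int_{\mathbb R}\big(\phi(x+z)-\phi(x)-1_{|z|\le1}z\phi'(x)\big)\nu(dz),$$ that is, $u:[0,T]\to H^1$ is weakly continuous and for all $\phi\in C_c^\infty(\mathbb R)$ and $t\in[0,T]$ $$\begin{aligned}(u_t,\phi)=(\psi,\phi)&+\int_0^t\Big[(\partial_xu_s,-\phi\,\partial_xa_s-a_s\partial_x\phi+b_s\phi)+(c_su_s,\phi)+(f_s,\phi)\Big]ds\\&-\int_0^t\int_{|z|\le1}\int_0^1(1-\theta)z^2(\partial_xu_s(\cdot+\theta z),\partial_x\phi)\,d\theta\,\nu(dz)\,ds\\&+\int_0^t\int_{|z|>1}(u_s(\cdot+z)-u_s,\phi)\,\nu(dz)\,ds.\end{aligned}$$ Let $h\in\{1/n:n=1,2,\dots\}$, $\mathbb G_h=h\mathbb Z$, and let $l_2(\mathbb G_h)$ be the space of $\phi:\mathbb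 G_h\to\mathbb R$ with $\|\phi\|_{l_2(\mathbb G_h)}^2=h\sum_{x\in\mathbb G_h}|\phi(x)|^2<\infty$. For $\lambda\ne0$ let $\delta_\lambda\phi(x)=(\phi(x+\lambda)-\phi(x))/\lambda$, and let $\delta^\lambda=(\delta_\lambda+\delta_{-\lambda})/2$. Let $B^h_k=((k-1)h,kh]$ for integers $k\ge1$ and $B^h_k=[kh,(k+1)h)$ for integers $k\le-1$. Define $$L_t^h\phi=a_t\,\delta^h\delta^h\phi+b_t\,\delta^h\phi+c_t\,\phi,\qquad J^h=J_1^h+J_2^h,$$ $$J_1^h\phi(x)=\sum_{0<|k|\le1/h}\zeta_k^h\sum_{l=0}^{|k|-1}\theta_k^l\,\delta_{-h}\delta_h\phi(x+s_klh),\qquad J_2^h\phi(x)=\sum_{|k|>1/h}\big(\phi(x+hk)-\phi(x)\big)\nu(B_k^h),$$ where $k$ runs through integers, $s_k=k/|k|$, $\zeta_k^h=\int_{B_k^h}z^2\,\nu(dz)$ and $\theta_k^l=\int_{l/|k|}^{(l+1)/|k|}(1-\theta)\,d\theta$. Let $v^h$ be the solution of the scheme $$dv^h_t=\big((L_t^h+J^h)v_t^h+f_t\big)\,dt,\qquad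 v^h_0=\psi\qquad\text{in }l_2(\mathbb G_h),$$ i.e. $v^h:[0,T]\to l_2(\mathbb G_h)$ is continuous and $v_t^h(x)=\psi(x)+\int_0^t\big[(L_s^h+J^h)v^h_s(x)+f_s(x)\big]ds$ for all $t\in[0,T]$, $x\in\mathbb G_h$. Then $$\sup_{t\in[0,T]}\sup_{x\in\mathbb G_h}|u_t(x)-v_t^h(x)|^2+\sup_{t\in[0,T]}\|u_t-v^h_t\|_{l_2(\mathbb G_h)}^2\le N h^2\mathcal K_m^2,$$ where $N$ is a constant depending only on $m,K,\mu_0,\mu_2$ and $T$. -/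

import Mathlib

open MeasureTheory Set
open scoped ENNReal ContDiff

namespace LevyFD

noncomputable section

/-! ### Sobolev spaces on the real line -/

/-- Test functions: smooth, compactly supported real functions on `ℝ`. -/
def IsTestFunction (φ : ℝ → ℝ) : Prop :=
  ContDiff ℝ ∞ φ ∧ HasCompactSupport φ

/-- `w ∈ L₂(ℝ)` is the `j`-th distributional derivative of `g ∈ L₂(ℝ)`. -/
def IsWeakDeriv (j : ℕ) (g w : Lp ℝ 2 (volume : Measure ℝ)) : Prop :=
  ∀ φ : ℝ → ℝ, IsTestFunction φ →
    ∫ x, w x * φ x = (-1) ^ j * ∫ x, g x * iteratedDeriv j φ x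

theorem integrable_mul_of_continuous (g : Lp ℝ 2 (volume : Measure ℝ)) {φ : ℝ → ℝ}
    (hc : Continuous φ) (hs : HasCompactSupport φ) : Integrable (fun x => g x * φ x) :=
  MemLp.integrable_mul (p := 2) (q := 2) (Lp.memLp g) (hc.memLp_of_hasCompactSupport hs)

theorem IsTestFunction.iteratedDeriv_continuous {φ : ℝ → ℝ} (hφ : IsTestFunction φ) (j : ℕ) :
    Continuous (iteratedDeriv j φ) :=
  hφ.1.continuous_iteratedDeriv j (by exact_mod_cast le_top)

theorem IsTestFunction.iteratedDeriv_hasCompactSupport {φ : ℝ → ℝ} (hφ : IsTestFunction φ)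
    (j : ℕ) : HasCompactSupport (iteratedDeriv j φ) := by
  induction j with
  | zero => simpa using hφ.2
  | succ j ih => rw [iteratedDeriv_succ]; exact ih.deriv

theorem integrable_mul_iteratedDeriv (g : Lp ℝ 2 (volume : Measure ℝ)) {φ : ℝ → ℝ}
    (hφ : IsTestFunction φ) (j : ℕ) : Integrable (fun x => g x * iteratedDeriv j φ x) :=
  integrable_mul_of_continuous g (hφ.iteratedDeriv_continuous j)
    (hφ.iteratedDeriv_hasCompactSupport j)

theorem integrable_mul_test (g : Lp ℝ 2 (volume : Measure ℝ)) {φ : ℝ → ℝ}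
    (hφ : IsTestFunction φ) : Integrable (fun x => g x * φ x) :=
  integrable_mul_of_continuous g hφ.1.continuous hφ.2

theorem integral_add_mul (g g' : Lp ℝ 2 (volume : Measure ℝ)) {φ : ℝ → ℝ}
    (h : Integrable (fun x => g x * φ x)) (h' : Integrable (fun x => g' x * φ x)) :
    ∫ x, (g + g' : Lp ℝ 2 (volume : Measure ℝ)) x * φ x
      = (∫ x, g x * φ x) + ∫ x, g' x * φ x := by
  rw [← integral_add h h']
  refine integral_congr_ae ?_
  filter_upwards [Lp.coeFn_add g g'] with x hx
  rw [hx, Pi.add_apply, add_mul]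

theorem integral_smul_mul (r : ℝ) (g : Lp ℝ 2 (volume : Measure ℝ)) (φ : ℝ → ℝ) :
    ∫ x, (r • g : Lp ℝ 2 (volume : Measure ℝ)) x * φ x = r * ∫ x, g x * φ x := by
  rw [← integral_const_mul]
  refine integral_congr_ae ?_
  filter_upwards [Lp.coeFn_smul r g] with x hx
  rw [hx, Pi.smul_apply, smul_eq_mul, mul_assoc]

theorem integral_zero_mul (φ : ℝ → ℝ) :
    ∫ x, (0 : Lp ℝ 2 (volume : Measure ℝ)) x * φ x = 0 := by
  have h := integral_smul_mul 0 0 φ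
  rwa [zero_smul, zero_mul] at h

/-- The Sobolev space `H^m` on `ℝ`: an element is recorded as the tuple `(g, ∂g, …, ∂^m g)` of
its distributional derivatives, all in `L₂(ℝ)`. The norm inherited from the `ℓ²`-product is
`‖g‖² = ∑_{j ≤ m} ‖∂^j g‖²_{L₂}`. -/
def sobolev (m : ℕ) :
    Submodule ℝ (PiLp 2 (fun _ : Fin (m + 1) => Lp ℝ 2 (volume : Measure ℝ))) where
  carrier := {g | ∀ j : Fin (m + 1), IsWeakDeriv j (g 0) (g j)}
  zero_mem' := by
    intro j φ _
    simp only [PiLp.zero_apply]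
    rw [integral_zero_mul, integral_zero_mul, mul_zero]
  add_mem' := by
    intro g g' hg hg' j φ hφ
    simp only [PiLp.add_apply]
    rw [integral_add_mul _ _ (integrable_mul_test _ hφ) (integrable_mul_test _ hφ),
      integral_add_mul _ _ (integrable_mul_iteratedDeriv _ hφ _)
        (integrable_mul_iteratedDeriv _ hφ _), hg j φ hφ, hg' j φ hφ]
    ring
  smul_mem' := by
    intro r g hg j φ hφ
    simp only [PiLp.smul_apply]
    rw [integral_smul_mul, integral_smul_mul, hg j φ hφ]
    ring

/-- The type of elements of `H^m`, a real inner product space. -/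
abbrev H (m : ℕ) : Type := sobolev m

/-- The `j`-th derivative of `g ∈ H^m`, as a function (determined up to null sets). -/
def H.D {m : ℕ} (g : H m) (j : Fin (m + 1)) : ℝ → ℝ := fun x => (g.1 j) x

open Classical in
/-- The continuous representative of a function on `ℝ` that is almost everywhere equal to a
continuous one (such a representative is unique). -/
def contRep (g : ℝ → ℝ) : ℝ → ℝ :=
  if hg : ∃ φ : ℝ → ℝ, Continuous φ ∧ φ =ᵐ[volume] g then hg.choose else 0

/-- The pointwise values of `g ∈ H^m` (for `m ≥ 1`): those of its continuous representative. -/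
def H.eval {m : ℕ} (g : H m) : ℝ → ℝ := contRep (g.D 0)

/-! ### The Lévy measure and the data -/

/-- A Lévy measure on `ℝ`: `ν({0}) = 0` and `∫ 1 ∧ z² ν(dz) < ∞`. -/
structure IsLevyMeasure (ν : Measure ℝ) : Prop where
  zero : ν {0} = 0
  finite : ∫⁻ z, ENNReal.ofReal (min 1 (z ^ 2)) ∂ν < ⊤

/-- `μ₀ = ν(ℝ \ [-1,1])`. -/
def mu0 (ν : Measure ℝ) : ℝ := ν.real (Icc (-1) 1)ᶜ

/-- `μ₂ = ∫_{|z| ≤ 1} z² ν(dz)`. -/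
def mu2 (ν : Measure ℝ) : ℝ := ∫ z in Icc (-1) 1, z ^ 2 ∂ν

/-- The coefficients `a, b, c` on `[0,T] × ℝ` are measurable in `(t,x)`; `b, c` and `a`, with
their spatial derivatives up to order `m` and up to order `max m 2` respectively, are continuous
in `x` and bounded in magnitude by `K`. -/
structure BoundedCoefficients (m : ℕ) (K T : ℝ) (a b c : ℝ → ℝ → ℝ) : Prop where
  measurable_a : Measurable fun p : Icc (0 : ℝ) T × ℝ => a p.1 p.2
  measurable_b : Measurable fun p : Icc (0 : ℝ) T × ℝ => b p.1 p.2
  measurable_c : Measurable fun p : Icc (0 : ℝ) T × ℝ => c p.1 p.2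
  contDiff_a : ∀ t ∈ Icc 0 T, ContDiff ℝ (max m 2 : ℕ) (a t)
  contDiff_b : ∀ t ∈ Icc 0 T, ContDiff ℝ m (b t)
  contDiff_c : ∀ t ∈ Icc 0 T, ContDiff ℝ m (c t)
  bound_a : ∀ t ∈ Icc 0 T, ∀ j ≤ max m 2, ∀ x, |iteratedDeriv j (a t) x| ≤ K
  bound_b : ∀ t ∈ Icc 0 T, ∀ j ≤ m, ∀ x, |iteratedDeriv j (b t) x| ≤ K
  bound_c : ∀ t ∈ Icc 0 T, ∀ j ≤ m, ∀ x, |iteratedDeriv j (c t) x| ≤ K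

/-- `𝒦_m² = ‖ψ‖²_{H^m} + ∫₀ᵀ ‖f_t‖²_{H^m} dt`. -/
def dataSq {m : ℕ} (T : ℝ) (ψ : H m) (f : ℝ → H m) : ℝ :=
  ‖ψ‖ ^ 2 + ∫ t in (0 : ℝ)..T, ‖f t‖ ^ 2

/-! ### The integro-differential equation -/

/-- `u : [0,T] → H¹` is a solution of `du = [(L_t + J) u + f] dt`, `u₀ = ψ`, where
`L_t φ = a φ'' + b φ' + c φ` and
`J φ (x) = ∫ (φ (x + z) - φ x - 1_{|z| ≤ 1} z φ' x) ν(dz)`: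
it is weakly continuous in `H¹` and satisfies the equation tested with every `φ ∈ C_c^∞`. -/
structure IsSolution {m : ℕ} (T : ℝ) (ν : Measure ℝ) (a b c : ℝ → ℝ → ℝ) (ψ : H m)
    (f : ℝ → H m) (u : ℝ → H 1) : Prop where
  weaklyContinuous : ∀ w : H 1, ContinuousOn (fun t => inner ℝ (u t) w) (Icc 0 T)
  equation : ∀ φ : ℝ → ℝ, IsTestFunction φ → ∀ t ∈ Icc 0 T,
    ∫ x, (u t).D 0 x * φ x =
      (∫ x, ψ.D 0 x * φ x)
      + (∫ s in (0 : ℝ)..t,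
          ((∫ x, (u s).D 1 x * (-(φ x * deriv (a s) x) - a s x * deriv φ x + b s x * φ x))
            + ∫ x, c s x * (u s).D 0 x * φ x))
      - (∫ s in (0 : ℝ)..t, ∫ z in {z : ℝ | |z| ≤ 1}, (∫ θ in (0 : ℝ)..1,
          (1 - θ) * z ^ 2 * ∫ x, (u s).D 1 (x + θ * z) * deriv φ x) ∂ν)
      + (∫ s in (0 : ℝ)..t, ∫ z in {z : ℝ | 1 < |z|},
          (∫ x, ((u s).D 0 (x + z) - (u s).D 0 x) * φ x) ∂ν)
      + ∫ s in (0 : ℝ)..t, ∫ x, (f s).D 0 x * φ x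

/-! ### The finite difference scheme

A function on the grid `hℤ` is written as a function of `k ∈ ℤ`, its value at `k` being the value
at the grid point `k h`. -/

/-- The admissible mesh sizes `{1/n : n = 1, 2, …}`. -/
def meshSizes : Set ℝ := {h | ∃ n : ℕ, 0 < n ∧ h = 1 / n}

/-- `δ_λ` on grid functions, for `λ = j h`: `(φ (x + λ) - φ x) / λ`. -/
def diffQuot (h : ℝ) (j : ℤ) (φ : ℤ → ℝ) : ℤ → ℝ :=
  fun k => (φ (k + j) - φ k) / (j * h)

/-- The symmetric difference `δ^h = (δ_h + δ_{-h}) / 2`. -/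
def centralDiff (h : ℝ) (φ : ℤ → ℝ) : ℤ → ℝ :=
  fun k => (diffQuot h 1 φ k + diffQuot h (-1) φ k) / 2

/-- `L_t^h φ = a_t δ^h δ^h φ + b_t δ^h φ + c_t φ`, for the coefficients `a, b, c` frozen at a
time. -/
def Lh (h : ℝ) (a b c : ℝ → ℝ) (φ : ℤ → ℝ) : ℤ → ℝ :=
  fun k => a (k * h) * centralDiff h (centralDiff h φ) k + b (k * h) * centralDiff h φ k + c (k * h) * φ k

/-- The cells `B^h_k = ((k-1)h, kh]` for `k ≥ 1` and `B^h_k = [kh, (k+1)h)` for `k ≤ -1`. -/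
def cell (h : ℝ) (k : ℤ) : Set ℝ :=
  if 1 ≤ k then Ioc ((k - 1) * h) (k * h)
  else if k ≤ -1 then Ico (k * h) ((k + 1) * h)
  else ∅

/-- `𝔸_h = {k ∈ ℤ : |k| ≤ 1/h, k ≠ 0}`. -/
def nearIndices (h : ℝ) : Finset ℤ := (Finset.Icc (-⌊1 / h⌋) ⌊1 / h⌋).erase 0

theorem mem_nearIndices (h : ℝ) (k : ℤ) :
    k ∈ nearIndices h ↔ |(k : ℝ)| ≤ 1 / h ∧ k ≠ 0 := by
  rw [nearIndices, Finset.mem_erase, Finset.mem_Icc, ← abs_le, Int.le_floor, Int.cast_abs]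
  exact and_comm

/-- `𝔹_h = ℤ \ (𝔸_h ∪ {0})`. -/
def farIndices (h : ℝ) : Set ℤ := {k | k ∉ nearIndices h ∧ k ≠ 0}

/-- `ζ^h_k = ∫_{B^h_k} z² ν(dz)`. -/
def zeta (ν : Measure ℝ) (h : ℝ) (k : ℤ) : ℝ := ∫ z in cell h k, z ^ 2 ∂ν

/-- `θ_k^l = ∫_{l/|k|}^{(l+1)/|k|} (1 - θ) dθ`. -/
def theta (k : ℤ) (l : ℕ) : ℝ :=
  ∫ θ in ((l : ℝ) / |(k : ℝ)|)..(((l : ℝ) + 1) / |(k : ℝ)|), (1 - θ)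

/-- `J₁^h φ (x) = ∑_{k ∈ 𝔸_h} ζ^h_k ∑_{l < |k|} θ_k^l δ_{-h} δ_h φ (x + s_k l h)`, with
`s_k = k / |k|`. -/
def J1h (ν : Measure ℝ) (h : ℝ) (φ : ℤ → ℝ) : ℤ → ℝ :=
  fun i => ∑ k ∈ nearIndices h, zeta ν h k *
    ∑ l ∈ Finset.range k.natAbs, theta k l *
      diffQuot h (-1) (diffQuot h 1 φ) (i + k.sign * l)

/-- `J₂^h φ (x) = ∑_{k ∈ 𝔹_h} (φ (x + h k) - φ x) ν(B^h_k)`. -/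
def J2h (ν : Measure ℝ) (h : ℝ) (φ : ℤ → ℝ) : ℤ → ℝ :=
  fun i => ∑' k : farIndices h, (φ (i + k) - φ i) * ν.real (cell h k)

/-- `J^h = J₁^h + J₂^h`. -/
def Jh (ν : Measure ℝ) (h : ℝ) (φ : ℤ → ℝ) : ℤ → ℝ :=
  fun i => J1h ν h φ i + J2h ν h φ i

/-- `v : [0,T] → l₂(hℤ)` is a solution of the scheme `dv = ((L^h_t + J^h) v + f_t) dt`, `v₀ = ψ`:
it is continuous in `l₂` and satisfies the integrated equation at every grid point. -/
structure IsGridSolution {m : ℕ} (T : ℝ) (ν : Measure ℝ) (a b c : ℝ → ℝ → ℝ) (ψ : H m)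
    (f : ℝ → H m) (h : ℝ) (v : ℝ → lp (fun _ : ℤ => ℝ) 2) : Prop where
  continuousOn : ContinuousOn v (Icc 0 T)
  equation : ∀ t ∈ Icc 0 T, ∀ k : ℤ,
    v t k = ψ.eval (k * h)
      + ∫ s in (0 : ℝ)..t,
          (Lh h (a s) (b s) (c s) (v s) k + Jh ν h (v s) k + (f s).eval (k * h))

/-- The squared norm `‖φ‖²_{l₂(hℤ)} = h ∑_x |φ x|²`, with value `∞` if `φ ∉ l₂(hℤ)`. -/
def gridNormSq (h : ℝ) (φ : ℤ → ℝ) : ℝ≥0∞ :=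
  ENNReal.ofReal h * ∑' k : ℤ, ENNReal.ofReal (|φ k| ^ 2)

end

end LevyFD

namespace LevyFD
noncomputable section
open Filter Topology

/-! ### Test functions and weak derivatives -/

/-! The truncation error is never expressed through derivatives of `u`; no regularity of `u` beyond
`H¹` is used. Instead the schemes on the dyadic refinements `h`, `h/2`, `h/4`, ... are compared with
one another, the differences are summed as a geometric series, and the limit is recognised as `u` by
uniqueness.

Comparison on one lattice. The scheme of mesh `2ε` is written on `εℤ` with stride two. It then
couples only points of equal parity, and its even points carry the scheme of mesh `2ε`
(`restrictEven_schemeOp`, `IsScheme.restrictEven`). The stride-two and stride-one schemes are now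
linear evolution equations in the same `ℓ²`. Their difference solves the stride-two equation with
zero initial value, forced by the difference of the two operators applied to the stride-one solution
(`IsScheme.sobSq_sub_le`).

Stability, uniform in the mesh, in discrete Sobolev norms up to order four:
`inner_delta_pow_Aop_le`, followed by Gronwall in `sobSq_le_of_evolution`. The jump operators
commute with differences and have nonpositive quadratic form, because the correlation `⟨shift p w,
w⟩` is largest at `p = 0`. In the Leibniz expansion of the possibly degenerate second order term
there are three cases. If no difference falls on `a`, the term is dissipative up to a second
difference of `a`, by `a ≥ 0`. If exactly one does, the term is antisymmetric up to a bounded error,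
thanks to the symmetric form of the Leibniz rule. If at least two do, it is of lower order.
Ellipticity plays no role.

Consistency: replacing mesh `2ε` by mesh `ε` costs `O(ε)` in the discrete `H¹` norm, measured by
four differences of the solution (`sobSq_schemeOp_sub_le`): three for the operators and one more for
the `H¹` norm. This is why `m ≥ 4` is asked. The jump part is compared through an integral over `θ`
in which both discretisations are step functions (`norm_avgLap_sub_le`).

Traces: the discrete `H¹` norm on a fine lattice controls the sup norm and the `ℓ²` norm on every
coarser sublattice of spacing at most one, with a constant that does not see the ratio of the
spacings (`Seq.trace_bound`). Hence successive approximations differ by `O(h 2^{-j})` on `hℤ`, in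
both norms of the theorem (`IsDyadicCauchy.error_bound`).

Identification of the limit: the lattice functions converge to a Lipschitz function lying in `H¹`
(`IsDyadicCauchy.isH1`). Summation by parts moves all differences to the test function, so that the
limit satisfies the weak equation (`dyadicLim_equation`). Uniqueness for weakly continuous `H¹`
curves (`IsSolution.unique`) follows from an energy identity that needs no time derivative
(`energy_identity`), an upper bound of the form by the `L₂` norm (`Coeffs.form_self_le`), and
Gronwall. -/

theorem IsTestFunction.continuous {φ : ℝ → ℝ} (hφ : IsTestFunction φ) : Continuous φ :=
  hφ.1.continuous

theorem IsTestFunction.memLp {φ : ℝ → ℝ} (hφ : IsTestFunction φ) : MemLp φ 2 volume :=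
  hφ.continuous.memLp_of_hasCompactSupport hφ.2

theorem IsTestFunction.differentiable {φ : ℝ → ℝ} (hφ : IsTestFunction φ) :
    Differentiable ℝ φ := hφ.1.differentiable (by simp)

theorem IsTestFunction.deriv {φ : ℝ → ℝ} (hφ : IsTestFunction φ) : IsTestFunction (deriv φ) :=
  ⟨(contDiff_infty_iff_deriv.1 hφ.1).2, hφ.2.deriv⟩

theorem IsTestFunction.mul_smooth {φ χ : ℝ → ℝ} (hφ : IsTestFunction φ) (hχ : ContDiff ℝ ∞ χ) :
    IsTestFunction fun x => χ x * φ x :=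
  ⟨hχ.mul hφ.1, hφ.2.mul_left⟩

theorem IsTestFunction.add {φ χ : ℝ → ℝ} (hφ : IsTestFunction φ) (hχ : IsTestFunction χ) :
    IsTestFunction fun x => φ x + χ x :=
  ⟨hφ.1.add hχ.1, hφ.2.add hχ.2⟩

theorem IsTestFunction.const_mul {φ : ℝ → ℝ} (hφ : IsTestFunction φ) (c : ℝ) :
    IsTestFunction fun x => c * φ x :=
  hφ.mul_smooth contDiff_const

/-- The primitive started far to the left vanishes there, and to the right of the support it equals
the total integral; mean zero is exactly what makes its support compact. -/
theorem IsTestFunction.exists_primitive {η : ℝ → ℝ} (hη : IsTestFunction η)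
    (h0 : ∫ x, η x = 0) : ∃ φ, IsTestFunction φ ∧ _root_.deriv φ = η := by
  obtain ⟨R, hR⟩ := hη.2.isCompact.isBounded.subset_closedBall 0
  have hz : ∀ x, R < |x| → η x = 0 := by
    intro x hx
    by_contra hne
    have := hR (subset_tsupport _ hne)
    rw [mem_closedBall_zero_iff, Real.norm_eq_abs] at this
    linarith
  let S := |R| + 1
  have hRS : R < S := lt_of_le_of_lt (le_abs_self R) (lt_add_one _)
  have hS : 0 < S := by positivity
  have hd : ∀ x, HasDerivAt (fun x => ∫ t in (-S)..x, η t) (η x) x := fun x =>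
    intervalIntegral.integral_hasDerivAt_right (hη.continuous.intervalIntegrable _ _)
      hη.continuous.aestronglyMeasurable.stronglyMeasurableAtFilter hη.continuous.continuousAt
  have hderiv : _root_.deriv (fun x => ∫ t in (-S)..x, η t) = η := funext fun x => (hd x).deriv
  refine ⟨fun x => ∫ t in (-S)..x, η t, ⟨contDiff_infty_iff_deriv.2
    ⟨fun x => (hd x).differentiableAt, by rw [hderiv]; exact hη.1⟩, ?_⟩, hderiv⟩
  have hful : ∫ t in (-S)..S, η t = 0 := by
    rw [intervalIntegral.integral_eq_integral_of_support_subset, h0]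
    intro x hx
    by_contra hne
    apply hx
    apply hz
    rw [mem_Ioc, not_and_or] at hne
    rcases hne with h | h
    · push Not at h
      rw [abs_of_nonpos (by linarith)]; linarith
    · push Not at h
      rw [abs_of_pos (by linarith)]; linarith
  refine HasCompactSupport.intro (isCompact_closedBall (0 : ℝ) S) fun x hx => ?_
  rw [mem_closedBall_zero_iff, Real.norm_eq_abs, not_le, lt_abs] at hx
  have hzero : ∀ a b : ℝ, (∀ x ∈ uIcc a b, R < |x|) → ∫ t in a..b, η t = 0 := by
    intro a b hab
    rw [intervalIntegral.integral_congr (g := fun _ => 0) (fun x hx => hz x (hab x hx))]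
    simp
  rcases hx with hx | hx
  · rw [← intervalIntegral.integral_add_adjacent_intervals
      (hη.continuous.intervalIntegrable (-S) S) (hη.continuous.intervalIntegrable S x), hful,
      zero_add]
    apply hzero
    intro y hy
    rw [uIcc_of_le hx.le] at hy
    rw [abs_of_pos (by linarith [hy.1])]; linarith [hy.1]
  · apply hzero
    intro y hy
    rw [uIcc_of_ge (by linarith)] at hy
    rw [abs_of_neg (by linarith [hy.2])]; linarith [hy.2]

theorem exists_testFunction_integral_one : ∃ χ : ℝ → ℝ, IsTestFunction χ ∧ ∫ x, χ x = 1 := by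
  let B : ContDiffBump (0 : ℝ) := ⟨1, 2, by norm_num, by norm_num⟩
  exact ⟨B.normed volume, ⟨B.contDiff_normed, B.hasCompactSupport_normed⟩, B.integral_normed⟩

/-- A locally integrable function with vanishing distributional derivative is constant. -/
theorem ae_eq_const_of_integral_mul_deriv_eq_zero {g : ℝ → ℝ} (hg : LocallyIntegrable g)
    (h : ∀ φ, IsTestFunction φ → ∫ x, g x * deriv φ x = 0) : ∃ c : ℝ, ∀ᵐ x, g x = c := by
  obtain ⟨χ, hχ, hχ1⟩ := exists_testFunction_integral_one
  have hint : ∀ η : ℝ → ℝ, IsTestFunction η → Integrable fun x => g x * η x := by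
    intro η hη
    simpa [mul_comm] using hg.integrable_smul_left_of_hasCompactSupport hη.continuous hη.2
  have hi : ∀ η : ℝ → ℝ, IsTestFunction η → Integrable η := fun η hη =>
    hη.continuous.integrable_of_hasCompactSupport hη.2
  refine ⟨∫ x, g x * χ x, ?_⟩
  set c := ∫ x, g x * χ x
  refine ae_eq_of_integral_contDiff_smul_eq hg (locallyIntegrable_const c) fun η hη1 hη2 => ?_
  have hη : IsTestFunction η := ⟨hη1, hη2⟩
  -- Subtracting a multiple of `χ` gives mean zero, hence a derivative of a test function; the
  -- hypothesis then reads `∫ g η = c ∫ η`.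
  have hξ : IsTestFunction fun x => η x + (-∫ y, η y) * χ x := hη.add (hχ.const_mul _)
  obtain ⟨φ, hφ, hd⟩ := hξ.exists_primitive (by
    rw [integral_add (hi _ hη) ((hi _ hχ).const_mul _), integral_const_mul, hχ1]; ring)
  have h1 := h φ hφ
  rw [hd] at h1
  have h2 : ∫ x, g x * (η x + (-∫ y, η y) * χ x)
      = (∫ x, g x * η x) + (-∫ y, η y) * c := by
    rw [← integral_const_mul, ← integral_add (hint _ hη) ((hint _ hχ).const_mul _)]
    congr 1; ext x; ring
  rw [h2] at h1
  simp only [smul_eq_mul]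
  rw [integral_mul_const]
  simp only [mul_comm (η _)]
  linarith

/-! ### Completeness of `H m` and density of test functions in `H 1`. -/

theorem integral_mul_toLp (g : Lp ℝ 2 (volume : Measure ℝ)) {φ : ℝ → ℝ} (hφ : MemLp φ 2 volume) :
    ∫ x, g x * φ x = inner ℝ g hφ.toLp := by
  rw [L2.inner_def]
  refine integral_congr_ae ?_
  filter_upwards [hφ.coeFn_toLp] with x hx
  rw [hx]; simp [mul_comm]

/-- Each defining identity equates two continuous linear functionals, because test functions and
their derivatives lie in `L₂`. Completeness is needed later for orthogonal complements, adjoints and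
Banach-Steinhaus in `H 1`. -/
theorem isClosed_sobolev (m : ℕ) :
    IsClosed (sobolev m : Set (PiLp 2 (fun _ : Fin (m + 1) => Lp ℝ 2 (volume : Measure ℝ)))) := by
  have : (sobolev m : Set (PiLp 2 (fun _ : Fin (m + 1) => Lp ℝ 2 (volume : Measure ℝ))))
      = ⋂ j : Fin (m + 1), ⋂ φ : {φ // IsTestFunction φ},
        {g | ∫ x, g j x * φ.1 x = (-1) ^ (j : ℕ) * ∫ x, g 0 x * iteratedDeriv j φ.1 x} := by
    ext g
    simp [sobolev, IsWeakDeriv]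
  rw [this]
  refine isClosed_iInter fun j => isClosed_iInter fun φ => ?_
  have hm : MemLp (iteratedDeriv j φ.1) 2 volume :=
    (φ.2.iteratedDeriv_continuous j).memLp_of_hasCompactSupport
      (φ.2.iteratedDeriv_hasCompactSupport j)
  have h1 := fun g : PiLp 2 (fun _ : Fin (m + 1) => Lp ℝ 2 (volume : Measure ℝ)) =>
    integral_mul_toLp (g j) φ.2.memLp
  have h2 := fun g : PiLp 2 (fun _ : Fin (m + 1) => Lp ℝ 2 (volume : Measure ℝ)) =>
    integral_mul_toLp (g 0) hm
  simp only [h1, h2]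
  have c : ∀ i, Continuous fun g : PiLp 2 (fun _ : Fin (m + 1) => Lp ℝ 2 (volume : Measure ℝ)) =>
    g i := fun i => PiLp.continuous_apply 2 _ i
  exact isClosed_eq ((c j).inner continuous_const) (continuous_const.mul ((c 0).inner continuous_const))

instance (m : ℕ) : CompleteSpace (H m) := (isClosed_sobolev m).completeSpace_coe

/-- The pair `(g, w)` of an `L₂` function and its weak derivative as an element of `H¹`. -/
def H.mk (g w : Lp ℝ 2 (volume : Measure ℝ))
    (h : ∀ φ, IsTestFunction φ → ∫ x, w x * φ x = -∫ x, g x * deriv φ x) : H 1 :=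
  ⟨WithLp.toLp 2 ![g, w], by
    intro j φ hφ
    fin_cases j
    · simp
    · simpa [iteratedDeriv_one] using h φ hφ⟩

theorem H.ext_one {g g' : H 1} (h0 : g.1 0 = g'.1 0) (h1 : g.1 1 = g'.1 1) : g = g' := by
  apply Subtype.ext
  ext1 j
  fin_cases j
  · exact h0
  · exact h1

theorem H.inner_one (g g' : H 1) :
    inner ℝ g g' = inner ℝ (g.1 0) (g'.1 0) + inner ℝ (g.1 1) (g'.1 1) := by
  rw [Submodule.coe_inner, PiLp.inner_apply, Fin.sum_univ_two]

theorem H.norm_sq_one (g : H 1) : ‖g‖ ^ 2 = ‖g.1 0‖ ^ 2 + ‖g.1 1‖ ^ 2 := by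
  rw [← real_inner_self_eq_norm_sq, H.inner_one, real_inner_self_eq_norm_sq,
    real_inner_self_eq_norm_sq]

theorem integral_deriv_mul_of_test {f φ : ℝ → ℝ} (hf : ContDiff ℝ 1 f) (hφ : ContDiff ℝ 1 φ)
    (hc : HasCompactSupport φ) : ∫ x, deriv f x * φ x = -∫ x, f x * deriv φ x := by
  have hf' := hf.continuous_deriv le_rfl
  have hφ' := hφ.continuous_deriv le_rfl
  have := integral_mul_deriv_eq_deriv_mul_of_integrable (u := f) (v := φ) (u' := deriv f)
    (v' := deriv φ) (fun x _ => (hf.differentiable one_ne_zero x).hasDerivAt)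
    (fun x _ => (hφ.differentiable one_ne_zero x).hasDerivAt)
    ((hf.continuous.mul hφ').integrable_of_hasCompactSupport hc.deriv.mul_left)
    ((hf'.mul hφ.continuous).integrable_of_hasCompactSupport hc.mul_left)
    ((hf.continuous.mul hφ.continuous).integrable_of_hasCompactSupport hc.mul_left)
  rw [this, neg_neg]

theorem IsTestFunction.contDiff_one {φ : ℝ → ℝ} (hφ : IsTestFunction φ) : ContDiff ℝ 1 φ :=
  hφ.1.of_le (by exact_mod_cast le_top)

/-- A test function as an element of `H¹`. -/
def IsTestFunction.toH {φ : ℝ → ℝ} (hφ : IsTestFunction φ) : H 1 :=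
  H.mk hφ.memLp.toLp hφ.deriv.memLp.toLp (by
    intro χ hχ
    have h1 : ∫ x, (hφ.deriv.memLp.toLp : Lp ℝ 2 (volume : Measure ℝ)) x * χ x
        = ∫ x, _root_.deriv φ x * χ x := by
      refine integral_congr_ae ?_
      filter_upwards [hφ.deriv.memLp.coeFn_toLp] with x hx
      rw [hx]
    have h2 : ∫ x, (hφ.memLp.toLp : Lp ℝ 2 (volume : Measure ℝ)) x * _root_.deriv χ x
        = ∫ x, φ x * _root_.deriv χ x := by
      refine integral_congr_ae ?_
      filter_upwards [hφ.memLp.coeFn_toLp] with x hx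
      rw [hx]
    rw [h1, h2, integral_deriv_mul_of_test hφ.contDiff_one hχ.contDiff_one hχ.2])

theorem IsTestFunction.toH_D_zero {φ : ℝ → ℝ} (hφ : IsTestFunction φ) :
    hφ.toH.D 0 =ᵐ[volume] φ := hφ.memLp.coeFn_toLp

theorem IsTestFunction.toH_D_one {φ : ℝ → ℝ} (hφ : IsTestFunction φ) :
    hφ.toH.D 1 =ᵐ[volume] _root_.deriv φ := hφ.deriv.memLp.coeFn_toLp

theorem IsTestFunction.toH_eq {φ : ℝ → ℝ} (hφ : IsTestFunction φ) {g : H 1}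
    (h0 : φ =ᵐ[volume] g.D 0) (h1 : _root_.deriv φ =ᵐ[volume] g.D 1) : hφ.toH = g :=
  H.ext_one (Lp.ext (hφ.toH_D_zero.trans h0)) (Lp.ext (hφ.toH_D_one.trans h1))

theorem H.weakDeriv (g : H 1) {φ : ℝ → ℝ} (hφ : IsTestFunction φ) :
    ∫ x, g.D 1 x * φ x = -∫ x, g.D 0 x * deriv φ x := by
  have := g.2 1 φ hφ
  simpa [iteratedDeriv_one, H.D] using this

theorem H.memLp_D {m : ℕ} (g : H m) (j : Fin (m + 1)) : MemLp (g.D j) 2 volume := Lp.memLp _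

/-- `L₂` solutions of `G' = s G` vanish. -/
theorem ae_eq_zero_of_weakDeriv_eq_self {G : ℝ → ℝ} (hG : MemLp G 2 volume) {s : ℝ}
    (h : ∀ φ, IsTestFunction φ → ∫ x, G x * (deriv φ x + s * φ x) = 0) : ∀ᵐ x, G x = 0 := by
  have hloc : LocallyIntegrable G := hG.locallyIntegrable (by norm_num)
  have hsm : ContDiff ℝ ∞ fun x => Real.exp (-s * x) := by fun_prop
  have hd : ∀ x, HasDerivAt (fun x => Real.exp (-s * x)) (-s * Real.exp (-s * x)) x := by
    intro x
    have := ((hasDerivAt_id x).const_mul (-s)).exp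
    simpa [mul_comm] using this
  -- Integrating factor: `G exp (-s x)` has vanishing weak derivative.
  obtain ⟨c, hc⟩ := ae_eq_const_of_integral_mul_deriv_eq_zero
    (g := fun x => G x * Real.exp (-s * x))
    (by
      have := hloc.smul_continuous hsm.continuous
      simpa [mul_comm] using this) (by
      intro χ hχ
      rw [← h _ (hχ.mul_smooth hsm)]
      congr 1; ext x
      have h1 : HasDerivAt (fun x => Real.exp (-s * x) * χ x)
          (-s * Real.exp (-s * x) * χ x + Real.exp (-s * x) * deriv χ x) x :=
        (hd x).mul (hχ.differentiable x).hasDerivAt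
      rw [h1.deriv]; ring)
  have hGc : ∀ᵐ x, G x = c * Real.exp (s * x) := by
    filter_upwards [hc] with x hx
    rw [← hx, mul_assoc, ← Real.exp_add]; simp
  by_contra hne
  have hc0 : c ≠ 0 := by
    rintro rfl
    apply hne
    filter_upwards [hGc] with x hx
    simpa using hx
  have hm : Integrable fun x => (c * Real.exp (s * x)) ^ 2 := by
    refine (hG.integrable_sq).congr ?_
    filter_upwards [hGc] with x hx
    rw [hx]
  have hm1 : Integrable fun x : ℝ => Real.exp (s * x) ^ 2 := by
    have := hm.const_mul (c ^ 2)⁻¹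
    refine this.congr (ae_of_all _ fun x => ?_)
    simp only [mul_pow]
    rw [← mul_assoc, inv_mul_cancel₀ (pow_ne_zero 2 hc0), one_mul]
  -- After reflection both exponentials `exp (± s x)` are square integrable. Their product is 1, so
  -- the constant 1 would be integrable on the line, whatever the sign of `s`.
  have hm2 : Integrable fun x : ℝ => Real.exp (s * -x) ^ 2 := hm1.comp_neg
  have hm3 : Integrable fun _ : ℝ => (1 : ℝ) := by
    refine (hm1.add hm2).mono' (by fun_prop) (ae_of_all _ fun x => ?_)
    have e : Real.exp (s * x) * Real.exp (s * -x) = 1 := by rw [← Real.exp_add]; simp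
    simp only [Pi.add_apply, norm_one]
    nlinarith [sq_nonneg (Real.exp (s * x) - Real.exp (s * -x))]
  simp [integrable_const_iff, isFiniteMeasure_iff] at hm3

/-- Test functions are dense in `H¹`. -/
theorem denseRange_toH : DenseRange fun φ : {φ : ℝ → ℝ // IsTestFunction φ} => φ.2.toH := by
  let S : Submodule ℝ (H 1) := Submodule.span ℝ (range fun φ : {φ : ℝ → ℝ // IsTestFunction φ} => φ.2.toH)
  -- Test functions already form a subspace, so density reduces to a trivial orthogonal complement.
  have hS : (S : Set (H 1)) = range fun φ : {φ : ℝ → ℝ // IsTestFunction φ} => φ.2.toH := by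
    refine Subset.antisymm ?_ Submodule.subset_span
    intro g hg
    refine Submodule.span_induction (fun x hx => hx) ?_ ?_ ?_ hg
    · refine ⟨⟨fun _ => 0, contDiff_const, HasCompactSupport.zero⟩, ?_⟩
      refine IsTestFunction.toH_eq _ ?_ ?_
      · exact (Lp.coeFn_zero ℝ 2 volume).symm
      · simp only [deriv_const']
        exact (Lp.coeFn_zero ℝ 2 volume).symm
    · rintro _ _ _ _ ⟨φ, rfl⟩ ⟨χ, rfl⟩
      refine ⟨⟨_, φ.2.add χ.2⟩, ?_⟩
      refine IsTestFunction.toH_eq _ ?_ ?_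
      · filter_upwards [Lp.coeFn_add (φ.2.toH.1 0) (χ.2.toH.1 0), φ.2.toH_D_zero,
          χ.2.toH_D_zero] with x h1 h2 h3
        exact (h1.trans (congrArg₂ (· + ·) h2 h3)).symm
      · filter_upwards [Lp.coeFn_add (φ.2.toH.1 1) (χ.2.toH.1 1), φ.2.toH_D_one,
          χ.2.toH_D_one] with x h1 h2 h3
        exact (deriv_fun_add (φ.2.differentiable x) (χ.2.differentiable x)).trans
          (h1.trans (congrArg₂ (· + ·) h2 h3)).symm
    · rintro r _ _ ⟨φ, rfl⟩
      refine ⟨⟨_, φ.2.const_mul r⟩, ?_⟩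
      refine IsTestFunction.toH_eq _ ?_ ?_
      · filter_upwards [Lp.coeFn_smul r (φ.2.toH.1 0), φ.2.toH_D_zero] with x h1 h2
        exact (h1.trans (congrArg (r * ·) h2)).symm
      · filter_upwards [Lp.coeFn_smul r (φ.2.toH.1 1), φ.2.toH_D_one] with x h1 h2
        exact (deriv_const_mul_field r).trans (h1.trans (congrArg (r * ·) h2)).symm
  rw [DenseRange, ← hS, Submodule.dense_iff_topologicalClosure_eq_top,
    Submodule.topologicalClosure_eq_top_iff, Submodule.eq_bot_iff]
  intro g hg
  have horth : ∀ φ : ℝ → ℝ, IsTestFunction φ →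
      (∫ x, g.D 0 x * φ x) + ∫ x, g.D 1 x * deriv φ x = 0 := by
    intro φ hφ
    have h1 : inner ℝ hφ.toH g = 0 := hg _ (Submodule.subset_span ⟨⟨φ, hφ⟩, rfl⟩)
    rw [real_inner_comm, H.inner_one] at h1
    rw [← h1]
    exact congrArg₂ (· + ·) (integral_mul_toLp (g.1 0) hφ.memLp)
      (integral_mul_toLp (g.1 1) hφ.deriv.memLp)
  have hi : ∀ (j : Fin 2) {φ : ℝ → ℝ}, IsTestFunction φ → Integrable fun x => g.D j x * φ x :=
    fun j φ hφ => integrable_mul_test _ hφ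
  -- Orthogonality to test functions says `g'' = g` weakly. This factorises: for `s = ±1` the
  -- function `G = g + s g'` solves `G' = s G` and must vanish in `L₂`; both signs together give `g
  -- = g' = 0`.
  have key : ∀ s : ℝ, s ^ 2 = 1 → ∀ᵐ x, g.D 0 x + s * g.D 1 x = 0 := by
    intro s hs
    refine ae_eq_zero_of_weakDeriv_eq_self (s := s) (G := fun x => g.D 0 x + s * g.D 1 x)
      ((g.memLp_D 0).add ((g.memLp_D 1).const_mul s)) fun φ hφ => ?_
    have e : (fun x => (g.D 0 x + s * g.D 1 x) * (deriv φ x + s * φ x))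
        = fun x => (g.D 0 x * deriv φ x + s ^ 2 * (g.D 1 x * φ x))
          + s * (g.D 0 x * φ x + g.D 1 x * deriv φ x) := by
      ext x; ring
    rw [e, integral_add (f := fun x => g.D 0 x * deriv φ x + s ^ 2 * (g.D 1 x * φ x))
      (g := fun x => s * (g.D 0 x * φ x + g.D 1 x * deriv φ x))
      (((hi 0 hφ.deriv)).add ((hi 1 hφ).const_mul _))
      (((hi 0 hφ).add (hi 1 hφ.deriv)).const_mul _), integral_const_mul,
      integral_add (hi 0 hφ.deriv) ((hi 1 hφ).const_mul _), integral_const_mul,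
      integral_add (hi 0 hφ) (hi 1 hφ.deriv), horth φ hφ, g.weakDeriv hφ, hs]
    ring
  have k1 := key 1 (by norm_num)
  have k2 := key (-1) (by norm_num)
  apply H.ext_one
  · apply Lp.ext
    filter_upwards [k1, k2, Lp.coeFn_zero ℝ 2 (volume : Measure ℝ)] with x h1 h2 h3
    refine Eq.trans ?_ h3.symm
    change g.D 0 x = 0
    linarith
  · apply Lp.ext
    filter_upwards [k1, k2, Lp.coeFn_zero ℝ 2 (volume : Measure ℝ)] with x h1 h2 h3
    refine Eq.trans ?_ h3.symm
    change g.D 1 x = 0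
    linarith

end
end LevyFD

namespace LevyFD
noncomputable section
open Filter Topology

/-! ### Absolutely continuous representatives and their values on a grid -/

/-- `g` is an absolutely continuous function in `L₂` with derivative `g'` in `L₂`. -/
structure IsH1 (g g' : ℝ → ℝ) : Prop where
  memLp : MemLp g 2 volume
  memLp' : MemLp g' 2 volume
  sub_eq : ∀ x y, g y - g x = ∫ t in x..y, g' t

theorem intervalIntegrable_of_memLp {g : ℝ → ℝ} (hg : MemLp g 2 volume) (a b : ℝ) :
    IntervalIntegrable g volume a b :=
  ((hg.locallyIntegrable (by norm_num)).integrableOn_isCompact isCompact_uIcc).intervalIntegrable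

theorem continuous_primitive_of_memLp {g : ℝ → ℝ} (hg : MemLp g 2 volume) (a : ℝ) :
    Continuous fun x => ∫ t in a..x, g t :=
  intervalIntegral.continuous_primitive (intervalIntegrable_of_memLp hg) a

theorem IsH1.continuous {g g' : ℝ → ℝ} (h : IsH1 g g') : Continuous g := by
  have : g = fun x => g 0 + ∫ t in (0 : ℝ)..x, g' t := by
    ext x; rw [← h.sub_eq]; ring
  rw [this]
  exact continuous_const.add (continuous_primitive_of_memLp h.memLp' 0)

/-- Integration by parts of a primitive against a test function. -/
theorem integral_primitive_mul_deriv {g φ : ℝ → ℝ} (hg : MemLp g 2 volume) (hφ : ContDiff ℝ 1 φ)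
    (hs : HasCompactSupport φ) :
    ∫ x, (∫ t in (0 : ℝ)..x, g t) * deriv φ x = -∫ x, g x * φ x := by
  obtain ⟨R, hR⟩ := hs.isCompact.isBounded.subset_closedBall 0
  let S := |R| + 1
  have hRS : R < S := lt_of_le_of_lt (le_abs_self R) (lt_add_one _)
  have hS : 0 < S := by positivity
  have hsupp : tsupport φ ⊆ Ioo (-S) S := by
    intro x hx
    have := hR hx
    rw [mem_closedBall_zero_iff, Real.norm_eq_abs] at this
    exact abs_lt.1 (lt_of_le_of_lt this hRS)
  have hz : ∀ x, x ∉ Ioo (-S) S → φ x = 0 := fun x hx =>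
    image_eq_zero_of_notMem_tsupport fun h => hx (hsupp h)
  have e1 : ∫ x, (∫ t in (0 : ℝ)..x, g t) * deriv φ x
      = ∫ x in (-S)..S, (∫ t in (0 : ℝ)..x, g t) * deriv φ x := by
    rw [intervalIntegral.integral_eq_integral_of_support_subset]
    intro x hx
    have : x ∈ tsupport φ := by
      apply support_deriv_subset
      intro h0
      apply hx
      simp [h0]
    exact Ioo_subset_Ioc_self (hsupp this)
  have e2 : ∫ x, g x * φ x = ∫ x in (-S)..S, g x * φ x := by
    rw [intervalIntegral.integral_eq_integral_of_support_subset]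
    intro x hx
    have : x ∈ tsupport φ := by
      apply subset_tsupport
      intro h0
      apply hx
      simp [h0]
    exact Ioo_subset_Ioc_self (hsupp this)
  have hi := intervalIntegrable_of_memLp hg (-S) S
  have hA : AbsolutelyContinuousOnInterval (fun x => ∫ t in (0 : ℝ)..x, g t) (-S) S :=
    hi.absolutelyContinuousOnInterval_intervalIntegral (by
      rw [uIcc_of_le (by linarith)]; constructor <;> linarith)
  have hB : AbsolutelyContinuousOnInterval φ (-S) S :=
    ContDiffOn.absolutelyContinuousOnInterval (hφ.contDiffOn)
  rw [e1, e2, AbsolutelyContinuousOnInterval.integral_mul_deriv_eq_deriv_mul hA hB,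
    hz S (by simp), hz (-S) (by simp)]
  simp only [mul_zero, sub_zero, zero_sub]
  congr 1
  apply intervalIntegral.integral_congr_ae
  filter_upwards [LocallyIntegrable.ae_hasDerivAt_integral
    (hg.locallyIntegrable (by norm_num))] with x hx _
  rw [(hx 0).deriv]

theorem IsH1.integral_mul_deriv {g g' φ : ℝ → ℝ} (h : IsH1 g g') (hφ : ContDiff ℝ 1 φ)
    (hs : HasCompactSupport φ) : ∫ x, g x * deriv φ x = -∫ x, g' x * φ x := by
  rw [← integral_primitive_mul_deriv h.memLp' hφ hs]
  have hd := hφ.continuous_deriv le_rfl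
  have e : ∀ x, g x * deriv φ x = g 0 * deriv φ x + (∫ t in (0 : ℝ)..x, g' t) * deriv φ x := by
    intro x; rw [← h.sub_eq]; ring
  have h0 : ∫ x, deriv φ x = 0 := by
    have := integral_deriv_mul_of_test (f := fun _ => (1 : ℝ)) contDiff_const hφ hs
    simpa using this
  simp only [e]
  have hi : Integrable fun x => (∫ t in (0 : ℝ)..x, g' t) * deriv φ x :=
    ((continuous_primitive_of_memLp h.memLp' 0).mul hd).integrable_of_hasCompactSupport
      hs.deriv.mul_left
  rw [integral_add ((hd.integrable_of_hasCompactSupport hs.deriv).const_mul _) hi, integral_const_mul, h0, mul_zero, zero_add]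

/-- Subtracting the primitive of the weak derivative leaves a function with zero distributional
derivative, that is, a constant. -/
theorem H.exists_isH1 (g : H 1) : ∃ G, IsH1 G (g.D 1) ∧ G =ᵐ[volume] g.D 0 := by
  have hP := continuous_primitive_of_memLp (g.memLp_D 1) 0
  have hi : ∀ {φ : ℝ → ℝ}, IsTestFunction φ →
      Integrable fun x => (∫ t in (0 : ℝ)..x, g.D 1 t) * φ x := fun hφ =>
    (hP.mul hφ.continuous).integrable_of_hasCompactSupport hφ.2.mul_left
  have hj : ∀ (j : Fin 2) {φ : ℝ → ℝ}, IsTestFunction φ → Integrable fun x => g.D j x * φ x :=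
    fun j φ hφ => integrable_mul_test _ hφ
  obtain ⟨c, hc⟩ := ae_eq_const_of_integral_mul_deriv_eq_zero
    (g := fun x => g.D 0 x - ∫ t in (0 : ℝ)..x, g.D 1 t)
    (((g.memLp_D 0).locallyIntegrable (by norm_num)).sub hP.locallyIntegrable) (by
      intro φ hφ
      simp only [sub_mul]
      rw [integral_sub (hj 0 hφ.deriv) (hi hφ.deriv),
        integral_primitive_mul_deriv (g.memLp_D 1) hφ.contDiff_one hφ.2, g.weakDeriv hφ]
      ring)
  have hG : (fun x => c + ∫ t in (0 : ℝ)..x, g.D 1 t) =ᵐ[volume] g.D 0 := by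
    filter_upwards [hc] with x hx
    linarith
  refine ⟨_, ⟨(memLp_congr_ae hG).2 (g.memLp_D 0), g.memLp_D 1, fun x y => ?_⟩, hG⟩
  have h1 := intervalIntegrable_of_memLp (g.memLp_D 1)
  rw [add_sub_add_left_eq_sub, intervalIntegral.integral_interval_sub_left (h1 _ _) (h1 _ _)]

theorem contRep_eq {g G : ℝ → ℝ} (hG : Continuous G) (h : G =ᵐ[volume] g) : contRep g = G := by
  have hex : ∃ φ : ℝ → ℝ, Continuous φ ∧ φ =ᵐ[volume] g := ⟨G, hG, h⟩
  rw [contRep, dif_pos hex]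
  exact (Continuous.ae_eq_iff_eq volume hex.choose_spec.1 hG).1 (hex.choose_spec.2.trans h.symm)

/-- The `j`-th and `(j+1)`-st derivatives of an element of `H^m`, as an element of `H¹`. -/
def H.pair {m : ℕ} (g : H m) (j : ℕ) (hj : j + 1 ≤ m) : H 1 :=
  H.mk (g.1 ⟨j, by omega⟩) (g.1 ⟨j + 1, by omega⟩) (by
    intro φ hφ
    have h1 := g.2 ⟨j + 1, by omega⟩ φ hφ
    have h2 := g.2 ⟨j, by omega⟩ (deriv φ) hφ.deriv
    rw [h1, h2, ← iteratedDeriv_succ', pow_succ]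
    ring)

/-- The `L₂`-norm squared of the `j`-th derivative is at most the norm squared in `H^m`. -/
theorem H.integral_D_sq_le {m : ℕ} (g : H m) (j : Fin (m + 1)) :
    ∫ x, g.D j x ^ 2 ≤ ‖g‖ ^ 2 := by
  have h1 : ∫ x, g.D j x ^ 2 = ‖g.1 j‖ ^ 2 := by
    rw [← real_inner_self_eq_norm_sq, L2.inner_def]
    refine integral_congr_ae (ae_of_all _ fun x => ?_)
    simp [H.D, sq]
  have h2 : ‖g‖ ^ 2 = ∑ i, ‖g.1 i‖ ^ 2 := PiLp.norm_sq_eq_of_L2 _ g.1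
  rw [h1, h2]
  exact Finset.single_le_sum (f := fun i => ‖g.1 i‖ ^ 2) (fun i _ => by positivity)
    (Finset.mem_univ j)

theorem H.integral_D_sq_add_one (g : H 1) :
    (∫ x, g.D 0 x ^ 2) + ∫ x, g.D 1 x ^ 2 = ‖g‖ ^ 2 := by
  have h1 : ∀ j : Fin 2, ∫ x, g.D j x ^ 2 = ‖g.1 j‖ ^ 2 := by
    intro j
    rw [← real_inner_self_eq_norm_sq, L2.inner_def]
    refine integral_congr_ae (ae_of_all _ fun x => ?_)
    simp [H.D, sq]
  rw [h1, h1, H.norm_sq_one]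

theorem H.isH1_eval {m : ℕ} (hm : 1 ≤ m) (g : H m) : IsH1 g.eval (g.D ⟨1, by omega⟩) := by
  obtain ⟨G, hG, hae⟩ := (g.pair 0 hm).exists_isH1
  have : g.eval = G := contRep_eq hG.continuous hae
  rw [this]
  exact hG

theorem H.eval_ae {m : ℕ} (hm : 1 ≤ m) (g : H m) : g.eval =ᵐ[volume] g.D 0 := by
  obtain ⟨G, hG, hae⟩ := (g.pair 0 hm).exists_isH1
  have : g.eval = G := contRep_eq hG.continuous hae
  rw [this]
  exact hae

theorem H.eval_add {m : ℕ} (hm : 1 ≤ m) (g g' : H m) (x : ℝ) :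
    (g + g').eval x = g.eval x + g'.eval x := by
  have : (g + g').eval = fun x => g.eval x + g'.eval x := by
    refine contRep_eq ((g.isH1_eval hm).continuous.add (g'.isH1_eval hm).continuous) ?_
    filter_upwards [g.eval_ae hm, g'.eval_ae hm, Lp.coeFn_add (g.1 0) (g'.1 0)] with x h1 h2 h3
    rw [h1, h2]
    exact h3.symm
  rw [this]

theorem H.eval_smul {m : ℕ} (hm : 1 ≤ m) (r : ℝ) (g : H m) (x : ℝ) :
    (r • g).eval x = r * g.eval x := by
  have : (r • g).eval = fun x => r * g.eval x := by
    refine contRep_eq (continuous_const.mul (g.isH1_eval hm).continuous) ?_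
    filter_upwards [g.eval_ae hm, Lp.coeFn_smul r (g.1 0)] with x h1 h3
    rw [h1]
    exact h3.symm
  rw [this]

/-- Cauchy-Schwarz against the constant 1, obtained by expanding the nonnegative integral of the
squared deviation of `g` from its mean. -/
theorem sq_intervalIntegral_le {g : ℝ → ℝ} (hg : MemLp g 2 volume) {a b : ℝ} (hab : a ≤ b) :
    (∫ t in a..b, g t) ^ 2 ≤ (b - a) * ∫ t in a..b, g t ^ 2 := by
  have hi : IntervalIntegrable (fun t => g t ^ 2) volume a b :=
    hg.integrable_sq.intervalIntegrable
  have hj := intervalIntegrable_of_memLp hg a b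
  rcases hab.eq_or_lt with rfl | hlt
  · simp
  set I := ∫ t in a..b, g t
  have hpos : 0 < b - a := sub_pos.2 hlt
  have h0 : 0 ≤ ∫ t in a..b, (g t - I / (b - a)) ^ 2 :=
    intervalIntegral.integral_nonneg hab fun _ _ => sq_nonneg _
  have e : ∫ t in a..b, (g t - I / (b - a)) ^ 2
      = (∫ t in a..b, g t ^ 2) - 2 * (I / (b - a)) * I + (I / (b - a)) ^ 2 * (b - a) := by
    have : (fun t => (g t - I / (b - a)) ^ 2)
        = fun t => (g t ^ 2 - 2 * (I / (b - a)) * g t) + (I / (b - a)) ^ 2 := by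
      ext t; ring
    rw [this, intervalIntegral.integral_add (hi.sub (hj.const_mul _)) (by simp),
      intervalIntegral.integral_sub hi (hj.const_mul _), intervalIntegral.integral_const_mul]
    simp only [intervalIntegral.integral_const, smul_eq_mul]
    change _ - 2 * (I / (b - a)) * I + _ = _
    ring
  rw [e] at h0
  have : (b - a) * ((∫ t in a..b, g t ^ 2) - 2 * (I / (b - a)) * I + (I / (b - a)) ^ 2 * (b - a))
      = (b - a) * (∫ t in a..b, g t ^ 2) - I ^ 2 := by
    field_simp; ring
  nlinarith [mul_nonneg hpos.le h0]

/-- Write `g x = g t - ∫ₓᵗ g'`, bound the integral by Cauchy-Schwarz, and integrate over `t` in an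
interval of length `ε`. The right side is local, so it can be summed over the cells of a grid. -/
theorem IsH1.local_bound {g g' : ℝ → ℝ} (h : IsH1 g g') {ε : ℝ} (hε : 0 < ε) (x : ℝ) :
    ε * g x ^ 2 ≤ ∫ t in x..(x + ε), (2 * g t ^ 2 + 2 * ε ^ 2 * g' t ^ 2) := by
  have hi : IntervalIntegrable (fun t => g t ^ 2) volume x (x + ε) :=
    h.memLp.integrable_sq.intervalIntegrable
  have hi' : ∀ a b, IntervalIntegrable (fun t => g' t ^ 2) volume a b := fun a b =>
    h.memLp'.integrable_sq.intervalIntegrable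
  set B := ∫ t in x..(x + ε), g' t ^ 2
  have hle : x ≤ x + ε := by linarith
  have hp : ∀ t ∈ Icc x (x + ε), g x ^ 2 ≤ 2 * g t ^ 2 + 2 * (ε * B) := by
    intro t ht
    have h1 := h.sub_eq x t
    have h2 := sq_intervalIntegral_le h.memLp' ht.1
    have h3 : ∫ s in x..t, g' s ^ 2 ≤ B :=
      intervalIntegral.integral_mono_interval le_rfl ht.1 ht.2
        (ae_of_all _ fun _ => sq_nonneg _) (hi' _ _)
    have h4 : 0 ≤ ∫ s in x..t, g' s ^ 2 :=
      intervalIntegral.integral_nonneg ht.1 fun _ _ => sq_nonneg _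
    have h5 : (t - x) * ∫ s in x..t, g' s ^ 2 ≤ ε * B :=
      mul_le_mul (by linarith [ht.2]) h3 h4 hε.le
    have h6 : g x = g t - ∫ s in x..t, g' s := by linarith
    rw [h6]
    nlinarith [sq_nonneg (g t + ∫ s in x..t, g' s)]
  have hmono := intervalIntegral.integral_mono_on hle (f := fun _ => g x ^ 2)
    (g := fun t => 2 * g t ^ 2 + 2 * (ε * B)) (by simp)
    ((hi.const_mul 2).add (by simp)) hp
  rw [intervalIntegral.integral_add (hi.const_mul 2) (by simp)] at hmono
  rw [intervalIntegral.integral_add (hi.const_mul 2) ((hi' _ _).const_mul _),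
    intervalIntegral.integral_const_mul (2 * ε ^ 2)]
  simp only [intervalIntegral.integral_const, smul_eq_mul, add_sub_cancel_left] at hmono
  change _ ≤ _ + 2 * ε ^ 2 * B
  linarith

theorem H.eval_sq_le {m : ℕ} (hm : 1 ≤ m) (g : H m) (x : ℝ) : g.eval x ^ 2 ≤ 4 * ‖g‖ ^ 2 := by
  have h := g.isH1_eval hm
  have h1 := h.local_bound one_pos x
  have hi0 := h.memLp.integrable_sq
  have hi1 := h.memLp'.integrable_sq
  have h2 : ∫ t in x..(x + 1), (2 * g.eval t ^ 2 + 2 * 1 ^ 2 * g.D ⟨1, by omega⟩ t ^ 2)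
      ≤ ∫ t, (2 * g.eval t ^ 2 + 2 * 1 ^ 2 * g.D ⟨1, by omega⟩ t ^ 2) := by
    rw [intervalIntegral.integral_of_le (by linarith)]
    exact setIntegral_le_integral ((hi0.const_mul 2).add (hi1.const_mul _))
      (ae_of_all _ fun t => by positivity)
  rw [integral_add (hi0.const_mul 2) (hi1.const_mul _), integral_const_mul, integral_const_mul] at h2
  have h3 : ∫ t, g.eval t ^ 2 = ∫ t, g.D 0 t ^ 2 := by
    refine integral_congr_ae ?_
    filter_upwards [g.eval_ae hm] with t ht
    rw [ht]
  have h4 := g.integral_D_sq_le 0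
  have h5 := g.integral_D_sq_le ⟨1, by omega⟩
  linarith

theorem H.abs_eval_le {m : ℕ} (hm : 1 ≤ m) (g : H m) (x : ℝ) : |g.eval x| ≤ 2 * ‖g‖ := by
  apply abs_le_of_sq_le_sq _ (by positivity)
  have := g.eval_sq_le hm x
  linarith [mul_pow 2 ‖g‖ 2]

/-- Evaluation at a point as a continuous linear functional on `H^m`, `m ≥ 1`. -/
def H.evalCLM {m : ℕ} (hm : 1 ≤ m) (x : ℝ) : H m →L[ℝ] ℝ :=
  LinearMap.mkContinuous
    { toFun := fun g => g.eval x
      map_add' := fun g g' => g.eval_add hm g' x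
      map_smul' := fun r g => g.eval_smul hm r x } 2 fun g => g.abs_eval_le hm x

/-- The integral over the line is the sum of the integrals over the cells of a grid. -/
theorem hasSum_integral_grid {f : ℝ → ℝ} (hf : Integrable f) {ε : ℝ} (hε : 0 < ε) :
    HasSum (fun k : ℤ => ∫ t in (k * ε)..(k * ε + ε), f t) (∫ t, f t) := by
  have hU := iUnion_Ioc_zsmul hε
  have h := hasSum_integral_iUnion (f := f) (μ := volume)
    (s := fun n : ℤ => Ioc (n • ε) ((n + 1) • ε)) (fun n => measurableSet_Ioc)
    (pairwise_disjoint_Ioc_zsmul ε) (by rw [hU]; exact hf.integrableOn)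
  rw [hU, setIntegral_univ] at h
  have e : (fun k : ℤ => ∫ t in (k * ε)..(k * ε + ε), f t)
      = fun n : ℤ => ∫ t in Ioc (n • ε) ((n + 1) • ε), f t := by
    ext k
    rw [intervalIntegral.integral_of_le (by linarith)]
    simp only [zsmul_eq_mul]
    push_cast
    rw [add_mul, one_mul]
  rw [e]
  exact h

/-- Sum of `IsH1.local_bound` over the cells `[kε, kε + ε]`, which tile the line. -/
theorem IsH1.grid_bound {g g' : ℝ → ℝ} (h : IsH1 g g') {ε : ℝ} (hε : 0 < ε) :
    Summable (fun k : ℤ => g (k * ε) ^ 2) ∧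
      ε * ∑' k : ℤ, g (k * ε) ^ 2 ≤ 2 * (∫ t, g t ^ 2) + 2 * ε ^ 2 * ∫ t, g' t ^ 2 := by
  have hi0 := h.memLp.integrable_sq
  have hi1 := h.memLp'.integrable_sq
  have hs := hasSum_integral_grid ((hi0.const_mul 2).add (hi1.const_mul (2 * ε ^ 2))) hε
  have hle : ∀ k : ℤ, ε * g (k * ε) ^ 2 ≤ _ := fun k => h.local_bound hε (k * ε)
  have hsum : Summable fun k : ℤ => ε * g (k * ε) ^ 2 :=
    Summable.of_nonneg_of_le (fun k => by positivity) hle hs.summable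
  refine ⟨(summable_mul_left_iff hε.ne').1 hsum, ?_⟩
  rw [← tsum_mul_left]
  refine (hsum.tsum_le_tsum hle hs.summable).trans (hs.tsum_eq.trans ?_).le
  simp only [Pi.add_apply]
  rw [integral_add (hi0.const_mul 2) (hi1.const_mul _), integral_const_mul, integral_const_mul]

/-- The forward difference quotient of a function on the line. -/
def dq (ε : ℝ) (g : ℝ → ℝ) : ℝ → ℝ := fun x => (g (x + ε) - g x) / ε

theorem IsH1.dq {g g' : ℝ → ℝ} (h : IsH1 g g') (ε : ℝ) : IsH1 (dq ε g) (dq ε g') := by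
  have hs : ∀ {f : ℝ → ℝ}, MemLp f 2 volume → MemLp (LevyFD.dq ε f) 2 volume := by
    intro f hf
    have h1 : MemLp (fun x => f (x + ε)) 2 volume :=
      hf.comp_measurePreserving (measurePreserving_add_right volume ε)
    have h2 := (h1.sub hf).const_mul ε⁻¹
    have e : LevyFD.dq ε f = fun x => ε⁻¹ * ((fun x => f (x + ε)) - f) x := by
      ext x
      exact div_eq_inv_mul _ _
    rwa [e]
  refine ⟨hs h.memLp, hs h.memLp', fun x y => ?_⟩
  have e1 := h.sub_eq x y
  have e2 := h.sub_eq (x + ε) (y + ε)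
  rw [← intervalIntegral.integral_comp_add_right] at e2
  have h1 : MemLp (fun x => g' (x + ε)) 2 volume :=
    h.memLp'.comp_measurePreserving (measurePreserving_add_right volume ε)
  simp only [LevyFD.dq]
  rw [intervalIntegral.integral_div, intervalIntegral.integral_sub
    (intervalIntegrable_of_memLp h1 _ _) (intervalIntegrable_of_memLp h.memLp' _ _), ← e1, ← e2]
  ring

theorem IsH1.dq_sq_le {g g' : ℝ → ℝ} (h : IsH1 g g') {ε : ℝ} (hε : 0 < ε) (x : ℝ) :
    ε * LevyFD.dq ε g x ^ 2 ≤ ∫ t in x..(x + ε), g' t ^ 2 := by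
  have h1 := sq_intervalIntegral_le h.memLp' (show x ≤ x + ε by linarith)
  rw [← h.sub_eq, add_sub_cancel_left] at h1
  rw [LevyFD.dq, div_pow, mul_div_assoc', div_le_iff₀ (by positivity)]
  nlinarith [mul_le_mul_of_nonneg_left h1 hε.le]

theorem IsH1.grid_dq_bound {g g' : ℝ → ℝ} (h : IsH1 g g') {ε : ℝ} (hε : 0 < ε) :
    Summable (fun k : ℤ => LevyFD.dq ε g (k * ε) ^ 2) ∧
      ε * ∑' k : ℤ, LevyFD.dq ε g (k * ε) ^ 2 ≤ ∫ t, g' t ^ 2 := by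
  have hs := hasSum_integral_grid h.memLp'.integrable_sq hε
  have hle : ∀ k : ℤ, ε * LevyFD.dq ε g (k * ε) ^ 2 ≤ _ := fun k => h.dq_sq_le hε (k * ε)
  have hsum : Summable fun k : ℤ => ε * LevyFD.dq ε g (k * ε) ^ 2 :=
    Summable.of_nonneg_of_le (fun k => by positivity) hle hs.summable
  refine ⟨(summable_mul_left_iff hε.ne').1 hsum, ?_⟩
  rw [← tsum_mul_left]
  exact (hsum.tsum_le_tsum hle hs.summable).trans hs.tsum_eq.le

/-- Tonelli and translation invariance. Working with `lintegral` avoids any integrability question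
on the product space. -/
theorem integral_sq_shift_average {g : ℝ → ℝ} (hg : MemLp g 2 volume) {ε : ℝ} (hε : 0 < ε) :
    ∫⁻ x, ENNReal.ofReal (∫ t in x..(x + ε), g t ^ 2) = ENNReal.ofReal (ε * ∫ t, g t ^ 2) := by
  have hm : AEMeasurable (fun x => ENNReal.ofReal (g x ^ 2)) volume :=
    (hg.aestronglyMeasurable.aemeasurable.pow_const 2).ennreal_ofReal
  have hm2 : AEMeasurable (Function.uncurry fun x y : ℝ => ENNReal.ofReal (g (x + y) ^ 2))
      (volume.prod (volume.restrict (Ioc 0 ε))) :=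
    (hm.comp_quasiMeasurePreserving (quasiMeasurePreserving_add volume volume)).mono_measure
      (Measure.prod_mono le_rfl Measure.restrict_le_self)
  have e : ∀ x, ENNReal.ofReal (∫ t in x..(x + ε), g t ^ 2)
      = ∫⁻ y in Ioc 0 ε, ENNReal.ofReal (g (x + y) ^ 2) := by
    intro x
    have h1 : ∫ t in x..(x + ε), g t ^ 2 = ∫ y in (0 : ℝ)..ε, g (x + y) ^ 2 := by
      rw [intervalIntegral.integral_comp_add_left (fun t => g t ^ 2) x, add_zero]
    rw [h1, intervalIntegral.integral_of_le hε.le, ofReal_integral_eq_lintegral_ofReal]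
    · have h2 : MemLp (fun y => g (x + y)) 2 volume :=
        hg.comp_measurePreserving (measurePreserving_add_left volume x)
      exact h2.integrable_sq.integrableOn
    · exact ae_of_all _ fun _ => sq_nonneg _
  simp only [e]
  rw [lintegral_lintegral_swap hm2]
  have e2 : ∀ y, ∫⁻ x, ENNReal.ofReal (g (x + y) ^ 2) = ENNReal.ofReal (∫ t, g t ^ 2) := by
    intro y
    rw [lintegral_add_right_eq_self (fun x => ENNReal.ofReal (g x ^ 2)) y,
      ofReal_integral_eq_lintegral_ofReal hg.integrable_sq (ae_of_all _ fun _ => sq_nonneg _)]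
  simp only [e2, lintegral_const, Measure.restrict_apply, MeasurableSet.univ, univ_inter,
    Real.volume_Ioc, sub_zero]
  rw [mul_comm, ENNReal.ofReal_mul hε.le]

/-- The quotient is the mean of `g'` over an interval of length `ε`, and taking means does not
increase the `L₂` norm. -/
theorem IsH1.integral_dq_sq_le {g g' : ℝ → ℝ} (h : IsH1 g g') {ε : ℝ} (hε : 0 < ε) :
    ∫ x, LevyFD.dq ε g x ^ 2 ≤ ∫ x, g' x ^ 2 := by
  have h1 : ∫⁻ x, ENNReal.ofReal (ε * LevyFD.dq ε g x ^ 2) ≤ ENNReal.ofReal (ε * ∫ t, g' t ^ 2) := by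
    rw [← integral_sq_shift_average h.memLp' hε]
    exact lintegral_mono fun x => ENNReal.ofReal_le_ofReal (h.dq_sq_le hε x)
  rw [← ofReal_integral_eq_lintegral_ofReal ((h.dq ε).memLp.integrable_sq.const_mul ε)
    (ae_of_all _ fun x => by positivity), integral_const_mul] at h1
  have h2 : 0 ≤ ∫ t, g' t ^ 2 := integral_nonneg fun _ => sq_nonneg _
  have h3 := (ENNReal.ofReal_le_ofReal_iff (by positivity)).1 h1
  exact le_of_mul_le_mul_left h3 hε

theorem IsH1.iterate_dq {g g' : ℝ → ℝ} (h : IsH1 g g') (ε : ℝ) (j : ℕ) :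
    IsH1 ((LevyFD.dq ε)^[j] g) ((LevyFD.dq ε)^[j] g') := by
  induction j with
  | zero => exact h
  | succ j ih => rw [Function.iterate_succ_apply', Function.iterate_succ_apply']; exact ih.dq ε

theorem dq_congr_ae {g f : ℝ → ℝ} (h : g =ᵐ[volume] f) (ε : ℝ) : dq ε g =ᵐ[volume] dq ε f := by
  have h1 := (measurePreserving_add_right volume ε).quasiMeasurePreserving.ae_eq_comp h
  filter_upwards [h, h1] with x hx hx1
  simp only [Function.comp_apply] at hx1
  rw [dq, dq, hx, hx1]

theorem iterate_dq_congr_ae {g f : ℝ → ℝ} (h : g =ᵐ[volume] f) (ε : ℝ) (j : ℕ) :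
    (dq ε)^[j] g =ᵐ[volume] (dq ε)^[j] f := by
  induction j with
  | zero => exact h
  | succ j ih => rw [Function.iterate_succ_apply', Function.iterate_succ_apply']; exact dq_congr_ae ih ε

/-- Each difference quotient is traded for one more derivative, with constant 1, so `j` quotients of
the `i`-th derivative cost the derivative of order `i + j`. -/
theorem H.integral_iterate_dq_sq_le {m : ℕ} (g : H m) {ε : ℝ} (hε : 0 < ε) (j : ℕ) :
    ∀ i (hij : i + j ≤ m), ∫ x, (dq ε)^[j] (g.D ⟨i, by omega⟩) x ^ 2 ≤ ‖g‖ ^ 2 := by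
  induction j with
  | zero => intro i hi; exact g.integral_D_sq_le _
  | succ j ih =>
    intro i hi
    obtain ⟨G, hG, hae⟩ := (g.pair i (by omega)).exists_isH1
    have h1 := ((hG.iterate_dq ε j).integral_dq_sq_le hε).trans (ih (i + 1) (by omega))
    refine (integral_congr_ae ?_).trans_le h1
    rw [Function.iterate_succ_apply']
    filter_upwards [dq_congr_ae (iterate_dq_congr_ae hae ε j) ε] with x hx
    rw [hx]
    rfl

/-- The forward difference quotient on grid functions. -/
def fd (ε : ℝ) (φ : ℤ → ℝ) : ℤ → ℝ := fun k => (φ (k + 1) - φ k) / ε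

theorem iterate_fd_eq (ε : ℝ) (g : ℝ → ℝ) (j : ℕ) :
    (fd ε)^[j] (fun k => g (k * ε)) = fun k : ℤ => (dq ε)^[j] g (k * ε) := by
  induction j with
  | zero => rfl
  | succ j ih =>
    rw [Function.iterate_succ_apply', Function.iterate_succ_apply', ih]
    ext k
    simp only [fd, dq]
    push_cast
    rw [add_mul, one_mul]

/-- The discrete Sobolev norms of the grid values of `g ∈ H^m` are bounded by `‖g‖_{H^m}`. -/
theorem H.grid_bound {m : ℕ} (hm : 1 ≤ m) (g : H m) {ε : ℝ} (hε : 0 < ε) (hε1 : ε ≤ 1) (j : ℕ)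
    (hj : j ≤ m) :
    Summable (fun k : ℤ => (fd ε)^[j] (fun k => g.eval (k * ε)) k ^ 2) ∧
      ε * ∑' k : ℤ, (fd ε)^[j] (fun k => g.eval (k * ε)) k ^ 2 ≤ 4 * ‖g‖ ^ 2 := by
  have h := g.isH1_eval hm
  rw [iterate_fd_eq]
  rcases j with _ | j
  · refine ⟨(h.grid_bound hε).1, (h.grid_bound hε).2.trans ?_⟩
    have h3 : ∫ t, g.eval t ^ 2 = ∫ t, g.D 0 t ^ 2 := by
      refine integral_congr_ae ?_
      filter_upwards [g.eval_ae hm] with t ht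
      rw [ht]
    have h4 := g.integral_D_sq_le 0
    have h5 := g.integral_D_sq_le ⟨1, by omega⟩
    have h6 : ε ^ 2 ≤ 1 := pow_le_one₀ hε.le hε1
    have h7 : 0 ≤ ∫ t, g.D ⟨1, by omega⟩ t ^ 2 := integral_nonneg fun _ => sq_nonneg _
    rw [h3]
    nlinarith
  -- The outermost quotient itself pays for the passage from the grid to the line, so `j + 1`
  -- differences need no more than `j + 1` derivatives. Only order zero spends an extra derivative,
  -- and there `ε ≤ 1` is used.
  · rw [Function.iterate_succ_apply']
    refine ⟨((h.iterate_dq ε j).grid_dq_bound hε).1,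
      ((h.iterate_dq ε j).grid_dq_bound hε).2.trans ?_⟩
    have := g.integral_iterate_dq_sq_le hε j 1 (by omega)
    nlinarith [sq_nonneg ‖g‖]

end
end LevyFD

namespace LevyFD
noncomputable section
open Filter Topology

/-! ### Evolution equations with measurable dependence on time -/

/-- The product `(C + N ∫₀ᵗ φ) exp (-N t)` is decreasing. Only continuity of `φ` enters, and no sign
of `C` or `φ` is needed. -/
theorem gronwall_integral {T C N : ℝ} (hN : 0 ≤ N) {φ : ℝ → ℝ} (hφ : ContinuousOn φ (Icc 0 T))
    (h : ∀ t ∈ Icc 0 T, φ t ≤ C + N * ∫ s in (0 : ℝ)..t, φ s) :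
    ∀ t ∈ Icc 0 T, φ t ≤ C * Real.exp (N * t) := by
  intro t ht
  have hT : 0 ≤ T := ht.1.trans ht.2
  have hi : IntervalIntegrable φ volume 0 T := hφ.intervalIntegrable_of_Icc hT
  have hYc : ContinuousOn (fun t => ∫ s in (0 : ℝ)..t, φ s) (Icc 0 T) := by
    have := intervalIntegral.continuousOn_primitive_interval (a := (0 : ℝ)) (b := T) (f := φ)
      (μ := volume) (by rw [uIcc_of_le hT]; exact hφ.integrableOn_Icc)
    rwa [uIcc_of_le hT] at this
  have hd : ∀ x ∈ Ioo 0 T, HasDerivAt (fun t => ∫ s in (0 : ℝ)..t, φ s) (φ x) x := by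
    intro x hx
    refine intervalIntegral.integral_hasDerivAt_right ?_ ?_ ?_
    · exact hi.mono_set (by
        rw [uIcc_of_le hx.1.le, uIcc_of_le hT]; exact Icc_subset_Icc_right hx.2.le)
    · exact hφ.stronglyMeasurableAtFilter_nhdsWithin measurableSet_Icc x |>.filter_mono
        (by rw [nhdsWithin_eq_nhds.2 (Icc_mem_nhds hx.1 hx.2)])
    · exact hφ.continuousAt (Icc_mem_nhds hx.1 hx.2)
  have hZ : ∀ x ∈ Ioo 0 T, HasDerivAt
      (fun t => (C + N * ∫ s in (0 : ℝ)..t, φ s) * Real.exp (-N * t))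
      (N * φ x * Real.exp (-N * x)
        + (C + N * ∫ s in (0 : ℝ)..x, φ s) * (Real.exp (-N * x) * (-N))) x := by
    intro x hx
    have h1 := ((hd x hx).const_mul N).const_add C
    have h2 := ((hasDerivAt_id x).const_mul (-N)).exp
    have h3 := h1.mul h2
    simp only [id_eq, mul_one] at h3
    exact h3
  have hanti : AntitoneOn (fun t => (C + N * ∫ s in (0 : ℝ)..t, φ s) * Real.exp (-N * t))
      (Icc 0 T) := by
    refine antitoneOn_of_deriv_nonpos (convex_Icc 0 T) ?_ ?_ ?_
    · exact (continuousOn_const.add (continuousOn_const.mul hYc)).mul (by fun_prop)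
    · rw [interior_Icc]
      exact fun x hx => (hZ x hx).differentiableAt.differentiableWithinAt
    · rw [interior_Icc]
      intro x hx
      rw [(hZ x hx).deriv]
      have := h x (Ioo_subset_Icc_self hx)
      have e := Real.exp_pos (-N * x)
      nlinarith [mul_nonneg hN (mul_nonneg (sub_nonneg.2 this) e.le)]
  have := hanti (left_mem_Icc.2 hT) ht ht.1
  simp only [intervalIntegral.integral_same, mul_zero, Real.exp_zero, mul_one, add_zero] at this
  calc φ t ≤ C + N * ∫ s in (0 : ℝ)..t, φ s := h t ht
    _ = ((C + N * ∫ s in (0 : ℝ)..t, φ s) * Real.exp (-N * t)) * Real.exp (N * t) := by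
      rw [mul_assoc, ← Real.exp_add]; simp
    _ ≤ C * Real.exp (N * t) := mul_le_mul_of_nonneg_right this (Real.exp_pos _).le

/-- If the increments of `F` are given by a family `B` which is continuous in the second variable,
then `F` is absolutely continuous with derivative `2 B(r,r)`. -/
theorem energy_identity {T : ℝ} {F : ℝ → ℝ} {B : ℝ → ℝ → ℝ} {g : ℝ → ℝ}
    (hmeas : ∀ t ∈ Icc 0 T, AEStronglyMeasurable (fun r => B r t) (volume.restrict (Icc 0 T)))
    (hcont : ∀ r ∈ Icc 0 T, ContinuousOn (B r) (Icc 0 T))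
    (hg : IntegrableOn g (Icc 0 T)) (hb : ∀ r ∈ Icc 0 T, ∀ t ∈ Icc 0 T, |B r t| ≤ g r)
    (hF : ∀ s ∈ Icc 0 T, ∀ t ∈ Icc 0 T, s ≤ t → F t - F s = ∫ r in s..t, (B r t + B r s))
    {t : ℝ} (ht : t ∈ Icc 0 T) :
    IntervalIntegrable (fun r => B r r) volume 0 t ∧ F t - F 0 = 2 * ∫ r in (0 : ℝ)..t, B r r := by
  rcases ht.1.eq_or_lt with rfl | h0
  · simp
  have hsub : Icc 0 t ⊆ Icc 0 T := Icc_subset_Icc_right ht.2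
  have hgt : IntervalIntegrable g volume 0 t :=
    (intervalIntegrable_iff_integrableOn_Icc_of_le h0.le).2 (hg.mono_set hsub)
  let τ : ℕ → ℕ → ℝ := fun n i => i * t / (n + 1)
  have hτmono : ∀ n, Monotone (τ n) := by
    intro n i j hij
    simp only [τ]
    gcongr
  have hτ0 : ∀ n, τ n 0 = 0 := fun n => by simp [τ]
  have hτn : ∀ n, τ n (n + 1) = t := fun n => by
    simp only [τ]; push_cast; field_simp
  have hτmem : ∀ n i, i ≤ n + 1 → τ n i ∈ Icc 0 t := fun n i hi =>
    ⟨(hτ0 n).symm.le.trans (hτmono n (Nat.zero_le _)), (hτmono n hi).trans (hτn n).le⟩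
  let idx : ℕ → ℝ → ℕ := fun n r => ⌊(n + 1) * r / t⌋₊
  have hidx : ∀ n i r, τ n i < r → r < τ n (i + 1) → idx n r = i := by
    intro n i r h1 h2
    have hn : (0 : ℝ) < n + 1 := by positivity
    simp only [τ] at h1 h2
    rw [div_lt_iff₀ hn] at h1
    rw [lt_div_iff₀ hn] at h2
    have hr : 0 ≤ r := by
      by_contra hneg
      have : (0 : ℝ) ≤ i * t := by positivity
      nlinarith
    rw [Nat.floor_eq_iff (by positivity)]
    constructor
    · rw [le_div_iff₀ h0]; linarith
    · rw [div_lt_iff₀ h0]; push_cast at h2; linarith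
  -- The second argument of `B` is moved to both endpoints of the partition cell containing `r`. The
  -- integral of `D n` telescopes to `F t - F 0` for every `n`, while `D n r` tends to `2 B(r, r)`.
  let D : ℕ → ℝ → ℝ := fun n r => B r (τ n (idx n r + 1)) + B r (τ n (idx n r))
  have hiB : ∀ s ∈ Icc 0 T, IntervalIntegrable (fun r => B r s) volume 0 T := by
    intro s hs
    rw [intervalIntegrable_iff_integrableOn_Icc_of_le (ht.1.trans ht.2)]
    exact hg.mono' (hmeas s hs) ((ae_restrict_mem measurableSet_Icc).mono fun r hr => hb r hr s hs)
  have hiB2 : ∀ s ∈ Icc 0 T, ∀ a ∈ Icc 0 t, ∀ b ∈ Icc 0 t,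
      IntervalIntegrable (fun r => B r s) volume a b := by
    intro s hs a ha b hb
    refine (hiB s hs).mono_set ?_
    rw [uIcc_of_le (ht.1.trans ht.2)]
    exact uIcc_subset_Icc (hsub ha) (hsub hb)
  have hpiece : ∀ n i, i < n + 1 → ∀ᵐ r, r ∈ uIoc (τ n i) (τ n (i + 1)) →
      B r (τ n (i + 1)) + B r (τ n i) = D n r := by
    intro n i hi
    have hne : ∀ᵐ r : ℝ, r ≠ τ n (i + 1) := by
      simp [ae_iff, measure_singleton]
    filter_upwards [hne] with r hr hmem
    rw [uIoc_of_le (hτmono n (Nat.le_succ i))] at hmem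
    simp only [D]
    rw [hidx n i r hmem.1 (lt_of_le_of_ne hmem.2 hr)]
  have hint : ∀ n i, i < n + 1 → IntervalIntegrable (D n) volume (τ n i) (τ n (i + 1)) := by
    intro n i hi
    have h1 := hτmem n i hi.le
    have h2 := hτmem n (i + 1) hi
    refine IntervalIntegrable.congr_ae
      ((hiB2 _ (hsub h2) _ h1 _ h2).add (hiB2 _ (hsub h1) _ h1 _ h2)) ?_
    exact (ae_restrict_iff' measurableSet_uIoc).2 (hpiece n i hi)
  have hDint : ∀ n, IntervalIntegrable (D n) volume 0 t := by
    intro n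
    have := IntervalIntegrable.trans_iterate (hint n)
    rwa [hτ0, hτn] at this
  have hDeq : ∀ n, ∫ r in (0 : ℝ)..t, D n r = F t - F 0 := by
    intro n
    have := intervalIntegral.sum_integral_adjacent_intervals (hint n)
    rw [hτ0, hτn] at this
    rw [← this]
    have h2 := Finset.sum_range_sub (fun i => F (τ n i)) (n + 1)
    rw [hτ0, hτn] at h2
    rw [← h2]
    refine Finset.sum_congr rfl fun i hi => ?_
    have hi := Finset.mem_range.1 hi
    rw [hF _ (hsub (hτmem n i hi.le)) _ (hsub (hτmem n (i + 1) hi)) (hτmono n (Nat.le_succ i))]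
    symm
    exact intervalIntegral.integral_congr_ae (hpiece n i hi)
  have hmemr : ∀ n, ∀ r ∈ Ioo 0 t, idx n r + 1 ≤ n + 1 ∧ τ n (idx n r) ≤ r ∧
      r ≤ τ n (idx n r + 1) := by
    intro n r hr
    have hn : (0 : ℝ) < n + 1 := by positivity
    have hq : 0 ≤ (n + 1) * r / t := by have := hr.1; positivity
    refine ⟨?_, ?_, ?_⟩
    · apply Nat.succ_le_of_lt
      rw [Nat.floor_lt hq, div_lt_iff₀ h0]
      push_cast
      nlinarith [hr.2]
    · have := Nat.floor_le hq
      simp only [τ, idx]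
      rw [div_le_iff₀ hn]
      rw [le_div_iff₀ h0] at this
      linarith
    · have := Nat.lt_floor_add_one ((n + 1) * r / t)
      simp only [τ, idx]
      rw [le_div_iff₀ hn]
      rw [div_lt_iff₀ h0] at this
      push_cast
      linarith
  have hgap : ∀ n i, τ n (i + 1) - τ n i = t / (n + 1) := by
    intro n i; simp only [τ]; push_cast; ring
  have htz : Tendsto (fun n : ℕ => t / ((n : ℝ) + 1)) atTop (𝓝 0) := by
    have := (tendsto_one_div_add_atTop_nhds_zero_nat (𝕜 := ℝ)).const_mul t
    simpa [div_eq_mul_inv] using this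
  have hlim : ∀ r ∈ Ioo 0 t, Tendsto (fun n => D n r) atTop (𝓝 (B r r + B r r)) := by
    intro r hr
    have hrT : r ∈ Icc 0 T := hsub (Ioo_subset_Icc_self hr)
    have hc := (hcont r hrT) r hrT
    have h1 : Tendsto (fun n => τ n (idx n r)) atTop (𝓝 r) := by
      refine tendsto_of_tendsto_of_tendsto_of_le_of_le (g := fun n : ℕ => r - t / ((n : ℝ) + 1))
        (h := fun _ => r) (by simpa using htz.const_sub r) tendsto_const_nhds ?_ ?_
      · intro n
        have := hgap n (idx n r)
        have := (hmemr n r hr).2.2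
        simp only; linarith
      · exact fun n => (hmemr n r hr).2.1
    have h2 : Tendsto (fun n => τ n (idx n r + 1)) atTop (𝓝 r) := by
      refine tendsto_of_tendsto_of_tendsto_of_le_of_le (g := fun _ => r)
        (h := fun n : ℕ => r + t / ((n : ℝ) + 1)) tendsto_const_nhds
        (by simpa using htz.const_add r) ?_ ?_
      · exact fun n => (hmemr n r hr).2.2
      · intro n
        have := hgap n (idx n r)
        have := (hmemr n r hr).2.1
        simp only; linarith
    refine Tendsto.add (hc.tendsto.comp (tendsto_nhdsWithin_iff.2 ⟨h2, .of_forall fun n => ?_⟩))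
      (hc.tendsto.comp (tendsto_nhdsWithin_iff.2 ⟨h1, .of_forall fun n => ?_⟩))
    · exact hsub (hτmem n _ (hmemr n r hr).1)
    · exact hsub (hτmem n _ (Nat.le_of_succ_le (hmemr n r hr).1))
  -- The right endpoint has to be dropped: at `r = t` the index is `n + 1`, whose cell lies outside
  -- `[0, t]`.
  have hae : ∀ᵐ r, r ∈ uIoc 0 t → r ∈ Ioo 0 t := by
    have hne : ∀ᵐ r : ℝ, r ≠ t := by simp [ae_iff, measure_singleton]
    filter_upwards [hne] with r hr hmem
    rw [uIoc_of_le h0.le] at hmem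
    exact ⟨hmem.1, lt_of_le_of_ne hmem.2 hr⟩
  have hlimae : ∀ᵐ r, r ∈ uIoc 0 t → Tendsto (fun n => D n r) atTop (𝓝 (B r r + B r r)) := by
    filter_upwards [hae] with r hr hmem using hlim r (hr hmem)
  have hbound : ∀ n, ∀ᵐ r, r ∈ uIoc 0 t → ‖D n r‖ ≤ 2 * g r := by
    intro n
    filter_upwards [hae] with r hr hmem
    have hr := hr hmem
    have hrT : r ∈ Icc 0 T := hsub (Ioo_subset_Icc_self hr)
    have h1 := hb r hrT _ (hsub (hτmem n _ (hmemr n r hr).1))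
    have h2 := hb r hrT _ (hsub (hτmem n _ (Nat.le_of_succ_le (hmemr n r hr).1)))
    calc ‖D n r‖ ≤ _ := norm_add_le _ _
      _ ≤ 2 * g r := by simp only [Real.norm_eq_abs]; linarith
  have hconv := intervalIntegral.tendsto_integral_filter_of_dominated_convergence
    (fun r => 2 * g r) (.of_forall fun n => (intervalIntegrable_iff.1 (hDint n)).aestronglyMeasurable)
    (.of_forall hbound) (hgt.const_mul 2) hlimae
  simp only [hDeq] at hconv
  have heq := tendsto_nhds_unique tendsto_const_nhds hconv
  -- Measurability of the diagonal `r ↦ B r r` is not assumed; it is inherited from the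
  -- approximations.
  have hmeasd : AEStronglyMeasurable (fun r => B r r + B r r) (volume.restrict (uIoc 0 t)) :=
    aestronglyMeasurable_of_tendsto_ae atTop
      (fun n => (intervalIntegrable_iff.1 (hDint n)).aestronglyMeasurable)
      ((ae_restrict_iff' measurableSet_uIoc).2 hlimae)
  have hi2 : IntervalIntegrable (fun r => B r r) volume 0 t := by
    have : IntervalIntegrable (fun r => B r r + B r r) volume 0 t := by
      refine (hgt.const_mul 2).mono_fun' hmeasd ((ae_restrict_iff' measurableSet_uIoc).2 ?_)
      filter_upwards [hae] with r hr hmem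
      have hrT : r ∈ Icc 0 T := hsub (Ioo_subset_Icc_self (hr hmem))
      have := hb r hrT r hrT
      calc ‖B r r + B r r‖ ≤ _ := norm_add_le _ _
        _ ≤ 2 * g r := by simp only [Real.norm_eq_abs]; linarith
    have h3 := this.const_mul (1 / 2)
    refine h3.congr_ae (ae_of_all _ fun r => ?_)
    simp only; ring
  refine ⟨hi2, heq.trans ?_⟩
  rw [intervalIntegral.integral_add hi2 hi2]; ring

section Hilbert

variable {X : Type*} [NormedAddCommGroup X] [InnerProductSpace ℝ X] [CompleteSpace X]

/-- `G` is only integrable in time, so `V` need not be differentiable; the increments of `‖V‖²` are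
written in a form to which `energy_identity` applies. -/
theorem norm_sq_eq_of_integral {T : ℝ} {V G : ℝ → X} {x : X} (hV : ContinuousOn V (Icc 0 T))
    (hG : IntegrableOn G (Icc 0 T))
    (h : ∀ t ∈ Icc 0 T, V t = x + ∫ s in (0 : ℝ)..t, G s) {t : ℝ} (ht : t ∈ Icc 0 T) :
    IntervalIntegrable (fun s => inner ℝ (G s) (V s)) volume 0 t ∧
      ‖V t‖ ^ 2 = ‖x‖ ^ 2 + 2 * ∫ s in (0 : ℝ)..t, inner ℝ (G s) (V s) := by
  have hT : 0 ≤ T := ht.1.trans ht.2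
  obtain ⟨C, hC⟩ := isCompact_Icc.exists_bound_of_continuousOn hV
  have hC0 : 0 ≤ C := (norm_nonneg _).trans (hC t ht)
  have hi : ∀ s ∈ Icc 0 T, ∀ t ∈ Icc 0 T, IntervalIntegrable G volume s t := by
    intro s hs t ht
    exact (hG.mono_set (uIcc_subset_Icc hs ht)).intervalIntegrable
  have key := energy_identity (F := fun t => ‖V t‖ ^ 2) (B := fun r t => inner ℝ (G r) (V t))
    (g := fun r => ‖G r‖ * C) (T := T)
    (fun t _ => hG.aestronglyMeasurable.inner aestronglyMeasurable_const)
    (fun r _ => continuousOn_const.inner hV)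
    (hG.norm.mul_const C)
    (fun r _ t ht => (abs_real_inner_le_norm _ _).trans
      (mul_le_mul_of_nonneg_left (hC t ht) (norm_nonneg _))) (by
      intro s hs t ht hst
      have h1 : V t - V s = ∫ r in s..t, G r := by
        rw [h t ht, h s hs, add_sub_add_left_eq_sub, intervalIntegral.integral_interval_sub_left
          (hi 0 (left_mem_Icc.2 hT) t ht) (hi 0 (left_mem_Icc.2 hT) s hs)]
      -- Polarisation: a difference of squares is the pairing of the sum with the difference, and
      -- the difference is the integral of `G`.
      have h2 : ‖V t‖ ^ 2 - ‖V s‖ ^ 2 = inner ℝ (V t + V s) (V t - V s) := by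
        rw [inner_add_left, inner_sub_right, inner_sub_right, real_inner_self_eq_norm_sq,
          real_inner_self_eq_norm_sq, real_inner_comm (V s) (V t)]
        ring
      have h3 : ∀ y : X, IntervalIntegrable (fun r => inner ℝ (G r) y) volume s t := by
        intro y
        have h4 : IntegrableOn (fun r => inner ℝ (G r) y) (Icc 0 T) := Integrable.inner_const hG y
        exact (h4.mono_set (uIcc_subset_Icc hs ht)).intervalIntegrable
      rw [h2, h1, intervalIntegral.integral_add (h3 _) (h3 _), ← intervalIntegral.integral_add (h3 _) (h3 _)]
      have h4 : ∀ y : X, inner ℝ y (∫ r in s..t, G r) = ∫ r in s..t, inner ℝ (G r) y := by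
        intro y
        have := (innerSL ℝ y).intervalIntegral_comp_comm (hi s hs t ht)
        simp only [innerSL_apply_apply] at this
        rw [← this]
        simp only [real_inner_comm]
      rw [h4]
      simp only [inner_add_right]) ht
  refine ⟨key.1, ?_⟩
  have h0 : V 0 = x := by
    rw [h 0 (left_mem_Icc.2 hT)]; simp
  have := key.2
  simp only [h0] at this
  linarith

end Hilbert

section Banach

variable {X : Type*} [NormedAddCommGroup X] [NormedSpace ℝ X]

theorem linear_ode_unique {T L : ℝ} {A : ℝ → X →L[ℝ] X} (hA : ∀ t ∈ Icc 0 T, ‖A t‖ ≤ L)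
    {F V W : ℝ → X} {x : X} (hV : ContinuousOn V (Icc 0 T)) (hW : ContinuousOn W (Icc 0 T))
    (hVi : IntegrableOn (fun s => A s (V s) + F s) (Icc 0 T))
    (hWi : IntegrableOn (fun s => A s (W s) + F s) (Icc 0 T))
    (hVe : ∀ t ∈ Icc 0 T, V t = x + ∫ s in (0 : ℝ)..t, (A s (V s) + F s))
    (hWe : ∀ t ∈ Icc 0 T, W t = x + ∫ s in (0 : ℝ)..t, (A s (W s) + F s)) :
    ∀ t ∈ Icc 0 T, V t = W t := by
  intro t ht
  have hL : 0 ≤ L := (norm_nonneg _).trans (hA t ht)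
  have hc : ContinuousOn (fun t => ‖V t - W t‖) (Icc 0 T) := (hV.sub hW).norm
  have := gronwall_integral (C := 0) hL hc (by
    intro t ht
    have hsub : uIcc 0 t ⊆ Icc 0 T := by
      rw [uIcc_of_le ht.1]; exact Icc_subset_Icc_right ht.2
    have hle : Icc 0 t ⊆ Icc 0 T := Icc_subset_Icc_right ht.2
    have e : V t - W t = ∫ s in (0 : ℝ)..t, A s (V s - W s) := by
      rw [hVe t ht, hWe t ht, add_sub_add_left_eq_sub,
        ← intervalIntegral.integral_sub (hVi.mono_set hsub).intervalIntegrable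
          (hWi.mono_set hsub).intervalIntegrable]
      congr 1; ext s; rw [map_sub]; abel
    rw [zero_add, e, ← intervalIntegral.integral_const_mul]
    refine intervalIntegral.norm_integral_le_of_norm_le ht.1 (ae_of_all _ fun s hs => ?_)
      (((hc.mono hle).intervalIntegrable_of_Icc ht.1).const_mul L)
    have hs' : s ∈ Icc 0 T := hle (Ioc_subset_Icc_self hs)
    exact ((A s).le_opNorm _).trans (mul_le_mul_of_nonneg_right (hA s hs') (norm_nonneg _))) t ht
  rw [zero_mul] at this
  exact sub_eq_zero.1 (norm_le_zero_iff.1 this)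

/-- Picard iteration on the whole interval at once, contracting in the sup norm with weight `exp (-λ
t)`. Measurability is requested only along continuous curves, since `t ↦ A t` may fail to be
measurable in operator norm. -/
theorem linear_ode_exists [CompleteSpace X] {T L : ℝ} (hT : 0 ≤ T) {A : ℝ → X →L[ℝ] X}
    (hA : ∀ t ∈ Icc 0 T, ‖A t‖ ≤ L)
    (hm : ∀ V : ℝ → X, ContinuousOn V (Icc 0 T) →
      AEStronglyMeasurable (fun t => A t (V t)) (volume.restrict (Icc 0 T)))
    {F : ℝ → X} (hF : IntegrableOn F (Icc 0 T)) (x : X) :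
    ∃ V : ℝ → X, ContinuousOn V (Icc 0 T) ∧
      IntegrableOn (fun s => A s (V s) + F s) (Icc 0 T) ∧
      ∀ t ∈ Icc 0 T, V t = x + ∫ s in (0 : ℝ)..t, (A s (V s) + F s) := by
  have hL : 0 ≤ L := (norm_nonneg _).trans (hA 0 (left_mem_Icc.2 hT))
  have hAi : ∀ V : ℝ → X, ContinuousOn V (Icc 0 T) → IntegrableOn (fun s => A s (V s)) (Icc 0 T) := by
    intro V hV
    have h1 : IntegrableOn (fun s => L * ‖V s‖) (Icc 0 T) :=
      (continuousOn_const.mul hV.norm).integrableOn_Icc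
    refine h1.mono' (hm V hV) ((ae_restrict_mem measurableSet_Icc).mono fun s hs => ?_)
    exact ((A s).le_opNorm _).trans (mul_le_mul_of_nonneg_right (hA s hs) (norm_nonneg _))
  -- Any weight with `L / lam ≤ 1/2` would do; the added 1 keeps it positive when `L = 0`.
  let lam : ℝ := 2 * L + 1
  have hlam : 0 < lam := by positivity
  -- The unknown of the fixed point problem is the weighted curve `exp (-lam t) V t`; `ext` removes
  -- the weight and makes it a function on the line.
  let ext : C(Icc (0 : ℝ) T, X) → ℝ → X := fun W t => Real.exp (lam * t) • W (projIcc 0 T hT t)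
  have hext : ∀ W, Continuous (ext W) := by
    intro W
    have := W.continuous.comp (continuous_projIcc (h := hT))
    exact (by fun_prop : Continuous fun t : ℝ => Real.exp (lam * t)).smul this
  have hint : ∀ W, IntegrableOn (fun s => A s (ext W s) + F s) (Icc 0 T) := fun W =>
    (hAi _ (hext W).continuousOn).add hF
  have hprim : ∀ W, ContinuousOn (fun t => ∫ s in (0 : ℝ)..t, (A s (ext W s) + F s)) (Icc 0 T) := by
    intro W
    have := intervalIntegral.continuousOn_primitive_interval (a := (0 : ℝ)) (b := T)
      (f := fun s => A s (ext W s) + F s) (μ := volume) (by rw [uIcc_of_le hT]; exact hint W)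
    rwa [uIcc_of_le hT] at this
  let Φ : C(Icc (0 : ℝ) T, X) → C(Icc (0 : ℝ) T, X) := fun W =>
    { toFun := fun t => Real.exp (-lam * t) • (x + ∫ s in (0 : ℝ)..t, (A s (ext W s) + F s))
      continuous_toFun := by
        have h1 := continuousOn_iff_continuous_domRestrict.1 (hprim W)
        exact (by fun_prop : Continuous fun t : Icc (0 : ℝ) T => Real.exp (-lam * t)).smul
          (continuous_const.add h1) }
  have hcontr : ContractingWith (1 / 2) Φ := by
    refine ⟨by norm_num, LipschitzWith.of_dist_le_mul fun W W' => ?_⟩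
    rw [ContinuousMap.dist_le (by positivity)]
    intro t
    have hsub : uIcc 0 t.1 ⊆ Icc 0 T := by
      rw [uIcc_of_le t.2.1]; exact Icc_subset_Icc_right t.2.2
    have e : Φ W t - Φ W' t = Real.exp (-lam * t) • ∫ s in (0 : ℝ)..t, A s (ext W s - ext W' s) := by
      simp only [Φ, ContinuousMap.coe_mk]
      rw [← smul_sub, add_sub_add_left_eq_sub,
        ← intervalIntegral.integral_sub ((hint W).mono_set hsub).intervalIntegrable
          ((hint W').mono_set hsub).intervalIntegrable]
      congr 2; ext s; rw [map_sub]; abel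
    rw [dist_eq_norm, e, norm_smul, Real.norm_of_nonneg (Real.exp_pos _).le]
    have h1 : ‖∫ s in (0 : ℝ)..t, A s (ext W s - ext W' s)‖
        ≤ ∫ s in (0 : ℝ)..t, L * (Real.exp (lam * s) * dist W W') := by
      refine intervalIntegral.norm_integral_le_of_norm_le t.2.1 (ae_of_all _ fun s hs => ?_)
        (Continuous.intervalIntegrable (by fun_prop) _ _)
      have hs' : s ∈ Icc 0 T := ⟨hs.1.le, hs.2.trans t.2.2⟩
      refine ((A s).le_opNorm _).trans (mul_le_mul (hA s hs') ?_ (norm_nonneg _) hL)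
      simp only [ext]
      rw [← smul_sub, norm_smul, Real.norm_of_nonneg (Real.exp_pos _).le]
      refine mul_le_mul_of_nonneg_left ?_ (Real.exp_pos _).le
      rw [← dist_eq_norm]
      exact ContinuousMap.dist_apply_le_dist _
    have h2 : ∫ s in (0 : ℝ)..t, L * (Real.exp (lam * s) * dist W W')
        = L * dist W W' * ((Real.exp (lam * t) - 1) / lam) := by
      have : ∫ s in (0 : ℝ)..t, Real.exp (lam * s) = (Real.exp (lam * t) - 1) / lam := by
        rw [intervalIntegral.integral_comp_mul_left (fun s => Real.exp s) hlam.ne', integral_exp]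
        simp [div_eq_inv_mul]
      rw [intervalIntegral.integral_const_mul, intervalIntegral.integral_mul_const, this]
      ring
    rw [h2] at h1
    refine (mul_le_mul_of_nonneg_left h1 (Real.exp_pos _).le).trans ?_
    have h3 : Real.exp (-lam * t) * Real.exp (lam * t) = 1 := by
      rw [← Real.exp_add]; simp
    have h4 : Real.exp (-lam * t) * (L * dist W W' * ((Real.exp (lam * t) - 1) / lam))
        = L / lam * (1 - Real.exp (-lam * t)) * dist W W' := by
      have : Real.exp (-lam * t) * (L * dist W W' * ((Real.exp (lam * t) - 1) / lam))
          = L / lam * (Real.exp (-lam * t) * Real.exp (lam * t) - Real.exp (-lam * t)) * dist W W' := by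
        ring
      rw [this, h3]
    rw [h4]
    have h5 : L / lam ≤ 1 / 2 := by
      rw [div_le_iff₀ hlam]; simp only [lam]; linarith
    have h6 : 1 - Real.exp (-lam * t) ≤ 1 := by linarith [Real.exp_pos (-lam * t)]
    have h7 : 0 ≤ L / lam := by positivity
    have h8 : L / lam * (1 - Real.exp (-lam * t)) ≤ 1 / 2 := by nlinarith
    have h9 : ((1 / 2 : NNReal) : ℝ) = 1 / 2 := by norm_num
    rw [h9]
    exact mul_le_mul_of_nonneg_right h8 dist_nonneg
  have hfix := hcontr.fixedPoint_isFixedPt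
  set W := ContractingWith.fixedPoint Φ hcontr
  refine ⟨ext W, (hext W).continuousOn, hint W, fun t ht => ?_⟩
  have h1 : W ⟨t, ht⟩ = Real.exp (-lam * t) • (x + ∫ s in (0 : ℝ)..t, (A s (ext W s) + F s)) := by
    conv_lhs => rw [← hfix.eq]
    rfl
  have h2 : ext W t = Real.exp (lam * t) • W ⟨t, ht⟩ := by
    simp only [ext]
    rw [projIcc_of_mem hT ht]
  rw [h2, h1, smul_smul, ← Real.exp_add]
  simp

end Banach

end
end LevyFD

namespace LevyFD
noncomputable section
open Filter Topology

/-! ### Operators on square summable sequences -/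

/-- Square summable functions on `ℤ`. -/
abbrev Seq : Type := lp (fun _ : ℤ => ℝ) 2

theorem memℓp_two_iff {φ : ℤ → ℝ} : Memℓp φ 2 ↔ Summable fun k => φ k ^ 2 := by
  rw [memℓp_gen_iff (by norm_num)]
  simp

@[simp] theorem Seq.add_apply (x y : Seq) (k : ℤ) : (x + y) k = x k + y k := rfl

@[simp] theorem Seq.sub_apply (x y : Seq) (k : ℤ) : (x - y) k = x k - y k := rfl

@[simp] theorem Seq.smul_apply (r : ℝ) (x : Seq) (k : ℤ) : (r • x) k = r * x k := rfl

theorem Seq.summable_sq (x : Seq) : Summable fun k => x k ^ 2 := memℓp_two_iff.1 x.2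

theorem Seq.norm_sq (x : Seq) : ‖x‖ ^ 2 = ∑' k, x k ^ 2 := by
  have := lp.norm_rpow_eq_tsum (p := 2) (by norm_num) x
  simpa using this

theorem Seq.inner_eq (x y : Seq) : inner ℝ x y = ∑' k, x k * y k := by
  rw [lp.inner_eq_tsum]
  simp [mul_comm]

theorem Seq.summable_mul (x y : Seq) : Summable fun k => x k * y k := by
  refine Summable.of_norm_bounded ((x.summable_sq.add y.summable_sq)) fun k => ?_
  rw [norm_mul, Real.norm_eq_abs, Real.norm_eq_abs, ← sq_abs (x k), ← sq_abs (y k)]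
  nlinarith [sq_nonneg (|x k| - |y k|), sq_nonneg (|x k|), sq_nonneg (|y k|)]

theorem Seq.abs_apply_le (x : Seq) (k : ℤ) : |x k| ≤ ‖x‖ := lp.norm_apply_le_norm (by norm_num) x k

theorem Seq.norm_le_of_abs_le {x y : Seq} {C : ℝ} (hC : 0 ≤ C) (h : ∀ k, |x k| ≤ C * |y k|) :
    ‖x‖ ≤ C * ‖y‖ := by
  apply le_of_sq_le_sq _ (by positivity)
  rw [mul_pow, x.norm_sq, y.norm_sq, ← tsum_mul_left]
  refine x.summable_sq.tsum_le_tsum (fun k => ?_) (y.summable_sq.mul_left _)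
  rw [← sq_abs (x k), ← sq_abs (y k), ← mul_pow]
  exact pow_le_pow_left₀ (abs_nonneg _) (h k) 2

theorem Seq.summable_sq_shift (x : Seq) (p : ℤ) : Summable fun k => x (k + p) ^ 2 :=
  x.summable_sq.comp_injective (add_left_injective p)

/-- The shift by `p`. -/
def shift (p : ℤ) : Seq →L[ℝ] Seq :=
  LinearMap.mkContinuous
    { toFun := fun x => ⟨fun k => x (k + p), memℓp_two_iff.2 (x.summable_sq_shift p)⟩
      map_add' := fun x y => rfl
      map_smul' := fun r x => rfl } 1 (by
    intro x
    rw [one_mul]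
    apply le_of_sq_le_sq _ (norm_nonneg _)
    rw [Seq.norm_sq, Seq.norm_sq]
    exact ((Equiv.addRight p).tsum_eq fun k => x k ^ 2).le)

@[simp] theorem shift_apply (p : ℤ) (x : Seq) (k : ℤ) : shift p x k = x (k + p) := rfl

@[simp] theorem norm_shift (p : ℤ) (x : Seq) : ‖shift p x‖ = ‖x‖ := by
  have h : ‖shift p x‖ ^ 2 = ‖x‖ ^ 2 := by
    rw [Seq.norm_sq, Seq.norm_sq]
    exact (Equiv.addRight p).tsum_eq fun k => x k ^ 2
  exact (pow_left_inj₀ (norm_nonneg _) (norm_nonneg _) two_ne_zero).1 h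

theorem Seq.ext {x y : Seq} (h : ∀ k, x k = y k) : x = y := lp.ext (funext h)

@[simp] theorem shift_zero (x : Seq) : shift 0 x = x := Seq.ext fun k => by simp

theorem shift_shift (p q : ℤ) (x : Seq) : shift p (shift q x) = shift (p + q) x :=
  Seq.ext fun k => by simp [add_assoc]

theorem inner_shift_left (p : ℤ) (x y : Seq) : inner ℝ (shift p x) y = inner ℝ x (shift (-p) y) := by
  rw [Seq.inner_eq, Seq.inner_eq, ← (Equiv.addRight p).tsum_eq fun k => x k * shift (-p) y k]
  simp

open Classical in
/-- Multiplication by a bounded sequence. -/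
def mulOp (g : ℤ → ℝ) : Seq →L[ℝ] Seq :=
  if hg : ∃ C : ℝ, ∀ k, |g k| ≤ C then
    LinearMap.mkContinuous
      { toFun := fun x => ⟨fun k => g k * x k, memℓp_two_iff.2 (by
          obtain ⟨C, hC⟩ := hg
          refine Summable.of_nonneg_of_le (fun k => sq_nonneg _) (fun k => ?_)
            (x.summable_sq.mul_left (C ^ 2))
          rw [mul_pow, ← sq_abs (g k)]
          exact mul_le_mul_of_nonneg_right (pow_le_pow_left₀ (abs_nonneg _) (hC k) 2)
            (sq_nonneg _))⟩
        map_add' := fun x y => Seq.ext fun k => mul_add _ _ _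
        map_smul' := fun r x => Seq.ext fun k => mul_left_comm _ _ _ } hg.choose (by
      intro x
      have hC := hg.choose_spec
      refine Seq.norm_le_of_abs_le ((abs_nonneg _).trans (hC 0)) fun k => ?_
      change |g k * x k| ≤ _
      rw [abs_mul]
      exact mul_le_mul_of_nonneg_right (hC k) (abs_nonneg _))
  else 0

theorem mulOp_apply {g : ℤ → ℝ} {C : ℝ} (hg : ∀ k, |g k| ≤ C) (x : Seq) (k : ℤ) :
    mulOp g x k = g k * x k := by
  have h : ∃ C : ℝ, ∀ k, |g k| ≤ C := ⟨C, hg⟩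
  rw [mulOp, dif_pos h]
  rfl

theorem norm_mulOp_le {g : ℤ → ℝ} {C : ℝ} (hg : ∀ k, |g k| ≤ C) (x : Seq) :
    ‖mulOp g x‖ ≤ C * ‖x‖ := by
  refine Seq.norm_le_of_abs_le ((abs_nonneg _).trans (hg 0)) fun k => ?_
  rw [mulOp_apply hg, abs_mul]
  exact mul_le_mul_of_nonneg_right (hg k) (abs_nonneg _)

/-- The only source of dissipativity of the jump operators: translations are isometries, so the
correlation function of `w` is maximal at zero. -/
theorem inner_shift_self_le (p : ℤ) (w : Seq) : inner ℝ (shift p w) w ≤ ‖w‖ ^ 2 := by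
  have := real_inner_le_norm (shift p w) w
  rwa [norm_shift, ← sq] at this

/-- Multiplication composed with an antisymmetric difference is bounded in energy by the
oscillation of the multiplier. -/
theorem abs_inner_mulOp_skew_le {g : ℤ → ℝ} {C Λ : ℝ} (hg : ∀ k, |g k| ≤ C) {p : ℤ}
    (hΛ : ∀ k, |g (k + p) - g k| ≤ Λ) (w : Seq) :
    |inner ℝ (mulOp g (shift p w - shift (-p) w)) w| ≤ Λ * ‖w‖ ^ 2 := by
  -- Taking adjoints turns the backward shift into a forward one with the multiplier translated by
  -- `p`. In the difference only `g - g (· + p)` survives.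
  have h1 : inner ℝ (mulOp g (shift (-p) w)) w = inner ℝ (mulOp (fun k => g (k + p)) (shift p w)) w := by
    have e1 : inner ℝ (mulOp g (shift (-p) w)) w = inner ℝ (shift (-p) w) (mulOp g w) := by
      rw [Seq.inner_eq, Seq.inner_eq]
      congr 1; ext k
      rw [mulOp_apply hg, mulOp_apply hg]; ring
    rw [e1, inner_shift_left, neg_neg, real_inner_comm]
    congr 1
    refine Seq.ext fun k => ?_
    rw [shift_apply, mulOp_apply hg, mulOp_apply fun k => hg (k + p), shift_apply]
  have hΛ' : ∀ k, |g k - g (k + p)| ≤ Λ := fun k => by rw [abs_sub_comm]; exact hΛ k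
  have h2 : inner ℝ (mulOp g (shift p w - shift (-p) w)) w
      = inner ℝ (mulOp (fun k => g k - g (k + p)) (shift p w)) w := by
    rw [map_sub, inner_sub_left, h1, ← inner_sub_left]
    congr 1
    refine Seq.ext fun k => ?_
    rw [Seq.sub_apply, mulOp_apply hg, mulOp_apply fun k => hg (k + p), mulOp_apply hΛ']
    ring
  rw [h2]
  calc _ ≤ ‖mulOp (fun k => g k - g (k + p)) (shift p w)‖ * ‖w‖ := abs_real_inner_le_norm _ _
    _ ≤ (Λ * ‖shift p w‖) * ‖w‖ :=
      mul_le_mul_of_nonneg_right (norm_mulOp_le hΛ' _) (norm_nonneg _)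
    _ = _ := by rw [norm_shift]; ring

/-- A nonnegative multiple of a second difference is dissipative up to the second difference of
the multiplier. -/
theorem inner_mulOp_second_diff_le {g : ℤ → ℝ} {C Λ : ℝ} (hg : ∀ k, |g k| ≤ C) (hg0 : ∀ k, 0 ≤ g k)
    {q : ℤ} (hΛ : ∀ k, |g (k + q) - 2 * g k + g (k - q)| ≤ Λ) (w : Seq) :
    inner ℝ (mulOp g (shift q w - (2 : ℝ) • w + shift (-q) w)) w ≤ Λ / 2 * ‖w‖ ^ 2 := by
  have hC : 0 ≤ C := (abs_nonneg _).trans (hg 0)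
  have hs : ∀ p r : ℤ, Summable fun k => g (k + p) * w (k + r) ^ 2 := by
    intro p r
    have h1 : Summable fun k => w (k + r) ^ 2 := w.summable_sq_shift r
    refine Summable.of_nonneg_of_le (fun k => mul_nonneg (hg0 _) (sq_nonneg _)) (fun k => ?_)
      (h1.mul_left C)
    exact mul_le_mul_of_nonneg_right ((le_abs_self _).trans (hg _)) (sq_nonneg _)
  have e1 : ∑' k, g k * w (k + q) ^ 2 = ∑' k, g (k - q) * w k ^ 2 := by
    rw [← (Equiv.addRight q).tsum_eq fun k => g (k - q) * w k ^ 2]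
    simp
  have e2 : ∑' k, g k * w (k + -q) ^ 2 = ∑' k, g (k + q) * w k ^ 2 := by
    rw [← (Equiv.addRight (-q)).tsum_eq fun k => g (k + q) * w k ^ 2]
    simp
  have s0 := hs 0 0
  have s1 := hs 0 q
  have s2 := hs 0 (-q)
  have s3 := hs q 0
  have s4 := hs (-q) 0
  simp only [add_zero] at s0 s1 s2 s3 s4
  have s4' : Summable fun k => g (k - q) * w k ^ 2 := s4
  have hsum : Summable fun k => (g (k + q) - 2 * g k + g (k - q)) / 2 * w k ^ 2 := by
    have := ((s3.sub (s0.mul_left 2)).add s4').mul_left (1 / 2)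
    refine this.congr fun k => ?_
    ring
  -- Pointwise, `w` times its second difference is half the second difference of `w²` minus half the
  -- two squared increments. The latter are discarded by `g ≥ 0`; summation by parts then moves the
  -- second difference from `w²` to `g`.
  have hle : inner ℝ (mulOp g (shift q w - (2 : ℝ) • w + shift (-q) w)) w
      ≤ ∑' k, (g (k + q) - 2 * g k + g (k - q)) / 2 * w k ^ 2 := by
    have e3 : ∑' k, (g (k + q) - 2 * g k + g (k - q)) / 2 * w k ^ 2
        = ∑' k, (1 / 2) * (g k * w (k + q) ^ 2 - 2 * (g k * w k ^ 2) + g k * w (k + -q) ^ 2) := by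
      rw [tsum_mul_left, (s1.sub (s0.mul_left 2)).tsum_add s2, s1.tsum_sub (s0.mul_left 2), e1, e2,
        ← s4'.tsum_sub (s0.mul_left 2), ← (s4'.sub (s0.mul_left 2)).tsum_add s3, ← tsum_mul_left]
      congr 1; ext k; ring
    rw [e3, Seq.inner_eq]
    refine Summable.tsum_le_tsum (fun k => ?_) ?_ ?_
    · rw [mulOp_apply hg]
      rw [Seq.add_apply, Seq.sub_apply, Seq.smul_apply, shift_apply, shift_apply]
      nlinarith [mul_nonneg (hg0 k) (sq_nonneg (w (k + q) - w k)),
        mul_nonneg (hg0 k) (sq_nonneg (w (k + -q) - w k))]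
    · exact Seq.summable_mul _ _
    · exact ((s1.sub (s0.mul_left 2)).add s2).mul_left _
  refine hle.trans ?_
  rw [w.norm_sq, ← tsum_mul_left]
  refine hsum.tsum_le_tsum (fun k => ?_) (w.summable_sq.mul_left _)
  exact mul_le_mul_of_nonneg_right (by linarith [(abs_le.1 (hΛ k)).2]) (sq_nonneg _)

/-- The forward difference quotient on `Seq`. -/
def delta (ε : ℝ) : Seq →L[ℝ] Seq := ε⁻¹ • (shift 1 - ContinuousLinearMap.id ℝ Seq)

/-- The average of a sequence and its shift by one. -/
def avg : Seq →L[ℝ] Seq := (1 / 2 : ℝ) • (shift 1 + ContinuousLinearMap.id ℝ Seq)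

/-- The central difference quotient with stride `n` and mesh size `h`. -/
def cdiff (h : ℝ) (n : ℤ) : Seq →L[ℝ] Seq := (2 * h)⁻¹ • (shift n - shift (-n))

@[simp] theorem delta_apply (ε : ℝ) (x : Seq) (k : ℤ) : delta ε x k = ε⁻¹ * (x (k + 1) - x k) := rfl

@[simp] theorem avg_apply (x : Seq) (k : ℤ) : avg x k = (1 / 2) * (x (k + 1) + x k) := rfl

@[simp] theorem cdiff_apply (h : ℝ) (n : ℤ) (x : Seq) (k : ℤ) :
    cdiff h n x k = (2 * h)⁻¹ * (x (k + n) - x (k + -n)) := rfl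

/-- The average of a function on `ℤ` and its shift by one. -/
def av (φ : ℤ → ℝ) : ℤ → ℝ := fun k => (1 / 2) * (φ (k + 1) + φ k)

theorem norm_avg_le (x : Seq) : ‖avg x‖ ≤ ‖x‖ := by
  have h := norm_add_le (shift 1 x) x
  rw [norm_shift] at h
  calc ‖avg x‖ = ‖(1 / 2 : ℝ) • (shift 1 x + x)‖ := rfl
    _ = 1 / 2 * ‖shift 1 x + x‖ := by rw [norm_smul]; norm_num
    _ ≤ ‖x‖ := by linarith

theorem norm_avg_pow_le (i : ℕ) (x : Seq) : ‖(avg ^ i) x‖ ≤ ‖x‖ := by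
  induction i with
  | zero => simp
  | succ i ih =>
    rw [pow_succ']
    exact (norm_avg_le _).trans ih

theorem coe_delta_pow (ε : ℝ) (j : ℕ) (x : Seq) : ⇑((delta ε ^ j) x) = (fd ε)^[j] x := by
  induction j with
  | zero => rfl
  | succ j ih =>
    rw [pow_succ', Function.iterate_succ_apply', ← ih]
    ext k
    simp [fd, div_eq_inv_mul]

theorem coe_avg_pow (j : ℕ) (x : Seq) : ⇑((avg ^ j) x) = av^[j] x := by
  induction j with
  | zero => rfl
  | succ j ih =>
    rw [pow_succ', Function.iterate_succ_apply', ← ih]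
    rfl

theorem fd_av_comm (ε : ℝ) : Function.Commute (fd ε) av := by
  intro φ; ext k; simp only [fd, av]; ring

/-- The discrete Leibniz rule. -/
theorem fd_mul (ε : ℝ) (f g : ℤ → ℝ) :
    fd ε (fun k => f k * g k) = fun k => fd ε f k * av g k + av f k * fd ε g k := by
  ext k; simp only [fd, av]; ring

theorem fd_sum {ι : Type*} (ε : ℝ) (s : Finset ι) (F : ι → ℤ → ℝ) (c : ι → ℕ) :
    fd ε (fun k => ∑ i ∈ s, c i • F i k) = fun k => ∑ i ∈ s, c i • fd ε (F i) k := by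
  ext k
  simp only [fd, ← Finset.sum_sub_distrib, Finset.sum_div]
  refine Finset.sum_congr rfl fun i _ => ?_
  simp only [nsmul_eq_mul]
  ring

/-- Averages commute with differences, so the symmetric product rule iterates like the binomial
theorem. The averages falling on `g` are essential: they make the term with exactly one difference
on the coefficient antisymmetric, see `inner_mulOp_avg_cdiff_cdiff_le`. -/
theorem iterate_fd_mul (ε : ℝ) (f g : ℤ → ℝ) (j : ℕ) :
    (fd ε)^[j] (fun k => f k * g k) = fun k => ∑ p ∈ Finset.HasAntidiagonal.antidiagonal j,
      j.choose p.1 • (((fd ε)^[p.1] (av^[p.2] f)) k * (av^[p.1] ((fd ε)^[p.2] g)) k) := by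
  induction j with
  | zero => ext k; simp
  | succ j ih =>
    rw [Function.iterate_succ_apply', ih, fd_sum]
    ext k
    rw [Finset.sum_antidiagonal_choose_succ_nsmul
      (fun a b => (((fd ε)^[a] (av^[b] f)) k * (av^[a] ((fd ε)^[b] g)) k)),
      ← Finset.sum_add_distrib]
    refine Finset.sum_congr rfl fun p hp => ?_
    have hp' : j.choose p.2 = j.choose p.1 := by
      rw [← Finset.HasAntidiagonal.mem_antidiagonal.1 hp, add_comm p.1, Nat.choose_symm_add]
    rw [hp', ← smul_add, fd_mul]
    congr 1
    have c1 : av ((fd ε)^[p.1] (av^[p.2] f)) = (fd ε)^[p.1] (av^[p.2 + 1] f) := by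
      rw [Function.iterate_succ_apply' av,
        ((fd_av_comm ε).iterate_left p.1).eq]
    have c2 : fd ε (av^[p.1] ((fd ε)^[p.2] g)) = av^[p.1] ((fd ε)^[p.2 + 1] g) := by
      rw [Function.iterate_succ_apply' (fd ε), ((fd_av_comm ε).iterate_right p.1).eq]
    rw [c1, c2, Function.iterate_succ_apply' (fd ε) p.1, Function.iterate_succ_apply' av p.1]
    ring

/-- All difference quotients of `g` up to order `r` are bounded by `K`. -/
def DiffBound (ε K : ℝ) (r : ℕ) (g : ℤ → ℝ) : Prop := ∀ i ≤ r, ∀ k, |(fd ε)^[i] g k| ≤ K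

theorem DiffBound.av {ε K : ℝ} {r : ℕ} {g : ℤ → ℝ} (h : DiffBound ε K r g) :
    DiffBound ε K r (LevyFD.av g) := by
  intro i hi k
  rw [((fd_av_comm ε).iterate_left i).eq, LevyFD.av, abs_mul]
  have h1 := h i hi k
  have h2 := h i hi (k + 1)
  have h3 := abs_add_le ((fd ε)^[i] g (k + 1)) ((fd ε)^[i] g k)
  rw [abs_of_pos (by norm_num : (0 : ℝ) < 1 / 2)]
  linarith

theorem DiffBound.iterate_av {ε K : ℝ} {r : ℕ} {g : ℤ → ℝ} (h : DiffBound ε K r g) (l : ℕ) :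
    DiffBound ε K r (LevyFD.av^[l] g) := by
  induction l with
  | zero => exact h
  | succ l ih => rw [Function.iterate_succ_apply']; exact ih.av

theorem DiffBound.bound {ε K : ℝ} {r : ℕ} {g : ℤ → ℝ} (h : DiffBound ε K r g) (k : ℤ) : |g k| ≤ K :=
  h 0 (Nat.zero_le _) k

theorem DiffBound.iterate_fd {ε K : ℝ} {r : ℕ} {g : ℤ → ℝ} (i : ℕ) (h : DiffBound ε K (i + r) g) :
    DiffBound ε K r ((LevyFD.fd ε)^[i] g) := fun j hj k => by
  have := h (j + i) (by omega) k
  rwa [Function.iterate_add_apply] at this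

theorem DiffBound.mono {ε K : ℝ} {r s : ℕ} {g : ℤ → ℝ} (h : DiffBound ε K r g) (hs : s ≤ r) :
    DiffBound ε K s g := fun i hi k => h i (hi.trans hs) k

theorem iterate_av_nonneg {g : ℤ → ℝ} (h : ∀ k, 0 ≤ g k) (l : ℕ) (k : ℤ) : 0 ≤ av^[l] g k := by
  induction l generalizing k with
  | zero => exact h k
  | succ l ih =>
    rw [Function.iterate_succ_apply', av]
    have := ih k
    have := ih (k + 1)
    positivity

theorem abs_shift_sub_le {ε Λ : ℝ} (hε : 0 < ε) {g : ℤ → ℝ} (h : ∀ k, |fd ε g k| ≤ Λ) (p : ℕ)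
    (k : ℤ) : |g (k + p) - g k| ≤ p * (ε * Λ) := by
  induction p with
  | zero => simp
  | succ p ih =>
    have h1 := h (k + p)
    rw [fd, abs_div, abs_of_pos hε, div_le_iff₀ hε] at h1
    have h2 := abs_add_le (g (k + p + 1) - g (k + p)) (g (k + p) - g k)
    have e : g (k + (p + 1 : ℕ)) - g k = (g (k + p + 1) - g (k + p)) + (g (k + p) - g k) := by
      push_cast; rw [add_assoc k]; ring
    rw [e]
    push_cast
    linarith

theorem abs_second_diff_le {ε Λ : ℝ} (hε : 0 < ε) {g : ℤ → ℝ} (h : ∀ k, |(fd ε)^[2] g k| ≤ Λ)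
    (q : ℕ) (k : ℤ) : |g (k + q) - 2 * g k + g (k - q)| ≤ (q * ε) ^ 2 * Λ := by
  have h1 : ∀ k, |fd ε (fun k => g (k + q) - g k) k| ≤ q * (ε * Λ) := by
    intro k
    have := abs_shift_sub_le hε (g := fd ε g) h q k
    convert this using 2
    simp only [fd]
    rw [add_right_comm]; ring
  have h2 := abs_shift_sub_le hε h1 q (k - q)
  simp only [sub_add_cancel] at h2
  have e : g (k + q) - 2 * g k + g (k - q) = g (k + q) - g k - (g k - g (k - q)) := by ring
  rw [e]
  calc _ ≤ _ := h2
    _ = _ := by ring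

end
end LevyFD

namespace LevyFD
noncomputable section
open Filter Topology

/-! ### The discretised jump operator -/

/-- The index of the cell of mesh size `h` that contains `z`. -/
def cidx (h z : ℝ) : ℤ := if 0 < z then ⌈z / h⌉ else ⌊z / h⌋

theorem measurable_cidx (h : ℝ) : Measurable (cidx h) :=
  Measurable.ite measurableSet_Ioi (Int.measurable_ceil.comp (measurable_id.div_const h))
    (Int.measurable_floor.comp (measurable_id.div_const h))

theorem cidx_pos {h z : ℝ} (hh : 0 < h) (hz : 0 < z) : 0 < cidx h z := by
  rw [cidx, if_pos hz]; exact Int.ceil_pos.2 (by positivity)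

theorem cidx_neg {h z : ℝ} (hh : 0 < h) (hz : z < 0) : cidx h z < 0 := by
  rw [cidx, if_neg hz.le.not_gt, Int.floor_lt, div_lt_iff₀ hh]; simpa

/-- Ceiling for positive and floor for negative `z` reproduce the half-open cells. Sums over cells
thereby become integrals of functions of `cidx h z`. The index 0 is excluded because its cell is
empty although `cidx h 0 = 0`. -/
theorem mem_cell_iff {h : ℝ} (hh : 0 < h) {k : ℤ} (hk : k ≠ 0) {z : ℝ} :
    z ∈ cell h k ↔ cidx h z = k := by
  rcases lt_or_gt_of_ne hk with hk0 | hk0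
  · rw [cell, if_neg (by omega), if_pos (by omega)]
    have hk' : ((k : ℝ) + 1) * h ≤ 0 := by
      have : (k : ℝ) + 1 ≤ 0 := by exact_mod_cast hk0
      nlinarith
    constructor
    · rintro ⟨h1, h2⟩
      rw [cidx, if_neg (by linarith), Int.floor_eq_iff, le_div_iff₀ hh, div_lt_iff₀ hh]
      exact ⟨h1, h2⟩
    · intro he
      have hz : ¬ 0 < z := fun hz => by have := cidx_pos hh hz; omega
      rw [cidx, if_neg hz, Int.floor_eq_iff, le_div_iff₀ hh, div_lt_iff₀ hh] at he
      exact he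
  · rw [cell, if_pos (by omega)]
    have hk' : 0 ≤ ((k : ℝ) - 1) * h := by
      have : (1 : ℝ) ≤ k := by exact_mod_cast hk0
      nlinarith
    constructor
    · rintro ⟨h1, h2⟩
      rw [cidx, if_pos (by linarith), Int.ceil_eq_iff, lt_div_iff₀ hh, div_le_iff₀ hh]
      exact ⟨h1, h2⟩
    · intro he
      have hz : 0 < z := by
        by_contra hz
        push Not at hz
        rcases hz.eq_or_lt with rfl | hz
        · simp [cidx] at he; omega
        · have := cidx_neg hh hz; omega
      rw [cidx, if_pos hz, Int.ceil_eq_iff, lt_div_iff₀ hh, div_le_iff₀ hh] at he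
      exact he

theorem abs_cidx_mul_sub_le {h : ℝ} (hh : 0 < h) (z : ℝ) : |cidx h z * h - z| ≤ h := by
  rw [cidx, abs_le]
  split_ifs with hz
  · have h1 := Int.le_ceil (z / h)
    have h2 := Int.ceil_lt_add_one (z / h)
    rw [div_le_iff₀ hh] at h1
    have h3 : z / h * h = z := div_mul_cancel₀ _ hh.ne'
    constructor <;> nlinarith
  · have h1 := Int.floor_le (z / h)
    have h2 := Int.lt_floor_add_one (z / h)
    rw [le_div_iff₀ hh] at h1
    have h3 : z / h * h = z := div_mul_cancel₀ _ hh.ne'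
    constructor <;> nlinarith

/-- The cells of size `2ε` are unions of two cells of size `ε`. -/
theorem cidx_double {ε : ℝ} (hε : 0 < ε) {z : ℝ} (hz : z ≠ 0) :
    (cidx (2 * ε) z).sign = (cidx ε z).sign ∧ 0 < (cidx (2 * ε) z).natAbs ∧
      (cidx ε z).natAbs ≤ 2 * (cidx (2 * ε) z).natAbs ∧
      2 * (cidx (2 * ε) z).natAbs ≤ (cidx ε z).natAbs + 1 := by
  have h2 : 0 < 2 * ε := by positivity
  rcases lt_or_gt_of_ne hz with hz | hz
  · have a1 := cidx_neg hε hz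
    have a2 := cidx_neg h2 hz
    have b1 : 2 * cidx (2 * ε) z ≤ cidx ε z := by
      rw [cidx, cidx, if_neg hz.le.not_gt, if_neg hz.le.not_gt, Int.le_floor]
      have := Int.floor_le (z / (2 * ε))
      push_cast
      have e : z / ε = 2 * (z / (2 * ε)) := by field_simp
      linarith
    have b2 : cidx ε z ≤ 2 * cidx (2 * ε) z + 1 := by
      have : cidx ε z < 2 * cidx (2 * ε) z + 2 := by
        rw [cidx, cidx, if_neg hz.le.not_gt, if_neg hz.le.not_gt, Int.floor_lt]
        have := Int.lt_floor_add_one (z / (2 * ε))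
        push_cast
        have e : z / ε = 2 * (z / (2 * ε)) := by field_simp
        linarith
      omega
    rw [Int.sign_eq_neg_one_of_neg a1, Int.sign_eq_neg_one_of_neg a2]
    omega
  · have a1 := cidx_pos hε hz
    have a2 := cidx_pos h2 hz
    have b1 : cidx ε z ≤ 2 * cidx (2 * ε) z := by
      rw [cidx, cidx, if_pos hz, if_pos hz, Int.ceil_le]
      have := Int.le_ceil (z / (2 * ε))
      push_cast
      have e : z / ε = 2 * (z / (2 * ε)) := by field_simp
      linarith
    have b2 : 2 * cidx (2 * ε) z ≤ cidx ε z + 1 := by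
      have : 2 * cidx (2 * ε) z - 2 < cidx ε z := by
        rw [cidx, cidx, if_pos hz, if_pos hz, Int.lt_ceil]
        have := Int.ceil_lt_add_one (z / (2 * ε))
        push_cast
        have e : z / ε = 2 * (z / (2 * ε)) := by field_simp
        linarith
      omega
    rw [Int.sign_eq_one_of_pos a1, Int.sign_eq_one_of_pos a2]
    omega

theorem theta_eq (k : ℤ) (l : ℕ) (hk : 0 < k.natAbs) :
    theta k l = (2 * k.natAbs - 2 * l - 1) / (2 * k.natAbs ^ 2) := by
  have hk' : (0 : ℝ) < k.natAbs := by exact_mod_cast hk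
  have e : |(k : ℝ)| = k.natAbs := by rw [Nat.cast_natAbs, Int.cast_abs]
  rw [theta, e, intervalIntegral.integral_sub (by simp) (by simp), integral_id]
  simp only [intervalIntegral.integral_const, smul_eq_mul, mul_one]
  field_simp
  ring

/-- The weights are integrals of `1 - θ` over the cells of a partition of `[0, 1]`, so the weighted
sum integrates a step function of `θ`. Sums belonging to different `k` can then be compared at the
same `θ`. -/
theorem sum_theta_smul {E : Type*} [NormedAddCommGroup E] [NormedSpace ℝ E] [CompleteSpace E]
    (k : ℤ) (hk : 0 < k.natAbs) (F : ℕ → E) :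
    IntervalIntegrable (fun θ : ℝ => (1 - θ) • F ⌊k.natAbs * θ⌋₊) volume 0 1 ∧
    ∑ l ∈ Finset.range k.natAbs, theta k l • F l
      = ∫ θ in (0 : ℝ)..1, (1 - θ) • F ⌊k.natAbs * θ⌋₊ := by
  set K := k.natAbs
  have hk' : (0 : ℝ) < K := by exact_mod_cast hk
  have e : |(k : ℝ)| = K := by rw [Nat.cast_natAbs, Int.cast_abs]
  let t : ℕ → ℝ := fun l => l / K
  have ht0 : t 0 = 0 := by simp [t]
  have htK : t K = 1 := by simp only [t]; field_simp
  have hle : ∀ l, t l ≤ t (l + 1) := fun l => by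
    simp only [t]; gcongr; simp
  have hpiece : ∀ l, ∀ᵐ θ : ℝ, θ ∈ uIoc (t l) (t (l + 1)) →
      (1 - θ) • F l = (1 - θ) • F ⌊K * θ⌋₊ := by
    intro l
    have hne : ∀ᵐ r : ℝ, r ≠ t (l + 1) := by simp [ae_iff, measure_singleton]
    filter_upwards [hne] with θ hθ hmem
    rw [uIoc_of_le (hle l)] at hmem
    have h1 := hmem.1
    have h2 := lt_of_le_of_ne hmem.2 hθ
    simp only [t] at h1 h2
    rw [div_lt_iff₀ hk'] at h1
    rw [lt_div_iff₀ hk'] at h2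
    have : ⌊K * θ⌋₊ = l := by
      rw [Nat.floor_eq_iff (by nlinarith [(Nat.cast_nonneg l : (0 : ℝ) ≤ l)])]
      push_cast at h2
      constructor <;> linarith
    rw [this]
  have hi : ∀ l, IntervalIntegrable (fun θ : ℝ => (1 - θ) • F ⌊K * θ⌋₊) volume (t l) (t (l + 1)) := by
    intro l
    refine IntervalIntegrable.congr_ae (f := fun θ : ℝ => (1 - θ) • F l) ?_
      ((ae_restrict_iff' measurableSet_uIoc).2 (hpiece l))
    exact Continuous.intervalIntegrable (by fun_prop) _ _
  have hall := IntervalIntegrable.trans_iterate (n := K) (fun l _ => hi l)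
  rw [ht0, htK] at hall
  refine ⟨hall, ?_⟩
  have := intervalIntegral.sum_integral_adjacent_intervals (n := K) (fun l _ => hi l)
  rw [ht0, htK] at this
  rw [← this]
  refine Finset.sum_congr rfl fun l _ => ?_
  rw [← intervalIntegral.integral_congr_ae (hpiece l), intervalIntegral.integral_smul_const, theta, e]
  simp only [t]
  push_cast
  rfl

theorem theta_nonneg (k : ℤ) {l : ℕ} (hl : l < k.natAbs) : 0 ≤ theta k l := by
  rw [theta_eq k l (by omega)]
  have : (l : ℝ) + 1 ≤ k.natAbs := by exact_mod_cast hl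
  apply div_nonneg _ (by positivity)
  linarith

theorem sum_theta_le (k : ℤ) : ∑ l ∈ Finset.range k.natAbs, theta k l ≤ 1 / 2 := by
  rcases Nat.eq_zero_or_pos k.natAbs with h | h
  · simp [h]
  · have := (sum_theta_smul k h (fun _ => (1 : ℝ))).2
    simp only [smul_eq_mul, mul_one] at this
    rw [this, intervalIntegral.integral_sub (by simp) (by simp), integral_id]
    simp only [intervalIntegral.integral_const, smul_eq_mul]
    norm_num

/-- The second difference quotient with stride `n` and mesh size `h`. -/
def lap (h : ℝ) (n : ℤ) : Seq →L[ℝ] Seq :=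
  (h ^ 2)⁻¹ • (shift n - (2 : ℝ) • ContinuousLinearMap.id ℝ Seq + shift (-n))

@[simp] theorem lap_apply (h : ℝ) (n : ℤ) (x : Seq) (k : ℤ) :
    lap h n x k = (h ^ 2)⁻¹ * (x (k + n) - 2 * x k + x (k + -n)) := rfl

/-- The averaged second difference `∑_l θ_k^l δ_{-h} δ_h T_{s_k l h}`. -/
def avgLap (h : ℝ) (n k : ℤ) : Seq →L[ℝ] Seq :=
  ∑ l ∈ Finset.range k.natAbs, theta k l • (lap h n).comp (shift (n * (k.sign * l)))

theorem avgLap_apply (h : ℝ) (n k : ℤ) (x : Seq) :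
    avgLap h n k x = ∑ l ∈ Finset.range k.natAbs, theta k l • lap h n (shift (n * (k.sign * l)) x) := by
  simp [avgLap]

theorem norm_avgLap_le (h : ℝ) (n k : ℤ) : ‖avgLap h n k‖ ≤ 1 / 2 * ‖lap h n‖ := by
  refine ContinuousLinearMap.opNorm_le_bound _ (by positivity) fun x => ?_
  rw [avgLap_apply]
  refine (norm_sum_le _ _).trans ?_
  calc ∑ l ∈ Finset.range k.natAbs, ‖theta k l • lap h n (shift (n * (k.sign * l)) x)‖
      ≤ ∑ l ∈ Finset.range k.natAbs, theta k l * (‖lap h n‖ * ‖x‖) := by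
        refine Finset.sum_le_sum fun l hl => ?_
        have h0 := theta_nonneg k (Finset.mem_range.1 hl)
        rw [norm_smul, Real.norm_of_nonneg h0]
        refine mul_le_mul_of_nonneg_left ?_ h0
        have := (lap h n).le_opNorm (shift (n * (k.sign * l)) x)
        rwa [norm_shift] at this
    _ ≤ 1 / 2 * ‖lap h n‖ * ‖x‖ := by
        rw [← Finset.sum_mul, mul_assoc]
        exact mul_le_mul_of_nonneg_right (sum_theta_le k) (by positivity)

/-- Summation by parts twice: the weights, which are `2 K²` times those of `theta`, are affine in
`l`, so only boundary terms remain. -/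
theorem sum_second_diff (r : ℤ → ℝ) (K : ℕ) (hK : 0 < K) :
    ∑ l ∈ Finset.range K, (2 * (K : ℝ) - 2 * l - 1) * (r (l + 1) - 2 * r l + r (l - 1))
      = (2 * K - 1) * r (-1) - (2 * K + 1) * r 0 + r (K - 1) + r K := by
  induction K, hK using Nat.le_induction with
  | base => norm_num; ring
  | succ K hK ih =>
    have h1 : ∀ K : ℕ, ∑ l ∈ Finset.range K, (r (l + 1) - 2 * r l + r (l - 1))
        = r K - r (K - 1) - r 0 + r (-1) := by
      intro K
      induction K with
      | zero => simp
      | succ K ih =>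
        rw [Finset.sum_range_succ, ih]
        push_cast
        rw [add_sub_cancel_right]
        ring
    -- Going from `K` to `K + 1` raises every weight by 2, which adds twice a telescoping sum.
    have h2 : ∑ l ∈ Finset.range K, (2 * ((K + 1 : ℕ) : ℝ) - 2 * l - 1)
          * (r (l + 1) - 2 * r l + r (l - 1))
        = ∑ l ∈ Finset.range K, (2 * (K : ℝ) - 2 * l - 1) * (r (l + 1) - 2 * r l + r (l - 1))
          + 2 * ∑ l ∈ Finset.range K, (r (l + 1) - 2 * r l + r (l - 1)) := by
      rw [Finset.mul_sum, ← Finset.sum_add_distrib]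
      refine Finset.sum_congr rfl fun l _ => ?_
      push_cast; ring
    rw [Finset.sum_range_succ, h2, ih, h1]
    push_cast
    rw [add_sub_cancel_right]
    ring

/-- The pairing is a second difference sum of the correlation function `r` of `w`. After summation
by parts its positive coefficients `2K - 1`, 1, 1 add up to the coefficient `2K + 1` subtracted at
`r 0`, and `r 0` is the maximum. -/
theorem inner_avgLap_nonpos (h : ℝ) (n k : ℤ) (w : Seq) :
    inner ℝ (avgLap h n k w) w ≤ 0 := by
  rcases Nat.eq_zero_or_pos k.natAbs with hk | hk
  · simp [avgLap, hk]
  set K := k.natAbs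
  let r : ℤ → ℝ := fun p => inner ℝ (shift (n * (k.sign * p)) w) w
  have hr0 : r 0 = ‖w‖ ^ 2 := by simp [r]
  have hr : ∀ p, r p ≤ r 0 := fun p => by rw [hr0]; exact inner_shift_self_le _ _
  have hs : k.sign = 1 ∨ k.sign = -1 := by
    rcases lt_trichotomy k 0 with h | h | h
    · right; exact Int.sign_eq_neg_one_of_neg h
    · simp [K, h] at hk
    · left; exact Int.sign_eq_one_of_pos h
  have e : inner ℝ (avgLap h n k w) w = (h ^ 2)⁻¹ * (2 * (K : ℝ) ^ 2)⁻¹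
      * ∑ l ∈ Finset.range K, (2 * (K : ℝ) - 2 * l - 1) * (r (l + 1) - 2 * r l + r (l - 1)) := by
    rw [avgLap_apply, sum_inner, Finset.mul_sum]
    refine Finset.sum_congr rfl fun l _ => ?_
    have e1 : lap h n (shift (n * (k.sign * l)) w)
        = (h ^ 2)⁻¹ • (shift (n + n * (k.sign * l)) w - (2 : ℝ) • shift (n * (k.sign * l)) w
          + shift (-n + n * (k.sign * l)) w) := by
      rw [← shift_shift, ← shift_shift]; rfl
    rw [inner_smul_left, theta_eq k l hk, e1, inner_smul_left, inner_add_left, inner_sub_left,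
      inner_smul_left]
    have e2 : inner ℝ (shift (n + n * (k.sign * l)) w) w
        + inner ℝ (shift (-n + n * (k.sign * l)) w) w = r (l + 1) + r (l - 1) := by
      simp only [r]
      -- For negative `k` the two outer points of the second difference exchange roles.
      rcases hs with hs | hs <;> rw [hs]
      · congr 4 <;> ring
      · rw [add_comm]
        congr 4 <;> ring
    have e3 : inner ℝ (shift (n * (k.sign * l)) w) w = r l := rfl
    rw [e3]
    simp only [conj_trivial]
    have : inner ℝ (shift (n + n * (k.sign * l)) w) w - 2 * r l
        + inner ℝ (shift (-n + n * (k.sign * l)) w) w = r (l + 1) - 2 * r l + r (l - 1) := by linarith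
    rw [this]
    ring
  rw [e, sum_second_diff r K hk]
  have hK : (1 : ℝ) ≤ K := by exact_mod_cast hk
  have h1 := hr (-1)
  have h2 := hr (K - 1)
  have h3 := hr K
  refine mul_nonpos_of_nonneg_of_nonpos (by positivity) ?_
  nlinarith [mul_le_mul_of_nonneg_left h1 (by linarith : (0 : ℝ) ≤ 2 * K - 1)]

/-- The small jump part of the discretised operator. -/
def J1op (ν : Measure ℝ) (h : ℝ) (n : ℤ) : Seq →L[ℝ] Seq :=
  ∫ z in Icc (-1) 1, z ^ 2 • avgLap h n (cidx h z) ∂ν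

/-- The large jump part of the discretised operator. -/
def J2op (ν : Measure ℝ) (h : ℝ) (n : ℤ) : Seq →L[ℝ] Seq :=
  ∫ z in (Icc (-1) 1)ᶜ, (shift (n * cidx h z) - ContinuousLinearMap.id ℝ Seq) ∂ν

theorem IsLevyMeasure.integrableOn_sq {ν : Measure ℝ} (hν : IsLevyMeasure ν) :
    IntegrableOn (fun z => z ^ 2) (Icc (-1) 1) ν := by
  have h1 : Integrable (fun z : ℝ => min 1 (z ^ 2)) ν := by
    refine ⟨(by fun_prop : Measurable fun z : ℝ => min 1 (z ^ 2)).aestronglyMeasurable, ?_⟩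
    rw [hasFiniteIntegral_iff_ofReal (ae_of_all _ fun z => by positivity)]
    exact hν.finite
  refine h1.integrableOn.congr_fun (fun z hz => ?_) measurableSet_Icc
  exact min_eq_right (by nlinarith [hz.1, hz.2])

theorem IsLevyMeasure.measure_compl_lt_top {ν : Measure ℝ} (hν : IsLevyMeasure ν) :
    ν (Icc (-1) 1)ᶜ < ⊤ := by
  refine lt_of_le_of_lt ?_ hν.finite
  rw [← setLIntegral_one]
  refine (setLIntegral_mono' measurableSet_Icc.compl fun z hz => ?_).trans
    (setLIntegral_le_lintegral _ _)
  rw [min_eq_left, ENNReal.ofReal_one]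
  rw [mem_compl_iff, mem_Icc, not_and_or] at hz
  rcases hz with hz | hz <;> push Not at hz <;> nlinarith

/-- Since `cidx h` takes integer values, operator-valued functions of it are strongly measurable in
operator norm; hence `J1op` and `J2op` are genuine Bochner integrals of operators. -/
theorem stronglyMeasurable_comp_cidx {E : Type*} [TopologicalSpace E] [TopologicalSpace.PseudoMetrizableSpace E]
    (h : ℝ) (F : ℤ → E) : StronglyMeasurable fun z => F (cidx h z) :=
  (StronglyMeasurable.of_discrete (f := F)).comp_measurable (measurable_cidx h)

theorem integrable_J1 {ν : Measure ℝ} (hν : IsLevyMeasure ν) (h : ℝ) (n : ℤ) :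
    IntegrableOn (fun z => z ^ 2 • avgLap h n (cidx h z)) (Icc (-1) 1) ν := by
  refine (hν.integrableOn_sq.mul_const (1 / 2 * ‖lap h n‖)).mono'
    (((by fun_prop : Measurable fun z : ℝ => z ^ 2).stronglyMeasurable.smul
      (stronglyMeasurable_comp_cidx h _)).aestronglyMeasurable) (ae_of_all _ fun z => ?_)
  rw [norm_smul, Real.norm_of_nonneg (sq_nonneg z)]
  exact mul_le_mul_of_nonneg_left (norm_avgLap_le _ _ _) (sq_nonneg z)

theorem norm_shift_sub_id_le (p : ℤ) : ‖shift p - ContinuousLinearMap.id ℝ Seq‖ ≤ 2 := by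
  refine ContinuousLinearMap.opNorm_le_bound _ (by norm_num) fun x => ?_
  refine (norm_sub_le (shift p x) x).trans ?_
  rw [norm_shift]; linarith

theorem integrable_J2 {ν : Measure ℝ} (hν : IsLevyMeasure ν) (h : ℝ) (n : ℤ) :
    IntegrableOn (fun z => shift (n * cidx h z) - ContinuousLinearMap.id ℝ Seq) (Icc (-1) 1)ᶜ ν := by
  refine (integrableOn_const (C := (2 : ℝ)) hν.measure_compl_lt_top.ne).mono'
    (stronglyMeasurable_comp_cidx h fun k => shift (n * k) - ContinuousLinearMap.id ℝ Seq).aestronglyMeasurable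
    (ae_of_all _ fun z => norm_shift_sub_id_le _)

theorem J1op_apply {ν : Measure ℝ} (hν : IsLevyMeasure ν) (h : ℝ) (n : ℤ) (x : Seq) :
    J1op ν h n x = ∫ z in Icc (-1) 1, z ^ 2 • avgLap h n (cidx h z) x ∂ν :=
  ContinuousLinearMap.integral_apply (integrable_J1 hν h n) x

theorem J2op_apply {ν : Measure ℝ} (hν : IsLevyMeasure ν) (h : ℝ) (n : ℤ) (x : Seq) :
    J2op ν h n x = ∫ z in (Icc (-1) 1)ᶜ, (shift (n * cidx h z) x - x) ∂ν :=
  ContinuousLinearMap.integral_apply (integrable_J2 hν h n) x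

theorem integrable_J1_apply {ν : Measure ℝ} (hν : IsLevyMeasure ν) (h : ℝ) (n : ℤ) (x : Seq) :
    IntegrableOn (fun z => z ^ 2 • avgLap h n (cidx h z) x) (Icc (-1) 1) ν :=
  (integrable_J1 hν h n).apply_continuousLinearMap x

theorem integrable_J2_apply {ν : Measure ℝ} (hν : IsLevyMeasure ν) (h : ℝ) (n : ℤ) (x : Seq) :
    IntegrableOn (fun z => shift (n * cidx h z) x - x) (Icc (-1) 1)ᶜ ν :=
  (integrable_J2 hν h n).apply_continuousLinearMap x

theorem inner_J1op_nonpos {ν : Measure ℝ} (hν : IsLevyMeasure ν) (h : ℝ) (n : ℤ) (w : Seq) :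
    inner ℝ (J1op ν h n w) w ≤ 0 := by
  rw [J1op_apply hν, real_inner_comm, ← integral_inner (integrable_J1_apply hν h n w)]
  refine integral_nonpos fun z => ?_
  rw [Pi.zero_apply, inner_smul_right, real_inner_comm]
  exact mul_nonpos_of_nonneg_of_nonpos (sq_nonneg z) (inner_avgLap_nonpos _ _ _ _)

theorem inner_J2op_nonpos {ν : Measure ℝ} (hν : IsLevyMeasure ν) (h : ℝ) (n : ℤ) (w : Seq) :
    inner ℝ (J2op ν h n w) w ≤ 0 := by
  rw [J2op_apply hν, real_inner_comm, ← integral_inner (integrable_J2_apply hν h n w)]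
  refine integral_nonpos fun z => ?_
  rw [Pi.zero_apply, inner_sub_right, real_inner_comm, real_inner_self_eq_norm_sq]
  linarith [inner_shift_self_le (n * cidx h z) w]

/-- Evaluation of a sequence at an index. -/
def coord (k : ℤ) : Seq →L[ℝ] ℝ :=
  LinearMap.mkContinuous
    { toFun := fun x => x k
      map_add' := fun _ _ => rfl
      map_smul' := fun _ _ => rfl } 1 fun x => by rw [one_mul]; exact x.abs_apply_le k

@[simp] theorem coord_apply (k : ℤ) (x : Seq) : coord k x = x k := rfl

theorem avgLap_apply_coord (h : ℝ) (n k : ℤ) (x : Seq) (i : ℤ) :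
    avgLap h n k x i = ∑ l ∈ Finset.range k.natAbs, theta k l * ((h ^ 2)⁻¹ *
      (x (i + n * (k.sign * l) + n) - 2 * x (i + n * (k.sign * l)) + x (i + n * (k.sign * l) - n))) := by
  rw [avgLap_apply, ← coord_apply, map_sum]
  refine Finset.sum_congr rfl fun l _ => ?_
  simp only [coord_apply, Seq.smul_apply, lap_apply, shift_apply]
  congr 3
  · ring_nf
  · ring_nf

theorem J1op_coord {ν : Measure ℝ} (hν : IsLevyMeasure ν) (h : ℝ) (n : ℤ) (x : Seq) (i : ℤ) :
    J1op ν h n x i = ∫ z in Icc (-1) 1, z ^ 2 * avgLap h n (cidx h z) x i ∂ν := by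
  rw [J1op_apply hν, ← coord_apply, ← (coord i).integral_comp_comm (integrable_J1_apply hν h n x)]
  rfl

theorem J2op_coord {ν : Measure ℝ} (hν : IsLevyMeasure ν) (h : ℝ) (n : ℤ) (x : Seq) (i : ℤ) :
    J2op ν h n x i = ∫ z in (Icc (-1) 1)ᶜ, (x (i + n * cidx h z) - x i) ∂ν := by
  rw [J2op_apply hν, ← coord_apply, ← (coord i).integral_comp_comm (integrable_J2_apply hν h n x)]
  rfl

end
end LevyFD

namespace LevyFD
noncomputable section
open Filter Topology

/-! ### Energy estimates and consistency of the scheme -/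

theorem commute_shift (p q : ℤ) : Commute (shift p) (shift q) := by
  ext1 x
  change shift p (shift q x) = shift q (shift p x)
  rw [shift_shift, shift_shift, add_comm]

theorem commute_delta_shift (ε : ℝ) (p : ℤ) : Commute (delta ε) (shift p) :=
  ((commute_shift 1 p).sub_left (Commute.one_left _)).smul_left _

theorem commute_delta_cdiff (ε h : ℝ) (n : ℤ) : Commute (delta ε) (cdiff h n) :=
  ((commute_delta_shift ε n).sub_right (commute_delta_shift ε (-n))).smul_right _

theorem commute_delta_lap (ε h : ℝ) (n : ℤ) : Commute (delta ε) (lap h n) :=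
  (((commute_delta_shift ε n).sub_right ((Commute.one_right _).smul_right _)).add_right
    (commute_delta_shift ε (-n))).smul_right _

theorem commute_delta_avgLap (ε h : ℝ) (n k : ℤ) : Commute (delta ε) (avgLap h n k) := by
  refine Commute.sum_right _ _ _ fun l _ => Commute.smul_right ?_ _
  exact (commute_delta_lap ε h n).mul_right (commute_delta_shift ε _)

theorem Commute.apply {A B : Seq →L[ℝ] Seq} (h : Commute A B) (x : Seq) : A (B x) = B (A x) :=
  DFunLike.congr_fun h.eq x

theorem commute_delta_J1op {ν : Measure ℝ} (hν : IsLevyMeasure ν) (ε h : ℝ) (n : ℤ) :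
    Commute (delta ε) (J1op ν h n) := by
  ext1 x
  change delta ε (J1op ν h n x) = J1op ν h n (delta ε x)
  rw [J1op_apply hν, J1op_apply hν,
    ← (delta ε).integral_comp_comm (integrable_J1_apply hν h n x)]
  congr 1; ext1 z
  rw [map_smul, Commute.apply (commute_delta_avgLap ε h n _)]

theorem commute_delta_J2op {ν : Measure ℝ} (hν : IsLevyMeasure ν) (ε h : ℝ) (n : ℤ) :
    Commute (delta ε) (J2op ν h n) := by
  ext1 x
  change delta ε (J2op ν h n x) = J2op ν h n (delta ε x)
  rw [J2op_apply hν, J2op_apply hν,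
    ← (delta ε).integral_comp_comm (integrable_J2_apply hν h n x)]
  congr 1; ext1 z
  rw [map_sub, Commute.apply (commute_delta_shift ε _)]

theorem norm_shift_sub_le {ε : ℝ} (hε : 0 < ε) (p : ℕ) (x : Seq) :
    ‖shift p x - x‖ ≤ p * (ε * ‖delta ε x‖) := by
  have h1 : shift 1 x - x = ε • delta ε x :=
    Seq.ext fun k => by simp [hε.ne']
  induction p with
  | zero => simp
  | succ p ih =>
    have e : shift ((p + 1 : ℕ) : ℤ) x - x = shift p (shift 1 x - x) + (shift p x - x) := by
      rw [map_sub, shift_shift]; push_cast; abel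
    rw [e]
    refine (norm_add_le _ _).trans ?_
    rw [norm_shift, h1, norm_smul, Real.norm_of_nonneg hε.le]
    push_cast
    linarith

theorem norm_shift_sub_shift_le {ε : ℝ} (hε : 0 < ε) (p q : ℤ) (x : Seq) :
    ‖shift p x - shift q x‖ ≤ |((p - q : ℤ) : ℝ)| * (ε * ‖delta ε x‖) := by
  wlog hpq : q ≤ p generalizing p q
  · have := this q p (by omega)
    rw [norm_sub_rev, ← neg_sub q p, Int.cast_neg, abs_neg]
    exact this
  obtain ⟨m, hm⟩ := Int.eq_ofNat_of_zero_le (sub_nonneg.2 hpq)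
  have e : shift p x - shift q x = shift q (shift m x - x) := by
    rw [map_sub, shift_shift, ← hm]; congr 2; ring_nf
  rw [e, norm_shift, hm]
  simpa using norm_shift_sub_le hε m x

/-- The central quotient of mesh `nε` is the mean of `2n` translates of the forward quotient of mesh
`ε`. -/
theorem norm_cdiff_le {ε : ℝ} (hε : 0 < ε) {n : ℕ} (hn : 0 < n) (x : Seq) :
    ‖cdiff (n * ε) n x‖ ≤ ‖delta ε x‖ := by
  have hn' : (0 : ℝ) < n := by exact_mod_cast hn
  have h := norm_shift_sub_shift_le hε n (-n) x
  have e : |((n - -n : ℤ) : ℝ)| = 2 * n := by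
    push_cast; rw [abs_of_pos (by linarith)]; ring
  rw [e] at h
  change ‖(2 * (n * ε))⁻¹ • (shift n x - shift (-n) x)‖ ≤ _
  rw [norm_smul, norm_inv, Real.norm_of_nonneg (by positivity), inv_mul_le_iff₀ (by positivity)]
  linarith

theorem delta_pow_mulOp {ε K : ℝ} {r j : ℕ} {f : ℤ → ℝ} (hf : DiffBound ε K r f) (hj : j ≤ r)
    (x : Seq) : (delta ε ^ j) (mulOp f x) = ∑ p ∈ Finset.HasAntidiagonal.antidiagonal j,
      j.choose p.1 • mulOp ((fd ε)^[p.1] (av^[p.2] f)) ((avg ^ p.1) ((delta ε ^ p.2) x)) := by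
  refine Seq.ext fun k => ?_
  rw [coe_delta_pow]
  have e : ⇑(mulOp f x) = fun k => f k * x k := funext fun k => mulOp_apply hf.bound x k
  rw [e, iterate_fd_mul, ← coord_apply, map_sum]
  refine Finset.sum_congr rfl fun p hp => ?_
  have hp' : p.1 ≤ r := by
    have := Finset.HasAntidiagonal.mem_antidiagonal.1 hp; omega
  rw [map_nsmul, coord_apply, mulOp_apply (fun k => (hf.iterate_av p.2) p.1 hp' k),
    coe_avg_pow, coe_delta_pow]

/-- The operator `L^h + J^h` with stride `n`, acting on functions on a lattice. -/
def Aop (ν : Measure ℝ) (h : ℝ) (n : ℤ) (a b c : ℤ → ℝ) : Seq →L[ℝ] Seq :=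
  (mulOp a).comp ((cdiff h n).comp (cdiff h n)) + (mulOp b).comp (cdiff h n) + mulOp c
    + (J1op ν h n + J2op ν h n)

theorem Aop_apply (ν : Measure ℝ) (h : ℝ) (n : ℤ) (a b c : ℤ → ℝ) (x : Seq) :
    Aop ν h n a b c x = mulOp a (cdiff h n (cdiff h n x)) + mulOp b (cdiff h n x) + mulOp c x
      + (J1op ν h n x + J2op ν h n x) := rfl

/-- The discrete Sobolev norm (squared) of order `j`. -/
def sobSq (ε : ℝ) (j : ℕ) (x : Seq) : ℝ := ∑ i ∈ Finset.range (j + 1), ‖(delta ε ^ i) x‖ ^ 2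

theorem sq_le_sobSq (ε : ℝ) {i j : ℕ} (hi : i ≤ j) (x : Seq) :
    ‖(delta ε ^ i) x‖ ^ 2 ≤ sobSq ε j x :=
  Finset.single_le_sum (f := fun i => ‖(delta ε ^ i) x‖ ^ 2) (fun _ _ => by positivity)
    (Finset.mem_range.2 (by omega))

theorem sobSq_nonneg (ε : ℝ) (j : ℕ) (x : Seq) : 0 ≤ sobSq ε j x :=
  Finset.sum_nonneg fun _ _ => by positivity

theorem mul_le_sobSq (ε : ℝ) {i l j : ℕ} (hi : i ≤ j) (hl : l ≤ j) (x : Seq) :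
    ‖(delta ε ^ i) x‖ * ‖(delta ε ^ l) x‖ ≤ sobSq ε j x := by
  have h1 := sq_le_sobSq ε hi x
  have h2 := sq_le_sobSq ε hl x
  nlinarith [sq_nonneg (‖(delta ε ^ i) x‖ - ‖(delta ε ^ l) x‖)]

/-- This is the Leibniz term with one difference on the coefficient: two central differences of `u`
against only one difference of `u`. Averaging makes the operator a combination of antisymmetric
shifts of `delta ε u` with prefactor of order `1/ε`, and `abs_inner_mulOp_skew_le` gains the factor
`ε` back from the oscillation of `g`. Both strides give the same constant: `(2 + 2)/8` and `(4 + 6 +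
4 + 2)/32`. -/
theorem inner_mulOp_avg_cdiff_cdiff_le {ε K : ℝ} (hε : 0 < ε) {n : ℕ} (hn : n = 1 ∨ n = 2)
    {g : ℤ → ℝ} (hg : DiffBound ε K 1 g) (u : Seq) :
    |inner ℝ (mulOp g (avg (cdiff (n * ε) n (cdiff (n * ε) n u)))) (delta ε u)|
      ≤ K / 2 * ‖delta ε u‖ ^ 2 := by
  have hl : ∀ (p : ℕ) (k : ℤ), |g (k + (p : ℤ)) - g k| ≤ p * (ε * K) := fun p k =>
    abs_shift_sub_le hε (fun k => hg 1 le_rfl k) p k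
  have hs : ∀ (p : ℕ), |inner ℝ (mulOp g (shift p (delta ε u) - shift (-p) (delta ε u))) (delta ε u)|
      ≤ p * (ε * K) * ‖delta ε u‖ ^ 2 := fun p =>
    abs_inner_mulOp_skew_le hg.bound (hl p) (delta ε u)
  rcases hn with rfl | rfl
  · have e : avg (cdiff ((1 : ℕ) * ε) (1 : ℕ) (cdiff ((1 : ℕ) * ε) (1 : ℕ) u))
        = (8 * ε)⁻¹ • ((shift (2 : ℕ) (delta ε u) - shift (-(2 : ℕ)) (delta ε u))
          + (2 : ℝ) • (shift (1 : ℕ) (delta ε u) - shift (-(1 : ℕ)) (delta ε u))) := by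
      refine Seq.ext fun k => ?_
      simp only [avg_apply, cdiff_apply, Seq.smul_apply, Seq.add_apply, Seq.sub_apply, shift_apply,
        delta_apply]
      push_cast
      ring_nf
    rw [e, map_smul, map_add, map_smul, inner_smul_left, inner_add_left, inner_smul_left]
    simp only [conj_trivial]
    have h1 := abs_le.1 (hs 1)
    have h2 := abs_le.1 (hs 2)
    rw [abs_mul, abs_inv, abs_of_pos (by positivity : 0 < 8 * ε), inv_mul_le_iff₀ (by positivity),
      abs_le]
    push_cast at h1 h2 ⊢
    constructor <;> linarith [h1.1, h1.2, h2.1, h2.2]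
  · have e : avg (cdiff ((2 : ℕ) * ε) (2 : ℕ) (cdiff ((2 : ℕ) * ε) (2 : ℕ) u))
        = (32 * ε)⁻¹ • ((shift (4 : ℕ) (delta ε u) - shift (-(4 : ℕ)) (delta ε u))
          + (2 : ℝ) • (shift (3 : ℕ) (delta ε u) - shift (-(3 : ℕ)) (delta ε u))
          + (2 : ℝ) • (shift (2 : ℕ) (delta ε u) - shift (-(2 : ℕ)) (delta ε u))
          + (2 : ℝ) • (shift (1 : ℕ) (delta ε u) - shift (-(1 : ℕ)) (delta ε u))) := by
      refine Seq.ext fun k => ?_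
      simp only [avg_apply, cdiff_apply, Seq.smul_apply, Seq.add_apply, Seq.sub_apply, shift_apply,
        delta_apply]
      push_cast
      ring_nf
    rw [e, map_smul, map_add, map_add, map_add, map_smul, map_smul, map_smul, inner_smul_left,
      inner_add_left, inner_add_left, inner_add_left, inner_smul_left, inner_smul_left,
      inner_smul_left]
    simp only [conj_trivial]
    have h1 := abs_le.1 (hs 1)
    have h2 := abs_le.1 (hs 2)
    have h3 := abs_le.1 (hs 3)
    have h4 := abs_le.1 (hs 4)
    rw [abs_mul, abs_inv, abs_of_pos (by positivity : 0 < 32 * ε), inv_mul_le_iff₀ (by positivity),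
      abs_le]
    push_cast at h1 h2 h3 h4 ⊢
    constructor <;> linarith [h1.1, h1.2, h2.1, h2.2, h3.1, h3.2, h4.1, h4.2]

theorem sum_choose_inner_le {j : ℕ} {S K : ℝ} {F : ℕ × ℕ → Seq} {w : Seq}
    (h : ∀ p ∈ Finset.HasAntidiagonal.antidiagonal j, inner ℝ (F p) w ≤ K * S) :
    inner ℝ (∑ p ∈ Finset.HasAntidiagonal.antidiagonal j, j.choose p.1 • F p) w ≤ 2 ^ j * (K * S) := by
  rw [sum_inner]
  have h2 : ∑ p ∈ Finset.HasAntidiagonal.antidiagonal j, (j.choose p.1 : ℝ) = 2 ^ j := by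
    rw [Finset.Nat.sum_antidiagonal_eq_sum_range_succ_mk]
    exact_mod_cast Nat.sum_range_choose j
  rw [← h2, Finset.sum_mul]
  refine Finset.sum_le_sum fun p hp => ?_
  rw [← Nat.cast_smul_eq_nsmul ℝ, inner_smul_left, conj_trivial]
  exact mul_le_mul_of_nonneg_left (h p hp) (Nat.cast_nonneg _)

theorem inner_le_of_norm_le {g : ℤ → ℝ} {K : ℝ} (hg : ∀ k, |g k| ≤ K) (i : ℕ) {y y' w : Seq}
    (hy : ‖y‖ ≤ ‖y'‖) {S : ℝ} (hS : ‖y'‖ * ‖w‖ ≤ S) :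
    inner ℝ (mulOp g ((avg ^ i) y)) w ≤ K * S := by
  have hK : 0 ≤ K := (abs_nonneg _).trans (hg 0)
  calc inner ℝ (mulOp g ((avg ^ i) y)) w ≤ ‖mulOp g ((avg ^ i) y)‖ * ‖w‖ := real_inner_le_norm _ _
    _ ≤ (K * ‖y'‖) * ‖w‖ := by
        refine mul_le_mul_of_nonneg_right ((norm_mulOp_le hg _).trans ?_) (norm_nonneg _)
        exact mul_le_mul_of_nonneg_left ((norm_avg_pow_le i y).trans hy) hK
    _ ≤ K * S := by rw [mul_assoc]; exact mul_le_mul_of_nonneg_left hS hK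

/-- The energy estimate for `L^h + J^h` in discrete Sobolev norms. -/
theorem inner_delta_pow_Aop_le {ν : Measure ℝ} (hν : IsLevyMeasure ν) {ε K : ℝ} (hε : 0 < ε)
    {n : ℕ} (hn : n = 1 ∨ n = 2) {a b c : ℤ → ℝ} {r j : ℕ} (hr : 2 ≤ r) (hj : j ≤ r)
    (ha : DiffBound ε K r a) (hb : DiffBound ε K r b) (hc : DiffBound ε K r c)
    (ha0 : ∀ k, 0 ≤ a k) (x : Seq) :
    inner ℝ ((delta ε ^ j) (Aop ν (n * ε) n a b c x)) ((delta ε ^ j) x)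
      ≤ 3 * 2 ^ j * (K * sobSq ε j x) := by
  have hn0 : 0 < n := by omega
  have hn' : (0 : ℝ) < n := by exact_mod_cast hn0
  set D := cdiff (n * ε) n with hD
  set w := (delta ε ^ j) x with hw
  set S := sobSq ε j x with hS
  have hK : 0 ≤ K := (abs_nonneg _).trans (ha.bound 0)
  have hwS : ‖w‖ ^ 2 ≤ S := sq_le_sobSq ε le_rfl x
  have hcomm : ∀ l, Commute (delta ε ^ l) D := fun l => (commute_delta_cdiff ε _ _).pow_left l
  have hsucc : ∀ l, delta ε ((delta ε ^ l) x) = (delta ε ^ (l + 1)) x := fun l => by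
    rw [pow_succ']; rfl
  have hb1 : ∀ l, ‖(delta ε ^ l) (D x)‖ ≤ ‖(delta ε ^ (l + 1)) x‖ := fun l => by
    rw [Commute.apply (hcomm l), ← hsucc]
    exact norm_cdiff_le hε hn0 _
  have hb2 : ∀ l, ‖(delta ε ^ l) (D (D x))‖ ≤ ‖(delta ε ^ (l + 2)) x‖ := fun l => by
    rw [Commute.apply (hcomm l), Commute.apply (hcomm l)]
    refine (norm_cdiff_le hε hn0 _).trans ?_
    rw [Commute.apply (commute_delta_cdiff ε _ _), hsucc]
    refine (norm_cdiff_le hε hn0 _).trans ?_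
    rw [hsucc]
  have hA : inner ℝ ((delta ε ^ j) (mulOp a (D (D x)))) w ≤ 2 ^ j * (K * S) := by
    rw [delta_pow_mulOp ha hj]
    refine sum_choose_inner_le fun p hp => ?_
    obtain ⟨i, l⟩ := p
    have hil : i + l = j := Finset.HasAntidiagonal.mem_antidiagonal.1 hp
    -- Split by the number `i` of differences on `a`: zero is dissipative, one is antisymmetric, and
    -- from two on at most `j` differences are left on `x`.
    rcases i with _ | _ | i
    · have hl : l = j := by omega
      subst hl
      simp only [Function.iterate_zero, id_eq, pow_zero, one_apply_eq_self]
      rw [Commute.apply (hcomm l), Commute.apply (hcomm l), ← hw]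
      have hav := ha.iterate_av l
      -- Two central differences of stride `n` form a second difference of step `2n`, normalised by
      -- the square of `2nε`.
      have e : D (D w) = ((2 * (n * ε)) ^ 2)⁻¹ •
          (shift ((2 * n : ℕ) : ℤ) w - (2 : ℝ) • w + shift (-((2 * n : ℕ) : ℤ)) w) := by
        refine Seq.ext fun k => ?_
        simp only [hD, cdiff_apply, Seq.smul_apply, Seq.add_apply, Seq.sub_apply, shift_apply]
        push_cast
        ring_nf
      have h2 := inner_mulOp_second_diff_le hav.bound (iterate_av_nonneg ha0 l)
        (q := ((2 * n : ℕ) : ℤ)) (abs_second_diff_le hε (fun k => hav 2 hr k) (2 * n)) w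
      rw [e, map_smul, inner_smul_left, conj_trivial, inv_mul_le_iff₀ (by positivity)]
      refine h2.trans ?_
      push_cast
      have h3 : 0 ≤ (2 * (n * ε)) ^ 2 * K := by positivity
      have h4 : 0 ≤ S := (sq_nonneg _).trans hwS
      nlinarith [mul_le_mul_of_nonneg_left hwS h3, mul_nonneg h3 h4]
    · have hl : j = l + 1 := by omega
      have hg : DiffBound ε K 1 ((fd ε)^[1] (av^[l] a)) :=
        ((ha.mono hr).iterate_av l).iterate_fd 1
      have h2 := inner_mulOp_avg_cdiff_cdiff_le hε hn hg ((delta ε ^ l) x)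
      rw [hsucc, ← hl] at h2
      simp only [zero_add, pow_one]
      rw [Commute.apply (hcomm l), Commute.apply (hcomm l)]
      refine (le_abs_self _).trans (h2.trans ?_)
      have h4 : 0 ≤ S := (sq_nonneg _).trans hwS
      nlinarith [mul_le_mul_of_nonneg_left hwS hK, mul_nonneg hK h4]
    · exact inner_le_of_norm_le (fun k => (ha.iterate_av l) _ (by omega) k) _ (hb2 l)
        (mul_le_sobSq ε (by omega) le_rfl x)
  have hB : inner ℝ ((delta ε ^ j) (mulOp b (D x))) w ≤ 2 ^ j * (K * S) := by
    rw [delta_pow_mulOp hb hj]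
    refine sum_choose_inner_le fun p hp => ?_
    obtain ⟨i, l⟩ := p
    have hil : i + l = j := Finset.HasAntidiagonal.mem_antidiagonal.1 hp
    -- With all differences on `x` the operator is antisymmetric up to the oscillation of `b`;
    -- otherwise the order does not exceed `j`.
    rcases i with _ | i
    · have hl : l = j := by omega
      subst hl
      simp only [Function.iterate_zero, id_eq, pow_zero, one_apply_eq_self]
      rw [Commute.apply (hcomm l), ← hw]
      have hav := hb.iterate_av l
      have h2 := abs_inner_mulOp_skew_le hav.bound (p := n)
        (fun k => abs_shift_sub_le hε (fun k => hav 1 (by omega) k) n k) w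
      change inner ℝ (mulOp (av^[l] b) ((2 * (n * ε))⁻¹ • (shift n w - shift (-n) w))) w ≤ _
      rw [map_smul, inner_smul_left, conj_trivial, inv_mul_le_iff₀ (by positivity)]
      refine (le_abs_self _).trans (h2.trans ?_)
      have h3 : 0 ≤ n * (ε * K) := by positivity
      have h4 : 0 ≤ S := (sq_nonneg _).trans hwS
      nlinarith [mul_le_mul_of_nonneg_left hwS h3, mul_nonneg h3 h4]
    · exact inner_le_of_norm_le (fun k => (hb.iterate_av l) _ (by omega) k) _ (hb1 l)
        (mul_le_sobSq ε (by omega) le_rfl x)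
  have hC : inner ℝ ((delta ε ^ j) (mulOp c x)) w ≤ 2 ^ j * (K * S) := by
    rw [delta_pow_mulOp hc hj]
    refine sum_choose_inner_le fun p hp => ?_
    obtain ⟨i, l⟩ := p
    have hil : i + l = j := Finset.HasAntidiagonal.mem_antidiagonal.1 hp
    exact inner_le_of_norm_le (fun k => (hc.iterate_av l) _ (by omega) k) _ le_rfl
      (mul_le_sobSq ε (by omega) le_rfl x)
  -- The jump operators are translation invariant, so they pass through the differences and act on
  -- `w` itself, where their form is nonpositive.
  rw [Aop_apply, map_add, map_add, map_add, map_add, inner_add_left, inner_add_left, inner_add_left,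
    inner_add_left, Commute.apply ((commute_delta_J1op hν ε _ _).pow_left j),
    Commute.apply ((commute_delta_J2op hν ε _ _).pow_left j)]
  have h1 := inner_J1op_nonpos hν (n * ε) n w
  have h2 := inner_J2op_nonpos hν (n * ε) n w
  linarith

end
end LevyFD

namespace LevyFD
noncomputable section
open Filter Topology

/-! ### Consistency of the operators of mesh `2ε` and `ε` on one lattice. -/

theorem avgLap_eq_integral (h : ℝ) (n k : ℤ) (hk : 0 < k.natAbs) (x : Seq) :
    IntervalIntegrable (fun θ : ℝ => (1 - θ) • lap h n (shift (n * (k.sign * ⌊k.natAbs * θ⌋₊)) x))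
      volume 0 1 ∧
    avgLap h n k x
      = ∫ θ in (0 : ℝ)..1, (1 - θ) • lap h n (shift (n * (k.sign * ⌊k.natAbs * θ⌋₊)) x) := by
  have := sum_theta_smul k hk fun l => lap h n (shift (n * (k.sign * l)) x)
  rw [avgLap_apply]
  exact this

theorem lap_one_eq {ε : ℝ} : lap ε 1 = delta ε * delta ε * shift (-1) := by
  ext1 x
  refine Seq.ext fun k => ?_
  change lap ε 1 x k = delta ε (delta ε (shift (-1) x)) k
  simp only [lap_apply, delta_apply, shift_apply]
  ring_nf

theorem norm_delta_lap (ε : ℝ) (x : Seq) : ‖delta ε (lap ε 1 x)‖ = ‖(delta ε ^ 3) x‖ := by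
  rw [lap_one_eq]
  change ‖delta ε (delta ε (delta ε (shift (-1) x)))‖ = ‖delta ε (delta ε (delta ε x))‖
  rw [Commute.apply (commute_delta_shift ε _), Commute.apply (commute_delta_shift ε _),
    Commute.apply (commute_delta_shift ε _), norm_shift]

/-- Consistency of the averaged second differences at mesh sizes `2ε` and `ε`. -/
theorem norm_avgLap_sub_le {ε : ℝ} (hε : 0 < ε) {z : ℝ} (hz : z ≠ 0) (x : Seq) :
    ‖avgLap (2 * ε) 2 (cidx (2 * ε) z) x - avgLap ε 1 (cidx ε z) x‖
      ≤ 3 * (ε * ‖(delta ε ^ 3) x‖) := by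
  obtain ⟨h1, h2, h3, h4⟩ := cidx_double hε hz
  have h5 : 0 < (cidx ε z).natAbs := by omega
  set K := (cidx (2 * ε) z).natAbs
  set J := (cidx ε z).natAbs
  obtain ⟨i1, e1⟩ := avgLap_eq_integral (2 * ε) 2 (cidx (2 * ε) z) h2 x
  obtain ⟨i2, e2⟩ := avgLap_eq_integral ε 1 (cidx ε z) h5 x
  rw [e1, e2, ← intervalIntegral.integral_sub i1 i2, h1]
  set s := (cidx ε z).sign
  have hs : |(s : ℝ)| ≤ 1 := by
    have : s = -1 ∨ s = 0 ∨ s = 1 := by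
      rcases lt_trichotomy (cidx ε z) 0 with h | h | h
      · left; exact Int.sign_eq_neg_one_of_neg h
      · right; left; simp [s, h]
      · right; right; exact Int.sign_eq_one_of_pos h
    rcases this with h | h | h <;> simp [h]
  set η := ε * ‖(delta ε ^ 3) x‖ with hη
  set g := lap ε 1 x with hg
  have hgη : ε * ‖delta ε g‖ = η := by rw [hη, hg, norm_delta_lap]
  have hη0 : 0 ≤ η := by positivity
  have hbound : ∀ θ ∈ uIoc (0 : ℝ) 1,
      ‖(1 - θ) • lap (2 * ε) 2 (shift (2 * (s * ⌊K * θ⌋₊)) x)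
        - (1 - θ) • lap ε 1 (shift (1 * (s * ⌊J * θ⌋₊)) x)‖ ≤ 3 * η := by
    intro θ hθ
    rw [uIoc_of_le zero_le_one] at hθ
    set p : ℤ := s * ⌊K * θ⌋₊
    set q : ℤ := s * ⌊J * θ⌋₊
    -- The coarse second difference is the average of the fine one with weights 1/4, 1/2, 1/4. What
    -- remains is the fine one evaluated at neighbouring points.
    have e3 : lap (2 * ε) 2 (shift (2 * p) x) - lap ε 1 (shift (1 * q) x)
        = (1 / 4 : ℝ) • (shift (2 * p + 1) g - shift (2 * p) g)
          + (1 / 4 : ℝ) • (shift (2 * p - 1) g - shift (2 * p) g)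
          + (shift (2 * p) g - shift q g) := by
      refine Seq.ext fun k => ?_
      simp only [hg, lap_apply, Seq.smul_apply, Seq.add_apply, Seq.sub_apply, shift_apply]
      ring_nf
    have hθ0 : 0 ≤ 1 - θ := by linarith [hθ.2]
    have b1 := norm_shift_sub_shift_le hε (2 * p + 1) (2 * p) g
    have b2 := norm_shift_sub_shift_le hε (2 * p - 1) (2 * p) g
    have b3 := norm_shift_sub_shift_le hε (2 * p) q g
    have c1 : |((2 * p + 1 - 2 * p : ℤ) : ℝ)| = 1 := by push_cast; ring_nf; simp
    have c2 : |((2 * p - 1 - 2 * p : ℤ) : ℝ)| = 1 := by push_cast; ring_nf; simp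
    -- The cell numbers satisfy `2K - 1 ≤ J ≤ 2K`, so `2Kθ` and `Jθ` differ by at most one, and the
    -- floors add at most one further step on either side. Altogether `1/4 + 1/4 + 2 ≤ 3` lattice
    -- steps are paid for.
    have c3 : |((2 * p - q : ℤ) : ℝ)| ≤ 2 := by
      have f1 := Nat.floor_le (show 0 ≤ K * θ by have := hθ.1; positivity)
      have f2 := Nat.lt_floor_add_one (K * θ)
      have f3 := Nat.floor_le (show 0 ≤ J * θ by have := hθ.1; positivity)
      have f4 := Nat.lt_floor_add_one (J * θ)
      have g1 : (J : ℝ) ≤ 2 * K := by exact_mod_cast h3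
      have g2 : 2 * (K : ℝ) ≤ J + 1 := by exact_mod_cast h4
      have e : ((2 * p - q : ℤ) : ℝ) = s * (2 * ⌊K * θ⌋₊ - ⌊J * θ⌋₊) := by
        simp only [p, q]; push_cast; ring
      rw [e, abs_mul]
      have k1 : |2 * (⌊K * θ⌋₊ : ℝ) - ⌊J * θ⌋₊| ≤ 2 := by
        rw [abs_le]
        have := hθ.1
        have := hθ.2
        constructor <;> nlinarith
      calc _ ≤ 1 * 2 := mul_le_mul hs k1 (abs_nonneg _) zero_le_one
        _ = 2 := by norm_num
    rw [hgη] at b1 b2 b3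
    rw [c1] at b1
    rw [c2] at b2
    have b3' := b3.trans (mul_le_mul_of_nonneg_right c3 hη0)
    rw [← smul_sub, norm_smul, Real.norm_of_nonneg hθ0, e3]
    have t1 := norm_add₃_le (a := (1 / 4 : ℝ) • (shift (2 * p + 1) g - shift (2 * p) g))
      (b := (1 / 4 : ℝ) • (shift (2 * p - 1) g - shift (2 * p) g)) (c := shift (2 * p) g - shift q g)
    rw [norm_smul, norm_smul, Real.norm_of_nonneg (by norm_num : (0 : ℝ) ≤ 1 / 4)] at t1
    have t2 : ‖(1 / 4 : ℝ) • (shift (2 * p + 1) g - shift (2 * p) g)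
          + (1 / 4 : ℝ) • (shift (2 * p - 1) g - shift (2 * p) g)
          + (shift (2 * p) g - shift q g)‖ ≤ 3 * η := by linarith
    calc _ ≤ 1 * (3 * η) := mul_le_mul (by linarith [hθ.1]) t2 (norm_nonneg _) zero_le_one
      _ = 3 * η := one_mul _
  have := intervalIntegral.norm_integral_le_of_norm_le_const hbound
  rw [sub_zero, abs_one, mul_one] at this
  exact this

theorem norm_J1op_sub_le {ν : Measure ℝ} (hν : IsLevyMeasure ν) {ε : ℝ} (hε : 0 < ε) (x : Seq) :
    ‖J1op ν (2 * ε) 2 x - J1op ν ε 1 x‖ ≤ mu2 ν * (3 * (ε * ‖(delta ε ^ 3) x‖)) := by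
  rw [J1op_apply hν, J1op_apply hν,
    ← integral_sub (integrable_J1_apply hν _ _ x) (integrable_J1_apply hν _ _ x), mu2,
    ← integral_mul_const]
  refine norm_integral_le_of_norm_le (hν.integrableOn_sq.mul_const _) (ae_of_all _ fun z => ?_)
  rw [← smul_sub, norm_smul, Real.norm_of_nonneg (sq_nonneg z)]
  -- At the origin the coarse and fine cells are not related, but the weight `z²` vanishes.
  rcases eq_or_ne z 0 with rfl | hz
  · simp
  · exact mul_le_mul_of_nonneg_left (norm_avgLap_sub_le hε hz x) (sq_nonneg z)

/-- Coarse and fine rounding of a jump `z` land at most one fine lattice step apart, so the error is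
a single difference of `x` times the finite mass of large jumps. -/
theorem norm_J2op_sub_le {ν : Measure ℝ} (hν : IsLevyMeasure ν) {ε : ℝ} (hε : 0 < ε) (x : Seq) :
    ‖J2op ν (2 * ε) 2 x - J2op ν ε 1 x‖ ≤ mu0 ν * (ε * ‖delta ε x‖) := by
  rw [J2op_apply hν, J2op_apply hν,
    ← integral_sub (integrable_J2_apply hν _ _ x) (integrable_J2_apply hν _ _ x)]
  have h1 : ∀ᵐ z ∂(ν.restrict (Icc (-1) 1)ᶜ), ‖shift (2 * cidx (2 * ε) z) x - x
      - (shift (1 * cidx ε z) x - x)‖ ≤ ε * ‖delta ε x‖ := by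
    refine (ae_restrict_mem measurableSet_Icc.compl).mono fun z hz => ?_
    have hz0 : z ≠ 0 := by rintro rfl; exact hz ⟨by norm_num, by norm_num⟩
    obtain ⟨h1, h2, h3, h4⟩ := cidx_double hε hz0
    rw [sub_sub_sub_cancel_right]
    refine (norm_shift_sub_shift_le hε _ _ x).trans ?_
    have h5 : |2 * cidx (2 * ε) z - 1 * cidx ε z| ≤ 1 := by
      have e1 := Int.sign_mul_natAbs (cidx (2 * ε) z)
      have e2 := Int.sign_mul_natAbs (cidx ε z)
      rw [h1] at e1
      rw [abs_le]
      rcases lt_trichotomy (cidx ε z) 0 with h | h | h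
      · rw [Int.sign_eq_neg_one_of_neg h] at e1 e2; omega
      · omega
      · rw [Int.sign_eq_one_of_pos h] at e1 e2; omega
    have h6 : |((2 * cidx (2 * ε) z - 1 * cidx ε z : ℤ) : ℝ)| ≤ 1 := by
      rw [← Int.cast_abs]; exact_mod_cast h5
    calc _ ≤ 1 * (ε * ‖delta ε x‖) := mul_le_mul_of_nonneg_right h6 (by positivity)
      _ = _ := one_mul _
  have := norm_setIntegral_le_of_norm_le_const_ae (μ := ν) hν.measure_compl_lt_top h1
  exact this.trans (mul_comm _ _).le

theorem cdiff_cdiff (h : ℝ) (n : ℤ) (y : Seq) : cdiff h n (cdiff h n y)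
    = ((2 * h) ^ 2)⁻¹ • (shift (2 * n) y - (2 : ℝ) • y + shift (-(2 * n)) y) := by
  refine Seq.ext fun k => ?_
  simp only [cdiff_apply, Seq.smul_apply, Seq.add_apply, Seq.sub_apply, shift_apply]
  ring_nf

/-- With `D` the central difference of stride one, the stride-two difference is `D` times the mean
`M` of the forward and backward shifts, and `M² = 1 + ε² D²`. So the squares differ by `ε² D⁴`; one
factor `ε D` has norm at most 1 and is given away, leaving three differences and one power of `ε`.
Similarly `M - 1` is `ε²/2` times a shifted second difference quotient. -/
theorem norm_cdiff_sub_le {ε : ℝ} (hε : 0 < ε) (x : Seq) :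
    ‖cdiff (2 * ε) 2 (cdiff (2 * ε) 2 x) - cdiff ε 1 (cdiff ε 1 x)‖ ≤ ε * ‖(delta ε ^ 3) x‖ ∧
    ‖cdiff (2 * ε) 2 x - cdiff ε 1 x‖ ≤ ε * ‖(delta ε ^ 2) x‖ := by
  have hc1 : ∀ y, ‖cdiff ε 1 y‖ ≤ ‖delta ε y‖ := fun y => by
    simpa using norm_cdiff_le hε one_pos y
  have hε1 : ∀ y, ‖ε • cdiff ε 1 y‖ ≤ ‖y‖ := fun y => by
    have e : ε • cdiff ε 1 y = (1 / 2 : ℝ) • (shift 1 y - shift (-1) y) := by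
      refine Seq.ext fun k => ?_
      simp only [cdiff_apply, Seq.smul_apply, Seq.sub_apply, shift_apply]
      field_simp
    rw [e, norm_smul, Real.norm_of_nonneg (by norm_num : (0 : ℝ) ≤ 1 / 2)]
    have := norm_sub_le (shift 1 y) (shift (-1) y)
    rw [norm_shift, norm_shift] at this
    linarith
  have hcc : ∀ y, delta ε (cdiff ε 1 y) = cdiff ε 1 (delta ε y) := fun y =>
    Commute.apply (commute_delta_cdiff ε ε 1) y
  constructor
  · have e : cdiff (2 * ε) 2 (cdiff (2 * ε) 2 x) - cdiff ε 1 (cdiff ε 1 x)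
        = ε • (ε • cdiff ε 1 (cdiff ε 1 (cdiff ε 1 (cdiff ε 1 x)))) := by
      rw [cdiff_cdiff, cdiff_cdiff (y := x), cdiff_cdiff]
      refine Seq.ext fun k => ?_
      simp only [Seq.smul_apply, Seq.sub_apply, Seq.add_apply, shift_apply, add_assoc]
      norm_num
      field_simp
      ring
    rw [e, norm_smul, Real.norm_of_nonneg hε.le]
    refine mul_le_mul_of_nonneg_left ((hε1 _).trans ((hc1 _).trans ?_)) hε.le
    rw [hcc]
    refine (hc1 _).trans ?_
    rw [hcc, hcc]
    change _ ≤ ‖delta ε (delta ε (delta ε x))‖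
    exact hc1 _
  · have e : cdiff (2 * ε) 2 x - cdiff ε 1 x
        = (ε * (1 / 2)) • (ε • cdiff ε 1 (shift (-1) (delta ε (delta ε x)))) := by
      refine Seq.ext fun k => ?_
      simp only [cdiff_apply, Seq.smul_apply, Seq.sub_apply, shift_apply, delta_apply, add_assoc]
      norm_num
      field_simp
      ring
    rw [e, norm_smul, Real.norm_of_nonneg (by positivity), mul_assoc]
    refine mul_le_mul_of_nonneg_left ?_ hε.le
    have := hε1 (shift (-1) (delta ε (delta ε x)))
    rw [norm_shift] at this
    change _ ≤ ‖delta ε (delta ε x)‖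
    linarith [norm_nonneg (delta ε (delta ε x))]

end
end LevyFD

namespace LevyFD
noncomputable section
open Filter Topology

/-! ### The scheme as an evolution equation in the space of square summable sequences -/

/-- A sequence is the limit of its truncations to finite sets of indices, so measurability may be
checked coordinatewise. -/
theorem Seq.aestronglyMeasurable {α : Type*} [MeasurableSpace α] {μ : Measure α} {f : α → Seq}
    (h : ∀ k, AEStronglyMeasurable (fun t => f t k) μ) : AEStronglyMeasurable f μ := by
  have hs : ∀ t, Tendsto (fun s : Finset ℤ => ∑ k ∈ s, lp.single 2 k (f t k)) atTop (𝓝 (f t)) :=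
    fun t => lp.hasSum_single (by norm_num) (f t)
  refine aestronglyMeasurable_of_tendsto_ae atTop
    (f := fun s t => ∑ k ∈ s, lp.single 2 k (f t k)) (fun s => ?_) (ae_of_all _ hs)
  refine Finset.aestronglyMeasurable_fun_sum _ fun k _ => ?_
  have hc : Continuous fun r : ℝ => (lp.single 2 k r : Seq) := by
    refine (LinearMap.mkContinuous
      ({ toFun := fun r : ℝ => (lp.single 2 k r : Seq)
         map_add' := fun r s => lp.single_add (E := fun _ : ℤ => ℝ) 2 k r s
         map_smul' := fun c r => lp.single_smul (E := fun _ : ℤ => ℝ) 2 k c r } : ℝ →ₗ[ℝ] Seq) 1 fun r => ?_).continuous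
    rw [one_mul]
    exact (lp.norm_single (E := fun _ : ℤ => ℝ) (p := 2) (by norm_num) k r).le
  exact hc.comp_aestronglyMeasurable (h k)

open Classical in
/-- The values of `g ∈ H^m` on the grid `εℤ`. -/
def H.toGrid {m : ℕ} (g : H m) (ε : ℝ) : Seq :=
  if h : Memℓp (fun k : ℤ => g.eval (k * ε)) 2 then ⟨_, h⟩ else 0

theorem H.toGrid_apply {m : ℕ} (hm : 1 ≤ m) (g : H m) {ε : ℝ} (hε : 0 < ε) (hε1 : ε ≤ 1) (k : ℤ) :
    g.toGrid ε k = g.eval (k * ε) := by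
  have h : Memℓp (fun k : ℤ => g.eval (k * ε)) 2 :=
    memℓp_two_iff.2 (g.grid_bound hm hε hε1 0 (Nat.zero_le _)).1
  rw [H.toGrid, dif_pos h]

/-- Five orders, each contributing at most `4 ‖g‖²`. The factor `ε` turns the sum into a Riemann
sum, so the bound is uniform in the mesh. -/
theorem H.sobSq_toGrid_le {m : ℕ} (hm : 4 ≤ m) (g : H m) {ε : ℝ} (hε : 0 < ε) (hε1 : ε ≤ 1) :
    ε * sobSq ε 4 (g.toGrid ε) ≤ 20 * ‖g‖ ^ 2 := by
  have h : ∀ i ∈ Finset.range 5, ε * ‖(delta ε ^ i) (g.toGrid ε)‖ ^ 2 ≤ 4 * ‖g‖ ^ 2 := by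
    intro i hi
    have hi := Finset.mem_range.1 hi
    rw [Seq.norm_sq, coe_delta_pow]
    have e : ⇑(g.toGrid ε) = fun k : ℤ => g.eval (k * ε) :=
      funext fun k => g.toGrid_apply (by omega) hε hε1 k
    rw [e]
    exact (g.grid_bound (by omega) hε hε1 i (by omega)).2
  rw [sobSq, Finset.mul_sum]
  refine (Finset.sum_le_sum h).trans ?_
  simp only [Finset.sum_const, Finset.card_range, nsmul_eq_mul]
  push_cast
  linarith

/-- Coefficients on `ℝ × ℝ`, measurable and bounded with four derivatives in space, with
nonnegative leading coefficient. -/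
structure Coeffs (K : ℝ) (a b c : ℝ → ℝ → ℝ) : Prop where
  measurable_a : Measurable fun p : ℝ × ℝ => a p.1 p.2
  measurable_b : Measurable fun p : ℝ × ℝ => b p.1 p.2
  measurable_c : Measurable fun p : ℝ × ℝ => c p.1 p.2
  contDiff_a : ∀ t, ContDiff ℝ 4 (a t)
  contDiff_b : ∀ t, ContDiff ℝ 4 (b t)
  contDiff_c : ∀ t, ContDiff ℝ 4 (c t)
  bound_a : ∀ t, ∀ j ≤ 4, ∀ x, |iteratedDeriv j (a t) x| ≤ K
  bound_b : ∀ t, ∀ j ≤ 4, ∀ x, |iteratedDeriv j (b t) x| ≤ K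
  bound_c : ∀ t, ∀ j ≤ 4, ∀ x, |iteratedDeriv j (c t) x| ≤ K
  nonneg_a : ∀ t x, 0 ≤ a t x

theorem hasDerivAt_iterate_dq {g : ℝ → ℝ} (hg : Differentiable ℝ g) (ε : ℝ) (j : ℕ) (x : ℝ) :
    HasDerivAt ((dq ε)^[j] g) ((dq ε)^[j] (deriv g) x) x := by
  induction j generalizing x with
  | zero => exact (hg x).hasDerivAt
  | succ j ih =>
    rw [Function.iterate_succ_apply', Function.iterate_succ_apply']
    have h1 := (ih (x + ε)).comp_add_const x ε
    exact (h1.sub (ih x)).div_const ε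

/-- Difference quotients commute with differentiation, and each is bounded by the supremum of the
derivative. -/
theorem abs_iterate_dq_le {K : ℝ} {ε : ℝ} (hε : 0 < ε) (j : ℕ) {g : ℝ → ℝ} (hg : ContDiff ℝ j g)
    (h : ∀ x, |iteratedDeriv j g x| ≤ K) (x : ℝ) : |(dq ε)^[j] g x| ≤ K := by
  induction j generalizing g x with
  | zero => simpa using h x
  | succ j ih =>
    have hd : Differentiable ℝ g := hg.differentiable (by simp)
    have hg' : ContDiff ℝ j (deriv g) := by
      have := (contDiff_succ_iff_deriv (n := (j : WithTop ℕ∞)) (f := g)).1 (by exact_mod_cast hg)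
      exact this.2.2
    have hb : ∀ y, |(dq ε)^[j] (deriv g) y| ≤ K := fun y =>
      ih hg' (fun x => by rw [← iteratedDeriv_succ']; exact h x) y
    rw [Function.iterate_succ_apply', dq, abs_div, abs_of_pos hε, div_le_iff₀ hε]
    have := Convex.norm_image_sub_le_of_norm_hasDerivWithin_le (s := univ) (x := x) (y := x + ε)
      (f := (dq ε)^[j] g) (f' := (dq ε)^[j] (deriv g)) (C := K)
      (fun y _ => (hasDerivAt_iterate_dq hd ε j y).hasDerivWithinAt) (fun y _ => hb y) convex_univ
      (mem_univ _) (mem_univ _)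
    simpa [abs_of_pos hε] using this

theorem diffBound_of_contDiff {K : ℝ} {ε : ℝ} (hε : 0 < ε) {g : ℝ → ℝ} (hg : ContDiff ℝ 4 g)
    (h : ∀ j ≤ 4, ∀ x, |iteratedDeriv j g x| ≤ K) : DiffBound ε K 4 fun k : ℤ => g (k * ε) := by
  intro i hi k
  rw [iterate_fd_eq]
  exact abs_iterate_dq_le hε i (hg.of_le (by exact_mod_cast hi)) (h i hi) _

/-- The operator `L^h_t + J^h` with stride `n` on the lattice `εℤ`, where `h = n ε`. -/
def schemeOp (ν : Measure ℝ) (a b c : ℝ → ℝ → ℝ) (ε : ℝ) (n : ℕ) (t : ℝ) : Seq →L[ℝ] Seq :=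
  Aop ν (n * ε) n (fun k => a t (k * ε)) (fun k => b t (k * ε)) (fun k => c t (k * ε))

theorem Coeffs.diffBound_a {K : ℝ} {a b c : ℝ → ℝ → ℝ} (hc : Coeffs K a b c) {ε : ℝ} (hε : 0 < ε)
    (t : ℝ) : DiffBound ε K 4 fun k : ℤ => a t (k * ε) :=
  diffBound_of_contDiff hε (hc.contDiff_a t) (hc.bound_a t)

theorem Coeffs.diffBound_b {K : ℝ} {a b c : ℝ → ℝ → ℝ} (hc : Coeffs K a b c) {ε : ℝ} (hε : 0 < ε)
    (t : ℝ) : DiffBound ε K 4 fun k : ℤ => b t (k * ε) :=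
  diffBound_of_contDiff hε (hc.contDiff_b t) (hc.bound_b t)

theorem Coeffs.diffBound_c {K : ℝ} {a b c : ℝ → ℝ → ℝ} (hc : Coeffs K a b c) {ε : ℝ} (hε : 0 < ε)
    (t : ℝ) : DiffBound ε K 4 fun k : ℤ => c t (k * ε) :=
  diffBound_of_contDiff hε (hc.contDiff_c t) (hc.bound_c t)

theorem Coeffs.abs_a_le {K : ℝ} {a b c : ℝ → ℝ → ℝ} (hc : Coeffs K a b c) (t x : ℝ) : |a t x| ≤ K := by
  simpa using hc.bound_a t 0 (by norm_num) x

theorem Coeffs.abs_b_le {K : ℝ} {a b c : ℝ → ℝ → ℝ} (hc : Coeffs K a b c) (t x : ℝ) : |b t x| ≤ K := by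
  simpa using hc.bound_b t 0 (by norm_num) x

theorem Coeffs.abs_c_le {K : ℝ} {a b c : ℝ → ℝ → ℝ} (hc : Coeffs K a b c) (t x : ℝ) : |c t x| ≤ K := by
  simpa using hc.bound_c t 0 (by norm_num) x

theorem Coeffs.nonneg {K : ℝ} {a b c : ℝ → ℝ → ℝ} (hc : Coeffs K a b c) : 0 ≤ K :=
  (abs_nonneg _).trans (hc.abs_a_le 0 0)

/-- The bound depends on the mesh and serves only integrability, existence and uniqueness for a
fixed lattice; the quantitative estimates rest on the energy method. -/
theorem Coeffs.exists_norm_schemeOp_le {K : ℝ} {a b c : ℝ → ℝ → ℝ} (hc : Coeffs K a b c)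
    (ν : Measure ℝ) (ε : ℝ) (n : ℕ) : ∃ L, ∀ t, ‖schemeOp ν a b c ε n t‖ ≤ L := by
  set D := cdiff (n * ε) n
  refine ⟨K * (‖D‖ * ‖D‖) + K * ‖D‖ + K + (‖J1op ν (n * ε) n‖ + ‖J2op ν (n * ε) n‖), fun t => ?_⟩
  have hK := hc.nonneg
  refine ContinuousLinearMap.opNorm_le_bound _ (by positivity) fun x => ?_
  rw [schemeOp, Aop_apply]
  have h1 := norm_mulOp_le (fun k : ℤ => hc.abs_a_le t (k * ε)) (D (D x))
  have h2 := norm_mulOp_le (fun k : ℤ => hc.abs_b_le t (k * ε)) (D x)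
  have h3 := norm_mulOp_le (fun k : ℤ => hc.abs_c_le t (k * ε)) x
  have h4 := D.le_opNorm x
  have h5 := (D.le_opNorm (D x)).trans (mul_le_mul_of_nonneg_left h4 (norm_nonneg _))
  have h6 := (J1op ν (n * ε) n).le_opNorm x
  have h7 := (J2op ν (n * ε) n).le_opNorm x
  have h8 := mul_le_mul_of_nonneg_left h4 hK
  have h9 := mul_le_mul_of_nonneg_left h5 hK
  refine (norm_add_le _ _).trans ((add_le_add (norm_add₃_le) (norm_add_le _ _)).trans ?_)
  nlinarith

theorem Coeffs.schemeOp_apply {K : ℝ} {a b c : ℝ → ℝ → ℝ} (hc : Coeffs K a b c)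
    (ν : Measure ℝ) (ε : ℝ) (n : ℕ) (t : ℝ) (x : Seq) (k : ℤ) :
    schemeOp ν a b c ε n t x k
      = a t (k * ε) * cdiff (n * ε) n (cdiff (n * ε) n x) k + b t (k * ε) * cdiff (n * ε) n x k
        + c t (k * ε) * x k + (J1op ν (n * ε) n x k + J2op ν (n * ε) n x k) := by
  rw [schemeOp, Aop_apply]
  simp only [Seq.add_apply]
  rw [mulOp_apply fun k : ℤ => hc.abs_a_le t (k * ε), mulOp_apply fun k : ℤ => hc.abs_b_le t (k * ε),
    mulOp_apply fun k : ℤ => hc.abs_c_le t (k * ε)]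

theorem Coeffs.aestronglyMeasurable_schemeOp {K T : ℝ} {a b c : ℝ → ℝ → ℝ} (hc : Coeffs K a b c)
    (ν : Measure ℝ) (ε : ℝ) (n : ℕ) (V : ℝ → Seq) (hV : ContinuousOn V (Icc 0 T)) :
    AEStronglyMeasurable (fun t => schemeOp ν a b c ε n t (V t)) (volume.restrict (Icc 0 T)) := by
  refine Seq.aestronglyMeasurable fun k => ?_
  simp only [hc.schemeOp_apply]
  have hm : ∀ P : Seq →L[ℝ] Seq, AEStronglyMeasurable (fun t => P (V t) k) (volume.restrict (Icc 0 T)) := by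
    intro P
    have : ContinuousOn (fun t => (coord k) (P (V t))) (Icc 0 T) :=
      (coord k).continuous.comp_continuousOn (P.continuous.comp_continuousOn hV)
    exact this.aestronglyMeasurable measurableSet_Icc
  have h1 : ∀ {g : ℝ → ℝ → ℝ}, Measurable (fun p : ℝ × ℝ => g p.1 p.2) →
      AEStronglyMeasurable (fun t => g t (k * ε)) (volume.restrict (Icc 0 T)) := fun hg =>
    (hg.comp (measurable_id.prodMk measurable_const)).aestronglyMeasurable
  exact ((((h1 hc.measurable_a).mul (hm ((cdiff (n * ε) n).comp (cdiff (n * ε) n)))).add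
    ((h1 hc.measurable_b).mul (hm (cdiff (n * ε) n)))).add
    ((h1 hc.measurable_c).mul (hm (.id ℝ Seq)))).add
    ((hm (J1op ν (n * ε) n)).add (hm (J2op ν (n * ε) n)))

theorem integrableOn_toGrid {m : ℕ} (hm : 4 ≤ m) {T : ℝ} {f : ℝ → H m}
    (hf : MemLp f 2 (volume.restrict (Icc 0 T))) {ε : ℝ} (hε : 0 < ε) (hε1 : ε ≤ 1) :
    IntegrableOn (fun s => (f s).toGrid ε) (Icc 0 T) := by
  have h1 : IntegrableOn (fun s => ‖f s‖) (Icc 0 T) := (hf.integrable one_le_two).norm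
  -- The factor 5 rounds up the square root of the constant 20 in `H.sobSq_toGrid_le`.
  refine (h1.const_mul (5 * (√ε)⁻¹)).mono' (Seq.aestronglyMeasurable fun k => ?_)
    (ae_of_all _ fun s => ?_)
  · simp only [H.toGrid_apply (by omega : 1 ≤ m) _ hε hε1]
    exact (H.evalCLM (by omega : 1 ≤ m) (k * ε)).continuous.comp_aestronglyMeasurable
      hf.aestronglyMeasurable
  · have h2 := (f s).sobSq_toGrid_le hm hε hε1
    have h3 := sq_le_sobSq ε (Nat.zero_le 4) ((f s).toGrid ε)
    have h4 : 0 < √ε := Real.sqrt_pos.2 hε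
    rw [mul_assoc, mul_left_comm, ← div_eq_inv_mul, le_div_iff₀ h4]
    apply le_of_sq_le_sq _ (by positivity)
    rw [mul_pow, Real.sq_sqrt hε.le, mul_pow]
    simp only [pow_zero, one_apply_eq_self] at h3
    nlinarith [sq_nonneg ‖f s‖]

/-- `V` solves the scheme with stride `n` on the lattice `εℤ`. -/
structure IsScheme {m : ℕ} (T : ℝ) (ν : Measure ℝ) (a b c : ℝ → ℝ → ℝ) (ψ : H m) (f : ℝ → H m)
    (ε : ℝ) (n : ℕ) (V : ℝ → Seq) : Prop where
  continuousOn : ContinuousOn V (Icc 0 T)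
  equation : ∀ t ∈ Icc 0 T, V t = ψ.toGrid ε
    + ∫ s in (0 : ℝ)..t, (schemeOp ν a b c ε n s (V s) + (f s).toGrid ε)

theorem Coeffs.integrableOn_schemeOp {K T : ℝ} {a b c : ℝ → ℝ → ℝ} (hc : Coeffs K a b c)
    (ν : Measure ℝ) (ε : ℝ) (n : ℕ) {V : ℝ → Seq} (hV : ContinuousOn V (Icc 0 T)) :
    IntegrableOn (fun s => schemeOp ν a b c ε n s (V s)) (Icc 0 T) := by
  obtain ⟨L, hL⟩ := hc.exists_norm_schemeOp_le ν ε n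
  have h1 : IntegrableOn (fun s => L * ‖V s‖) (Icc 0 T) :=
    (continuousOn_const.mul hV.norm).integrableOn_Icc
  refine h1.mono' (hc.aestronglyMeasurable_schemeOp ν ε n V hV) (ae_of_all _ fun s => ?_)
  exact ((schemeOp ν a b c ε n s).le_opNorm _).trans
    (mul_le_mul_of_nonneg_right (hL s) (norm_nonneg _))

section Scheme

variable {m : ℕ} {K T : ℝ} {ν : Measure ℝ} {a b c : ℝ → ℝ → ℝ} {ψ : H m} {f : ℝ → H m} {ε : ℝ}
  {n : ℕ}

theorem IsScheme.integrableOn (hc : Coeffs K a b c) (hm : 4 ≤ m)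
    (hf : MemLp f 2 (volume.restrict (Icc 0 T))) (hε : 0 < ε) (hε1 : ε ≤ 1) {V : ℝ → Seq}
    (hV : IsScheme T ν a b c ψ f ε n V) :
    IntegrableOn (fun s => schemeOp ν a b c ε n s (V s) + (f s).toGrid ε) (Icc 0 T) :=
  (hc.integrableOn_schemeOp ν ε n hV.continuousOn).add (integrableOn_toGrid hm hf hε hε1)

theorem IsScheme.unique (hc : Coeffs K a b c) (hm : 4 ≤ m)
    (hf : MemLp f 2 (volume.restrict (Icc 0 T))) (hε : 0 < ε) (hε1 : ε ≤ 1) {V W : ℝ → Seq}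
    (hV : IsScheme T ν a b c ψ f ε n V) (hW : IsScheme T ν a b c ψ f ε n W) :
    ∀ t ∈ Icc 0 T, V t = W t := by
  obtain ⟨L, hL⟩ := hc.exists_norm_schemeOp_le ν ε n
  exact linear_ode_unique (fun t _ => hL t) hV.continuousOn hW.continuousOn
    (hV.integrableOn hc hm hf hε hε1) (hW.integrableOn hc hm hf hε hε1) hV.equation hW.equation

theorem exists_isScheme (hT : 0 ≤ T) (hc : Coeffs K a b c) (ν : Measure ℝ) (hm : 4 ≤ m) (ψ : H m)
    (hf : MemLp f 2 (volume.restrict (Icc 0 T))) (hε : 0 < ε) (hε1 : ε ≤ 1) (n : ℕ) :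
    ∃ V, IsScheme T ν a b c ψ f ε n V := by
  obtain ⟨L, hL⟩ := hc.exists_norm_schemeOp_le ν ε n
  obtain ⟨V, h1, -, h2⟩ := linear_ode_exists hT (fun t _ => hL t)
    (hc.aestronglyMeasurable_schemeOp ν ε n) (integrableOn_toGrid hm hf hε hε1) (ψ.toGrid ε)
  exact ⟨V, h1, h2⟩

end Scheme

/-- Restriction of a lattice function to the sublattice of even points. -/
def restrictEven : Seq →L[ℝ] Seq :=
  LinearMap.mkContinuous
    { toFun := fun x => ⟨fun k => x (2 * k), memℓp_two_iff.2
        (x.summable_sq.comp_injective (mul_right_injective₀ two_ne_zero))⟩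
      map_add' := fun x y => rfl
      map_smul' := fun r x => rfl } 1 (by
    intro x
    rw [one_mul]
    apply le_of_sq_le_sq _ (norm_nonneg _)
    rw [Seq.norm_sq, Seq.norm_sq]
    exact tsum_comp_le_tsum_of_inj x.summable_sq (fun _ => sq_nonneg _)
      (mul_right_injective₀ (two_ne_zero (α := ℤ))))

@[simp] theorem restrictEven_apply (x : Seq) (k : ℤ) : restrictEven x k = x (2 * k) := rfl

/-- With stride two the operator connects points of equal parity only. On the even points the two
sides are literally the same formula, with the same mesh size `2ε` in all quotients. -/
theorem restrictEven_schemeOp {K : ℝ} {ν : Measure ℝ} (hν : IsLevyMeasure ν) {a b c : ℝ → ℝ → ℝ}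
    (hc : Coeffs K a b c) (ε t : ℝ) (x : Seq) :
    restrictEven (schemeOp ν a b c ε 2 t x) = schemeOp ν a b c (2 * ε) 1 t (restrictEven x) := by
  refine Seq.ext fun k => ?_
  rw [restrictEven_apply, hc.schemeOp_apply, hc.schemeOp_apply, J1op_coord hν, J1op_coord hν,
    J2op_coord hν, J2op_coord hν]
  simp only [cdiff_apply, restrictEven_apply, avgLap_apply_coord]
  push_cast
  simp only [one_mul]
  have e : (2 * (k : ℝ)) * ε = k * (2 * ε) := by ring
  rw [e]
  ring_nf

theorem IsScheme.restrictEven {m : ℕ} {K T : ℝ} {ν : Measure ℝ} (hν : IsLevyMeasure ν)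
    {a b c : ℝ → ℝ → ℝ} {ψ : H m} {f : ℝ → H m} {ε : ℝ} (hc : Coeffs K a b c) (hm : 4 ≤ m)
    (hf : MemLp f 2 (volume.restrict (Icc 0 T))) (hε : 0 < ε) (hε1 : 2 * ε ≤ 1) {V : ℝ → Seq}
    (hV : IsScheme T ν a b c ψ f ε 2 V) :
    IsScheme T ν a b c ψ f (2 * ε) 1 fun t => LevyFD.restrictEven (V t) := by
  have hg : ∀ g : H m, LevyFD.restrictEven (g.toGrid ε) = g.toGrid (2 * ε) := by
    intro g
    refine Seq.ext fun k => ?_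
    rw [restrictEven_apply, H.toGrid_apply (by omega) g hε (by linarith),
      H.toGrid_apply (by omega) g (by positivity) hε1]
    push_cast
    congr 1; ring
  refine ⟨LevyFD.restrictEven.continuous.comp_continuousOn hV.continuousOn, fun t ht => ?_⟩
  have hi := (hV.integrableOn hc hm hf hε (by linarith)).mono_set
    (uIcc_subset_Icc (left_mem_Icc.2 (ht.1.trans ht.2)) ht)
  rw [hV.equation t ht, map_add, hg,
    ← LevyFD.restrictEven.intervalIntegral_comp_comm hi.intervalIntegrable]
  congr 2; ext1 s
  rw [map_add, hg, restrictEven_schemeOp hν hc]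

end
end LevyFD

namespace LevyFD
noncomputable section
open Filter Topology

/-! ### Identification with the finite difference scheme -/

/-- Since `1/h` is an integer, `±1` are grid points and no cell straddles them; the splitting of
indices therefore matches the splitting of jumps at `|z| = 1`. -/
theorem cidx_mem_nearIndices {h : ℝ} (hh : h ∈ meshSizes) {z : ℝ} (hz : z ≠ 0) :
    cidx h z ∈ nearIndices h ↔ z ∈ Icc (-1 : ℝ) 1 := by
  obtain ⟨N, hN, rfl⟩ := hh
  have hN' : (0 : ℝ) < N := by exact_mod_cast hN
  have e : (⌊(1 : ℝ) / (1 / N)⌋ : ℤ) = N := by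
    rw [one_div_one_div]; exact_mod_cast Int.floor_natCast (R := ℝ) N
  have hh : (0 : ℝ) < 1 / N := by positivity
  rw [nearIndices, Finset.mem_erase, Finset.mem_Icc, e, mem_Icc]
  rcases lt_or_gt_of_ne hz with h0 | h0
  · have h1 := cidx_neg hh h0
    have h2 : -(N : ℤ) ≤ cidx (1 / N) z ↔ -1 ≤ z := by
      rw [cidx, if_neg h0.le.not_gt, Int.le_floor, le_div_iff₀ hh]
      push_cast
      rw [neg_mul, mul_one_div_cancel hN'.ne']
    constructor
    · exact fun h => ⟨h2.1 h.2.1, by linarith⟩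
    · exact fun h => ⟨h1.ne, h2.2 h.1, by omega⟩
  · have h1 := cidx_pos hh h0
    have h2 : cidx (1 / N) z ≤ (N : ℤ) ↔ z ≤ 1 := by
      rw [cidx, if_pos h0, Int.ceil_le, div_le_iff₀ hh]
      push_cast
      rw [mul_one_div_cancel hN'.ne']
    constructor
    · exact fun h => ⟨by linarith, h2.1 h.2.2⟩
    · exact fun h => ⟨h1.ne', by omega, h2.2 h.2⟩

theorem pos_of_mem_meshSizes {h : ℝ} (hh : h ∈ meshSizes) : 0 < h ∧ h ≤ 1 := by
  obtain ⟨N, hN, rfl⟩ := hh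
  have hN' : (1 : ℝ) ≤ N := by exact_mod_cast hN
  exact ⟨by positivity, by rw [div_le_one (by linarith)]; exact hN'⟩

theorem measurableSet_cell (h : ℝ) (k : ℤ) : MeasurableSet (cell h k) := by
  rw [cell]; split_ifs <;> measurability

/-- On each cell the averaged second difference is constant in `z`, so integrating cell by cell
produces the weights `zeta`. The point `z = 0`, in the closure of the cells, is harmless because of
`z²`. -/
theorem J1op_eq_J1h {ν : Measure ℝ} (hν : IsLevyMeasure ν) {h : ℝ} (hh : h ∈ meshSizes) (x : Seq)
    (i : ℤ) : J1op ν h 1 x i = J1h ν h x i := by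
  have h0 := (pos_of_mem_meshSizes hh).1
  have hc : ∀ k ∈ nearIndices h, cell h k ⊆ Icc (-1) 1 := by
    intro k hk z hz
    have hk0 : k ≠ 0 := ((mem_nearIndices h k).1 hk).2
    have hz' := (mem_cell_iff h0 hk0).1 hz
    rcases eq_or_ne z 0 with rfl | hz0
    · simp
    · exact (cidx_mem_nearIndices hh hz0).1 (by rwa [hz'])
  have e1 : ∀ z ∈ Icc (-1 : ℝ) 1, z ^ 2 * avgLap h 1 (cidx h z) x i
      = ∑ k ∈ nearIndices h, (cell h k).indicator (fun z => z ^ 2) z * avgLap h 1 k x i := by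
    intro z hz
    rcases eq_or_ne z 0 with rfl | hz0
    · rw [Finset.sum_eq_zero]
      · simp
      · intro k _
        simp [indicator]
    · rw [Finset.sum_eq_single (cidx h z)]
      · have hk := (cidx_mem_nearIndices hh hz0).2 hz
        rw [indicator_of_mem ((mem_cell_iff h0 ((mem_nearIndices h _).1 hk).2).2 rfl)]
      · intro k hk hne
        rw [indicator_of_notMem, zero_mul]
        exact fun hm => hne ((mem_cell_iff h0 ((mem_nearIndices h _).1 hk).2).1 hm).symm
      · exact fun hk => absurd ((cidx_mem_nearIndices hh hz0).2 hz) hk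
  rw [J1op_coord hν, setIntegral_congr_fun measurableSet_Icc e1, integral_finsetSum]
  · refine Finset.sum_congr rfl fun k hk => ?_
    rw [integral_mul_const, setIntegral_indicator (measurableSet_cell h k),
      inter_eq_self_of_subset_right (hc k hk), ← zeta]
    congr 1
    rw [avgLap_apply_coord]
    refine Finset.sum_congr rfl fun l _ => ?_
    congr 1
    simp only [diffQuot]
    push_cast
    ring_nf
  · intro k _
    exact (hν.integrableOn_sq.indicator (measurableSet_cell h k)).mul_const _

/-- The complement of `[-1, 1]` is a countable disjoint union of far cells, on each of which the
integrand is constant. -/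
theorem J2op_eq_J2h {ν : Measure ℝ} (hν : IsLevyMeasure ν) {h : ℝ} (hh : h ∈ meshSizes) (x : Seq)
    (i : ℤ) : J2op ν h 1 x i = J2h ν h x i := by
  have h0 := (pos_of_mem_meshSizes hh).1
  have hU : (Icc (-1 : ℝ) 1)ᶜ = ⋃ k : farIndices h, cell h k := by
    ext z
    rw [mem_iUnion]
    constructor
    · intro hz
      have hz0 : z ≠ 0 := by rintro rfl; simp at hz
      have hk0 : cidx h z ≠ 0 := by
        rcases lt_or_gt_of_ne hz0 with h1 | h1
        · exact (cidx_neg h0 h1).ne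
        · exact (cidx_pos h0 h1).ne'
      exact ⟨⟨cidx h z, fun hk => hz ((cidx_mem_nearIndices hh hz0).1 hk), hk0⟩,
        (mem_cell_iff h0 hk0).2 rfl⟩
    · rintro ⟨⟨k, hk, hk0⟩, hz⟩ hz'
      have e := (mem_cell_iff h0 hk0).1 hz
      rcases eq_or_ne z 0 with rfl | hz0
      · apply hk0; rw [← e]; simp [cidx]
      · exact hk (e ▸ (cidx_mem_nearIndices hh hz0).2 hz')
  have hi : IntegrableOn (fun z => x (i + 1 * cidx h z) - x i) (⋃ k : farIndices h, cell h k) ν := by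
    rw [← hU]
    exact (coord i).integrable_comp (integrable_J2_apply hν h 1 x)
  have hd : Pairwise (Function.onFun Disjoint fun k : farIndices h => cell h k) := by
    intro k l hkl
    refine disjoint_left.2 fun z hz hz' => hkl (Subtype.ext ?_)
    rw [← (mem_cell_iff h0 k.2.2).1 hz, ← (mem_cell_iff h0 l.2.2).1 hz']
  rw [J2op_coord hν, hU, J2h,
    ← (hasSum_integral_iUnion (s := fun k : farIndices h => cell h k)
      (fun k => measurableSet_cell h k) hd hi).tsum_eq]
  refine tsum_congr fun k => ?_
  rw [setIntegral_congr_fun (g := fun _ => x (i + k) - x i) (measurableSet_cell h k)]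
  · rw [setIntegral_const, smul_eq_mul, mul_comm]
  · intro z hz
    simp only [(mem_cell_iff h0 k.2.2).1 hz, one_mul]

theorem schemeOp_one_apply {K : ℝ} {ν : Measure ℝ} (hν : IsLevyMeasure ν) {a b c : ℝ → ℝ → ℝ}
    (hc : Coeffs K a b c) {h : ℝ} (hh : h ∈ meshSizes) (t : ℝ) (x : Seq) (k : ℤ) :
    schemeOp ν a b c h 1 t x k = Lh h (a t) (b t) (c t) x k + Jh ν h x k := by
  rw [hc.schemeOp_apply, Nat.cast_one, one_mul, Nat.cast_one, J1op_eq_J1h hν hh, J2op_eq_J2h hν hh,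
    ← Jh]
  have h0 := (pos_of_mem_meshSizes hh).1
  have e : ∀ y : Seq, ∀ k, centralDiff h y k = cdiff h 1 y k := by
    intro y k
    simp only [centralDiff, diffQuot, cdiff_apply]
    field_simp
    push_cast
    ring
  have e' : ∀ y : Seq, centralDiff h y = cdiff h 1 y := fun y => funext (e y)
  rw [Lh, e', e']

/-- The scheme is stated point by point. The `ℓ²`-valued integrand is Bochner integrable, so
evaluation at a point passes through the integral and the equation holds in `ℓ²`. -/
theorem IsGridSolution.isScheme {m : ℕ} {K T : ℝ} {ν : Measure ℝ} (hν : IsLevyMeasure ν)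
    {a b c : ℝ → ℝ → ℝ} (hc : Coeffs K a b c) (hm : 4 ≤ m) {ψ : H m} {f : ℝ → H m}
    (hf : MemLp f 2 (volume.restrict (Icc 0 T))) {h : ℝ} (hh : h ∈ meshSizes) {v : ℝ → Seq}
    (hv : IsGridSolution T ν a b c ψ f h v) : IsScheme T ν a b c ψ f h 1 v := by
  obtain ⟨h0, h1⟩ := pos_of_mem_meshSizes hh
  refine ⟨hv.continuousOn, fun t ht => Seq.ext fun k => ?_⟩
  have hi : IntegrableOn (fun s => schemeOp ν a b c h 1 s (v s) + (f s).toGrid h) (Icc 0 T) :=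
    (hc.integrableOn_schemeOp ν h 1 hv.continuousOn).add (integrableOn_toGrid hm hf h0 h1)
  have hi' := hi.mono_set (uIcc_subset_Icc (left_mem_Icc.2 (ht.1.trans ht.2)) ht)
  rw [hv.equation t ht k, Seq.add_apply, H.toGrid_apply (by omega) ψ h0 h1,
    ← coord_apply k (∫ s in (0 : ℝ)..t, _),
    ← (coord k).intervalIntegral_comp_comm hi'.intervalIntegrable]
  congr 2; ext1 s
  rw [coord_apply, Seq.add_apply, schemeOp_one_apply hν hc hh, H.toGrid_apply (by omega) _ h0 h1]

/-! ### Estimates in discrete Sobolev norms -/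

theorem sobSq_mono (ε : ℝ) {i j : ℕ} (hij : i ≤ j) (x : Seq) : sobSq ε i x ≤ sobSq ε j x :=
  Finset.sum_le_sum_of_subset_of_nonneg (Finset.range_mono (by omega)) fun _ _ _ => by positivity

theorem continuous_sobSq (ε : ℝ) (j : ℕ) : Continuous (sobSq ε j) :=
  continuous_finsetSum _ fun i _ => ((delta ε ^ i).continuous.norm).pow 2

/-- The constant: `2 · 3 · 2^i ≤ 96` for `i ≤ 4`, times at most five orders, gives 480; the extra 1
comes from Young's inequality for the forcing. -/
theorem inner_schemeOp_le {K : ℝ} {ν : Measure ℝ} (hν : IsLevyMeasure ν) {a b c : ℝ → ℝ → ℝ}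
    (hc : Coeffs K a b c) {ε : ℝ} (hε : 0 < ε) {n : ℕ} (hn : n = 1 ∨ n = 2) {j : ℕ} (hj : j ≤ 4)
    (t : ℝ) (x g : Seq) :
    2 * ∑ i ∈ Finset.range (j + 1),
        inner ℝ ((delta ε ^ i) (schemeOp ν a b c ε n t x + g)) ((delta ε ^ i) x)
      ≤ (480 * K + 1) * sobSq ε j x + sobSq ε j g := by
  have hK := hc.nonneg
  have h0 := sobSq_nonneg ε j x
  have h1 : ∀ i ∈ Finset.range (j + 1),
      2 * inner ℝ ((delta ε ^ i) (schemeOp ν a b c ε n t x + g)) ((delta ε ^ i) x)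
      ≤ 96 * K * sobSq ε j x + (‖(delta ε ^ i) g‖ ^ 2 + ‖(delta ε ^ i) x‖ ^ 2) := by
    intro i hi
    have hi := Finset.mem_range.1 hi
    have h2 := inner_delta_pow_Aop_le hν hε hn (r := 4) (j := i) (by norm_num) (by omega)
      (hc.diffBound_a hε t) (hc.diffBound_b hε t) (hc.diffBound_c hε t) (fun k => hc.nonneg_a _ _) x
    have h3 := sobSq_mono ε (show i ≤ j by omega) x
    have h4 : (2 : ℝ) ^ i ≤ 16 := by
      calc (2 : ℝ) ^ i ≤ 2 ^ 4 := pow_le_pow_right₀ (by norm_num) (by omega)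
        _ = 16 := by norm_num
    have h5 := real_inner_le_norm ((delta ε ^ i) g) ((delta ε ^ i) x)
    have h6 : 3 * 2 ^ i * (K * sobSq ε i x) ≤ 3 * 16 * (K * sobSq ε j x) := by
      have := sobSq_nonneg ε i x
      gcongr
    rw [map_add, inner_add_left, schemeOp]
    nlinarith [sq_nonneg (‖(delta ε ^ i) g‖ - ‖(delta ε ^ i) x‖)]
  rw [Finset.mul_sum]
  refine (Finset.sum_le_sum h1).trans ?_
  rw [Finset.sum_add_distrib, Finset.sum_add_distrib, ← sobSq, ← sobSq]
  simp only [Finset.sum_const, Finset.card_range, nsmul_eq_mul]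
  have : ((j + 1 : ℕ) : ℝ) ≤ 5 := by exact_mod_cast (by omega : j + 1 ≤ 5)
  have h7 : ((j + 1 : ℕ) : ℝ) * (96 * K * sobSq ε j x) ≤ 5 * (96 * K * sobSq ε j x) := by gcongr
  linarith

/-- Apply the `ℓ²` energy identity to each `(delta ε ^ i) W`, add up and use Gronwall. The majorant
`R` is there because an integrable `G` need not make its squared norm integrable. -/
theorem sobSq_le_of_evolution {K T : ℝ} {ν : Measure ℝ} (hν : IsLevyMeasure ν) {a b c : ℝ → ℝ → ℝ}
    (hc : Coeffs K a b c) {ε : ℝ} (hε : 0 < ε) {n : ℕ} (hn : n = 1 ∨ n = 2) {j : ℕ} (hj : j ≤ 4)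
    {W G : ℝ → Seq} {x : Seq} (hW : ContinuousOn W (Icc 0 T)) (hG : IntegrableOn G (Icc 0 T))
    (he : ∀ t ∈ Icc 0 T, W t = x + ∫ s in (0 : ℝ)..t, (schemeOp ν a b c ε n s (W s) + G s))
    {R : ℝ → ℝ} (hR : IntegrableOn R (Icc 0 T)) (hGR : ∀ s, sobSq ε j (G s) ≤ R s) :
    ∀ t ∈ Icc 0 T, sobSq ε j (W t)
      ≤ (sobSq ε j x + ∫ s in (0 : ℝ)..T, R s) * Real.exp ((480 * K + 1) * t) := by
  have hK := hc.nonneg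
  have hi : IntegrableOn (fun s => schemeOp ν a b c ε n s (W s) + G s) (Icc 0 T) :=
    (hc.integrableOn_schemeOp ν ε n hW).add hG
  refine gronwall_integral (by positivity) ((continuous_sobSq ε j).comp_continuousOn hW) ?_
  intro t ht
  have hsub : uIcc 0 t ⊆ Icc 0 T := uIcc_subset_Icc (left_mem_Icc.2 (ht.1.trans ht.2)) ht
  have key : ∀ i, IntervalIntegrable (fun s => inner ℝ
      ((delta ε ^ i) (schemeOp ν a b c ε n s (W s) + G s)) ((delta ε ^ i) (W s))) volume 0 t ∧
      ‖(delta ε ^ i) (W t)‖ ^ 2 = ‖(delta ε ^ i) x‖ ^ 2 + 2 * ∫ s in (0 : ℝ)..t, inner ℝ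
        ((delta ε ^ i) (schemeOp ν a b c ε n s (W s) + G s)) ((delta ε ^ i) (W s)) := by
    intro i
    refine norm_sq_eq_of_integral ((delta ε ^ i).continuous.comp_continuousOn hW)
      ((delta ε ^ i).integrable_comp hi) (fun s hs => ?_) ht
    have hsub : uIcc 0 s ⊆ Icc 0 T := uIcc_subset_Icc (left_mem_Icc.2 (hs.1.trans hs.2)) hs
    rw [Function.comp_apply, he s hs, map_add,
      ← (delta ε ^ i).intervalIntegral_comp_comm (hi.mono_set hsub).intervalIntegrable]
  have hc1 : IntervalIntegrable (fun s => sobSq ε j (W s)) volume 0 t :=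
    (((continuous_sobSq ε j).comp_continuousOn hW).mono hsub).intervalIntegrable
  have hR1 : IntervalIntegrable R volume 0 t := (hR.mono_set hsub).intervalIntegrable
  have hle : ∫ s in (0 : ℝ)..t, R s ≤ ∫ s in (0 : ℝ)..T, R s := by
    refine intervalIntegral.integral_mono_interval le_rfl ht.1 ht.2
      (ae_of_all _ fun s => (sobSq_nonneg ε j _).trans (hGR s)) ?_
    exact (hR.mono_set (by rw [uIcc_of_le (ht.1.trans ht.2)])).intervalIntegrable
  calc sobSq ε j (W t)
      = ∑ i ∈ Finset.range (j + 1), ‖(delta ε ^ i) x‖ ^ 2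
        + ∫ s in (0 : ℝ)..t, 2 * ∑ i ∈ Finset.range (j + 1), inner ℝ
          ((delta ε ^ i) (schemeOp ν a b c ε n s (W s) + G s)) ((delta ε ^ i) (W s)) := by
        rw [intervalIntegral.integral_const_mul,
          intervalIntegral.integral_finsetSum fun i _ => (key i).1, Finset.mul_sum,
          ← Finset.sum_add_distrib]
        exact Finset.sum_congr rfl fun i _ => (key i).2
    _ ≤ sobSq ε j x + ∫ s in (0 : ℝ)..t, ((480 * K + 1) * sobSq ε j (W s) + R s) := by
        refine add_le_add le_rfl (intervalIntegral.integral_mono_on ht.1 ?_ ?_ fun s _ => ?_)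
        · refine IntervalIntegrable.const_mul ?_ 2
          have := IntervalIntegrable.sum (Finset.range (j + 1)) fun i _ => (key i).1
          rwa [Finset.sum_fn] at this
        · exact (hc1.const_mul _).add hR1
        · exact (inner_schemeOp_le hν hc hε hn hj s (W s) (G s)).trans
            (add_le_add le_rfl (hGR s))
    _ ≤ _ := by
        rw [intervalIntegral.integral_add (hc1.const_mul _) hR1,
          intervalIntegral.integral_const_mul]
        linarith

theorem dataSq_nonneg {m : ℕ} {T : ℝ} (hT : 0 ≤ T) (ψ : H m) (f : ℝ → H m) : 0 ≤ dataSq T ψ f :=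
  add_nonneg (sq_nonneg _) (intervalIntegral.integral_nonneg hT fun _ _ => sq_nonneg _)

theorem integrableOn_norm_sq {m : ℕ} {T : ℝ} {f : ℝ → H m}
    (hf : MemLp f 2 (volume.restrict (Icc 0 T))) : IntegrableOn (fun s => ‖f s‖ ^ 2) (Icc 0 T) := by
  have h := hf.integrable_norm_rpow (by norm_num) (by norm_num)
  simp only [ENNReal.toReal_ofNat, Real.rpow_ofNat] at h
  exact h

/-- Stability with a constant free of the mesh: the factor `ε` cancels the `ε⁻¹` in the bounds of
the initial value and the forcing. -/
theorem IsScheme.sobSq_le {m : ℕ} {K T : ℝ} {ν : Measure ℝ} (hν : IsLevyMeasure ν)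
    {a b c : ℝ → ℝ → ℝ} (hc : Coeffs K a b c) (hm : 4 ≤ m) {ψ : H m} {f : ℝ → H m}
    (hf : MemLp f 2 (volume.restrict (Icc 0 T))) {ε : ℝ} (hε : 0 < ε) (hε1 : ε ≤ 1) {n : ℕ}
    (hn : n = 1 ∨ n = 2) {V : ℝ → Seq} (hV : IsScheme T ν a b c ψ f ε n V) :
    ∀ t ∈ Icc 0 T, ε * sobSq ε 4 (V t) ≤ 20 * dataSq T ψ f * Real.exp ((480 * K + 1) * T) := by
  intro t ht
  have hK := hc.nonneg
  have hT : 0 ≤ T := ht.1.trans ht.2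
  have h1 := sobSq_le_of_evolution hν hc hε hn le_rfl hV.continuousOn
    (integrableOn_toGrid hm hf hε hε1) hV.equation
    (R := fun s => ε⁻¹ * (20 * ‖f s‖ ^ 2)) (((integrableOn_norm_sq hf).const_mul _).const_mul _)
    (fun s => by
      rw [← div_eq_inv_mul, le_div_iff₀ hε, mul_comm]; exact (f s).sobSq_toGrid_le hm hε hε1) t ht
  have h2 := ψ.sobSq_toGrid_le hm hε hε1
  have h3 : Real.exp ((480 * K + 1) * t) ≤ Real.exp ((480 * K + 1) * T) :=
    Real.exp_le_exp.2 (mul_le_mul_of_nonneg_left ht.2 (by positivity))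
  rw [intervalIntegral.integral_const_mul, intervalIntegral.integral_const_mul] at h1
  have h4 := mul_le_mul_of_nonneg_left h1 hε.le
  have hI : 0 ≤ ∫ s in (0 : ℝ)..T, ‖f s‖ ^ 2 :=
    intervalIntegral.integral_nonneg hT fun _ _ => sq_nonneg _
  refine h4.trans ?_
  rw [← mul_assoc, mul_add, ← mul_assoc ε, mul_inv_cancel₀ hε.ne', one_mul, dataSq]
  refine mul_le_mul (by linarith) h3 (Real.exp_pos _).le (by positivity)

/-! ### Comparison of the schemes with strides one and two -/

theorem delta_mulOp {ε K : ℝ} {g : ℤ → ℝ} (hg : DiffBound ε K 1 g) (y : Seq) :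
    delta ε (mulOp g y) = mulOp (fd ε g) (avg y) + mulOp (av g) (delta ε y) := by
  have h := delta_pow_mulOp (j := 1) hg le_rfl y
  have e : Finset.HasAntidiagonal.antidiagonal 1 = {((0 : ℕ), (1 : ℕ)), (1, 0)} := by decide
  rw [e, Finset.sum_pair (by simp)] at h
  simpa [add_comm] using h

theorem norm_delta_mulOp_le {ε K : ℝ} {g : ℤ → ℝ} (hg : DiffBound ε K 1 g) (y : Seq) :
    ‖delta ε (mulOp g y)‖ ≤ K * ‖y‖ + K * ‖delta ε y‖ := by
  have hK : 0 ≤ K := (abs_nonneg _).trans (hg.bound 0)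
  rw [delta_mulOp hg]
  refine (norm_add_le _ _).trans (add_le_add ?_ (norm_mulOp_le hg.av.bound _))
  exact (norm_mulOp_le (fun k => hg 1 le_rfl k) _).trans
    (mul_le_mul_of_nonneg_left (norm_avg_le y) hK)

/-- Consistency of the schemes with strides one and two. -/
theorem sobSq_schemeOp_sub_le {K : ℝ} {ν : Measure ℝ} (hν : IsLevyMeasure ν) {a b c : ℝ → ℝ → ℝ}
    (hc : Coeffs K a b c) {ε : ℝ} (hε : 0 < ε) (t : ℝ) (x : Seq) :
    sobSq ε 1 (schemeOp ν a b c ε 2 t x - schemeOp ν a b c ε 1 t x)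
      ≤ 2 * (4 * K + 3 * mu2 ν + mu0 ν) ^ 2 * ε ^ 2 * sobSq ε 4 x := by
  have hK := hc.nonneg
  have hm2 : 0 ≤ mu2 ν := integral_nonneg fun _ => sq_nonneg _
  have hm0 : 0 ≤ mu0 ν := measureReal_nonneg
  set y2 := cdiff (2 * ε) 2 (cdiff (2 * ε) 2 x) - cdiff ε 1 (cdiff ε 1 x)
  set y1 := cdiff (2 * ε) 2 x - cdiff ε 1 x
  set z1 := J1op ν (2 * ε) 2 x - J1op ν ε 1 x
  set z2 := J2op ν (2 * ε) 2 x - J2op ν ε 1 x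
  have e : schemeOp ν a b c ε 2 t x - schemeOp ν a b c ε 1 t x
      = mulOp (fun k => a t (k * ε)) y2 + mulOp (fun k => b t (k * ε)) y1 + (z1 + z2) := by
    simp only [schemeOp, Aop_apply, y2, y1, z1, z2, map_sub, Nat.cast_ofNat, Nat.cast_one, one_mul]
    abel
  set S := √(sobSq ε 4 x)
  have hS : S ^ 2 = sobSq ε 4 x := Real.sq_sqrt (sobSq_nonneg _ _ _)
  have hS0 : 0 ≤ S := Real.sqrt_nonneg _
  have hi : ∀ i ≤ 4, ‖(delta ε ^ i) x‖ ≤ S := fun i hi => by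
    apply le_of_sq_le_sq _ hS0
    rw [hS]; exact sq_le_sobSq ε hi x
  have hs : ∀ i, (delta ε ^ i) (delta ε x) = (delta ε ^ (i + 1)) x := fun i => rfl
  have b1 : ‖y2‖ ≤ ε * S := (norm_cdiff_sub_le hε x).1.trans
    (mul_le_mul_of_nonneg_left (hi 3 (by norm_num)) hε.le)
  have b2 : ‖y1‖ ≤ ε * S := (norm_cdiff_sub_le hε x).2.trans
    (mul_le_mul_of_nonneg_left (hi 2 (by norm_num)) hε.le)
  have b3 : ‖z1‖ ≤ mu2 ν * (3 * (ε * S)) := (norm_J1op_sub_le hν hε x).trans (by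
    have := hi 3 (by norm_num); gcongr)
  have b4 : ‖z2‖ ≤ mu0 ν * (ε * S) := (norm_J2op_sub_le hν hε x).trans (by
    have : ‖delta ε x‖ ≤ S := by simpa using hi 1 (by norm_num)
    gcongr)
  -- The same four estimates one order higher: `delta` commutes with all translation invariant
  -- operators, so they apply to `delta ε x`. This is the step that consumes the fourth difference.
  have d1 : ‖delta ε y2‖ ≤ ε * S := by
    have : delta ε y2 = cdiff (2 * ε) 2 (cdiff (2 * ε) 2 (delta ε x))
        - cdiff ε 1 (cdiff ε 1 (delta ε x)) := by
      simp only [y2, map_sub, Commute.apply (commute_delta_cdiff ε _ _)]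
    rw [this]
    refine (norm_cdiff_sub_le hε (delta ε x)).1.trans (mul_le_mul_of_nonneg_left ?_ hε.le)
    rw [hs]; exact hi 4 le_rfl
  have d2 : ‖delta ε y1‖ ≤ ε * S := by
    have : delta ε y1 = cdiff (2 * ε) 2 (delta ε x) - cdiff ε 1 (delta ε x) := by
      simp only [y1, map_sub, Commute.apply (commute_delta_cdiff ε _ _)]
    rw [this]
    refine (norm_cdiff_sub_le hε (delta ε x)).2.trans (mul_le_mul_of_nonneg_left ?_ hε.le)
    rw [hs]; exact hi 3 (by norm_num)
  have d3 : ‖delta ε z1‖ ≤ mu2 ν * (3 * (ε * S)) := by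
    have : delta ε z1 = J1op ν (2 * ε) 2 (delta ε x) - J1op ν ε 1 (delta ε x) := by
      simp only [z1, map_sub, Commute.apply (commute_delta_J1op hν ε _ _)]
    rw [this]
    refine (norm_J1op_sub_le hν hε (delta ε x)).trans ?_
    have := hi 4 le_rfl
    rw [hs]; gcongr
  have d4 : ‖delta ε z2‖ ≤ mu0 ν * (ε * S) := by
    have : delta ε z2 = J2op ν (2 * ε) 2 (delta ε x) - J2op ν ε 1 (delta ε x) := by
      simp only [z2, map_sub, Commute.apply (commute_delta_J2op hν ε _ _)]
    rw [this]
    refine (norm_J2op_sub_le hν hε (delta ε x)).trans ?_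
    have : ‖delta ε (delta ε x)‖ ≤ S := hi 2 (by norm_num)
    gcongr
  have hda := (hc.diffBound_a hε t).mono (show 1 ≤ 4 by norm_num)
  have hdb := (hc.diffBound_b hε t).mono (show 1 ≤ 4 by norm_num)
  have c0 : ‖schemeOp ν a b c ε 2 t x - schemeOp ν a b c ε 1 t x‖
      ≤ (4 * K + 3 * mu2 ν + mu0 ν) * (ε * S) := by
    rw [e]
    refine (norm_add₃_le).trans ?_
    have h1 := norm_mulOp_le hda.bound y2
    have h2 := norm_mulOp_le hdb.bound y1
    have h3 := norm_add_le z1 z2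
    have h4 := mul_le_mul_of_nonneg_left b1 hK
    have h5 := mul_le_mul_of_nonneg_left b2 hK
    have h6 : 0 ≤ K * (ε * S) := by positivity
    linarith
  have c1 : ‖delta ε (schemeOp ν a b c ε 2 t x - schemeOp ν a b c ε 1 t x)‖
      ≤ (4 * K + 3 * mu2 ν + mu0 ν) * (ε * S) := by
    rw [e, map_add, map_add, map_add]
    refine (norm_add₃_le).trans ?_
    have h1 := norm_delta_mulOp_le hda y2
    have h2 := norm_delta_mulOp_le hdb y1
    have h3 := norm_add_le (delta ε z1) (delta ε z2)
    have h4 := mul_le_mul_of_nonneg_left b1 hK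
    have h5 := mul_le_mul_of_nonneg_left b2 hK
    have h6 := mul_le_mul_of_nonneg_left d1 hK
    have h7 := mul_le_mul_of_nonneg_left d2 hK
    linarith
  have e2 : ((4 * K + 3 * mu2 ν + mu0 ν) * (ε * S)) ^ 2
      = (4 * K + 3 * mu2 ν + mu0 ν) ^ 2 * ε ^ 2 * sobSq ε 4 x := by rw [← hS]; ring
  have c0' := pow_le_pow_left₀ (norm_nonneg _) c0 2
  have c1' := pow_le_pow_left₀ (norm_nonneg _) c1 2
  rw [e2] at c0' c1'
  rw [sobSq, Finset.sum_range_succ, Finset.sum_range_one]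
  simp only [pow_zero, pow_one, one_apply_eq_self]
  linarith

/-- The constant in the comparison of consecutive schemes. -/
def compConst (K μ0 μ2 T : ℝ) : ℝ :=
  40 * (4 * K + 3 * μ2 + μ0) ^ 2 * T * Real.exp ((480 * K + 1) * T) ^ 2

/-- The difference starts at zero and follows the stride-two dynamics with the consistency error of
`W` as forcing. Stability at order one and the order-four bound on `W` each contribute an
exponential, and 40 is `2 · 20`. -/
theorem IsScheme.sobSq_sub_le {m : ℕ} {K T : ℝ} {ν : Measure ℝ} (hν : IsLevyMeasure ν)
    {a b c : ℝ → ℝ → ℝ} (hc : Coeffs K a b c) (hm : 4 ≤ m) {ψ : H m} {f : ℝ → H m}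
    (hf : MemLp f 2 (volume.restrict (Icc 0 T))) {ε : ℝ} (hε : 0 < ε) (hε1 : ε ≤ 1)
    {V W : ℝ → Seq} (hV : IsScheme T ν a b c ψ f ε 2 V) (hW : IsScheme T ν a b c ψ f ε 1 W) :
    ∀ t ∈ Icc 0 T, ε * sobSq ε 1 (V t - W t)
      ≤ compConst K (mu0 ν) (mu2 ν) T * ε ^ 2 * dataSq T ψ f := by
  intro t ht
  have hK := hc.nonneg
  have hT : 0 ≤ T := ht.1.trans ht.2
  have hD := dataSq_nonneg hT ψ f
  set E := Real.exp ((480 * K + 1) * T)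
  set C := 2 * (4 * K + 3 * mu2 ν + mu0 ν) ^ 2
  have hC : 0 ≤ C := by positivity
  -- Cutting off outside `[0, T]` makes the bound on the forcing valid for all times, as
  -- `sobSq_le_of_evolution` requires.
  let G : ℝ → Seq := indicator (Icc 0 T) fun s =>
    schemeOp ν a b c ε 2 s (W s) - schemeOp ν a b c ε 1 s (W s)
  have hGi : IntegrableOn G (Icc 0 T) := IntegrableOn.indicator
    ((hc.integrableOn_schemeOp ν ε 2 hW.continuousOn).sub
      (hc.integrableOn_schemeOp ν ε 1 hW.continuousOn)) measurableSet_Icc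
  have hR : ∀ s, sobSq ε 1 (G s) ≤ ε⁻¹ * (C * ε ^ 2 * (20 * dataSq T ψ f * E)) := by
    intro s
    by_cases hs : s ∈ Icc 0 T
    · rw [show G s = _ from indicator_of_mem hs _]
      have h1 := sobSq_schemeOp_sub_le hν hc hε s (W s)
      have h2 := hW.sobSq_le hν hc hm hf hε hε1 (Or.inl rfl) s hs
      rw [← div_eq_inv_mul, le_div_iff₀ hε]
      calc _ ≤ C * ε ^ 2 * sobSq ε 4 (W s) * ε := mul_le_mul_of_nonneg_right h1 hε.le
        _ = C * ε ^ 2 * (ε * sobSq ε 4 (W s)) := by ring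
        _ ≤ _ := mul_le_mul_of_nonneg_left h2 (by positivity)
    · rw [show G s = 0 from indicator_of_notMem hs _]
      have : sobSq ε 1 0 = 0 := by simp [sobSq]
      rw [this]; positivity
  have he : ∀ t ∈ Icc 0 T, V t - W t
      = 0 + ∫ s in (0 : ℝ)..t, (schemeOp ν a b c ε 2 s (V s - W s) + G s) := by
    intro t ht
    have hsub : uIcc 0 t ⊆ Icc 0 T := uIcc_subset_Icc (left_mem_Icc.2 hT) ht
    rw [hV.equation t ht, hW.equation t ht, zero_add, add_sub_add_left_eq_sub,
      ← intervalIntegral.integral_sub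
        ((hV.integrableOn hc hm hf hε hε1).mono_set hsub).intervalIntegrable
        ((hW.integrableOn hc hm hf hε hε1).mono_set hsub).intervalIntegrable]
    refine intervalIntegral.integral_congr fun s hs => ?_
    rw [show G s = _ from indicator_of_mem (hsub hs) _, map_sub]
    abel
  have h1 := sobSq_le_of_evolution hν hc hε (Or.inr rfl) (j := 1) (by norm_num)
    (hV.continuousOn.sub hW.continuousOn) hGi he (integrableOn_const (by simp)) hR t ht
  have h3 : Real.exp ((480 * K + 1) * t) ≤ E :=
    Real.exp_le_exp.2 (mul_le_mul_of_nonneg_left ht.2 (by positivity))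
  have h0 : sobSq ε 1 0 = 0 := by simp [sobSq]
  rw [h0, zero_add, intervalIntegral.integral_const, smul_eq_mul, sub_zero] at h1
  calc ε * sobSq ε 1 (V t - W t)
      ≤ ε * (T * (ε⁻¹ * (C * ε ^ 2 * (20 * dataSq T ψ f * E))) * E) := by
        refine mul_le_mul_of_nonneg_left (h1.trans ?_) hε.le
        exact mul_le_mul_of_nonneg_left h3 (by positivity)
    _ = compConst K (mu0 ν) (mu2 ν) T * ε ^ 2 * dataSq T ψ f := by
        simp only [compConst, C, E]; field_simp; ring

/-! ### Traces of lattice functions -/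

/-- The discrete counterpart of `IsH1.local_bound`: a value at `n k` is compared with the `n`
lattice points of its block, and the blocks partition the lattice. The constants depend on the
spacing `n ε` of the sublattice, not on `n`. -/
theorem Seq.trace_bound (w : Seq) {ε : ℝ} (hε : 0 < ε) {n : ℕ} (hn : 0 < n) :
    (Summable fun k : ℤ => w (n * k) ^ 2) ∧
    n * ε * ∑' k : ℤ, w (n * k) ^ 2
      ≤ 2 * (ε * ‖w‖ ^ 2) + 2 * (n * ε) ^ 2 * (ε * ‖delta ε w‖ ^ 2) := by
  have hn' : (0 : ℝ) < n := by exact_mod_cast hn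
  have hs : Summable fun k : ℤ => w (n * k) ^ 2 := w.summable_sq.comp_injective
    (mul_right_injective₀ (by exact_mod_cast hn.ne'))
  have hsum : ∀ (x : Seq) (s : Finset ℤ),
      ∑ k ∈ s, ∑ l ∈ Finset.range n, x (n * k + l) ^ 2 ≤ ‖x‖ ^ 2 := by
    intro x s
    rw [Seq.norm_sq, ← Finset.sum_product']
    have hinj : Set.InjOn (fun p : ℤ × ℕ => (n : ℤ) * p.1 + p.2) ↑(s ×ˢ Finset.range n) := by
      rintro ⟨k, l⟩ h1 ⟨k', l'⟩ h2 h3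
      simp only [Finset.coe_product, mem_prod, Finset.mem_coe, Finset.mem_range] at h1 h2 h3
      have hk : k = k' := by
        have e1 : ((n : ℤ) * k + l) / n = k := by
          rw [Int.mul_add_ediv_left _ _ (by omega), Int.ediv_eq_zero_of_lt (by omega) (by omega),
            add_zero]
        have e2 : ((n : ℤ) * k' + l') / n = k' := by
          rw [Int.mul_add_ediv_left _ _ (by omega), Int.ediv_eq_zero_of_lt (by omega) (by omega),
            add_zero]
        rw [← e1, h3, e2]
      subst hk
      simp only [add_right_inj, Nat.cast_inj] at h3
      rw [h3]
    rw [← Finset.sum_image (f := fun i => x i ^ 2) (g := fun p : ℤ × ℕ => (n : ℤ) * p.1 + p.2) hinj]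
    exact x.summable_sq.sum_le_tsum _ fun _ _ => sq_nonneg _
  have hpt : ∀ k : ℤ, n * w (n * k) ^ 2 ≤ 2 * ∑ l ∈ Finset.range n, w (n * k + l) ^ 2
      + 2 * (n * ε) ^ 2 * ∑ l ∈ Finset.range n, delta ε w (n * k + l) ^ 2 := by
    intro k
    set D := ∑ l ∈ Finset.range n, delta ε w (n * k + l) ^ 2
    have h1 : ∀ l ∈ Finset.range n, w (n * k) ^ 2 ≤ 2 * w (n * k + l) ^ 2 + 2 * (ε ^ 2 * n * D) := by
      intro l hl
      have hl := Finset.mem_range.1 hl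
      have e : w (n * k + l) - w (n * k) = ε * ∑ i ∈ Finset.range l, delta ε w (n * k + i) := by
        rw [Finset.mul_sum]
        have : ∀ i ∈ Finset.range l, ε * delta ε w (n * k + i)
            = w (n * k + (i + 1 : ℕ)) - w (n * k + i) := by
          intro i _
          rw [delta_apply, mul_inv_cancel_left₀ hε.ne']
          push_cast; rw [add_assoc]
        rw [Finset.sum_congr rfl this, Finset.sum_range_sub (fun i : ℕ => w (n * k + i))]
        simp
      have h2 : (∑ i ∈ Finset.range l, delta ε w (n * k + i)) ^ 2 ≤ n * D := by
        refine (sq_sum_le_card_mul_sum_sq).trans ?_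
        rw [Finset.card_range]
        refine mul_le_mul (by exact_mod_cast hl.le) ?_ (Finset.sum_nonneg fun _ _ => sq_nonneg _)
          hn'.le
        exact Finset.sum_le_sum_of_subset_of_nonneg (Finset.range_mono hl.le)
          fun _ _ _ => sq_nonneg _
      have h3 := mul_le_mul_of_nonneg_left h2 (sq_nonneg ε)
      rw [← mul_pow, ← e] at h3
      nlinarith [sq_nonneg (w (n * k + l) + (w (n * k + l) - w (n * k)))]
    have h4 := Finset.sum_le_sum h1
    simp only [Finset.sum_const, Finset.card_range, nsmul_eq_mul, Finset.sum_add_distrib,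
      ← Finset.mul_sum] at h4
    calc _ ≤ _ := h4
      _ = _ := by ring
  refine ⟨hs, ?_⟩
  have h5 : ∑' k : ℤ, w (n * k) ^ 2 ≤ (n : ℝ)⁻¹ * (2 * ‖w‖ ^ 2 + 2 * (n * ε) ^ 2 * ‖delta ε w‖ ^ 2) := by
    refine hs.tsum_le_of_sum_le fun s => ?_
    rw [← div_eq_inv_mul, le_div_iff₀ hn', mul_comm, Finset.mul_sum]
    refine (Finset.sum_le_sum fun k _ => hpt k).trans ?_
    rw [Finset.sum_add_distrib, ← Finset.mul_sum, ← Finset.mul_sum]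
    exact add_le_add (mul_le_mul_of_nonneg_left (hsum w s) (by norm_num))
      (mul_le_mul_of_nonneg_left (hsum (delta ε w) s) (by positivity))
  calc n * ε * ∑' k : ℤ, w (n * k) ^ 2
      ≤ n * ε * ((n : ℝ)⁻¹ * (2 * ‖w‖ ^ 2 + 2 * (n * ε) ^ 2 * ‖delta ε w‖ ^ 2)) :=
        mul_le_mul_of_nonneg_left h5 (by positivity)
    _ = _ := by field_simp

theorem sobSq_one_eq (ε : ℝ) (w : Seq) : sobSq ε 1 w = ‖w‖ ^ 2 + ‖delta ε w‖ ^ 2 := by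
  rw [sobSq, Finset.sum_range_succ, Finset.sum_range_one]
  simp

theorem Seq.trace_le_sobSq (w : Seq) {ε : ℝ} (hε : 0 < ε) {n : ℕ} (hn : 0 < n) (h1 : n * ε ≤ 1) :
    n * ε * ∑' k : ℤ, w (n * k) ^ 2 ≤ 2 * (ε * sobSq ε 1 w) := by
  refine (w.trace_bound hε hn).2.trans ?_
  rw [sobSq_one_eq]
  have : (n * ε) ^ 2 * (ε * ‖delta ε w‖ ^ 2) ≤ 1 * (ε * ‖delta ε w‖ ^ 2) :=
    mul_le_mul_of_nonneg_right (pow_le_one₀ (by positivity) h1) (by positivity)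
  linarith

/-- Discrete Sobolev embedding: translate the point to the origin and take the trace on the
sublattice of spacing exactly 1, which exists because `1/ε` is an integer. -/
theorem Seq.sq_apply_le_sobSq (w : Seq) {ε : ℝ} (hε : ε ∈ meshSizes) (i : ℤ) :
    w i ^ 2 ≤ 2 * (ε * sobSq ε 1 w) := by
  have hε0 := (pos_of_mem_meshSizes hε).1
  obtain ⟨n, hn, rfl⟩ := hε
  have hn' : (0 : ℝ) < n := by exact_mod_cast hn
  have e : (n : ℝ) * (1 / n) = 1 := mul_one_div_cancel hn'.ne'
  have h1 := (shift i w).trace_le_sobSq hε0 hn e.le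
  rw [e, one_mul, sobSq_one_eq, Commute.apply (commute_delta_shift _ i), norm_shift, norm_shift,
    ← sobSq_one_eq] at h1
  have h2 := ((shift i w).trace_bound hε0 hn).1.le_tsum 0 fun _ _ => sq_nonneg _
  simp only [mul_zero, shift_apply, zero_add] at h2 h1
  exact h2.trans h1

end
end LevyFD

namespace LevyFD
noncomputable section
open Filter Topology

/-! ### Riemann sums and step functions -/

/-- Lattice sums become integrals of step functions on the line, which makes Fatou and dominated
convergence available for varying meshes. -/
theorem map_floor_div {ε : ℝ} (hε : 0 < ε) :
    (volume.map fun x : ℝ => ⌊x / ε⌋) = ENNReal.ofReal ε • Measure.count := by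
  refine Measure.ext_of_singleton fun k => ?_
  have hm : Measurable fun x : ℝ => ⌊x / ε⌋ := Int.measurable_floor.comp (measurable_id.div_const ε)
  have e : (fun x : ℝ => ⌊x / ε⌋) ⁻¹' {k} = Ico (k * ε) (k * ε + ε) := by
    ext x
    rw [mem_preimage, mem_singleton_iff, Int.floor_eq_iff, mem_Ico, le_div_iff₀ hε, div_lt_iff₀ hε,
      add_mul, one_mul]
  rw [Measure.map_apply hm (measurableSet_singleton k), e, Real.volume_Ico, add_sub_cancel_left]
  simp

theorem measurable_floor_div (ε : ℝ) : Measurable fun x : ℝ => ⌊x / ε⌋ :=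
  Int.measurable_floor.comp (measurable_id.div_const ε)

theorem lintegral_floor_div {ε : ℝ} (hε : 0 < ε) (F : ℤ → ℝ≥0∞) :
    ∫⁻ x : ℝ, F ⌊x / ε⌋ = ENNReal.ofReal ε * ∑' k, F k := by
  have h := lintegral_map (μ := (volume : Measure ℝ)) (f := F) (.of_discrete) (measurable_floor_div ε)
  rw [← h, map_floor_div hε, lintegral_smul_measure, lintegral_count, smul_eq_mul]

theorem integral_floor_div {ε : ℝ} (hε : 0 < ε) {F : ℤ → ℝ} (hF : Summable F) :
    ∫ x : ℝ, F ⌊x / ε⌋ = ε * ∑' k, F k := by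
  have hi : Integrable F Measure.count := integrable_count_iff.2 hF.norm
  have h := integral_map (μ := (volume : Measure ℝ)) (measurable_floor_div ε).aemeasurable (f := F)
    (Measurable.of_discrete.aestronglyMeasurable)
  rw [← h, map_floor_div hε, integral_smul_measure, integral_countable hi,
    ENNReal.toReal_ofReal hε.le, smul_eq_mul]
  simp [measureReal_def]

/-- Points of a step function approximation. -/
theorem abs_floor_div_mul_sub_le {ε : ℝ} (hε : 0 < ε) (x : ℝ) : |(⌊x / ε⌋ : ℝ) * ε - x| ≤ ε := by
  have h1 := Int.floor_le (x / ε)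
  have h2 := Int.lt_floor_add_one (x / ε)
  rw [le_div_iff₀ hε] at h1
  rw [div_lt_iff₀ hε] at h2
  rw [abs_le]; constructor <;> linarith

theorem tendsto_floor_div_mul {ε : ℕ → ℝ} (hε : ∀ j, 0 < ε j) (hε0 : Tendsto ε atTop (𝓝 0)) (x : ℝ) :
    Tendsto (fun j => (⌊x / ε j⌋ : ℝ) * ε j) atTop (𝓝 x) := by
  rw [tendsto_iff_norm_sub_tendsto_zero]
  exact squeeze_zero (fun _ => norm_nonneg _) (fun j => abs_floor_div_mul_sub_le (hε j) x) hε0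

/-- Convergence of Riemann sums. -/
theorem tendsto_mul_inner {ε : ℕ → ℝ} (hε : ∀ j, 0 < ε j) (hε1 : ∀ j, ε j ≤ 1)
    {w g : ℕ → Seq} {W G : ℝ → ℝ} {B C R : ℝ} (hw : ∀ j k, |w j k| ≤ B) (hg : ∀ j k, |g j k| ≤ C)
    (hs : ∀ j (k : ℤ), R < |k * ε j| → g j k = 0)
    (hW : ∀ x, Tendsto (fun j => w j ⌊x / ε j⌋) atTop (𝓝 (W x)))
    (hG : ∀ x, Tendsto (fun j => g j ⌊x / ε j⌋) atTop (𝓝 (G x))) :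
    Tendsto (fun j => ε j * inner ℝ (w j) (g j)) atTop (𝓝 (∫ x, W x * G x)) := by
  have hB : 0 ≤ B := (abs_nonneg _).trans (hw 0 0)
  have hC : 0 ≤ C := (abs_nonneg _).trans (hg 0 0)
  have e : ∀ j, ε j * inner ℝ (w j) (g j) = ∫ x : ℝ, w j ⌊x / ε j⌋ * g j ⌊x / ε j⌋ := by
    intro j
    rw [integral_floor_div (hε j) ((w j).summable_mul (g j)), Seq.inner_eq]
  simp only [e]
  -- The dominating interval has radius `R + 1`, since the lattice point attached to `x` may lie up
  -- to `ε ≤ 1` away from it.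
  refine tendsto_integral_of_dominated_convergence
    (indicator (Icc (-(R + 1)) (R + 1)) fun _ => B * C) (fun j => ?_) ?_ (fun j => ?_) ?_
  · exact (Measurable.comp (g := fun k : ℤ => w j k * g j k) .of_discrete
      (measurable_floor_div (ε j))).aestronglyMeasurable
  · exact (integrable_indicator_iff measurableSet_Icc).2 (integrableOn_const (by simp))
  · refine ae_of_all _ fun x => ?_
    by_cases hx : x ∈ Icc (-(R + 1)) (R + 1)
    · rw [indicator_of_mem hx, norm_mul]
      exact mul_le_mul (hw _ _) (hg _ _) (norm_nonneg _) hB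
    · rw [indicator_of_notMem hx, hs, mul_zero, norm_zero]
      have h1 := abs_floor_div_mul_sub_le (hε j) x
      have h2 : R + 1 < |x| := by
        by_contra h
        exact hx (abs_le.1 (not_lt.1 h))
      have h3 := abs_sub_abs_le_abs_sub x (⌊x / ε j⌋ * ε j)
      rw [abs_sub_comm] at h3
      linarith [hε1 j]
  · exact ae_of_all _ fun x => (hW x).mul (hG x)

theorem mul_norm_sq_le_of_support {ε : ℝ} (hε : 0 < ε) (hε1 : ε ≤ 1) {g : Seq} {C R : ℝ}
    (hR : 0 ≤ R) (hg : ∀ k, |g k| ≤ C) (hs : ∀ k : ℤ, R < |k * ε| → g k = 0) :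
    ε * ‖g‖ ^ 2 ≤ C ^ 2 * (2 * (R + 1)) := by
  rw [Seq.norm_sq, ← integral_floor_div hε g.summable_sq]
  have h : ∫ x, indicator (Icc (-(R + 1)) (R + 1)) (fun _ => C ^ 2) x = C ^ 2 * (2 * (R + 1)) := by
    rw [integral_indicator measurableSet_Icc, setIntegral_const, measureReal_def, Real.volume_Icc,
      ENNReal.toReal_ofReal (by linarith), smul_eq_mul]
    ring
  rw [← h]
  refine integral_mono_of_nonneg (ae_of_all _ fun x => sq_nonneg _)
    ((integrable_indicator_iff measurableSet_Icc).2 (integrableOn_const (by simp)))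
    (ae_of_all _ fun x => ?_)
  by_cases hx : x ∈ Icc (-(R + 1)) (R + 1)
  · rw [indicator_of_mem hx]
    exact sq_le_sq' (neg_le_of_abs_le (hg _)) (le_of_abs_le (hg _))
  · rw [indicator_of_notMem hx]
    have h0 : g ⌊x / ε⌋ = 0 := by
      apply hs
      have h1 := abs_floor_div_mul_sub_le hε x
      have h2 : R + 1 < |x| := by
        by_contra h
        exact hx (abs_le.1 (not_lt.1 h))
      have h3 := abs_sub_abs_le_abs_sub x (⌊x / ε⌋ * ε)
      rw [abs_sub_comm] at h3
      linarith
    change g ⌊x / ε⌋ ^ 2 ≤ 0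
    rw [h0]; norm_num

/-! ### Mean values of difference quotients -/

theorem exists_deriv_eq_diff {g : ℝ → ℝ} (hg : Differentiable ℝ g) {l : ℝ} (hl : 0 < l) (y : ℝ) :
    ∃ η, |η - y| ≤ l ∧ (2 * l)⁻¹ * (g (y + l) - g (y - l)) = deriv g η := by
  obtain ⟨η, h1, h2⟩ := exists_deriv_eq_slope g (show y - l < y + l by linarith)
    hg.continuous.continuousOn hg.differentiableOn
  refine ⟨η, abs_le.2 ⟨by linarith [h1.1], by linarith [h1.2]⟩, ?_⟩
  rw [h2]
  ring_nf

/-- The mean value theorem for the increment `x ↦ g (x + l) - g x`, then for `g'`. -/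
theorem exists_deriv_eq_second_diff {g : ℝ → ℝ} (hg : Differentiable ℝ g)
    (hg' : Differentiable ℝ (deriv g)) {l : ℝ} (hl : 0 < l) (y : ℝ) :
    ∃ η, |η - y| ≤ l ∧ (l ^ 2)⁻¹ * (g (y + l) - 2 * g y + g (y - l)) = deriv (deriv g) η := by
  have hF : ∀ x, HasDerivAt (fun x => g (x + l) - g x) (deriv g (x + l) - deriv g x) x := fun x =>
    ((hg (x + l)).hasDerivAt.comp_add_const x l).sub (hg x).hasDerivAt
  have hFd : Differentiable ℝ fun x => g (x + l) - g x := fun x => (hF x).differentiableAt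
  obtain ⟨ξ, h1, h2⟩ := exists_deriv_eq_slope (fun x => g (x + l) - g x) (show y - l < y by linarith)
    hFd.continuous.continuousOn hFd.differentiableOn
  obtain ⟨η, h3, h4⟩ := exists_deriv_eq_slope (deriv g) (show ξ < ξ + l by linarith)
    hg'.continuous.continuousOn hg'.differentiableOn
  refine ⟨η, abs_le.2 ⟨by linarith [h1.1, h3.1], by linarith [h1.2, h3.2]⟩, ?_⟩
  rw [h4]
  rw [(hF ξ).deriv] at h2
  rw [h2]
  have : y - l + l = y := by ring
  rw [this, sub_sub_cancel, add_sub_cancel_left, div_div, ← sq, div_eq_inv_mul]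
  ring

theorem tendsto_diff_grid {g : ℝ → ℝ} (hg : ContDiff ℝ 1 g) {ε : ℕ → ℝ} (hε : ∀ j, 0 < ε j)
    (hε0 : Tendsto ε atTop (𝓝 0)) (x : ℝ) :
    Tendsto (fun j => (2 * ε j)⁻¹ * (g (⌊x / ε j⌋ * ε j + ε j) - g (⌊x / ε j⌋ * ε j - ε j)))
      atTop (𝓝 (deriv g x)) := by
  choose η h1 h2 using fun j => exists_deriv_eq_diff (hg.differentiable one_ne_zero) (hε j)
    (⌊x / ε j⌋ * ε j)
  simp only [h2]
  have h3 : Tendsto η atTop (𝓝 x) := by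
    have h4 : Tendsto (fun j => η j - ⌊x / ε j⌋ * ε j) atTop (𝓝 0) :=
      squeeze_zero_norm (fun j => h1 j) hε0
    have := h4.add (tendsto_floor_div_mul hε hε0 x)
    simpa using this
  exact ((hg.continuous_deriv le_rfl).tendsto x).comp h3

theorem tendsto_second_diff_grid {g : ℝ → ℝ} (hg : ContDiff ℝ 2 g) {ε l : ℕ → ℝ} (hε : ∀ j, 0 < ε j)
    (hε0 : Tendsto ε atTop (𝓝 0)) (hl : ∀ j, 0 < l j) (hl0 : Tendsto l atTop (𝓝 0)) (x : ℝ) :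
    Tendsto (fun j => (l j ^ 2)⁻¹ * (g (⌊x / ε j⌋ * ε j + l j) - 2 * g (⌊x / ε j⌋ * ε j)
      + g (⌊x / ε j⌋ * ε j - l j))) atTop (𝓝 (deriv (deriv g) x)) := by
  have hg1 : ContDiff ℝ 1 (deriv g) := by
    have := (contDiff_succ_iff_deriv (n := (1 : WithTop ℕ∞)) (f := g)).1
      (by rw [one_add_one_eq_two]; exact hg)
    exact this.2.2
  choose η h1 h2 using fun j => exists_deriv_eq_second_diff (hg.differentiable two_ne_zero)
    (hg1.differentiable one_ne_zero) (hl j) (⌊x / ε j⌋ * ε j)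
  simp only [h2]
  have h3 : Tendsto η atTop (𝓝 x) := by
    have h4 : Tendsto (fun j => η j - ⌊x / ε j⌋ * ε j) atTop (𝓝 0) :=
      squeeze_zero_norm (fun j => h1 j) hl0
    have := h4.add (tendsto_floor_div_mul hε hε0 x)
    simpa using this
  exact ((hg1.continuous_deriv le_rfl).tendsto x).comp h3

end
end LevyFD

namespace LevyFD
noncomputable section
open Filter Topology

/-! ### Limits of lattice functions along dyadic refinements -/

/-- Fatou's lemma. The maximum with 0 covers negative `A`, for which `ENNReal.ofReal A` is zero. -/
theorem memLp_two_of_tendsto {F : ℕ → ℝ → ℝ} {g : ℝ → ℝ} {A : ℝ}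
    (hF : ∀ j, Measurable (F j)) (hg : ∀ᵐ x, Tendsto (fun j => F j x) atTop (𝓝 (g x)))
    (hA : ∀ j, ∫⁻ x, ENNReal.ofReal (F j x ^ 2) ≤ ENNReal.ofReal A) :
    MemLp g 2 volume ∧ ∫ x, g x ^ 2 ≤ max A 0 := by
  have hgm : AEStronglyMeasurable g volume :=
    aestronglyMeasurable_of_tendsto_ae atTop (fun j => (hF j).aestronglyMeasurable) hg
  have h1 : ∫⁻ x, ENNReal.ofReal (g x ^ 2) ≤ ENNReal.ofReal A := by
    calc ∫⁻ x, ENNReal.ofReal (g x ^ 2)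
        = ∫⁻ x, liminf (fun j => ENNReal.ofReal (F j x ^ 2)) atTop := by
          refine lintegral_congr_ae (hg.mono fun x hx => ?_)
          exact ((ENNReal.continuous_ofReal.tendsto _).comp (hx.pow 2)).liminf_eq.symm
      _ ≤ liminf (fun j => ∫⁻ x, ENNReal.ofReal (F j x ^ 2)) atTop :=
          lintegral_liminf_le fun j => ((hF j).pow_const 2).ennreal_ofReal
      _ ≤ ENNReal.ofReal A := liminf_le_of_le (by isBoundedDefault) fun b hb => by
          obtain ⟨j, hj⟩ := hb.exists
          exact hj.trans (hA j)
  have h2 : Integrable fun x => g x ^ 2 := by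
    refine ⟨hgm.pow 2, ?_⟩
    rw [hasFiniteIntegral_iff_ofReal (ae_of_all _ fun x => sq_nonneg _)]
    exact h1.trans_lt ENNReal.ofReal_lt_top
  refine ⟨(memLp_two_iff_integrable_sq hgm).2 h2, ?_⟩
  rw [← ofReal_integral_eq_lintegral_ofReal h2 (ae_of_all _ fun x => sq_nonneg _)] at h1
  rcases ENNReal.ofReal_le_ofReal_iff'.1 h1 with h | h
  · exact h.trans (le_max_left _ _)
  · exact h.trans (le_max_right _ _)

/-- A sequence of lattice functions on the dyadic refinements of `hℤ`, bounded in a discrete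
Sobolev norm and with summable increments. -/
structure IsDyadicCauchy (h A C : ℝ) (x : ℕ → Seq) : Prop where
  bound : ∀ j, h / 2 ^ j * sobSq (h / 2 ^ j) 4 (x j) ≤ A
  step : ∀ j, ∃ D : Seq, restrictEven D = x j - restrictEven (x (j + 1)) ∧
    h / 2 ^ (j + 1) * sobSq (h / 2 ^ (j + 1)) 1 D ≤ C * (h / 2 ^ (j + 1)) ^ 2

theorem div_two_pow_mem_meshSizes {h : ℝ} (hh : h ∈ meshSizes) (j : ℕ) : h / 2 ^ j ∈ meshSizes := by
  obtain ⟨n, hn, rfl⟩ := hh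
  exact ⟨n * 2 ^ j, by positivity, by push_cast; field_simp⟩

theorem tendsto_div_two_pow (h : ℝ) : Tendsto (fun j : ℕ => h / 2 ^ j) atTop (𝓝 0) := by
  have := (tendsto_pow_atTop_nhds_zero_of_lt_one (r := (1 / 2 : ℝ)) (by norm_num)
    (by norm_num)).const_mul h
  rw [mul_zero] at this
  refine this.congr fun j => ?_
  rw [one_div, inv_pow, div_eq_mul_inv]

namespace IsDyadicCauchy

variable {h A C : ℝ} {x : ℕ → Seq}

theorem nonneg (hx : IsDyadicCauchy h A C x) (hh : h ∈ meshSizes) : 0 ≤ A ∧ 0 ≤ C := by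
  have h0 := (pos_of_mem_meshSizes hh).1
  refine ⟨(mul_nonneg (by positivity) (sobSq_nonneg _ _ _)).trans (hx.bound 0), ?_⟩
  obtain ⟨D, -, hD⟩ := hx.step 0
  have := (mul_nonneg (by positivity) (sobSq_nonneg _ _ _)).trans hD
  exact nonneg_of_mul_nonneg_left this (by positivity)

theorem abs_le (hx : IsDyadicCauchy h A C x) (hh : h ∈ meshSizes) (j : ℕ) (k : ℤ) :
    |x j k| ≤ √(2 * A) := by
  apply abs_le_of_sq_le_sq _ (Real.sqrt_nonneg _)
  have hj := div_two_pow_mem_meshSizes hh j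
  have h1 := (x j).sq_apply_le_sobSq hj k
  have h2 := sobSq_mono (h / 2 ^ j) (show 1 ≤ 4 by norm_num) (x j)
  have h3 := mul_le_mul_of_nonneg_left h2 (pos_of_mem_meshSizes hj).1.le
  rw [Real.sq_sqrt (by linarith [(hx.nonneg hh).1])]
  linarith [hx.bound j]

theorem abs_delta_le (hx : IsDyadicCauchy h A C x) (hh : h ∈ meshSizes) (j : ℕ) (k : ℤ) :
    |delta (h / 2 ^ j) (x j) k| ≤ √(2 * A) := by
  apply abs_le_of_sq_le_sq _ (Real.sqrt_nonneg _)
  have hj := div_two_pow_mem_meshSizes hh j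
  have h1 := (delta (h / 2 ^ j) (x j)).sq_apply_le_sobSq hj k
  have h2 : sobSq (h / 2 ^ j) 1 (delta (h / 2 ^ j) (x j)) ≤ sobSq (h / 2 ^ j) 4 (x j) := by
    rw [sobSq_one_eq]
    have h4 : sobSq (h / 2 ^ j) 4 (x j)
        = ∑ i ∈ Finset.range 5, ‖(delta (h / 2 ^ j) ^ i) (x j)‖ ^ 2 := rfl
    rw [h4]
    simp only [Finset.sum_range_succ, Finset.sum_range_zero]
    have e1 : (delta (h / 2 ^ j) ^ 1) (x j) = delta (h / 2 ^ j) (x j) := by simp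
    have e2 : (delta (h / 2 ^ j) ^ 2) (x j) = delta (h / 2 ^ j) (delta (h / 2 ^ j) (x j)) := rfl
    rw [e1, e2]
    nlinarith [sq_nonneg ‖(delta (h / 2 ^ j) ^ 0) (x j)‖, sq_nonneg ‖(delta (h / 2 ^ j) ^ 3) (x j)‖,
      sq_nonneg ‖(delta (h / 2 ^ j) ^ 4) (x j)‖]
  have h3 := mul_le_mul_of_nonneg_left h2 (pos_of_mem_meshSizes hj).1.le
  rw [Real.sq_sqrt (by linarith [(hx.nonneg hh).1])]
  linarith [hx.bound j]

theorem abs_sub_le (hx : IsDyadicCauchy h A C x) (hh : h ∈ meshSizes) (j : ℕ) (k l : ℤ) :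
    |x j k - x j l| ≤ √(2 * A) * |k * (h / 2 ^ j) - l * (h / 2 ^ j)| := by
  wlog hkl : l ≤ k generalizing k l
  · rw [abs_sub_comm, abs_sub_comm ((k : ℝ) * _)]
    exact this l k (by omega)
  have hj := (pos_of_mem_meshSizes (div_two_pow_mem_meshSizes hh j)).1
  obtain ⟨p, hp⟩ := Int.eq_ofNat_of_zero_le (sub_nonneg.2 hkl)
  obtain rfl : k = l + p := by omega
  have := LevyFD.abs_shift_sub_le hj (g := x j) (Λ := √(2 * A)) (fun i => by
    have := hx.abs_delta_le hh j i
    rwa [delta_apply, ← div_eq_inv_mul] at this) p l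
  refine this.trans (le_of_eq ?_)
  push_cast
  rw [show (l + p : ℝ) * (h / 2 ^ j) - l * (h / 2 ^ j) = p * (h / 2 ^ j) by ring,
    abs_of_nonneg (by positivity)]
  ring

theorem abs_step_le (hx : IsDyadicCauchy h A C x) (hh : h ∈ meshSizes) (j : ℕ) (k : ℤ) :
    |x j k - x (j + 1) (2 * k)| ≤ √(2 * C) * (h / 2 ^ (j + 1)) := by
  obtain ⟨D, hD, hD'⟩ := hx.step j
  have hj := div_two_pow_mem_meshSizes hh (j + 1)
  have h0 := (pos_of_mem_meshSizes hj).1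
  have e : D (2 * k) = x j k - x (j + 1) (2 * k) := by
    rw [← restrictEven_apply D, hD, Seq.sub_apply, restrictEven_apply]
  rw [← e]
  apply abs_le_of_sq_le_sq _ (by positivity)
  rw [mul_pow, Real.sq_sqrt (by linarith [(hx.nonneg hh).2])]
  linarith [D.sq_apply_le_sobSq hj (2 * k)]

theorem dist_step_le (hx : IsDyadicCauchy h A C x) (hh : h ∈ meshSizes) (y : ℝ) (j : ℕ) :
    dist (x j ⌊y / (h / 2 ^ j)⌋) (x (j + 1) ⌊y / (h / 2 ^ (j + 1))⌋)
      ≤ ((√(2 * C) + √(2 * A)) * h) / 2 / 2 ^ j := by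
  have h0 := (pos_of_mem_meshSizes hh).1
  set m := ⌊y / (h / 2 ^ j)⌋
  set m' := ⌊y / (h / 2 ^ (j + 1))⌋
  have e : y / (h / 2 ^ (j + 1)) = 2 * (y / (h / 2 ^ j)) := by
    rw [pow_succ]; field_simp
  have h1 : (m : ℝ) ≤ y / (h / 2 ^ j) := Int.floor_le _
  have h2 : y / (h / 2 ^ j) < m + 1 := Int.lt_floor_add_one _
  have h3 : 2 * m ≤ m' := by
    rw [Int.le_floor, e]; push_cast; linarith
  have h4 : m' < 2 * m + 2 := by
    rw [Int.floor_lt, e]; push_cast; linarith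
  have h5 := hx.abs_step_le hh j m
  have h6 := hx.abs_sub_le hh (j + 1) (2 * m) m'
  have h7 : |((2 * m : ℤ) : ℝ) * (h / 2 ^ (j + 1)) - m' * (h / 2 ^ (j + 1))| ≤ h / 2 ^ (j + 1) := by
    rw [← sub_mul, abs_mul, abs_of_pos (show 0 < h / 2 ^ (j + 1) by positivity)]
    have : |((2 * m : ℤ) : ℝ) - m'| ≤ 1 := by
      rw [← Int.cast_sub, ← Int.cast_abs]
      exact_mod_cast _root_.abs_le.2 ⟨by omega, by omega⟩
    have := mul_le_mul_of_nonneg_right this (show 0 ≤ h / 2 ^ (j + 1) by positivity)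
    rwa [one_mul] at this
  have h8 := mul_le_mul_of_nonneg_left h7 (Real.sqrt_nonneg (2 * A))
  rw [Real.dist_eq]
  calc |x j m - x (j + 1) m'| ≤ |x j m - x (j + 1) (2 * m)| + |x (j + 1) (2 * m) - x (j + 1) m'| :=
        _root_.abs_sub_le _ _ _
    _ ≤ √(2 * C) * (h / 2 ^ (j + 1)) + √(2 * A) * (h / 2 ^ (j + 1)) := add_le_add h5 (h6.trans h8)
    _ = _ := by rw [pow_succ]; field_simp

end IsDyadicCauchy

/-- The limit of a sequence of lattice functions on dyadic grids. -/
def dyadicLim (h : ℝ) (x : ℕ → Seq) (y : ℝ) : ℝ := limUnder atTop fun j => x j ⌊y / (h / 2 ^ j)⌋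

namespace IsDyadicCauchy

variable {h A C : ℝ} {x : ℕ → Seq}

theorem tendsto_floor (hx : IsDyadicCauchy h A C x) (hh : h ∈ meshSizes) (y : ℝ) :
    Tendsto (fun j => x j ⌊y / (h / 2 ^ j)⌋) atTop (𝓝 (dyadicLim h x y)) :=
  tendsto_nhds_limUnder
    (cauchySeq_tendsto_of_complete (cauchySeq_of_le_geometric_two (hx.dist_step_le hh y)))

theorem abs_sub_dyadicLim_le (hx : IsDyadicCauchy h A C x) (hh : h ∈ meshSizes) (y : ℝ) (j : ℕ) :
    |x j ⌊y / (h / 2 ^ j)⌋ - dyadicLim h x y| ≤ ((√(2 * C) + √(2 * A)) * h) / 2 ^ j :=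
  dist_le_of_le_geometric_two_of_tendsto (hx.dist_step_le hh y) (hx.tendsto_floor hh y) j

theorem abs_dyadicLim_le (hx : IsDyadicCauchy h A C x) (hh : h ∈ meshSizes) (y : ℝ) :
    |dyadicLim h x y| ≤ √(2 * A) :=
  le_of_tendsto (hx.tendsto_floor hh y).abs (Eventually.of_forall fun j => hx.abs_le hh j _)

/-- Convergence along lattice points converging to `y`. -/
theorem tendsto_of_tendsto (hx : IsDyadicCauchy h A C x) (hh : h ∈ meshSizes) {y : ℝ} {k : ℕ → ℤ}
    (hk : Tendsto (fun j => k j * (h / 2 ^ j)) atTop (𝓝 y)) :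
    Tendsto (fun j => x j (k j)) atTop (𝓝 (dyadicLim h x y)) := by
  have hε : ∀ j : ℕ, 0 < h / 2 ^ j := fun j =>
    (pos_of_mem_meshSizes (div_two_pow_mem_meshSizes hh j)).1
  have h1 : Tendsto (fun j => x j (k j) - x j ⌊y / (h / 2 ^ j)⌋) atTop (𝓝 0) := by
    refine squeeze_zero_norm (fun j => hx.abs_sub_le hh j _ _) ?_
    have := ((hk.sub (tendsto_floor_div_mul hε (tendsto_div_two_pow h) y)).abs.const_mul √(2 * A))
    simpa using this
  simpa using h1.add (hx.tendsto_floor hh y)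

theorem lipschitz (hx : IsDyadicCauchy h A C x) (hh : h ∈ meshSizes) :
    LipschitzWith (Real.toNNReal √(2 * A)) (dyadicLim h x) := by
  refine LipschitzWith.of_dist_le' fun y z => ?_
  have hε : ∀ j : ℕ, 0 < h / 2 ^ j := fun j =>
    (pos_of_mem_meshSizes (div_two_pow_mem_meshSizes hh j)).1
  have hf := tendsto_floor_div_mul hε (tendsto_div_two_pow h)
  exact le_of_tendsto_of_tendsto' ((hx.tendsto_floor hh y).dist (hx.tendsto_floor hh z))
    (((hf y).dist (hf z)).const_mul √(2 * A)) fun j => hx.abs_sub_le hh j _ _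

theorem lintegral_floor_sq (w : Seq) {ε : ℝ} (hε : 0 < ε) :
    ∫⁻ y, ENNReal.ofReal (w ⌊y / ε⌋ ^ 2) = ENNReal.ofReal (ε * ‖w‖ ^ 2) := by
  rw [lintegral_floor_div hε (fun k => ENNReal.ofReal (w k ^ 2)), Seq.norm_sq,
    ENNReal.ofReal_mul hε.le, ENNReal.ofReal_tsum_of_nonneg (fun k => sq_nonneg _) w.summable_sq]

theorem memLp (hx : IsDyadicCauchy h A C x) (hh : h ∈ meshSizes) :
    MemLp (dyadicLim h x) 2 volume ∧ ∫ y, dyadicLim h x y ^ 2 ≤ A := by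
  have hε : ∀ j : ℕ, 0 < h / 2 ^ j := fun j =>
    (pos_of_mem_meshSizes (div_two_pow_mem_meshSizes hh j)).1
  have := memLp_two_of_tendsto (F := fun j y => x j ⌊y / (h / 2 ^ j)⌋) (A := A)
    (fun j => Measurable.comp (g := fun k : ℤ => x j k) .of_discrete (measurable_floor_div _))
    (ae_of_all _ (hx.tendsto_floor hh)) fun j => by
      rw [lintegral_floor_sq _ (hε j)]
      refine ENNReal.ofReal_le_ofReal (le_trans ?_ (hx.bound j))
      have := sq_le_sobSq (h / 2 ^ j) (show 0 ≤ 4 by norm_num) (x j)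
      exact mul_le_mul_of_nonneg_left (by simpa using this) (hε j).le
  rwa [max_eq_left (hx.nonneg hh).1] at this

/-- A shift by `h / 2^i` is a whole number `2^l` of steps on the lattice `l` levels finer. The slope
is thus a limit of means of forward quotients, whose norms are uniformly bounded, and Fatou applies.
-/
theorem lintegral_slope_sq_le (hx : IsDyadicCauchy h A C x) (hh : h ∈ meshSizes) (i : ℕ) :
    ∫⁻ y, ENNReal.ofReal (((h / 2 ^ i)⁻¹ * (dyadicLim h x (y + h / 2 ^ i) - dyadicLim h x y)) ^ 2)
      ≤ ENNReal.ofReal A := by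
  have hε : ∀ j : ℕ, 0 < h / 2 ^ j := fun j =>
    (pos_of_mem_meshSizes (div_two_pow_mem_meshSizes hh j)).1
  let w : ℕ → Seq := fun l => (h / 2 ^ i)⁻¹ • (shift (2 ^ l : ℕ) (x (i + l)) - x (i + l))
  have hw : ∀ l y, w l ⌊y / (h / 2 ^ (i + l))⌋ = (h / 2 ^ i)⁻¹ *
      (x (i + l) ⌊(y + h / 2 ^ i) / (h / 2 ^ (i + l))⌋ - x (i + l) ⌊y / (h / 2 ^ (i + l))⌋) := by
    intro l y
    have h0 := (pos_of_mem_meshSizes hh).1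
    have e : (y + h / 2 ^ i) / (h / 2 ^ (i + l)) = y / (h / 2 ^ (i + l)) + ((2 ^ l : ℕ) : ℤ) := by
      rw [add_div, pow_add]; push_cast; field_simp
    simp only [w, Seq.smul_apply, Seq.sub_apply, shift_apply]
    rw [e, Int.floor_add_intCast]
  have hwn : ∀ l, h / 2 ^ (i + l) * ‖w l‖ ^ 2 ≤ A := by
    intro l
    have h1 := norm_shift_sub_le (hε (i + l)) (2 ^ l) (x (i + l))
    have h2 : ‖w l‖ ≤ ‖delta (h / 2 ^ (i + l)) (x (i + l))‖ := by
      have h0 := (pos_of_mem_meshSizes hh).1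
      rw [norm_smul, norm_inv, Real.norm_of_nonneg (hε i).le, ← div_eq_inv_mul, div_le_iff₀ (hε i)]
      refine h1.trans (le_of_eq ?_)
      rw [pow_add]; push_cast; field_simp
    have h3 := sq_le_sobSq (h / 2 ^ (i + l)) (show 1 ≤ 4 by norm_num) (x (i + l))
    rw [pow_one] at h3
    exact (mul_le_mul_of_nonneg_left ((pow_le_pow_left₀ (norm_nonneg _) h2 2).trans h3)
      (hε _).le).trans (hx.bound _)
  have ht : ∀ y, Tendsto (fun l => w l ⌊y / (h / 2 ^ (i + l))⌋) atTop
      (𝓝 ((h / 2 ^ i)⁻¹ * (dyadicLim h x (y + h / 2 ^ i) - dyadicLim h x y))) := by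
    intro y
    simp only [hw]
    have hl : Tendsto (fun l : ℕ => i + l) atTop atTop := tendsto_atTop_mono (fun l => Nat.le_add_left l i) tendsto_id
    exact (((hx.tendsto_floor hh _).comp hl).sub ((hx.tendsto_floor hh y).comp hl)).const_mul _
  have hm : ∀ l, Measurable fun y => w l ⌊y / (h / 2 ^ (i + l))⌋ := fun l =>
    Measurable.comp (g := fun k : ℤ => w l k) .of_discrete (measurable_floor_div _)
  calc _ = ∫⁻ y, liminf (fun l => ENNReal.ofReal (w l ⌊y / (h / 2 ^ (i + l))⌋ ^ 2)) atTop := by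
          refine lintegral_congr fun y => ?_
          exact ((ENNReal.continuous_ofReal.tendsto _).comp ((ht y).pow 2)).liminf_eq.symm
    _ ≤ liminf (fun l => ∫⁻ y, ENNReal.ofReal (w l ⌊y / (h / 2 ^ (i + l))⌋ ^ 2)) atTop :=
        lintegral_liminf_le fun l => ((hm l).pow_const 2).ennreal_ofReal
    _ ≤ ENNReal.ofReal A := liminf_le_of_le (by isBoundedDefault) fun b hb => by
        obtain ⟨l, hl⟩ := hb.exists
        rw [lintegral_floor_sq _ (hε _)] at hl
        exact hl.trans (ENNReal.ofReal_le_ofReal (hwn l))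

/-- The limit is Lipschitz, hence absolutely continuous and differentiable almost everywhere. Its
derivative is the limit of dyadic slopes and inherits their `L₂` bound by Fatou. -/
theorem isH1 (hx : IsDyadicCauchy h A C x) (hh : h ∈ meshSizes) :
    IsH1 (dyadicLim h x) (deriv (dyadicLim h x)) ∧ ∫ y, deriv (dyadicLim h x) y ^ 2 ≤ A := by
  have hε : ∀ j : ℕ, 0 < h / 2 ^ j := fun j =>
    (pos_of_mem_meshSizes (div_two_pow_mem_meshSizes hh j)).1
  have hL := hx.lipschitz hh
  have hlim : Tendsto (fun j : ℕ => h / 2 ^ j) atTop (𝓝[>] 0) :=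
    tendsto_nhdsWithin_iff.2 ⟨tendsto_div_two_pow h, Eventually.of_forall hε⟩
  have hd := memLp_two_of_tendsto (g := deriv (dyadicLim h x)) (A := A)
    (F := fun j y => (h / 2 ^ j)⁻¹ * (dyadicLim h x (y + h / 2 ^ j) - dyadicLim h x y))
    (fun j => by have := hL.continuous; fun_prop)
    (hL.ae_differentiableAt_real.mono fun y hy => by
      simpa only [smul_eq_mul, Function.comp_def] using
        hy.hasDerivAt.tendsto_slope_zero_right.comp hlim)
    (hx.lintegral_slope_sq_le hh)
  refine ⟨⟨(hx.memLp hh).1, hd.1, fun y z => ?_⟩, by rw [max_eq_left (hx.nonneg hh).1] at hd; exact hd.2⟩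
  exact (AbsolutelyContinuousOnInterval.integral_deriv_eq_sub
    (hL.lipschitzOnWith.absolutelyContinuousOnInterval)).symm

/-- The values of the limit on the coarsest grid differ little from the first lattice function. -/
theorem error_bound (hx : IsDyadicCauchy h A C x) (hh : h ∈ meshSizes) :
    (∀ k : ℤ, |dyadicLim h x (k * h) - x 0 k| ^ 2 ≤ 2 * C * h ^ 2) ∧
    gridNormSq h (fun k => dyadicLim h x (k * h) - x 0 k) ≤ ENNReal.ofReal (2 * C * h ^ 2) := by
  obtain ⟨h0, h1⟩ := pos_of_mem_meshSizes hh
  have hC := (hx.nonneg hh).2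
  have hrp : ∀ (j : ℕ) (w : Seq) (k : ℤ), (restrictEven ^ j) w k = w ((2 ^ j : ℕ) * k) := by
    intro j
    induction j with
    | zero => intro w k; simp
    | succ j ih =>
      intro w k
      rw [pow_succ]
      change (restrictEven ^ j) (restrictEven w) k = _
      rw [ih, restrictEven_apply, pow_succ]
      push_cast; ring_nf
  let y : ℕ → Seq := fun j => (restrictEven ^ j) (x j)
  have hlim : ∀ k : ℤ, Tendsto (fun j => y j k) atTop (𝓝 (dyadicLim h x (k * h))) := by
    intro k
    simp only [y, hrp]
    refine hx.tendsto_of_tendsto hh (tendsto_const_nhds.congr fun j => ?_)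
    push_cast; field_simp
  have hstep : ∀ j, ∃ D : Seq, (restrictEven ^ (j + 1)) D = y j - y (j + 1) ∧
      h / 2 ^ (j + 1) * sobSq (h / 2 ^ (j + 1)) 1 D ≤ C * (h / 2 ^ (j + 1)) ^ 2 := by
    intro j
    obtain ⟨D, hD, hD'⟩ := hx.step j
    refine ⟨D, ?_, hD'⟩
    have e : ∀ w, (restrictEven ^ (j + 1)) w = (restrictEven ^ j) (restrictEven w) := fun w => by
      rw [pow_succ]; rfl
    simp only [y]
    rw [e, e, hD, map_sub]
  -- The increment on the coarsest grid is a trace of `D`, which lives on the finest of the lattices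
  -- involved and is small there in the discrete `H¹` norm. The bounds sum to `√(2C/h) · h`, whose
  -- square times `h` is `2 C h²`.
  have hn : ∀ j, dist (y j) (y (j + 1)) ≤ (√(2 * C / h) * h) / 2 / 2 ^ j := by
    intro j
    obtain ⟨D, hD, hD'⟩ := hstep j
    have hε : 0 < h / 2 ^ (j + 1) := by positivity
    have e : (((2 : ℕ) ^ (j + 1) : ℕ) : ℝ) * (h / 2 ^ (j + 1)) = h := by push_cast; field_simp
    have h2 := D.trace_le_sobSq hε (n := 2 ^ (j + 1)) (by positivity) (e.le.trans h1)
    rw [e] at h2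
    have h3 : ‖y j - y (j + 1)‖ ^ 2 = ∑' k : ℤ, D (((2 : ℕ) ^ (j + 1) : ℕ) * k) ^ 2 := by
      rw [← hD, Seq.norm_sq]
      exact tsum_congr fun k => by rw [hrp]
    rw [← h3] at h2
    rw [dist_eq_norm]
    apply le_of_sq_le_sq _ (by positivity)
    rw [div_div, div_pow, mul_pow, Real.sq_sqrt (by positivity), ← pow_succ']
    have h4 : h * ‖y j - y (j + 1)‖ ^ 2 ≤ 2 * (C * (h / 2 ^ (j + 1)) ^ 2) := h2.trans (by linarith)
    calc ‖y j - y (j + 1)‖ ^ 2 = h⁻¹ * (h * ‖y j - y (j + 1)‖ ^ 2) := by field_simp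
      _ ≤ h⁻¹ * (2 * (C * (h / 2 ^ (j + 1)) ^ 2)) := by gcongr
      _ = _ := by field_simp
  have hcs := cauchySeq_of_le_geometric_two hn
  obtain ⟨Y, hY⟩ := cauchySeq_tendsto_of_complete hcs
  -- Convergence in `ℓ²` implies convergence of coordinates, so the abstract limit has the values of
  -- `dyadicLim`.
  have hYk : ∀ k : ℤ, Y k = dyadicLim h x (k * h) := fun k =>
    tendsto_nhds_unique (((coord k).continuous.tendsto Y).comp hY) (hlim k)
  have hd := dist_le_of_le_geometric_two_of_tendsto₀ hn hY
  constructor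
  · intro k
    have hs : ∀ j, dist (y j k) (y (j + 1) k) ≤ (√(2 * C) * h) / 2 / 2 ^ j := by
      intro j
      have := hx.abs_step_le hh j ((2 ^ j : ℕ) * k)
      rw [Real.dist_eq]
      simp only [y, hrp]
      have e : ((2 ^ (j + 1) : ℕ) : ℤ) * k = 2 * ((2 ^ j : ℕ) * k) := by push_cast; ring
      rw [e]
      refine this.trans (le_of_eq ?_)
      rw [pow_succ]; field_simp
    have h2 := dist_le_of_le_geometric_two_of_tendsto₀ hs (hlim k)
    rw [dist_comm, Real.dist_eq] at h2
    have h3 := pow_le_pow_left₀ (abs_nonneg _) h2 2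
    rw [mul_pow, Real.sq_sqrt (by positivity)] at h3
    exact h3
  · have h2 : gridNormSq h (fun k => dyadicLim h x (k * h) - x 0 k)
        = ENNReal.ofReal (h * ‖Y - x 0‖ ^ 2) := by
      rw [gridNormSq, ENNReal.ofReal_mul h0.le, Seq.norm_sq,
        ENNReal.ofReal_tsum_of_nonneg (fun k => sq_nonneg _) (Y - x 0).summable_sq]
      congr 1
      refine tsum_congr fun k => ?_
      rw [sq_abs, Seq.sub_apply, hYk]
    rw [h2]
    refine ENNReal.ofReal_le_ofReal ?_
    have h3 : ‖Y - x 0‖ ≤ √(2 * C / h) * h := by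
      rw [dist_comm, dist_eq_norm] at hd
      exact hd
    have h4 := pow_le_pow_left₀ (norm_nonneg _) h3 2
    rw [mul_pow, Real.sq_sqrt (by positivity)] at h4
    calc h * ‖Y - x 0‖ ^ 2 ≤ h * (2 * C / h * h ^ 2) := by gcongr
      _ = _ := by field_simp

end IsDyadicCauchy

end
end LevyFD

namespace LevyFD
noncomputable section
open Filter Topology

theorem IsTestFunction.contDiff_two {φ : ℝ → ℝ} (hφ : IsTestFunction φ) : ContDiff ℝ 2 φ := by
  exact_mod_cast contDiff_infty.1 hφ.1 2

/-! ### Lattice restrictions of compactly supported functions -/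

open Classical in
/-- The restriction of a function to the lattice `εℤ`. -/
def gridOf (g : ℝ → ℝ) (ε : ℝ) : Seq :=
  if h : Memℓp (fun k : ℤ => g (k * ε)) 2 then ⟨_, h⟩ else 0

theorem gridOf_apply {g : ℝ → ℝ} (hg : HasCompactSupport g) {ε : ℝ} (hε : 0 < ε) (k : ℤ) :
    gridOf g ε k = g (k * ε) := by
  have h : Memℓp (fun k : ℤ => g (k * ε)) 2 := by
    refine memℓp_two_iff.2 (summable_of_hasFiniteSupport ?_)
    obtain ⟨R, hR⟩ := hg.isCompact.isBounded.subset_closedBall 0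
    refine (Set.finite_Icc (-⌈R / ε⌉) ⌈R / ε⌉).subset fun k hk => ?_
    have hk' : g (k * ε) ≠ 0 := fun h0 => hk (by simp [h0])
    have h1 := hR (subset_tsupport _ hk')
    rw [mem_closedBall_zero_iff, Real.norm_eq_abs, abs_mul, abs_of_pos hε, ← le_div_iff₀ hε] at h1
    have h2 : ((|k| : ℤ) : ℝ) ≤ ⌈R / ε⌉ := by rw [Int.cast_abs]; exact h1.trans (Int.le_ceil _)
    exact abs_le.1 (by exact_mod_cast h2)
  rw [gridOf, dif_pos h]

/-- Uniformly bounded lattice functions with a common bounded support, converging pointwise. -/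
def GridTendsto (ε : ℕ → ℝ) (g : ℕ → Seq) (G : ℝ → ℝ) : Prop :=
  ∃ C R : ℝ, 0 ≤ R ∧ (∀ j k, |g j k| ≤ C) ∧ (∀ j (k : ℤ), R < |k * ε j| → g j k = 0) ∧
    ∀ x, Tendsto (fun j => g j ⌊x / ε j⌋) atTop (𝓝 (G x))

theorem GridTendsto.add {ε : ℕ → ℝ} {g g' : ℕ → Seq} {G G' : ℝ → ℝ} (h : GridTendsto ε g G)
    (h' : GridTendsto ε g' G') : GridTendsto ε (fun j => g j + g' j) fun x => G x + G' x := by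
  obtain ⟨C, R, hR, h1, h2, h3⟩ := h
  obtain ⟨C', R', -, h1', h2', h3'⟩ := h'
  refine ⟨C + C', max R R', hR.trans (le_max_left _ _), fun j k => ?_, fun j k hk => ?_,
    fun x => (h3 x).add (h3' x)⟩
  · exact (abs_add_le _ _).trans (add_le_add (h1 j k) (h1' j k))
  · rw [Seq.add_apply, h2 j k ((le_max_left _ _).trans_lt hk),
      h2' j k ((le_max_right _ _).trans_lt hk), add_zero]

theorem GridTendsto.neg {ε : ℕ → ℝ} {g : ℕ → Seq} {G : ℝ → ℝ} (h : GridTendsto ε g G) :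
    GridTendsto ε (fun j => (-1 : ℝ) • g j) fun x => -G x := by
  obtain ⟨C, R, hR, h1, h2, h3⟩ := h
  refine ⟨C, R, hR, fun j k => ?_, fun j k hk => ?_, fun x => ?_⟩
  · rw [Seq.smul_apply, neg_one_mul, abs_neg]; exact h1 j k
  · rw [Seq.smul_apply, h2 j k hk, mul_zero]
  · simpa using (h3 x).neg

theorem GridTendsto.tendsto_mul_inner {ε : ℕ → ℝ} (hε : ∀ j, 0 < ε j) (hε1 : ∀ j, ε j ≤ 1)
    {w g : ℕ → Seq} {W G : ℝ → ℝ} {B : ℝ} (hw : ∀ j k, |w j k| ≤ B)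
    (hW : ∀ x, Tendsto (fun j => w j ⌊x / ε j⌋) atTop (𝓝 (W x))) (hg : GridTendsto ε g G) :
    Tendsto (fun j => ε j * inner ℝ (w j) (g j)) atTop (𝓝 (∫ x, W x * G x)) := by
  obtain ⟨C, R, -, h1, h2, h3⟩ := hg
  exact LevyFD.tendsto_mul_inner hε hε1 hw h1 h2 hW h3

theorem GridTendsto.exists_norm_le {ε : ℕ → ℝ} (hε : ∀ j, 0 < ε j) (hε1 : ∀ j, ε j ≤ 1)
    {g : ℕ → Seq} {G : ℝ → ℝ} (hg : GridTendsto ε g G) :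
    ∃ M, 0 ≤ M ∧ ∀ j, ε j * ‖g j‖ ^ 2 ≤ M := by
  obtain ⟨C, R, hR, h1, h2, -⟩ := hg
  exact ⟨C ^ 2 * (2 * (R + 1)), by positivity,
    fun j => mul_norm_sq_le_of_support (hε j) (hε1 j) hR (h1 j) (h2 j)⟩

theorem exists_bound_of_compact {g : ℝ → ℝ} (hc : Continuous g) (hs : HasCompactSupport g) :
    ∃ C, ∀ x, |g x| ≤ C := hc.bounded_above_of_compact_support hs

theorem exists_support_bound {g : ℝ → ℝ} (hs : HasCompactSupport g) :
    ∃ R, 0 ≤ R ∧ ∀ x, R < |x| → g x = 0 := by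
  obtain ⟨R, hR⟩ := hs.isCompact.isBounded.subset_closedBall 0
  refine ⟨max R 0, le_max_right _ _, fun x hx => ?_⟩
  by_contra hne
  have := hR (subset_tsupport _ hne)
  rw [mem_closedBall_zero_iff, Real.norm_eq_abs] at this
  exact absurd ((le_max_left R 0).trans_lt hx) this.not_gt

theorem gridTendsto_gridOf {g : ℝ → ℝ} (hc : Continuous g) (hs : HasCompactSupport g) {ε : ℕ → ℝ}
    (hε : ∀ j, 0 < ε j) (hε0 : Tendsto ε atTop (𝓝 0)) :
    GridTendsto ε (fun j => gridOf g (ε j)) g := by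
  obtain ⟨C, hC⟩ := exists_bound_of_compact hc hs
  obtain ⟨R, hR, hR'⟩ := exists_support_bound hs
  refine ⟨C, R, hR, fun j k => ?_, fun j k hk => ?_, fun x => ?_⟩
  · rw [gridOf_apply hs (hε j)]; exact hC _
  · rw [gridOf_apply hs (hε j)]; exact hR' _ hk
  · simp only [gridOf_apply hs (hε _)]
    exact (hc.tendsto x).comp (tendsto_floor_div_mul hε hε0 x)

theorem gridTendsto_cdiff {g : ℝ → ℝ} (hg : ContDiff ℝ 1 g) (hs : HasCompactSupport g) {ε : ℕ → ℝ}
    (hε : ∀ j, 0 < ε j) (hε1 : ∀ j, ε j ≤ 1) (hε0 : Tendsto ε atTop (𝓝 0)) :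
    GridTendsto ε (fun j => cdiff (ε j) 1 (gridOf g (ε j))) (deriv g) := by
  obtain ⟨C, hC⟩ := exists_bound_of_compact (hg.continuous_deriv le_rfl) hs.deriv
  obtain ⟨R, hR, hR'⟩ := exists_support_bound hs
  have e : ∀ j k, cdiff (ε j) 1 (gridOf g (ε j)) k
      = (2 * ε j)⁻¹ * (g (k * ε j + ε j) - g (k * ε j - ε j)) := by
    intro j k
    rw [cdiff_apply, gridOf_apply hs (hε j), gridOf_apply hs (hε j)]
    push_cast; ring_nf
  refine ⟨C, R + 1, by linarith, fun j k => ?_, fun j k hk => ?_, fun x => ?_⟩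
  · obtain ⟨η, -, h2⟩ := exists_deriv_eq_diff (hg.differentiable one_ne_zero) (hε j) (k * ε j)
    rw [e, h2]; exact hC _
  · have h1 := abs_sub_abs_le_abs_sub (k * ε j) (-ε j)
    have h2 := abs_sub_abs_le_abs_sub (k * ε j) (ε j)
    rw [sub_neg_eq_add, abs_neg, abs_of_pos (hε j)] at h1
    rw [abs_of_pos (hε j)] at h2
    have := hε1 j
    rw [e, hR' _ (by linarith), hR' _ (by linarith)]; simp
  · simp only [e]
    exact tendsto_diff_grid hg hε hε0 x

theorem deriv_deriv_continuous {g : ℝ → ℝ} (hg : ContDiff ℝ 2 g) :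
    ContDiff ℝ 1 (deriv g) ∧ Continuous (deriv (deriv g)) := by
  have h1 : ContDiff ℝ 1 (deriv g) :=
    ((contDiff_succ_iff_deriv (n := (1 : WithTop ℕ∞)) (f := g)).1
      (by rw [one_add_one_eq_two]; exact hg)).2.2
  exact ⟨h1, h1.continuous_deriv le_rfl⟩

theorem gridTendsto_second_diff {g : ℝ → ℝ} (hg : ContDiff ℝ 2 g) (hs : HasCompactSupport g)
    {ε : ℕ → ℝ} (hε : ∀ j, 0 < ε j) (hε1 : ∀ j, ε j ≤ 1) (hε0 : Tendsto ε atTop (𝓝 0)) {n : ℕ}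
    (hn : 0 < n) {G : ℕ → Seq} (e : ∀ j k, G j k = ((n * ε j) ^ 2)⁻¹ *
      (g (k * ε j + n * ε j) - 2 * g (k * ε j) + g (k * ε j - n * ε j))) :
    GridTendsto ε G (deriv (deriv g)) := by
  obtain ⟨hg1, hg2⟩ := deriv_deriv_continuous hg
  obtain ⟨C, hC⟩ := exists_bound_of_compact hg2 hs.deriv.deriv
  obtain ⟨R, hR, hR'⟩ := exists_support_bound hs
  have hn' : (0 : ℝ) < n := by exact_mod_cast hn
  have hl : ∀ j, 0 < n * ε j := fun j => mul_pos hn' (hε j)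
  refine ⟨C, R + n, by linarith, fun j k => ?_, fun j k hk => ?_, fun x => ?_⟩
  · obtain ⟨η, -, h2⟩ := exists_deriv_eq_second_diff (hg.differentiable two_ne_zero)
      (hg1.differentiable one_ne_zero) (hl j) (k * ε j)
    rw [e, h2]; exact hC _
  · have h1 := abs_sub_abs_le_abs_sub (k * ε j) (-(n * ε j))
    have h2 := abs_sub_abs_le_abs_sub (k * ε j) (n * ε j)
    rw [sub_neg_eq_add, abs_neg, abs_of_pos (hl j)] at h1
    rw [abs_of_pos (hl j)] at h2
    have := mul_le_mul_of_nonneg_left (hε1 j) hn'.le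
    rw [e, hR' _ (by linarith), hR' _ (by linarith), hR' _ (by linarith)]; simp
  · simp only [e]
    refine tendsto_second_diff_grid hg hε hε0 hl ?_ x
    simpa using hε0.const_mul (n : ℝ)

theorem gridTendsto_cdiff_cdiff {g : ℝ → ℝ} (hg : ContDiff ℝ 2 g) (hs : HasCompactSupport g)
    {ε : ℕ → ℝ} (hε : ∀ j, 0 < ε j) (hε1 : ∀ j, ε j ≤ 1) (hε0 : Tendsto ε atTop (𝓝 0)) :
    GridTendsto ε (fun j => cdiff (ε j) 1 (cdiff (ε j) 1 (gridOf g (ε j)))) (deriv (deriv g)) := by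
  refine gridTendsto_second_diff hg hs hε hε1 hε0 (n := 2) (by norm_num) fun j k => ?_
  rw [cdiff_cdiff]
  simp only [Seq.smul_apply, Seq.add_apply, Seq.sub_apply, shift_apply, gridOf_apply hs (hε j)]
  push_cast; ring_nf

theorem gridTendsto_lap {g : ℝ → ℝ} (hg : ContDiff ℝ 2 g) (hs : HasCompactSupport g)
    {ε : ℕ → ℝ} (hε : ∀ j, 0 < ε j) (hε1 : ∀ j, ε j ≤ 1) (hε0 : Tendsto ε atTop (𝓝 0)) :
    GridTendsto ε (fun j => lap (ε j) 1 (gridOf g (ε j))) (deriv (deriv g)) := by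
  refine gridTendsto_second_diff hg hs hε hε1 hε0 (n := 1) (by norm_num) fun j k => ?_
  rw [lap_apply]
  simp only [gridOf_apply hs (hε j)]
  push_cast; ring_nf

/-! ### Summation by parts -/

theorem inner_cdiff_left (h : ℝ) (n : ℤ) (x y : Seq) :
    inner ℝ (cdiff h n x) y = inner ℝ x ((-1 : ℝ) • cdiff h n y) := by
  have e : ∀ z, cdiff h n z = (2 * h)⁻¹ • (shift n z - shift (-n) z) := fun z => rfl
  rw [e, e, inner_smul_left, inner_sub_left, inner_shift_left, inner_shift_left, neg_neg,
    inner_smul_right, inner_smul_right, inner_sub_right]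
  simp only [conj_trivial]
  ring

theorem inner_lap_left (h : ℝ) (n : ℤ) (x y : Seq) :
    inner ℝ (lap h n x) y = inner ℝ x (lap h n y) := by
  have e : ∀ z, lap h n z = (h ^ 2)⁻¹ • (shift n z - (2 : ℝ) • z + shift (-n) z) := fun z => rfl
  rw [e, e, inner_smul_left, inner_add_left, inner_sub_left, inner_shift_left, inner_shift_left,
    neg_neg, inner_smul_left, inner_smul_right, inner_add_right, inner_sub_right, inner_smul_right]
  simp only [conj_trivial]
  ring

theorem inner_mulOp_left {g : ℤ → ℝ} {C : ℝ} (hg : ∀ k, |g k| ≤ C) (x y : Seq) :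
    inner ℝ (mulOp g x) y = inner ℝ x (mulOp g y) := by
  rw [Seq.inner_eq, Seq.inner_eq]
  refine tsum_congr fun k => ?_
  rw [mulOp_apply hg, mulOp_apply hg]; ring

theorem mulOp_gridOf {a φ : ℝ → ℝ} {K : ℝ} (ha : ∀ x, |a x| ≤ K) (hφ : HasCompactSupport φ) {ε : ℝ}
    (hε : 0 < ε) : mulOp (fun k => a (k * ε)) (gridOf φ ε) = gridOf (fun x => a x * φ x) ε := by
  refine Seq.ext fun k => ?_
  rw [mulOp_apply fun k : ℤ => ha (k * ε), gridOf_apply hφ hε,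
    gridOf_apply (g := fun x => a x * φ x) hφ.mul_left hε]

/-- The differential part of the scheme with stride one. -/
def localOp (a b c : ℝ → ℝ) (ε : ℝ) (x : Seq) : Seq :=
  mulOp (fun k => a (k * ε)) (cdiff ε 1 (cdiff ε 1 x)) + mulOp (fun k => b (k * ε)) (cdiff ε 1 x)
    + mulOp (fun k => c (k * ε)) x

theorem schemeOp_one (ν : Measure ℝ) (a b c : ℝ → ℝ → ℝ) (ε t : ℝ) (x : Seq) :
    schemeOp ν a b c ε 1 t x = localOp (a t) (b t) (c t) ε x + (J1op ν ε 1 x + J2op ν ε 1 x) := by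
  rw [schemeOp, Aop_apply, localOp]; simp

/-- All differences are moved to products of coefficients with the test function. Those have enough
derivatives for their difference quotients to converge, so bounded pointwise convergence of the
lattice functions suffices. -/
theorem inner_localOp {a b c φ : ℝ → ℝ} {K : ℝ} (ha : ∀ x, |a x| ≤ K) (hb : ∀ x, |b x| ≤ K)
    (hc : ∀ x, |c x| ≤ K) (hφ : HasCompactSupport φ) {ε : ℝ} (hε : 0 < ε) (x : Seq) :
    inner ℝ (localOp a b c ε x) (gridOf φ ε)
      = inner ℝ x (cdiff ε 1 (cdiff ε 1 (gridOf (fun x => a x * φ x) ε))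
        + (-1 : ℝ) • cdiff ε 1 (gridOf (fun x => b x * φ x) ε) + gridOf (fun x => c x * φ x) ε) := by
  rw [localOp, inner_add_left, inner_add_left, inner_mulOp_left fun k : ℤ => ha (k * ε),
    inner_mulOp_left fun k : ℤ => hb (k * ε), inner_mulOp_left fun k : ℤ => hc (k * ε),
    mulOp_gridOf ha hφ hε, mulOp_gridOf hb hφ hε, mulOp_gridOf hc hφ hε, inner_cdiff_left,
    inner_cdiff_left, inner_cdiff_left, inner_add_right, inner_add_right, map_smul, smul_smul]
  simp

theorem IsH1.shift {g g' : ℝ → ℝ} (h : IsH1 g g') (p : ℝ) :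
    IsH1 (fun x => g (x + p)) fun x => g' (x + p) where
  memLp := h.memLp.comp_measurePreserving (measurePreserving_add_right volume p)
  memLp' := h.memLp'.comp_measurePreserving (measurePreserving_add_right volume p)
  sub_eq x y := by rw [h.sub_eq, intervalIntegral.integral_comp_add_right]

theorem norm_lap_one (ε : ℝ) (x : Seq) : ‖lap ε 1 x‖ = ‖(delta ε ^ 2) x‖ := by
  rw [lap_one_eq]
  change ‖delta ε (delta ε (LevyFD.shift (-1) x))‖ = ‖delta ε (delta ε x)‖
  rw [Commute.apply (commute_delta_shift ε _), Commute.apply (commute_delta_shift ε _), norm_shift]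

namespace IsDyadicCauchy

variable {h A C : ℝ} {x : ℕ → Seq}

theorem mesh_pos (hh : h ∈ meshSizes) (j : ℕ) : 0 < h / 2 ^ j :=
  (pos_of_mem_meshSizes (div_two_pow_mem_meshSizes hh j)).1

theorem mesh_le_one (hh : h ∈ meshSizes) (j : ℕ) : h / 2 ^ j ≤ 1 :=
  (pos_of_mem_meshSizes (div_two_pow_mem_meshSizes hh j)).2

/-- Cauchy-Schwarz for the scaled pairing. -/
theorem abs_mul_inner_le {ε A M : ℝ} (hε : 0 < ε) {y g : Seq} (hy : ε * ‖y‖ ^ 2 ≤ A)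
    (hg : ε * ‖g‖ ^ 2 ≤ M) : |ε * inner ℝ y g| ≤ √A * √M := by
  have hA : 0 ≤ A := le_trans (by positivity) hy
  have hM : 0 ≤ M := le_trans (by positivity) hg
  rw [abs_mul, abs_of_pos hε, ← Real.sqrt_mul hA]
  apply Real.le_sqrt_of_sq_le
  have h1 := abs_real_inner_le_norm y g
  calc (ε * |inner ℝ y g|) ^ 2 ≤ (ε * (‖y‖ * ‖g‖)) ^ 2 := by gcongr
    _ = (ε * ‖y‖ ^ 2) * (ε * ‖g‖ ^ 2) := by ring
    _ ≤ A * M := by gcongr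

theorem mul_norm_sq_le (hx : IsDyadicCauchy h A C x) (hh : h ∈ meshSizes) (j : ℕ) {i : ℕ}
    (hi : i ≤ 4) {y : Seq} (hy : ‖y‖ ≤ ‖(delta (h / 2 ^ j) ^ i) (x j)‖) :
    h / 2 ^ j * ‖y‖ ^ 2 ≤ A := by
  refine le_trans (mul_le_mul_of_nonneg_left ?_ (mesh_pos hh j).le) (hx.bound j)
  exact (pow_le_pow_left₀ (norm_nonneg _) hy 2).trans (sq_le_sobSq _ hi _)

theorem tendsto_localOp (hx : IsDyadicCauchy h A C x) (hh : h ∈ meshSizes) {a b c φ : ℝ → ℝ} {K : ℝ}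
    (ha : ∀ x, |a x| ≤ K) (hb : ∀ x, |b x| ≤ K) (hc : ∀ x, |c x| ≤ K) (ha' : ContDiff ℝ 2 a)
    (hb' : ContDiff ℝ 1 b) (hc' : Continuous c) (hφ : IsTestFunction φ) :
    Tendsto (fun j => h / 2 ^ j * inner ℝ (localOp a b c (h / 2 ^ j) (x j)) (gridOf φ (h / 2 ^ j)))
      atTop (𝓝 ((∫ y, deriv (dyadicLim h x) y * (-(φ y * deriv a y) - a y * deriv φ y + b y * φ y))
        + ∫ y, c y * dyadicLim h x y * φ y)) := by
  have hε := mesh_pos hh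
  have hε1 := mesh_le_one hh
  have hε0 := tendsto_div_two_pow h
  have hφ2 : ContDiff ℝ 2 φ := hφ.contDiff_two
  have haφ : ContDiff ℝ 2 fun x => a x * φ x := ha'.mul hφ2
  have hbφ : ContDiff ℝ 1 fun x => b x * φ x := hb'.mul hφ.contDiff_one
  have hcφ : Continuous fun x => c x * φ x := hc'.mul hφ.continuous
  have hsa : HasCompactSupport fun x => a x * φ x := hφ.2.mul_left
  have hsb : HasCompactSupport fun x => b x * φ x := hφ.2.mul_left
  have hsc : HasCompactSupport fun x => c x * φ x := hφ.2.mul_left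
  simp only [inner_localOp ha hb hc hφ.2 (hε _)]
  have key := GridTendsto.tendsto_mul_inner hε hε1 (hx.abs_le hh) (hx.tendsto_floor hh)
    (((gridTendsto_cdiff_cdiff haφ hsa hε hε1 hε0).add
      (gridTendsto_cdiff hbφ hsb hε hε1 hε0).neg).add (gridTendsto_gridOf hcφ hsc hε hε0))
  convert key using 2
  -- The limit appears with all derivatives on the test side; one integration by parts against the
  -- `H¹` limit restores the weak form of the equation.
  obtain ⟨hL, -⟩ := hx.isH1 hh
  obtain ⟨haφ1, haφ2⟩ := deriv_deriv_continuous haφ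
  have i1 := hL.integral_mul_deriv haφ1 hsa.deriv
  have i2 := hL.integral_mul_deriv hbφ hsb
  have hint : ∀ {w g : ℝ → ℝ}, MemLp w 2 volume → Continuous g → HasCompactSupport g →
      Integrable fun y => w y * g y := fun hw hg hs =>
    hw.integrable_mul (q := 2) (hg.memLp_of_hasCompactSupport hs)
  have j1 := hint hL.memLp haφ2 hsa.deriv.deriv
  have j2 := hint hL.memLp (hbφ.continuous_deriv le_rfl) hsb.deriv
  have j3 := hint hL.memLp hcφ hsc
  have j4 := hint hL.memLp' haφ1.continuous hsa.deriv
  have j5 := hint hL.memLp' hbφ.continuous hsb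
  have e1 : ∀ y, dyadicLim h x y * (deriv (deriv fun x => a x * φ x) y
      + -deriv (fun x => b x * φ x) y + c y * φ y)
      = dyadicLim h x y * deriv (deriv fun x => a x * φ x) y
        - dyadicLim h x y * deriv (fun x => b x * φ x) y + dyadicLim h x y * (c y * φ y) := by
    intro y; ring
  have e2 : ∀ y, deriv (dyadicLim h x) y * (-(φ y * deriv a y) - a y * deriv φ y + b y * φ y)
      = -(deriv (dyadicLim h x) y * deriv (fun x => a x * φ x) y)
        + deriv (dyadicLim h x) y * (b y * φ y) := by
    intro y
    have : deriv (fun x => a x * φ x) y = deriv a y * φ y + a y * deriv φ y :=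
      deriv_fun_mul (ha'.differentiable two_ne_zero y) (hφ.differentiable y)
    rw [this]; ring
  simp only [e1, e2]
  have j12 : Integrable fun y => dyadicLim h x y * deriv (deriv fun x => a x * φ x) y
      - dyadicLim h x y * deriv (fun x => b x * φ x) y := j1.sub j2
  have j4' : Integrable fun y => -(deriv (dyadicLim h x) y * deriv (fun x => a x * φ x) y) := j4.neg
  rw [integral_add j12 j3, integral_sub j1 j2, i1, i2, integral_add j4' j5, integral_neg]
  have e3 : ∀ y, c y * dyadicLim h x y * φ y = dyadicLim h x y * (c y * φ y) := fun y => by ring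
  simp only [e3]
  ring

theorem tendsto_cidx (hh : h ∈ meshSizes) (z : ℝ) :
    Tendsto (fun j : ℕ => (cidx (h / 2 ^ j) z : ℝ) * (h / 2 ^ j)) atTop (𝓝 z) := by
  rw [tendsto_iff_norm_sub_tendsto_zero]
  exact squeeze_zero (fun _ => norm_nonneg _) (fun j => abs_cidx_mul_sub_le (mesh_pos hh j) z)
    (tendsto_div_two_pow h)

theorem tendsto_shift (hx : IsDyadicCauchy h A C x) (hh : h ∈ meshSizes) {p : ℕ → ℤ} {q : ℝ}
    (hp : Tendsto (fun j => (p j : ℝ) * (h / 2 ^ j)) atTop (𝓝 q)) (y : ℝ) :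
    Tendsto (fun j => LevyFD.shift (p j) (x j) ⌊y / (h / 2 ^ j)⌋) atTop
      (𝓝 (dyadicLim h x (y + q))) := by
  simp only [shift_apply]
  refine hx.tendsto_of_tendsto hh ?_
  refine ((tendsto_floor_div_mul (mesh_pos hh) (tendsto_div_two_pow h) y).add hp).congr fun j => ?_
  push_cast; ring

/-- In the `θ`-integral the lattice shift tends to `θ z`, while the second difference is moved to
`φ` and tends to `φ''`. One derivative is then returned to the translated limit, which produces the
minus sign. -/
theorem tendsto_avgLap (hx : IsDyadicCauchy h A C x) (hh : h ∈ meshSizes) {φ : ℝ → ℝ}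
    (hφ : IsTestFunction φ) {z : ℝ} (hz : z ≠ 0) :
    Tendsto (fun j => h / 2 ^ j * inner ℝ (avgLap (h / 2 ^ j) 1 (cidx (h / 2 ^ j) z) (x j))
      (gridOf φ (h / 2 ^ j))) atTop
      (𝓝 (-∫ θ in (0 : ℝ)..1, (1 - θ) * ∫ y, deriv (dyadicLim h x) (y + θ * z) * deriv φ y)) := by
  have hε := mesh_pos hh
  have hε1 := mesh_le_one hh
  have hε0 := tendsto_div_two_pow h
  have hφ2 : ContDiff ℝ 2 φ := hφ.contDiff_two
  have hK : ∀ j, 0 < (cidx (h / 2 ^ j) z).natAbs := fun j => by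
    rcases lt_or_gt_of_ne hz with h0 | h0
    · have := cidx_neg (hε j) h0; omega
    · have := cidx_pos (hε j) h0; omega
  obtain ⟨M, hM0, hM⟩ := (gridTendsto_gridOf hφ.continuous hφ.2 hε hε0).exists_norm_le hε hε1
  let p : ℕ → ℝ → ℤ := fun j θ =>
    1 * ((cidx (h / 2 ^ j) z).sign * ⌊((cidx (h / 2 ^ j) z).natAbs : ℝ) * θ⌋₊)
  let F : ℕ → ℝ → ℝ := fun j θ => (1 - θ) * (h / 2 ^ j * inner ℝ
    (lap (h / 2 ^ j) 1 (LevyFD.shift (p j θ) (x j))) (gridOf φ (h / 2 ^ j)))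
  have hF : ∀ j, IntervalIntegrable (F j) volume 0 1 ∧
      h / 2 ^ j * inner ℝ (avgLap (h / 2 ^ j) 1 (cidx (h / 2 ^ j) z) (x j)) (gridOf φ (h / 2 ^ j))
        = ∫ θ in (0 : ℝ)..1, F j θ := by
    intro j
    obtain ⟨h1, h2⟩ := avgLap_eq_integral (h / 2 ^ j) 1 (cidx (h / 2 ^ j) z) (hK j) (x j)
    let Λ : Seq →L[ℝ] ℝ := (h / 2 ^ j) • innerSL ℝ (gridOf φ (h / 2 ^ j))
    have hΛ : ∀ y, Λ y = h / 2 ^ j * inner ℝ y (gridOf φ (h / 2 ^ j)) := fun y => by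
      rw [real_inner_comm]; rfl
    have e : ∀ θ, Λ ((1 - θ) • lap (h / 2 ^ j) 1 (LevyFD.shift (p j θ) (x j))) = F j θ := fun θ => by
      rw [map_smul, hΛ, smul_eq_mul]
    constructor
    · have h3 := Λ.integrable_comp h1.1
      refine (intervalIntegrable_iff_integrableOn_Ioc_of_le zero_le_one).2 (h3.congr ?_)
      exact ae_of_all _ e
    · rw [← hΛ, h2, ← Λ.intervalIntegral_comp_comm h1]
      exact intervalIntegral.integral_congr fun θ _ => e θ
  simp only [fun j => (hF j).2]
  rw [← intervalIntegral.integral_neg]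
  refine intervalIntegral.tendsto_integral_filter_of_dominated_convergence (fun _ => √A * √M)
    (Eventually.of_forall fun j => by
      rw [uIoc_of_le zero_le_one]; exact (hF j).1.1.aestronglyMeasurable)
    (Eventually.of_forall fun j => ae_of_all _ fun θ hθ => ?_)
    (by simp) (ae_of_all _ fun θ hθ => ?_)
  · rw [uIoc_of_le zero_le_one] at hθ
    rw [norm_mul]
    have h1 : ‖1 - θ‖ ≤ 1 := by
      rw [Real.norm_eq_abs, _root_.abs_le]; constructor <;> linarith [hθ.1, hθ.2]
    have h2 : |h / 2 ^ j * inner ℝ (lap (h / 2 ^ j) 1 (LevyFD.shift (p j θ) (x j)))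
        (gridOf φ (h / 2 ^ j))| ≤ √A * √M := by
      refine abs_mul_inner_le (hε j) (hx.mul_norm_sq_le hh j (i := 2) (by norm_num) ?_) (hM j)
      rw [norm_lap_one]
      change ‖delta _ (delta _ (LevyFD.shift _ _))‖ ≤ _
      rw [Commute.apply (commute_delta_shift _ _), Commute.apply (commute_delta_shift _ _), norm_shift]
      exact le_rfl
    calc _ ≤ 1 * (√A * √M) := mul_le_mul h1 h2 (abs_nonneg _) zero_le_one
      _ = _ := one_mul _
  · rw [uIoc_of_le zero_le_one] at hθ
    -- The floor contributes an error of at most one lattice step to `θ` times the rounded jump.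
    have hp : Tendsto (fun j => (p j θ : ℝ) * (h / 2 ^ j)) atTop (𝓝 (θ * z)) := by
      have h1 := (tendsto_cidx hh z).const_mul θ
      have h2 : Tendsto (fun j => (p j θ : ℝ) * (h / 2 ^ j)
          - θ * ((cidx (h / 2 ^ j) z : ℝ) * (h / 2 ^ j))) atTop (𝓝 0) := by
        refine squeeze_zero_norm (fun j => ?_) hε0
        have h3 := Nat.floor_le (show 0 ≤ ((cidx (h / 2 ^ j) z).natAbs : ℝ) * θ by
          have := hθ.1; positivity)
        have h4 := Nat.lt_floor_add_one (((cidx (h / 2 ^ j) z).natAbs : ℝ) * θ)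
        have h5 : (cidx (h / 2 ^ j) z : ℝ)
            = (cidx (h / 2 ^ j) z).sign * ((cidx (h / 2 ^ j) z).natAbs : ℝ) := by
          rw [Nat.cast_natAbs]
          exact_mod_cast (Int.sign_mul_abs (cidx (h / 2 ^ j) z)).symm
        have h6 : |((cidx (h / 2 ^ j) z).sign : ℝ)| ≤ 1 := by
          rcases Int.sign_trichotomy (cidx (h / 2 ^ j) z) with h | h | h <;> rw [h] <;> simp
        have h7 : (p j θ : ℝ) * (h / 2 ^ j) - θ * ((cidx (h / 2 ^ j) z : ℝ) * (h / 2 ^ j))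
            = (cidx (h / 2 ^ j) z).sign * ((⌊((cidx (h / 2 ^ j) z).natAbs : ℝ) * θ⌋₊ : ℝ)
              - ((cidx (h / 2 ^ j) z).natAbs : ℝ) * θ) * (h / 2 ^ j) := by
          simp only [p]
          push_cast
          linear_combination (-θ * (h / 2 ^ j)) * h5
        rw [h7, Real.norm_eq_abs, abs_mul, abs_mul, abs_of_pos (hε j)]
        have h8 : |(⌊((cidx (h / 2 ^ j) z).natAbs : ℝ) * θ⌋₊ : ℝ)
            - ((cidx (h / 2 ^ j) z).natAbs : ℝ) * θ| ≤ 1 := by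
          rw [_root_.abs_le]; constructor <;> linarith
        have h9 := mul_le_mul h6 h8 (abs_nonneg _) zero_le_one
        calc _ ≤ 1 * 1 * (h / 2 ^ j) := mul_le_mul_of_nonneg_right h9 (hε j).le
          _ = _ := by ring
      simpa using h2.add h1
    have h1 := GridTendsto.tendsto_mul_inner hε hε1
      (w := fun j => LevyFD.shift (p j θ) (x j)) (fun j k => hx.abs_le hh j _)
      (hx.tendsto_shift hh hp) (gridTendsto_lap hφ2 hφ.2 hε hε1 hε0)
    have h2 := ((hx.isH1 hh).1.shift (θ * z)).integral_mul_deriv hφ.deriv.contDiff_one hφ.2.deriv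
    rw [h2] at h1
    have h3 := h1.const_mul (1 - θ)
    rw [mul_neg] at h3
    refine h3.congr fun j => ?_
    simp only [F, inner_lap_left]

/-- In contrast to `norm_avgLap_le`, this bound does not degenerate as the mesh tends to zero, which
dominated convergence in `z` and in time needs. -/
theorem norm_avgLap_le_delta (ε : ℝ) (k : ℤ) (y : Seq) : ‖avgLap ε 1 k y‖ ≤ ‖(delta ε ^ 2) y‖ := by
  rw [avgLap_apply]
  refine (norm_sum_le _ _).trans ?_
  have h1 : ∀ l ∈ Finset.range k.natAbs, ‖theta k l • lap ε 1 (LevyFD.shift (1 * (k.sign * l)) y)‖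
      ≤ theta k l * ‖(delta ε ^ 2) y‖ := by
    intro l hl
    rw [norm_smul, Real.norm_of_nonneg (theta_nonneg k (Finset.mem_range.1 hl)), norm_lap_one]
    refine mul_le_mul_of_nonneg_left ?_ (theta_nonneg k (Finset.mem_range.1 hl))
    change ‖delta _ (delta _ (LevyFD.shift _ _))‖ ≤ _
    rw [Commute.apply (commute_delta_shift _ _), Commute.apply (commute_delta_shift _ _), norm_shift]
    exact le_rfl
  refine (Finset.sum_le_sum h1).trans ?_
  rw [← Finset.sum_mul]
  have := mul_le_mul_of_nonneg_right (sum_theta_le k) (norm_nonneg ((delta ε ^ 2) y))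
  linarith [norm_nonneg ((delta ε ^ 2) y)]

/-- Dominated convergence in `z` with majorant a multiple of `z²`, integrable near the origin for a
Lévy measure. The first part is the bound used for dominated convergence in time. -/
theorem J1_bound_tendsto (hx : IsDyadicCauchy h A C x) (hh : h ∈ meshSizes) {ν : Measure ℝ}
    (hν : IsLevyMeasure ν) {φ : ℝ → ℝ} (hφ : IsTestFunction φ) {M : ℝ}
    (hM : ∀ j, h / 2 ^ j * ‖gridOf φ (h / 2 ^ j)‖ ^ 2 ≤ M) :
    (∀ j, |h / 2 ^ j * inner ℝ (J1op ν (h / 2 ^ j) 1 (x j)) (gridOf φ (h / 2 ^ j))|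
      ≤ mu2 ν * (√A * √M)) ∧
    Tendsto (fun j => h / 2 ^ j * inner ℝ (J1op ν (h / 2 ^ j) 1 (x j)) (gridOf φ (h / 2 ^ j))) atTop
      (𝓝 (-∫ z in {z : ℝ | |z| ≤ 1}, (∫ θ in (0 : ℝ)..1,
          (1 - θ) * z ^ 2 * ∫ y, deriv (dyadicLim h x) (y + θ * z) * deriv φ y) ∂ν)) := by
  have hε := mesh_pos hh
  let F : ℕ → ℝ → ℝ := fun j z => z ^ 2 * (h / 2 ^ j * inner ℝ
    (avgLap (h / 2 ^ j) 1 (cidx (h / 2 ^ j) z) (x j)) (gridOf φ (h / 2 ^ j)))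
  have hF : ∀ j, IntegrableOn (F j) (Icc (-1) 1) ν ∧
      h / 2 ^ j * inner ℝ (J1op ν (h / 2 ^ j) 1 (x j)) (gridOf φ (h / 2 ^ j))
        = ∫ z in Icc (-1) 1, F j z ∂ν := by
    intro j
    let Λ : Seq →L[ℝ] ℝ := (h / 2 ^ j) • innerSL ℝ (gridOf φ (h / 2 ^ j))
    have hΛ : ∀ y, Λ y = h / 2 ^ j * inner ℝ y (gridOf φ (h / 2 ^ j)) := fun y => by
      rw [real_inner_comm]; rfl
    have e : ∀ z, Λ (z ^ 2 • avgLap (h / 2 ^ j) 1 (cidx (h / 2 ^ j) z) (x j)) = F j z := fun z => by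
      rw [map_smul, hΛ, smul_eq_mul]
    have h1 := integrable_J1_apply hν (h / 2 ^ j) 1 (x j)
    constructor
    · exact (Λ.integrable_comp h1).congr (ae_of_all _ e)
    · rw [← hΛ, J1op_apply hν, ← Λ.integral_comp_comm h1]
      exact integral_congr_ae (ae_of_all _ e)
  have hb : ∀ j z, ‖F j z‖ ≤ z ^ 2 * (√A * √M) := by
    intro j z
    rw [norm_mul, Real.norm_of_nonneg (sq_nonneg z)]
    refine mul_le_mul_of_nonneg_left ?_ (sq_nonneg z)
    exact abs_mul_inner_le (hε j) (hx.mul_norm_sq_le hh j (i := 2) (by norm_num)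
      (norm_avgLap_le_delta _ _ _)) (hM j)
  have hset : {z : ℝ | |z| ≤ 1} = Icc (-1) 1 := by ext z; simp [_root_.abs_le]
  refine ⟨fun j => ?_, ?_⟩
  · rw [(hF j).2, mu2, ← integral_mul_const]
    exact norm_integral_le_of_norm_le (hν.integrableOn_sq.mul_const _) (ae_of_all _ (hb j))
  · simp only [fun j => (hF j).2]
    rw [hset, ← integral_neg]
    refine tendsto_integral_of_dominated_convergence (fun z => z ^ 2 * (√A * √M))
      (fun j => (hF j).1.aestronglyMeasurable) (hν.integrableOn_sq.mul_const _)
      (fun j => ae_of_all _ (hb j)) (ae_of_all _ fun z => ?_)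
    have e : ∀ θ : ℝ, (1 - θ) * z ^ 2 * ∫ y, deriv (dyadicLim h x) (y + θ * z) * deriv φ y
        = z ^ 2 * ((1 - θ) * ∫ y, deriv (dyadicLim h x) (y + θ * z) * deriv φ y) := fun θ => by ring
    simp only [e, intervalIntegral.integral_const_mul]
    rcases eq_or_ne z 0 with rfl | hz
    · simp [F]
    · rw [← mul_neg]
      exact (hx.tendsto_avgLap hh hφ hz).const_mul _

/-- The integrand is bounded and the large jumps have finite mass; no difference of the lattice
functions is used. -/
theorem J2_bound_tendsto (hx : IsDyadicCauchy h A C x) (hh : h ∈ meshSizes) {ν : Measure ℝ}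
    (hν : IsLevyMeasure ν) {φ : ℝ → ℝ} (hφ : IsTestFunction φ) {M : ℝ}
    (hM : ∀ j, h / 2 ^ j * ‖gridOf φ (h / 2 ^ j)‖ ^ 2 ≤ M) :
    (∀ j, |h / 2 ^ j * inner ℝ (J2op ν (h / 2 ^ j) 1 (x j)) (gridOf φ (h / 2 ^ j))|
      ≤ mu0 ν * (2 * (√A * √M))) ∧
    Tendsto (fun j => h / 2 ^ j * inner ℝ (J2op ν (h / 2 ^ j) 1 (x j)) (gridOf φ (h / 2 ^ j))) atTop
      (𝓝 (∫ z in {z : ℝ | 1 < |z|},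
          (∫ y, (dyadicLim h x (y + z) - dyadicLim h x y) * φ y) ∂ν)) := by
  have hε := mesh_pos hh
  have hε1 := mesh_le_one hh
  have hε0 := tendsto_div_two_pow h
  let F : ℕ → ℝ → ℝ := fun j z => h / 2 ^ j * inner ℝ
    (LevyFD.shift (1 * cidx (h / 2 ^ j) z) (x j) - x j) (gridOf φ (h / 2 ^ j))
  have hF : ∀ j, IntegrableOn (F j) (Icc (-1) 1)ᶜ ν ∧
      h / 2 ^ j * inner ℝ (J2op ν (h / 2 ^ j) 1 (x j)) (gridOf φ (h / 2 ^ j))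
        = ∫ z in (Icc (-1) 1)ᶜ, F j z ∂ν := by
    intro j
    let Λ : Seq →L[ℝ] ℝ := (h / 2 ^ j) • innerSL ℝ (gridOf φ (h / 2 ^ j))
    have hΛ : ∀ y, Λ y = h / 2 ^ j * inner ℝ y (gridOf φ (h / 2 ^ j)) := fun y => by
      rw [real_inner_comm]; rfl
    have e : ∀ z, Λ (LevyFD.shift (1 * cidx (h / 2 ^ j) z) (x j) - x j) = F j z := fun z => hΛ _
    have h1 := integrable_J2_apply hν (h / 2 ^ j) 1 (x j)
    constructor
    · exact (Λ.integrable_comp h1).congr (ae_of_all _ e)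
    · rw [← hΛ, J2op_apply hν, ← Λ.integral_comp_comm h1]
      exact integral_congr_ae (ae_of_all _ e)
  have hb : ∀ j z, ‖F j z‖ ≤ 2 * (√A * √M) := by
    intro j z
    have h1 := abs_mul_inner_le (hε j) (y := LevyFD.shift (1 * cidx (h / 2 ^ j) z) (x j))
      (hx.mul_norm_sq_le hh j (i := 0) (by norm_num) (by simp)) (hM j)
    have h2 := abs_mul_inner_le (hε j) (y := x j)
      (hx.mul_norm_sq_le hh j (i := 0) (by norm_num) (by simp)) (hM j)
    simp only [F]
    rw [inner_sub_left, mul_sub]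
    exact (norm_sub_le _ _).trans (by rw [Real.norm_eq_abs, Real.norm_eq_abs]; linarith)
  have hset : {z : ℝ | 1 < |z|} = (Icc (-1) 1)ᶜ := by
    ext z; simp [← _root_.abs_le]
  refine ⟨fun j => ?_, ?_⟩
  · have hfin : ν (Icc (-1 : ℝ) 1)ᶜ < ⊤ := hν.measure_compl_lt_top
    have := norm_setIntegral_le_of_norm_le_const hfin (fun z _ => hb j z)
    rw [(hF j).2, mu0, mul_comm]
    exact this
  · simp only [fun j => (hF j).2]
    rw [hset]
    refine tendsto_integral_of_dominated_convergence (fun z => 2 * (√A * √M))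
      (fun j => (hF j).1.aestronglyMeasurable) (integrableOn_const hν.measure_compl_lt_top.ne)
      (fun j => ae_of_all _ (hb j)) (ae_of_all _ fun z => ?_)
    have hp : Tendsto (fun j => ((1 * cidx (h / 2 ^ j) z : ℤ) : ℝ) * (h / 2 ^ j)) atTop (𝓝 z) := by
      simpa using tendsto_cidx hh z
    refine GridTendsto.tendsto_mul_inner hε hε1 (B := 2 * √(2 * A)) (fun j k => ?_) (fun y => ?_)
      (gridTendsto_gridOf hφ.continuous hφ.2 hε hε0)
    · have h1 := hx.abs_le hh j (k + 1 * cidx (h / 2 ^ j) z)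
      have h2 := hx.abs_le hh j k
      rw [Seq.sub_apply, shift_apply]
      exact (abs_sub _ _).trans (by linarith)
    · exact (hx.tendsto_shift hh hp y).sub (hx.tendsto_floor hh y)

theorem abs_localOp_le (hx : IsDyadicCauchy h A C x) (hh : h ∈ meshSizes) {a b c : ℝ → ℝ} {K : ℝ}
    (ha : ∀ x, |a x| ≤ K) (hb : ∀ x, |b x| ≤ K) (hc : ∀ x, |c x| ≤ K) {g : Seq} {j : ℕ} {M : ℝ}
    (hM : h / 2 ^ j * ‖g‖ ^ 2 ≤ M) :
    |h / 2 ^ j * inner ℝ (localOp a b c (h / 2 ^ j) (x j)) g| ≤ 3 * (√(K ^ 2 * A) * √M) := by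
  have hε := mesh_pos hh j
  have hK : 0 ≤ K := (abs_nonneg _).trans (ha 0)
  have hc1 : ∀ y, ‖cdiff (h / 2 ^ j) 1 y‖ ≤ ‖delta (h / 2 ^ j) y‖ := fun y => by
    simpa using norm_cdiff_le hε one_pos y
  have hm : ∀ {f : ℝ → ℝ} {y : Seq} {i : ℕ}, (∀ x, |f x| ≤ K) → i ≤ 4 →
      ‖y‖ ≤ ‖(delta (h / 2 ^ j) ^ i) (x j)‖ →
      |h / 2 ^ j * inner ℝ (mulOp (fun k => f (k * (h / 2 ^ j))) y) g| ≤ √(K ^ 2 * A) * √M := by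
    intro f y i hf hi hy
    refine abs_mul_inner_le hε ?_ hM
    have h1 := norm_mulOp_le (fun k : ℤ => hf (k * (h / 2 ^ j))) y
    have h2 := hx.mul_norm_sq_le hh j hi hy
    calc _ ≤ h / 2 ^ j * (K * ‖y‖) ^ 2 := by gcongr
      _ = K ^ 2 * (h / 2 ^ j * ‖y‖ ^ 2) := by ring
      _ ≤ _ := by gcongr
  have h1 := hm (y := cdiff (h / 2 ^ j) 1 (cdiff (h / 2 ^ j) 1 (x j))) (i := 2) ha (by norm_num) (by
    refine (hc1 _).trans ?_
    rw [Commute.apply (commute_delta_cdiff _ _ _)]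
    exact hc1 _)
  have h2 := hm (y := cdiff (h / 2 ^ j) 1 (x j)) (i := 1) hb (by norm_num) (by
    simpa using hc1 (x j))
  have h3 := hm (y := x j) (i := 0) hc (by norm_num) (by simp)
  rw [localOp, inner_add_left, inner_add_left, mul_add, mul_add]
  refine (abs_add_three _ _ _).trans ?_
  linarith

end IsDyadicCauchy

end
end LevyFD

namespace LevyFD
noncomputable section
open Filter Topology

/-! ### The limit of the schemes solves the equation -/

/-- An absolutely continuous function in `H¹` as an element of `H¹`. -/
def IsH1.toH {g g' : ℝ → ℝ} (h : IsH1 g g') : H 1 :=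
  H.mk h.memLp.toLp h.memLp'.toLp (by
    intro φ hφ
    have e0 : ∫ x, (h.memLp.toLp : Lp ℝ 2 (volume : Measure ℝ)) x * deriv φ x
        = ∫ x, g x * deriv φ x :=
      integral_congr_ae (h.memLp.coeFn_toLp.mono fun x hx => by simp only [hx])
    have e1 : ∫ x, (h.memLp'.toLp : Lp ℝ 2 (volume : Measure ℝ)) x * φ x = ∫ x, g' x * φ x :=
      integral_congr_ae (h.memLp'.coeFn_toLp.mono fun x hx => by simp only [hx])
    rw [e0, e1, h.integral_mul_deriv hφ.contDiff_one hφ.2, neg_neg])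

theorem IsH1.toH_D_zero {g g' : ℝ → ℝ} (h : IsH1 g g') : h.toH.D 0 =ᵐ[volume] g :=
  h.memLp.coeFn_toLp

theorem IsH1.toH_D_one {g g' : ℝ → ℝ} (h : IsH1 g g') : h.toH.D 1 =ᵐ[volume] g' :=
  h.memLp'.coeFn_toLp

theorem IsH1.eval_toH {g g' : ℝ → ℝ} (h : IsH1 g g') : h.toH.eval = g :=
  contRep_eq h.continuous h.toH_D_zero.symm

theorem IsH1.norm_toH_sq {g g' : ℝ → ℝ} (h : IsH1 g g') :
    ‖h.toH‖ ^ 2 = (∫ x, g x ^ 2) + ∫ x, g' x ^ 2 := by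
  rw [← H.integral_D_sq_add_one]
  congr 1
  · exact integral_congr_ae (h.toH_D_zero.mono fun x hx => by simp only [hx])
  · exact integral_congr_ae (h.toH_D_one.mono fun x hx => by simp only [hx])

theorem H.inner_toH (g : H 1) {φ : ℝ → ℝ} (hφ : IsTestFunction φ) :
    inner ℝ g hφ.toH = (∫ x, g.D 0 x * φ x) + ∫ x, g.D 1 x * deriv φ x := by
  rw [H.inner_one]
  congr 1
  · exact (integral_mul_toLp _ hφ.memLp).symm
  · exact (integral_mul_toLp _ hφ.deriv.memLp).symm

section

variable {m : ℕ} {K T : ℝ} {ν : Measure ℝ} {a b c : ℝ → ℝ → ℝ} {ψ : H m} {f : ℝ → H m} {h : ℝ}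

/-- Solutions of the schemes on the dyadic refinements of a grid. -/
theorem exists_isDyadicCauchy (hν : IsLevyMeasure ν) (hT : 0 ≤ T) (hc : Coeffs K a b c) (hm : 4 ≤ m)
    (hf : MemLp f 2 (volume.restrict (Icc 0 T))) (hh : h ∈ meshSizes) {v : ℝ → Seq}
    (hv : IsScheme T ν a b c ψ f h 1 v) : ∃ V : ℕ → ℝ → Seq,
      (∀ j, IsScheme T ν a b c ψ f (h / 2 ^ j) 1 (V j)) ∧ (∀ t ∈ Icc 0 T, V 0 t = v t) ∧
      ∀ t ∈ Icc 0 T, IsDyadicCauchy h (20 * dataSq T ψ f * Real.exp ((480 * K + 1) * T))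
        (compConst K (mu0 ν) (mu2 ν) T * dataSq T ψ f) fun j => V j t := by
  have hε := IsDyadicCauchy.mesh_pos hh
  have hε1 := IsDyadicCauchy.mesh_le_one hh
  choose V hV using fun j => exists_isScheme hT hc ν hm ψ hf (hε j) (hε1 j) 1
  refine ⟨V, hV, ?_, fun t ht => ⟨fun j => ?_, fun j => ?_⟩⟩
  · have h0 := hV 0
    rw [pow_zero, div_one] at h0
    exact h0.unique hc hm hf (pos_of_mem_meshSizes hh).1 (pos_of_mem_meshSizes hh).2 hv
  · exact (hV j).sobSq_le hν hc hm hf (hε j) (hε1 j) (Or.inl rfl) t ht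
  -- `W` extends the scheme of level `j` to the lattice of level `j + 1` with stride two. By
  -- uniqueness its even part is `V j`, so `W - V (j + 1)` witnesses the step.
  · obtain ⟨W, hW⟩ := exists_isScheme hT hc ν hm ψ hf (hε (j + 1)) (hε1 (j + 1)) 2
    have e : 2 * (h / 2 ^ (j + 1)) = h / 2 ^ j := by rw [pow_succ]; field_simp
    have hWr := hW.restrictEven hν hc hm hf (hε (j + 1)) (by rw [e]; exact hε1 j)
    rw [e] at hWr
    have hu := hWr.unique hc hm hf (hε j) (hε1 j) (hV j) t ht
    refine ⟨W t - V (j + 1) t, ?_, ?_⟩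
    · rw [map_sub, ← hu]
    · refine (hW.sobSq_sub_le hν hc hm hf (hε _) (hε1 _) (hV (j + 1)) t ht).trans (le_of_eq ?_)
      ring

variable {A C : ℝ} {V : ℕ → ℝ → Seq}

/-- The geometric bound on the remaining increments is independent of time, so the limit is uniform
in `t`. -/
theorem continuousOn_dyadicLim (hh : h ∈ meshSizes) (hV : ∀ j, ContinuousOn (V j) (Icc 0 T))
    (hx : ∀ t ∈ Icc 0 T, IsDyadicCauchy h A C fun j => V j t) (y : ℝ) :
    ContinuousOn (fun t => dyadicLim h (fun j => V j t) y) (Icc 0 T) := by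
  have hu : TendstoUniformlyOn (fun j t => V j t ⌊y / (h / 2 ^ j)⌋)
      (fun t => dyadicLim h (fun j => V j t) y) atTop (Icc 0 T) := by
    rw [Metric.tendstoUniformlyOn_iff]
    intro r hr
    have := (tendsto_div_two_pow ((√(2 * C) + √(2 * A)) * h)).eventually (gt_mem_nhds hr)
    filter_upwards [this] with j hj t ht
    rw [dist_comm]
    exact ((hx t ht).abs_sub_dyadicLim_le hh y j).trans_lt hj
  refine hu.continuousOn (Frequently.of_forall fun j => ?_)
  exact (coord ⌊y / (h / 2 ^ j)⌋).continuous.comp_continuousOn (hV j)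

theorem continuousOn_integral_dyadicLim (hh : h ∈ meshSizes)
    (hV : ∀ j, ContinuousOn (V j) (Icc 0 T))
    (hx : ∀ t ∈ Icc 0 T, IsDyadicCauchy h A C fun j => V j t) {g : ℝ → ℝ} (hg : Continuous g)
    (hs : HasCompactSupport g) :
    ContinuousOn (fun t => ∫ y, dyadicLim h (fun j => V j t) y * g y) (Icc 0 T) := by
  refine continuousOn_of_dominated (bound := fun y => √(2 * A) * |g y|) (fun t ht => ?_)
    (fun t ht => ae_of_all _ fun y => ?_) ?_ (ae_of_all _ fun y => ?_)
  · exact (((hx t ht).lipschitz hh).continuous.mul hg).aestronglyMeasurable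
  · rw [norm_mul]
    exact mul_le_mul_of_nonneg_right ((hx t ht).abs_dyadicLim_le hh y) (abs_nonneg _)
  · exact ((hg.integrable_of_hasCompactSupport hs).abs).const_mul _
  · exact (continuousOn_dyadicLim hh hV hx y).mul continuousOn_const

open Classical in
/-- The limit of the schemes, as a function with values in `H¹`. -/
def limitSolution (h : ℝ) (V : ℕ → ℝ → Seq) (t : ℝ) : H 1 :=
  if hx : IsH1 (dyadicLim h fun j => V j t) (deriv (dyadicLim h fun j => V j t)) then hx.toH else 0

theorem limitSolution_spec (hh : h ∈ meshSizes) {t : ℝ}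
    (hx : IsDyadicCauchy h A C fun j => V j t) :
    (limitSolution h V t).D 0 =ᵐ[volume] dyadicLim h (fun j => V j t) ∧
    (limitSolution h V t).D 1 =ᵐ[volume] deriv (dyadicLim h fun j => V j t) ∧
    (limitSolution h V t).eval = dyadicLim h (fun j => V j t) ∧
    ‖limitSolution h V t‖ ^ 2 ≤ 2 * A := by
  obtain ⟨h1, h2⟩ := hx.isH1 hh
  have e : limitSolution h V t = h1.toH := by rw [limitSolution, dif_pos h1]
  rw [e]
  refine ⟨h1.toH_D_zero, h1.toH_D_one, h1.eval_toH, ?_⟩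
  rw [h1.norm_toH_sq]
  linarith [(hx.memLp hh).2]

/-- Against a test function the `H¹` pairing is rewritten, by parts, without derivatives of the
limit, and is continuous. Density of test functions and the uniform `H¹` bound extend this to every
`w`. -/
theorem limitSolution_weaklyContinuous (hh : h ∈ meshSizes)
    (hV : ∀ j, ContinuousOn (V j) (Icc 0 T))
    (hx : ∀ t ∈ Icc 0 T, IsDyadicCauchy h A C fun j => V j t) (w : H 1) :
    ContinuousOn (fun t => inner ℝ (limitSolution h V t) w) (Icc 0 T) := by
  have htest : ∀ φ, ∀ hφ : IsTestFunction φ,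
      ContinuousOn (fun t => inner ℝ (limitSolution h V t) hφ.toH) (Icc 0 T) := by
    intro φ hφ
    have h1 := continuousOn_integral_dyadicLim hh hV hx hφ.continuous hφ.2
    have h2 := continuousOn_integral_dyadicLim hh hV hx hφ.deriv.deriv.continuous
      hφ.deriv.deriv.2
    refine (h1.sub h2).congr fun t ht => ?_
    obtain ⟨s0, s1, -, -⟩ := limitSolution_spec hh (hx t ht)
    have e := ((hx t ht).isH1 hh).1.integral_mul_deriv hφ.deriv.contDiff_one hφ.2.deriv
    simp only [Pi.sub_apply]
    rw [e, H.inner_toH, sub_neg_eq_add]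
    congr 1
    · exact integral_congr_ae (s0.mono fun x hx => by simp only [hx])
    · exact integral_congr_ae (s1.mono fun x hx => by simp only [hx])
  refine continuousOn_of_uniform_approx_of_continuousOn fun u hu => ?_
  obtain ⟨r, hr, hru⟩ := Metric.mem_uniformity_dist.1 hu
  have hB : 0 < √(2 * A) + 1 := by positivity
  obtain ⟨⟨φ, hφ⟩, hd⟩ := denseRange_toH.exists_dist_lt w (div_pos hr hB)
  refine ⟨_, htest φ hφ, fun t ht => hru ?_⟩
  rw [Real.dist_eq, ← inner_sub_right]
  have hn : ‖limitSolution h V t‖ ≤ √(2 * A) :=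
    Real.le_sqrt_of_sq_le (limitSolution_spec hh (hx t ht)).2.2.2
  rw [dist_eq_norm] at hd
  calc _ ≤ ‖limitSolution h V t‖ * ‖w - hφ.toH‖ := abs_real_inner_le_norm _ _
    _ ≤ (√(2 * A) + 1) * ‖w - hφ.toH‖ :=
        mul_le_mul_of_nonneg_right (by linarith) (norm_nonneg _)
    _ < (√(2 * A) + 1) * (r / (√(2 * A) + 1)) := mul_lt_mul_of_pos_left hd hB
    _ = r := by field_simp

theorem tendsto_toGrid (hm : 4 ≤ m) (hh : h ∈ meshSizes) (g : H m) {φ : ℝ → ℝ}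
    (hφ : IsTestFunction φ) :
    Tendsto (fun j => h / 2 ^ j * inner ℝ (g.toGrid (h / 2 ^ j)) (gridOf φ (h / 2 ^ j))) atTop
      (𝓝 (∫ y, g.D 0 y * φ y)) := by
  have hε := IsDyadicCauchy.mesh_pos hh
  have hε1 := IsDyadicCauchy.mesh_le_one hh
  have hε0 := tendsto_div_two_pow h
  have key := GridTendsto.tendsto_mul_inner hε hε1 (w := fun j => g.toGrid (h / 2 ^ j))
    (W := g.eval) (B := 2 * ‖g‖)
    (fun j k => by
      rw [H.toGrid_apply (by omega) g (hε j) (hε1 j)]; exact g.abs_eval_le (by omega) _)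
    (fun y => by
      simp only [H.toGrid_apply (by omega : 1 ≤ m) g (hε _) (hε1 _)]
      exact ((g.isH1_eval (by omega)).continuous.tendsto y).comp
        (tendsto_floor_div_mul hε hε0 y))
    (gridTendsto_gridOf hφ.continuous hφ.2 hε hε0)
  convert key using 2
  exact integral_congr_ae ((g.eval_ae (by omega)).mono fun x hx => by simp only [hx])

theorem toGrid_bound (hm : 4 ≤ m) (hh : h ∈ meshSizes) (g : H m) {y : Seq} {M : ℝ} {j : ℕ}
    (hM : h / 2 ^ j * ‖y‖ ^ 2 ≤ M) :
    |h / 2 ^ j * inner ℝ (g.toGrid (h / 2 ^ j)) y| ≤ √20 * √M * ‖g‖ := by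
  have hε := IsDyadicCauchy.mesh_pos hh j
  have h1 := g.sobSq_toGrid_le hm hε (IsDyadicCauchy.mesh_le_one hh j)
  have h2 := sq_le_sobSq (h / 2 ^ j) (Nat.zero_le 4) (g.toGrid (h / 2 ^ j))
  simp only [pow_zero, one_apply_eq_self] at h2
  have h3 := IsDyadicCauchy.abs_mul_inner_le hε
    ((mul_le_mul_of_nonneg_left h2 hε.le).trans h1) hM
  refine h3.trans (le_of_eq ?_)
  rw [Real.sqrt_mul (by norm_num), Real.sqrt_sq (norm_nonneg _)]
  ring

/-- The equation satisfied by the limit, tested with a smooth function. -/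
theorem dyadicLim_equation (hν : IsLevyMeasure ν) (hc : Coeffs K a b c) (hm : 4 ≤ m)
    (hf : MemLp f 2 (volume.restrict (Icc 0 T))) (hh : h ∈ meshSizes)
    (hV : ∀ j, IsScheme T ν a b c ψ f (h / 2 ^ j) 1 (V j))
    (hx : ∀ t ∈ Icc 0 T, IsDyadicCauchy h A C fun j => V j t) {φ : ℝ → ℝ} (hφ : IsTestFunction φ)
    {t : ℝ} (ht : t ∈ Icc 0 T) :
    ∫ x, dyadicLim h (fun j => V j t) x * φ x =
      (∫ x, ψ.D 0 x * φ x)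
      + (∫ s in (0 : ℝ)..t,
          ((∫ x, deriv (dyadicLim h fun j => V j s) x
              * (-(φ x * deriv (a s) x) - a s x * deriv φ x + b s x * φ x))
            + ∫ x, c s x * dyadicLim h (fun j => V j s) x * φ x))
      - (∫ s in (0 : ℝ)..t, ∫ z in {z : ℝ | |z| ≤ 1}, (∫ θ in (0 : ℝ)..1,
          (1 - θ) * z ^ 2 * ∫ x, deriv (dyadicLim h fun j => V j s) (x + θ * z) * deriv φ x) ∂ν)
      + (∫ s in (0 : ℝ)..t, ∫ z in {z : ℝ | 1 < |z|},
          (∫ x, (dyadicLim h (fun j => V j s) (x + z) - dyadicLim h (fun j => V j s) x) * φ x) ∂ν)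
      + ∫ s in (0 : ℝ)..t, ∫ x, (f s).D 0 x * φ x := by
  have hε := IsDyadicCauchy.mesh_pos hh
  have hε1 := IsDyadicCauchy.mesh_le_one hh
  have hε0 := tendsto_div_two_pow h
  have hsub : uIcc 0 t ⊆ Icc 0 T := uIcc_subset_Icc (left_mem_Icc.2 (ht.1.trans ht.2)) ht
  have hsub' : uIoc 0 t ⊆ Icc 0 T := uIoc_subset_uIcc.trans hsub
  obtain ⟨M, hM0, hM⟩ := (gridTendsto_gridOf hφ.continuous hφ.2 hε hε0).exists_norm_le hε hε1
  let Λ : ℕ → Seq →L[ℝ] ℝ := fun j => (h / 2 ^ j) • innerSL ℝ (gridOf φ (h / 2 ^ j))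
  have hΛ : ∀ j y, Λ j y = h / 2 ^ j * inner ℝ y (gridOf φ (h / 2 ^ j)) := fun j y => by
    rw [real_inner_comm]; rfl
  let P1 : ℕ → ℝ → Seq := fun j s => localOp (a s) (b s) (c s) (h / 2 ^ j) (V j s)
  let P2 : ℕ → ℝ → Seq := fun j s => J1op ν (h / 2 ^ j) 1 (V j s)
  let P3 : ℕ → ℝ → Seq := fun j s => J2op ν (h / 2 ^ j) 1 (V j s)
  let P4 : ℕ → ℝ → Seq := fun j s => (f s).toGrid (h / 2 ^ j)
  have i2 : ∀ j, IntegrableOn (P2 j) (Icc 0 T) := fun j =>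
    ((J1op ν (h / 2 ^ j) 1).continuous.comp_continuousOn (hV j).continuousOn).integrableOn_Icc
  have i3 : ∀ j, IntegrableOn (P3 j) (Icc 0 T) := fun j =>
    ((J2op ν (h / 2 ^ j) 1).continuous.comp_continuousOn (hV j).continuousOn).integrableOn_Icc
  have i4 : ∀ j, IntegrableOn (P4 j) (Icc 0 T) := fun j => integrableOn_toGrid hm hf (hε j) (hε1 j)
  have i1 : ∀ j, IntegrableOn (P1 j) (Icc 0 T) := fun j => by
    have := (hc.integrableOn_schemeOp ν (h / 2 ^ j) 1 (hV j).continuousOn).sub ((i2 j).add (i3 j))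
    refine this.congr (ae_of_all _ fun s => ?_)
    simp only [Pi.sub_apply, Pi.add_apply, P1, P2, P3, schemeOp_one]
    abel
  have hint : ∀ {P : ℕ → ℝ → Seq}, (∀ j, IntegrableOn (P j) (Icc 0 T)) → ∀ j,
      IntervalIntegrable (P j) volume 0 t := fun hP j => ((hP j).mono_set hsub).intervalIntegrable
  have hΛi : ∀ {P : ℕ → ℝ → Seq}, (∀ j, IntegrableOn (P j) (Icc 0 T)) → ∀ j,
      IntervalIntegrable (fun s => Λ j (P j s)) volume 0 t := fun hP j =>
    (IntegrableOn.mono_set ((Λ j).integrable_comp (hP j)) hsub).intervalIntegrable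
  have heq : ∀ j, Λ j (V j t) = Λ j (ψ.toGrid (h / 2 ^ j)) + ((∫ s in (0 : ℝ)..t, Λ j (P1 j s))
      + (∫ s in (0 : ℝ)..t, Λ j (P2 j s)) + (∫ s in (0 : ℝ)..t, Λ j (P3 j s))
      + ∫ s in (0 : ℝ)..t, Λ j (P4 j s)) := by
    intro j
    rw [(hV j).equation t ht, map_add, ← (Λ j).intervalIntegral_comp_comm
      (((hV j).integrableOn hc hm hf (hε j) (hε1 j)).mono_set hsub).intervalIntegrable,
      ← intervalIntegral.integral_add (hΛi i1 j) (hΛi i2 j),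
      ← intervalIntegral.integral_add ((hΛi i1 j).add (hΛi i2 j)) (hΛi i3 j),
      ← intervalIntegral.integral_add (((hΛi i1 j).add (hΛi i2 j)).add (hΛi i3 j)) (hΛi i4 j)]
    congr 2
    ext1 s
    rw [schemeOp_one, map_add, map_add, map_add, ← add_assoc]
  -- One dominated convergence argument in time serves the local, small jump, large jump and forcing
  -- terms alike.
  have hdom : ∀ {P : ℕ → ℝ → Seq} {G g : ℝ → ℝ}, (∀ j, IntegrableOn (P j) (Icc 0 T)) →
      IntegrableOn g (Icc 0 T) → (∀ j, ∀ s ∈ Icc 0 T, |Λ j (P j s)| ≤ g s) →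
      (∀ s ∈ Icc 0 T, Tendsto (fun j => Λ j (P j s)) atTop (𝓝 (G s))) →
      Tendsto (fun j => ∫ s in (0 : ℝ)..t, Λ j (P j s)) atTop (𝓝 (∫ s in (0 : ℝ)..t, G s)) := by
    intro P G g hP hg hb hl
    refine intervalIntegral.tendsto_integral_filter_of_dominated_convergence g
      (Eventually.of_forall fun j => ?_) (Eventually.of_forall fun j => ae_of_all _ fun s hs => ?_)
      (hg.mono_set hsub).intervalIntegrable (ae_of_all _ fun s hs => ?_)
    · exact (IntegrableOn.mono_set ((Λ j).integrable_comp (hP j)) hsub').aestronglyMeasurable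
    · exact hb j s (hsub' hs)
    · exact hl s (hsub' hs)
  have t0 : Tendsto (fun j => Λ j (V j t)) atTop (𝓝 (∫ x, dyadicLim h (fun j => V j t) x * φ x)) := by
    simp only [hΛ]
    exact GridTendsto.tendsto_mul_inner hε hε1 ((hx t ht).abs_le hh) ((hx t ht).tendsto_floor hh)
      (gridTendsto_gridOf hφ.continuous hφ.2 hε hε0)
  have tψ : Tendsto (fun j => Λ j (ψ.toGrid (h / 2 ^ j))) atTop (𝓝 (∫ x, ψ.D 0 x * φ x)) := by
    simp only [hΛ]
    exact tendsto_toGrid hm hh ψ hφ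
  have t1 := hdom i1 (g := fun _ => 3 * (√(K ^ 2 * A) * √M)) (integrableOn_const (by simp))
    (fun j s hs => by
      rw [hΛ]
      exact (hx s hs).abs_localOp_le hh (hc.abs_a_le s) (hc.abs_b_le s) (hc.abs_c_le s) (hM j))
    (fun s hs => by
      simp only [hΛ]
      exact (hx s hs).tendsto_localOp hh (hc.abs_a_le s) (hc.abs_b_le s) (hc.abs_c_le s)
        ((hc.contDiff_a s).of_le (by norm_num)) ((hc.contDiff_b s).of_le (by norm_num))
        (hc.contDiff_c s).continuous hφ)
  have t2 := hdom i2 (g := fun _ => mu2 ν * (√A * √M)) (integrableOn_const (by simp))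
    (fun j s hs => by rw [hΛ]; exact ((hx s hs).J1_bound_tendsto hh hν hφ hM).1 j)
    (fun s hs => by simp only [hΛ]; exact ((hx s hs).J1_bound_tendsto hh hν hφ hM).2)
  have t3 := hdom i3 (g := fun _ => mu0 ν * (2 * (√A * √M))) (integrableOn_const (by simp))
    (fun j s hs => by rw [hΛ]; exact ((hx s hs).J2_bound_tendsto hh hν hφ hM).1 j)
    (fun s hs => by simp only [hΛ]; exact ((hx s hs).J2_bound_tendsto hh hν hφ hM).2)
  have t4 := hdom i4 (g := fun s => √20 * √M * ‖f s‖)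
    ((hf.integrable one_le_two).norm.const_mul _)
    (fun j s hs => by rw [hΛ]; exact toGrid_bound hm hh (f s) (hM j))
    (fun s hs => by simp only [hΛ]; exact tendsto_toGrid hm hh (f s) hφ)
  have hfin := tψ.add (((t1.add t2).add t3).add t4)
  simp only [← heq] at hfin
  rw [tendsto_nhds_unique t0 hfin, intervalIntegral.integral_neg]
  ring

theorem ae_eq_shift {g g' : ℝ → ℝ} (h : g =ᵐ[volume] g') (p : ℝ) :
    (fun x => g (x + p)) =ᵐ[volume] fun x => g' (x + p) :=
  (measurePreserving_add_right volume p).quasiMeasurePreserving.ae_eq_comp h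

theorem limitSolution_isSolution (hν : IsLevyMeasure ν) (hc : Coeffs K a b c) (hm : 4 ≤ m)
    (hf : MemLp f 2 (volume.restrict (Icc 0 T))) (hh : h ∈ meshSizes)
    (hV : ∀ j, IsScheme T ν a b c ψ f (h / 2 ^ j) 1 (V j))
    (hx : ∀ t ∈ Icc 0 T, IsDyadicCauchy h A C fun j => V j t) :
    IsSolution T ν a b c ψ f (limitSolution h V) where
  weaklyContinuous := limitSolution_weaklyContinuous hh (fun j => (hV j).continuousOn) hx
  equation φ hφ t ht := by
    have hsub : uIcc 0 t ⊆ Icc 0 T := uIcc_subset_Icc (left_mem_Icc.2 (ht.1.trans ht.2)) ht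
    have hD := fun s (hs : s ∈ Icc 0 T) => limitSolution_spec hh (hx s hs)
    have e0 : ∫ x, (limitSolution h V t).D 0 x * φ x
        = ∫ x, dyadicLim h (fun j => V j t) x * φ x :=
      integral_congr_ae ((hD t ht).1.mono fun x hx => by simp only [hx])
    rw [e0, dyadicLim_equation hν hc hm hf hh hV hx hφ ht]
    congr 1
    congr 1
    · congr 1
      · congr 1
        refine intervalIntegral.integral_congr fun s hs => ?_
        obtain ⟨d0, d1, -, -⟩ := hD s (hsub hs)
        congr 1
        · exact integral_congr_ae (d1.mono fun x hx => by simp only [hx])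
        · exact integral_congr_ae (d0.mono fun x hx => by simp only [hx])
      · refine intervalIntegral.integral_congr fun s hs => ?_
        obtain ⟨d0, d1, -, -⟩ := hD s (hsub hs)
        refine integral_congr_ae (ae_of_all _ fun z => ?_)
        refine intervalIntegral.integral_congr fun θ _ => ?_
        refine congrArg (fun r => (1 - θ) * z ^ 2 * r) ?_
        exact integral_congr_ae ((ae_eq_shift d1 (θ * z)).mono fun x hx => by simp only [hx])
    · refine intervalIntegral.integral_congr fun s hs => ?_
      obtain ⟨d0, d1, -, -⟩ := hD s (hsub hs)
      refine integral_congr_ae (ae_of_all _ fun z => ?_)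
      refine integral_congr_ae ?_
      filter_upwards [d0, ae_eq_shift d0 z] with x h1 h2
      rw [h1, h2]

end

end
end LevyFD



namespace LevyFD

noncomputable section

open Filter Topology

/-- The space `L₂(ℝ)`. -/
abbrev L2 : Type := Lp ℝ 2 (volume : Measure ℝ)

/-! ### Translations and the integral operators on `L₂` -/

/-- The translation `g ↦ g (· + p)` on `L₂(ℝ)`. -/
def trans (p : ℝ) : L2 →ₗᵢ[ℝ] L2 :=
  Lp.compMeasurePreservingₗᵢ ℝ (fun x => x + p) (measurePreserving_add_right volume p)

theorem trans_coeFn (p : ℝ) (g : L2) : trans p g =ᵐ[volume] fun x => g (x + p) :=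
  Lp.coeFn_compMeasurePreserving g (measurePreserving_add_right volume p)

theorem norm_trans (p : ℝ) (g : L2) : ‖trans p g‖ = ‖g‖ := (trans p).norm_map g

theorem continuous_trans (g : L2) : Continuous fun p => trans p g := by
  let G : ℝ → C(ℝ, ℝ) := fun p => ⟨fun x => x + p, by fun_prop⟩
  have hG : Continuous G :=
    (ContinuousMap.curry ⟨fun q : ℝ × ℝ => q.2 + q.1, by fun_prop⟩ : C(ℝ, C(ℝ, ℝ))).continuous
  exact Continuous.compMeasurePreservingLp (continuous_const (y := g)) hG
    (fun p => measurePreserving_add_right volume p) (by norm_num)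

/-- The vector `z² ∫₀¹ (1 - θ) g (· + θ z) dθ`. -/
def nearVec (g : L2) (z : ℝ) : L2 := ∫ θ in (0 : ℝ)..1, ((1 - θ) * z ^ 2) • trans (θ * z) g

theorem continuous_nearVec_integrand (g : L2) :
    Continuous fun q : ℝ × ℝ => ((1 - q.2) * q.1 ^ 2) • trans (q.2 * q.1) g := by
  have h := continuous_trans g
  fun_prop

theorem continuous_nearVec (g : L2) : Continuous (nearVec g) :=
  intervalIntegral.continuous_parametric_intervalIntegral_of_continuous'
    (continuous_nearVec_integrand g) 0 1

theorem intervalIntegrable_nearVec (g : L2) (z : ℝ) :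
    IntervalIntegrable (fun θ => ((1 - θ) * z ^ 2) • trans (θ * z) g) volume 0 1 :=
  ((continuous_nearVec_integrand g).comp (Continuous.prodMk_right z)).intervalIntegrable 0 1

theorem norm_nearVec_le (g : L2) (z : ℝ) : ‖nearVec g z‖ ≤ ‖g‖ * z ^ 2 := by
  have h := intervalIntegral.norm_integral_le_of_norm_le_const (a := (0 : ℝ)) (b := 1)
    (f := fun θ => ((1 - θ) * z ^ 2) • trans (θ * z) g) (C := ‖g‖ * z ^ 2) (by
      intro θ hθ
      rw [uIoc_of_le zero_le_one] at hθ
      rw [norm_smul, norm_trans, Real.norm_eq_abs, abs_mul, abs_of_nonneg (sq_nonneg z),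
        abs_of_nonneg (by linarith [hθ.2])]
      nlinarith [norm_nonneg g, sq_nonneg z, mul_nonneg (norm_nonneg g) (sq_nonneg z), hθ.1, hθ.2])
  simpa [nearVec] using h

theorem setOf_abs_le_one : {z : ℝ | |z| ≤ 1} = Icc (-1) 1 := by
  ext z
  simp [abs_le]

theorem setOf_one_lt_abs : {z : ℝ | 1 < |z|} = (Icc (-1) 1)ᶜ := by
  rw [← setOf_abs_le_one]
  ext z
  simp

theorem IsLevyMeasure.integrableOn_nearVec {ν : Measure ℝ} (hν : IsLevyMeasure ν) (g : L2) :
    IntegrableOn (nearVec g) {z | |z| ≤ 1} ν := by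
  rw [setOf_abs_le_one]
  exact Integrable.mono' (hν.integrableOn_sq.const_mul ‖g‖)
    (continuous_nearVec g).aestronglyMeasurable (ae_of_all _ (norm_nearVec_le g))

theorem IsLevyMeasure.integrableOn_trans_sub {ν : Measure ℝ} (hν : IsLevyMeasure ν) (g : L2) :
    IntegrableOn (fun z => trans z g - g) {z | 1 < |z|} ν := by
  rw [setOf_one_lt_abs]
  refine Measure.integrableOn_of_bounded (M := 2 * ‖g‖) hν.measure_compl_lt_top.ne
    ((continuous_trans g).sub continuous_const).aestronglyMeasurable (ae_of_all _ fun z => ?_)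
  calc ‖trans z g - g‖ ≤ ‖trans z g‖ + ‖g‖ := norm_sub_le _ _
    _ = 2 * ‖g‖ := by rw [norm_trans]; ring

/-- The operator `g ↦ ∫_{|z| ≤ 1} ∫₀¹ (1 - θ) z² g (· + θ z) dθ ν(dz)` on `L₂(ℝ)`. -/
def nearOp {ν : Measure ℝ} (hν : IsLevyMeasure ν) : L2 →L[ℝ] L2 :=
  LinearMap.mkContinuous
    { toFun := fun g => ∫ z in {z : ℝ | |z| ≤ 1}, nearVec g z ∂ν
      map_add' := fun g g' => by
        rw [← integral_add (hν.integrableOn_nearVec g) (hν.integrableOn_nearVec g')]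
        congr 1 with z : 1
        rw [nearVec, nearVec, nearVec, ← intervalIntegral.integral_add
          (intervalIntegrable_nearVec g z) (intervalIntegrable_nearVec g' z)]
        simp only [map_add, smul_add]
      map_smul' := fun r g => by
        rw [RingHom.id_apply, ← integral_smul]
        congr 1 with z : 1
        rw [nearVec, nearVec, ← intervalIntegral.integral_smul]
        simp only [map_smul, smul_comm r] }
    (mu2 ν) (fun g => by
      refine (norm_integral_le_of_norm_le (g := fun z => ‖g‖ * z ^ 2) ?_
        (ae_of_all _ (norm_nearVec_le g))).trans ?_
      · rw [setOf_abs_le_one]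
        exact hν.integrableOn_sq.const_mul ‖g‖
      · rw [integral_const_mul, setOf_abs_le_one, mul_comm, mu2])

/-- The operator `g ↦ ∫_{|z| > 1} (g (· + z) - g) ν(dz)` on `L₂(ℝ)`. -/
def farOp {ν : Measure ℝ} (hν : IsLevyMeasure ν) : L2 →L[ℝ] L2 :=
  LinearMap.mkContinuous
    { toFun := fun g => ∫ z in {z : ℝ | 1 < |z|}, (trans z g - g) ∂ν
      map_add' := fun g g' => by
        rw [← integral_add (hν.integrableOn_trans_sub g) (hν.integrableOn_trans_sub g')]
        congr 1 with z : 1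
        rw [map_add]
        abel
      map_smul' := fun r g => by
        rw [RingHom.id_apply, ← integral_smul]
        congr 1 with z : 1
        rw [map_smul, smul_sub] }
    (2 * mu0 ν) (fun g => by
      have := norm_setIntegral_le_of_norm_le_const (μ := ν) (s := (Icc (-1 : ℝ) 1)ᶜ)
        (f := fun z => trans z g - g) (C := 2 * ‖g‖) hν.measure_compl_lt_top (fun z _ => by
          calc ‖trans z g - g‖ ≤ ‖trans z g‖ + ‖g‖ := norm_sub_le _ _
            _ = 2 * ‖g‖ := by rw [norm_trans]; ring)
      simp only [LinearMap.coe_mk, AddHom.coe_mk, setOf_one_lt_abs]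
      calc _ ≤ 2 * ‖g‖ * mu0 ν := this
        _ = _ := by ring)

theorem inner_nearVec (g w : L2) (z : ℝ) :
    inner ℝ (nearVec g z) w
      = ∫ θ in (0 : ℝ)..1, (1 - θ) * z ^ 2 * inner ℝ (trans (θ * z) g) w := by
  rw [real_inner_comm, ← innerSL_apply_apply ℝ w, nearVec,
    ← ContinuousLinearMap.intervalIntegral_comp_comm _ (intervalIntegrable_nearVec g z)]
  simp only [innerSL_apply_apply, real_inner_smul_right, real_inner_comm]

theorem inner_nearOp {ν : Measure ℝ} (hν : IsLevyMeasure ν) (g w : L2) :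
    inner ℝ (nearOp hν g) w = ∫ z in {z : ℝ | |z| ≤ 1}, (∫ θ in (0 : ℝ)..1,
      (1 - θ) * z ^ 2 * inner ℝ (trans (θ * z) g) w) ∂ν := by
  change inner ℝ (∫ z in {z : ℝ | |z| ≤ 1}, nearVec g z ∂ν) w = _
  rw [real_inner_comm, ← integral_inner (hν.integrableOn_nearVec g)]
  refine integral_congr_ae (ae_of_all _ fun z => ?_)
  exact (real_inner_comm _ _).trans (inner_nearVec g w z)

theorem inner_farOp {ν : Measure ℝ} (hν : IsLevyMeasure ν) (g w : L2) :
    inner ℝ (farOp hν g) w = ∫ z in {z : ℝ | 1 < |z|}, inner ℝ (trans z g - g) w ∂ν := by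
  change inner ℝ (∫ z in {z : ℝ | 1 < |z|}, (trans z g - g) ∂ν) w = _
  rw [real_inner_comm, ← integral_inner (hν.integrableOn_trans_sub g)]
  simp only [real_inner_comm]

/-- Translations are isometries of `L₂`, so the pairing of `trans z g - g` with `g` is nonpositive
for every `z`. -/
theorem inner_farOp_self_nonpos {ν : Measure ℝ} (hν : IsLevyMeasure ν) (g : L2) :
    inner ℝ (farOp hν g) g ≤ 0 := by
  rw [inner_farOp]
  refine integral_nonpos fun z => ?_
  have h := real_inner_le_norm (trans z g) g
  rw [norm_trans] at h
  change inner ℝ (trans z g - g) g ≤ 0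
  rw [inner_sub_left, real_inner_self_eq_norm_sq]
  nlinarith

theorem inner_trans_toLp (g : L2) (p : ℝ) {φ : ℝ → ℝ} (hφ : MemLp φ 2) :
    inner ℝ (trans p g) hφ.toLp = ∫ x, g (x + p) * φ x := by
  rw [← integral_mul_toLp]
  refine integral_congr_ae ?_
  filter_upwards [trans_coeFn p g] with x hx
  rw [hx]

theorem inner_trans_toLp_toLp (p : ℝ) {φ χ : ℝ → ℝ} (hφ : MemLp φ 2) (hχ : MemLp χ 2) :
    inner ℝ (trans p hφ.toLp) hχ.toLp = ∫ x, φ (x + p) * χ x := by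
  rw [inner_trans_toLp]
  refine integral_congr_ae ?_
  filter_upwards [ae_eq_shift hφ.coeFn_toLp p] with x hx
  rw [hx]

theorem hasDerivAt_integral_shift_mul {φ χ : ℝ → ℝ} (hφ : IsTestFunction φ)
    (hχ : IsTestFunction χ) (p : ℝ) :
    HasDerivAt (fun p => ∫ x, φ (x + p) * χ x) (∫ x, deriv φ (x + p) * χ x) p := by
  obtain ⟨M, hM⟩ := hφ.deriv.2.exists_bound_of_continuous hφ.deriv.continuous
  have hφc := hφ.continuous
  have hdc := hφ.deriv.continuous
  have hχc := hχ.continuous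
  have hi : ∀ {η : ℝ → ℝ}, Continuous η → Integrable fun x => η x * χ x := fun hη =>
    (hη.mul hχc).integrable_of_hasCompactSupport hχ.2.mul_left
  refine (hasDerivAt_integral_of_dominated_loc_of_deriv_le (bound := fun x => M * |χ x|)
    (F := fun p x => φ (x + p) * χ x) (F' := fun p x => deriv φ (x + p) * χ x)
    univ_mem (Eventually.of_forall fun q => ?_) 
    (hi (by fun_prop)) ?_ (ae_of_all _ ?_) ?_
    (ae_of_all _ ?_)).2
  · exact Continuous.aestronglyMeasurable (by fun_prop)
  · exact Continuous.aestronglyMeasurable (by fun_prop)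
  · intro x q _
    rw [norm_mul, Real.norm_eq_abs (χ x)]
    exact mul_le_mul_of_nonneg_right (hM _) (abs_nonneg _)
  · exact ((hχc.abs).integrable_of_hasCompactSupport hχ.2.abs).const_mul M
  · intro x q _
    have h := (hφ.differentiable (x + q)).hasDerivAt.comp q ((hasDerivAt_id q).const_add x)
    simpa using h.mul_const (χ x)

theorem integral_shift_deriv_mul {φ χ : ℝ → ℝ} (hφ : IsTestFunction φ)
    (hχ : IsTestFunction χ) (p : ℝ) :
    ∫ x, deriv φ (x + p) * χ x = -∫ x, φ (x + p) * deriv χ x := by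
  have h := integral_deriv_mul_of_test (f := fun x => φ (x + p))
    (hφ.contDiff_one.comp (contDiff_id.add contDiff_const)) hχ.contDiff_one hχ.2
  simpa only [deriv_comp_add_const] using h

/-- Taylor's formula for the correlation function of a test function. -/
theorem integral_correlation {φ : ℝ → ℝ} (hφ : IsTestFunction φ) (z : ℝ) :
    ∫ θ in (0 : ℝ)..1, (1 - θ) * z ^ 2 * ∫ x, deriv φ (x + θ * z) * deriv φ x
      = (∫ x, φ x * φ x) - ∫ x, φ (x + z) * φ x := by
  set r : ℝ → ℝ := fun p => ∫ x, φ (x + p) * φ x with hr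
  set r₁ : ℝ → ℝ := fun p => ∫ x, deriv φ (x + p) * φ x with hr₁
  set r₂ : ℝ → ℝ := fun p => ∫ x, deriv φ (x + p) * deriv φ x with hr₂
  have h1 : ∀ p, HasDerivAt r (r₁ p) p := hasDerivAt_integral_shift_mul hφ hφ
  have h2 : ∀ p, HasDerivAt r₁ (-r₂ p) p := fun p => by
    have h := hasDerivAt_integral_shift_mul hφ.deriv hφ p
    rwa [integral_shift_deriv_mul hφ.deriv hφ p] at h
  have h3 : Continuous r₂ := by
    rw [continuous_iff_continuousAt]
    exact fun p => (hasDerivAt_integral_shift_mul hφ.deriv hφ.deriv p).continuousAt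
  -- The correlation satisfies `r'' = -r₂`, so this is the explicit antiderivative from Taylor's
  -- formula with integral remainder.
  have h4 : ∀ θ ∈ uIcc (0 : ℝ) 1, HasDerivAt
      (fun θ => (θ - 1) * (z * r₁ (θ * z)) - r (θ * z)) ((1 - θ) * z ^ 2 * r₂ (θ * z)) θ := by
    intro θ _
    have e : HasDerivAt (fun θ : ℝ => θ * z) z θ := hasDerivAt_mul_const z
    have e1 := (h1 (θ * z)).comp θ e
    have e2 := ((h2 (θ * z)).comp θ e).const_mul z
    have e3 := (((hasDerivAt_id θ).sub_const 1).mul e2).sub e1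
    refine e3.congr_deriv ?_
    simp only [id, Function.comp]
    ring
  rw [intervalIntegral.integral_eq_sub_of_hasDerivAt h4
    (Continuous.intervalIntegrable (by fun_prop) 0 1)]
  -- Integration by parts at `p = 0` shows that `∫ φ' φ` equals its own negative.
  have h0 : r₁ 0 = 0 := by
    have h := integral_shift_deriv_mul hφ hφ 0
    have e : ∫ x, φ (x + 0) * deriv φ x = r₁ 0 := by simp [hr₁, mul_comm]
    have e' : r₁ 0 = -r₁ 0 := by rw [← e, ← h]; simp [mul_comm]
    linarith
  have hz : r 0 = ∫ x, φ x * φ x := by simp [hr]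
  rw [zero_mul, one_mul, h0, hz]
  ring

/-- By `integral_correlation` the integrand in `z` is `r 0 - r z`, where `r` is the correlation
function of `φ`, and `r` is maximal at zero. This is the dissipativity of the small jumps in weak
form. -/
theorem inner_nearOp_deriv_nonneg {ν : Measure ℝ} (hν : IsLevyMeasure ν) {φ : ℝ → ℝ}
    (hφ : IsTestFunction φ) :
    0 ≤ inner ℝ (nearOp hν hφ.deriv.memLp.toLp) hφ.deriv.memLp.toLp := by
  rw [inner_nearOp]
  refine integral_nonneg fun z => ?_
  simp only [inner_trans_toLp_toLp]
  rw [integral_correlation hφ z]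
  have h0 : ∫ x, φ x * φ x = ‖hφ.memLp.toLp‖ ^ 2 := by
    rw [← real_inner_self_eq_norm_sq, ← integral_mul_toLp]
    refine integral_congr_ae ?_
    filter_upwards [hφ.memLp.coeFn_toLp] with x hx
    rw [hx]
  have h := real_inner_le_norm (trans z hφ.memLp.toLp) hφ.memLp.toLp
  rw [norm_trans, inner_trans_toLp_toLp] at h
  rw [h0]
  simp only [Pi.zero_apply]
  nlinarith

end

end LevyFD



namespace LevyFD

noncomputable section

open Filter Topology

/-! ### The bilinear form of the equation -/

theorem real_inner_apply_mul (x y : ℝ) : inner ℝ x y = x * y := by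
  rw [RCLike.inner_apply, conj_trivial, mul_comm]

theorem memLp_bdd_mul {a : ℝ → ℝ} {K : ℝ} (ha : Measurable a) (hb : ∀ x, |a x| ≤ K) (g : L2) :
    MemLp (fun x => a x * g x) 2 :=
  (Lp.memLp g).of_le_mul (c := K)
    (ha.aestronglyMeasurable.mul (Lp.memLp g).1) (ae_of_all _ fun x => by
      rw [norm_mul]
      exact mul_le_mul_of_nonneg_right (hb x) (norm_nonneg _))

/-- Multiplication by a bounded measurable function, as an operator on `L₂(ℝ)`. -/
def mulCLM {a : ℝ → ℝ} {K : ℝ} (ha : Measurable a) (hb : ∀ x, |a x| ≤ K) : L2 →L[ℝ] L2 :=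
  LinearMap.mkContinuous
    { toFun := fun g => (memLp_bdd_mul ha hb g).toLp
      map_add' := fun g g' => by
        refine Lp.ext ?_
        filter_upwards [(memLp_bdd_mul ha hb (g + g')).coeFn_toLp, (memLp_bdd_mul ha hb g).coeFn_toLp,
          (memLp_bdd_mul ha hb g').coeFn_toLp, Lp.coeFn_add g g',
          Lp.coeFn_add (memLp_bdd_mul ha hb g).toLp (memLp_bdd_mul ha hb g').toLp]
          with x h1 h2 h3 h4 h5
        rw [h1, h5, Pi.add_apply, h2, h3, h4, Pi.add_apply, mul_add]
      map_smul' := fun r g => by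
        refine Lp.ext ?_
        filter_upwards [(memLp_bdd_mul ha hb (r • g)).coeFn_toLp, (memLp_bdd_mul ha hb g).coeFn_toLp,
          Lp.coeFn_smul r g, Lp.coeFn_smul r (memLp_bdd_mul ha hb g).toLp] with x h1 h2 h3 h4
        rw [h1, RingHom.id_apply, h4, Pi.smul_apply, h2, h3, Pi.smul_apply, smul_eq_mul,
          smul_eq_mul, mul_left_comm] }
    K (fun g => by
      refine Lp.norm_le_mul_norm_of_ae_le_mul ?_
      filter_upwards [(memLp_bdd_mul ha hb g).coeFn_toLp] with x hx
      simp only [LinearMap.coe_mk, AddHom.coe_mk]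
      rw [hx, norm_mul]
      exact mul_le_mul_of_nonneg_right (hb x) (norm_nonneg _))

theorem mulCLM_coeFn {a : ℝ → ℝ} {K : ℝ} (ha : Measurable a) (hb : ∀ x, |a x| ≤ K) (g : L2) :
    mulCLM ha hb g =ᵐ[volume] fun x => a x * g x := (memLp_bdd_mul ha hb g).coeFn_toLp

theorem norm_mulCLM_le {a : ℝ → ℝ} {K : ℝ} (ha : Measurable a) (hb : ∀ x, |a x| ≤ K) (g : L2) :
    ‖mulCLM ha hb g‖ ≤ K * ‖g‖ :=
  (mulCLM ha hb).le_of_opNorm_le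
    (LinearMap.mkContinuous_norm_le _ ((abs_nonneg _).trans (hb 0)) _) g

theorem inner_mulCLM {a : ℝ → ℝ} {K : ℝ} (ha : Measurable a) (hb : ∀ x, |a x| ≤ K) (g w : L2) :
    inner ℝ (mulCLM ha hb g) w = ∫ x, a x * g x * w x := by
  rw [L2.inner_def]
  refine integral_congr_ae ?_
  filter_upwards [mulCLM_coeFn ha hb g] with x hx
  rw [hx, real_inner_apply_mul]

theorem measurable_inner_mulCLM {a : ℝ → ℝ → ℝ} {K : ℝ}
    (ha : Measurable fun p : ℝ × ℝ => a p.1 p.2) (ha' : ∀ r, Measurable (a r))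
    (hb : ∀ r x, |a r x| ≤ K) (g w : L2) :
    StronglyMeasurable fun r => inner ℝ (mulCLM (ha' r) (hb r) g) w := by
  simp only [inner_mulCLM]
  refine StronglyMeasurable.integral_prod_right (f := fun r x => a r x * g x * w x) ?_
  have hg := (Lp.stronglyMeasurable g).measurable
  have hw := (Lp.stronglyMeasurable w).measurable
  exact ((ha.mul (hg.comp measurable_snd)).mul (hw.comp measurable_snd)).stronglyMeasurable

namespace Coeffs

variable {K : ℝ} {a b c : ℝ → ℝ → ℝ}

theorem differentiable_a (hc : Coeffs K a b c) (t : ℝ) : Differentiable ℝ (a t) :=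
  (hc.contDiff_a t).differentiable (by norm_num)

theorem abs_deriv_a_le (hc : Coeffs K a b c) (t x : ℝ) : |deriv (a t) x| ≤ K := by
  simpa using hc.bound_a t 1 (by norm_num) x

theorem abs_deriv_b_le (hc : Coeffs K a b c) (t x : ℝ) : |deriv (b t) x| ≤ K := by
  simpa using hc.bound_b t 1 (by norm_num) x

theorem abs_deriv_deriv_a_le (hc : Coeffs K a b c) (t x : ℝ) : |deriv (deriv (a t)) x| ≤ K := by
  have h := hc.bound_a t 2 (by norm_num) x
  rwa [iteratedDeriv_succ, iteratedDeriv_one] at h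

/-- Joint measurability: the derivative is a pointwise limit of jointly measurable difference
quotients along `1/(n+1)`. -/
theorem measurable_deriv_a (hc : Coeffs K a b c) :
    Measurable fun p : ℝ × ℝ => deriv (a p.1) p.2 := by
  have hu : Tendsto (fun n : ℕ => 1 / ((n : ℝ) + 1)) atTop (𝓝[≠] 0) :=
    tendsto_nhdsWithin_iff.2 ⟨tendsto_one_div_add_atTop_nhds_zero_nat,
      Eventually.of_forall fun n => by simp only [mem_compl_iff, mem_singleton_iff]; positivity⟩
  refine measurable_of_tendsto_metrizable
    (f := fun (n : ℕ) (p : ℝ × ℝ) => (1 / ((n : ℝ) + 1))⁻¹ •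
      (a p.1 (p.2 + 1 / ((n : ℝ) + 1)) - a p.1 p.2)) (fun n => ?_)
    (tendsto_pi_nhds.2 fun p =>
      (hasDerivAt_iff_tendsto_slope_zero.1 (hc.differentiable_a p.1 p.2).hasDerivAt).comp hu)
  have h1 : Measurable fun p : ℝ × ℝ => a p.1 (p.2 + 1 / ((n : ℝ) + 1)) :=
    hc.measurable_a.comp (measurable_fst.prodMk (measurable_snd.add_const _))
  exact (h1.sub hc.measurable_a).const_smul (M := ℝ) _

/-- The first order coefficient `b - ∂a` of the equation in divergence form. -/
theorem measurable_drift (hc : Coeffs K a b c) :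
    Measurable fun p : ℝ × ℝ => b p.1 p.2 - deriv (a p.1) p.2 :=
  hc.measurable_b.sub hc.measurable_deriv_a

theorem abs_drift_le (hc : Coeffs K a b c) (t x : ℝ) : |b t x - deriv (a t) x| ≤ 2 * K := by
  have h1 := abs_le.1 (hc.abs_b_le t x)
  have h2 := abs_le.1 (hc.abs_deriv_a_le t x)
  exact abs_le.2 ⟨by linarith, by linarith⟩

theorem measurable_drift_apply (hc : Coeffs K a b c) (t : ℝ) :
    Measurable fun x => b t x - deriv (a t) x :=
  hc.measurable_drift.comp measurable_prodMk_left

theorem measurable_a_apply (hc : Coeffs K a b c) (t : ℝ) : Measurable (a t) :=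
  hc.measurable_a.comp measurable_prodMk_left

theorem measurable_c_apply (hc : Coeffs K a b c) (t : ℝ) : Measurable (c t) :=
  hc.measurable_c.comp measurable_prodMk_left

/-- The form of the differential operator: `(u', (b - a') φ - a φ') + (c u, φ)`. -/
def localForm (hc : Coeffs K a b c) (s : ℝ) (φ g : H 1) : ℝ :=
  inner ℝ (mulCLM (hc.measurable_drift_apply s) (hc.abs_drift_le s) (φ.1 0)) (g.1 1)
    - inner ℝ (mulCLM (hc.measurable_a_apply s) (hc.abs_a_le s) (φ.1 1)) (g.1 1)
    + inner ℝ (mulCLM (hc.measurable_c_apply s) (hc.abs_c_le s) (φ.1 0)) (g.1 0)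

end Coeffs

/-- The form of the integral operator. -/
def levyForm {ν : Measure ℝ} (hν : IsLevyMeasure ν) (φ g : H 1) : ℝ :=
  inner ℝ (farOp hν (g.1 0)) (φ.1 0) - inner ℝ (nearOp hν (g.1 1)) (φ.1 1)

/-- The embedding `g ↦ ∂^j g` of `H¹` into `L₂`. -/
def H.proj (j : Fin 2) : H 1 →L[ℝ] L2 :=
  (PiLp.proj 2 (fun _ : Fin (1 + 1) => Lp ℝ 2 (volume : Measure ℝ)) j : _ →L[ℝ] _).comp
    (sobolev 1).subtypeL

theorem H.continuous_coe (j : Fin 2) : Continuous fun g : H 1 => g.1 j := (H.proj j).continuous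

theorem H.norm_coe_le (g : H 1) (j : Fin 2) : ‖g.1 j‖ ≤ ‖g‖ := by
  have h := H.norm_sq_one g
  refine (sq_le_sq₀ (norm_nonneg _) (norm_nonneg g)).1 ?_
  fin_cases j
  · exact h ▸ le_add_of_nonneg_right (sq_nonneg _)
  · exact h ▸ le_add_of_nonneg_left (sq_nonneg _)

theorem Coeffs.abs_localForm_le {K : ℝ} {a b c : ℝ → ℝ → ℝ} (hc : Coeffs K a b c) (s : ℝ)
    (φ g : H 1) : |hc.localForm s φ g| ≤ 4 * K * (‖φ‖ * ‖g‖) := by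
  have key : ∀ {q : ℝ → ℝ} {C : ℝ} (hq : Measurable q) (hC : ∀ x, |q x| ≤ C) (i j : Fin 2),
      |inner ℝ (mulCLM hq hC (φ.1 i)) (g.1 j)| ≤ C * (‖φ‖ * ‖g‖) := by
    intro q C hq hC i j
    have hC0 : 0 ≤ C := (abs_nonneg _).trans (hC 0)
    calc |inner ℝ (mulCLM hq hC (φ.1 i)) (g.1 j)| ≤ ‖mulCLM hq hC (φ.1 i)‖ * ‖g.1 j‖ :=
          abs_real_inner_le_norm _ _
      _ ≤ C * ‖φ‖ * ‖g‖ := by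
          gcongr
          · exact (norm_mulCLM_le hq hC _).trans
              (mul_le_mul_of_nonneg_left (H.norm_coe_le φ i) hC0)
          · exact H.norm_coe_le g j
      _ = _ := mul_assoc _ _ _
  have h1 := abs_le.1 (key (hc.measurable_drift_apply s) (hc.abs_drift_le s) 0 1)
  have h2 := abs_le.1 (key (hc.measurable_a_apply s) (hc.abs_a_le s) 1 1)
  have h3 := abs_le.1 (key (hc.measurable_c_apply s) (hc.abs_c_le s) 0 0)
  rw [Coeffs.localForm]
  exact abs_le.2 ⟨by linarith, by linarith⟩

theorem exists_abs_levyForm_le {ν : Measure ℝ} (hν : IsLevyMeasure ν) :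
    ∃ C, 0 ≤ C ∧ ∀ φ g : H 1, |levyForm hν φ g| ≤ C * (‖φ‖ * ‖g‖) := by
  refine ⟨‖farOp hν‖ + ‖nearOp hν‖, by positivity, fun φ g => ?_⟩
  have key : ∀ (S : L2 →L[ℝ] L2) (j : Fin 2),
      |inner ℝ (S (g.1 j)) (φ.1 j)| ≤ ‖S‖ * (‖φ‖ * ‖g‖) := by
    intro S j
    calc |inner ℝ (S (g.1 j)) (φ.1 j)| ≤ ‖S (g.1 j)‖ * ‖φ.1 j‖ := abs_real_inner_le_norm _ _
      _ ≤ ‖S‖ * ‖g‖ * ‖φ‖ := by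
          gcongr
          · exact (S.le_opNorm _).trans
              (mul_le_mul_of_nonneg_left (H.norm_coe_le g j) (norm_nonneg _))
          · exact H.norm_coe_le φ j
      _ = _ := by ring
  have h1 := abs_le.1 (key (farOp hν) 0)
  have h2 := abs_le.1 (key (nearOp hν) 1)
  rw [levyForm]
  exact abs_le.2 ⟨by linarith, by linarith⟩

theorem Coeffs.continuous_localForm {K : ℝ} {a b c : ℝ → ℝ → ℝ} (hc : Coeffs K a b c) (s : ℝ) :
    Continuous fun p : H 1 × H 1 => hc.localForm s p.1 p.2 := by
  have h0 := H.continuous_coe 0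
  have h1 := H.continuous_coe 1
  unfold Coeffs.localForm
  fun_prop

theorem continuous_levyForm {ν : Measure ℝ} (hν : IsLevyMeasure ν) :
    Continuous fun p : H 1 × H 1 => levyForm hν p.1 p.2 := by
  have h0 := H.continuous_coe 0
  have h1 := H.continuous_coe 1
  unfold levyForm
  fun_prop

theorem Coeffs.localForm_sub {K : ℝ} {a b c : ℝ → ℝ → ℝ} (hc : Coeffs K a b c) (s : ℝ)
    (φ g g' : H 1) :
    hc.localForm s φ (g - g') = hc.localForm s φ g - hc.localForm s φ g' := by
  have e : ∀ j : Fin 2, (g - g').1 j = g.1 j - g'.1 j := fun j => rfl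
  simp only [Coeffs.localForm, e, inner_sub_right]
  ring

theorem levyForm_sub {ν : Measure ℝ} (hν : IsLevyMeasure ν) (φ g g' : H 1) :
    levyForm hν φ (g - g') = levyForm hν φ g - levyForm hν φ g' := by
  have e : ∀ j : Fin 2, (g - g').1 j = g.1 j - g'.1 j := fun j => rfl
  simp only [levyForm, e, map_sub, inner_sub_left]
  ring

theorem Coeffs.localForm_toH {K : ℝ} {a b c : ℝ → ℝ → ℝ} (hc : Coeffs K a b c) (s : ℝ)
    {φ : ℝ → ℝ} (hφ : IsTestFunction φ) (g : H 1) :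
    hc.localForm s hφ.toH g
      = (∫ x, g.D 1 x * (-(φ x * deriv (a s) x) - a s x * deriv φ x + b s x * φ x))
        + ∫ x, c s x * g.D 0 x * φ x := by
  rw [Coeffs.localForm]
  congr 1
  · rw [← inner_sub_left, L2.inner_def]
    refine integral_congr_ae ?_
    filter_upwards [Lp.coeFn_sub
      (mulCLM (hc.measurable_drift_apply s) (hc.abs_drift_le s) (hφ.toH.1 0))
      (mulCLM (hc.measurable_a_apply s) (hc.abs_a_le s) (hφ.toH.1 1)),
      mulCLM_coeFn (hc.measurable_drift_apply s) (hc.abs_drift_le s) (hφ.toH.1 0),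
      mulCLM_coeFn (hc.measurable_a_apply s) (hc.abs_a_le s) (hφ.toH.1 1),
      hφ.toH_D_zero, hφ.toH_D_one] with x h1 h2 h3 h4 h5
    rw [H.D] at h4 h5
    rw [h1, Pi.sub_apply, h2, h3, h4, h5, real_inner_apply_mul, H.D]
    ring
  · rw [inner_mulCLM]
    refine integral_congr_ae ?_
    filter_upwards [hφ.toH_D_zero] with x h4
    rw [H.D] at h4
    rw [h4, H.D]
    ring

theorem inner_farOp_toH {ν : Measure ℝ} (hν : IsLevyMeasure ν) {φ : ℝ → ℝ}
    (hφ : IsTestFunction φ) (g : H 1) :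
    inner ℝ (farOp hν (g.1 0)) (hφ.toH.1 0)
      = ∫ z in {z : ℝ | 1 < |z|}, (∫ x, (g.D 0 (x + z) - g.D 0 x) * φ x) ∂ν := by
  rw [inner_farOp]
  refine integral_congr_ae (ae_of_all _ fun z => ?_)
  refine (integral_mul_toLp _ hφ.memLp).symm.trans (integral_congr_ae ?_)
  filter_upwards [Lp.coeFn_sub (trans z (g.1 0)) (g.1 0), trans_coeFn z (g.1 0)] with x h1 h2
  rw [h1, Pi.sub_apply, h2]
  rfl

theorem inner_nearOp_toH {ν : Measure ℝ} (hν : IsLevyMeasure ν) {φ : ℝ → ℝ}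
    (hφ : IsTestFunction φ) (g : H 1) :
    inner ℝ (nearOp hν (g.1 1)) (hφ.toH.1 1)
      = ∫ z in {z : ℝ | |z| ≤ 1}, (∫ θ in (0 : ℝ)..1,
          (1 - θ) * z ^ 2 * ∫ x, g.D 1 (x + θ * z) * deriv φ x) ∂ν := by
  rw [inner_nearOp]
  refine integral_congr_ae (ae_of_all _ fun z => intervalIntegral.integral_congr fun θ _ => ?_)
  change _ * inner ℝ (trans (θ * z) (g.1 1)) hφ.deriv.memLp.toLp = _
  rw [inner_trans_toLp]
  rfl

/-- The form is bounded above by the `L₂` norm. -/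
theorem Coeffs.form_self_le_of_test {K : ℝ} {a b c : ℝ → ℝ → ℝ} {ν : Measure ℝ}
    (hc : Coeffs K a b c) (hν : IsLevyMeasure ν) (s : ℝ) {φ : ℝ → ℝ} (hφ : IsTestFunction φ) :
    hc.localForm s hφ.toH hφ.toH + levyForm hν hφ.toH hφ.toH ≤ 2 * K * ‖hφ.toH.1 0‖ ^ 2 := by
  have hlevy : levyForm hν hφ.toH hφ.toH ≤ 0 := by
    rw [levyForm]
    have h1 := inner_farOp_self_nonpos hν (hφ.toH.1 0)
    have h2 := inner_nearOp_deriv_nonneg hν hφ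
    change inner ℝ (farOp hν (hφ.toH.1 0)) (hφ.toH.1 0)
      - inner ℝ (nearOp hν hφ.deriv.memLp.toLp) hφ.deriv.memLp.toLp ≤ 0
    linarith
  have hφc := hφ.continuous
  have hdc := hφ.deriv.continuous
  have hac := hc.contDiff_a s
  have hq : ContDiff ℝ 1 fun x => b s x - deriv (a s) x := by
    refine ((hc.contDiff_b s).of_le (by norm_num)).sub ?_
    have : ContDiff ℝ (1 + 1) (a s) := hac.of_le (by norm_num)
    exact (contDiff_succ_iff_deriv.1 this).2.2
  have hcc := (hc.contDiff_c s).continuous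
  have hqc := hq.continuous
  have hq'c : Continuous (deriv fun x => b s x - deriv (a s) x) := hq.continuous_deriv_one
  have hq' : ∀ x, |deriv (fun x => b s x - deriv (a s) x) x| ≤ 2 * K := by
    intro x
    have hd : deriv (fun x => b s x - deriv (a s) x) x = deriv (b s) x - deriv (deriv (a s)) x := by
      refine deriv_fun_sub ((hc.contDiff_b s).differentiable (by norm_num) x) ?_
      have : ContDiff ℝ (1 + 1) (a s) := hac.of_le (by norm_num)
      exact (contDiff_succ_iff_deriv.1 this).2.2.differentiable (by norm_num) x
    rw [hd]
    have h1 := abs_le.1 (hc.abs_deriv_b_le s x)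
    have h2 := abs_le.1 (hc.abs_deriv_deriv_a_le s x)
    exact abs_le.2 ⟨by linarith, by linarith⟩
  -- With `q = b - a'`, twice the integral of `q φ' φ` is minus that of `q' φ²`, and `|q'| ≤ 2K`.
  have hparts := integral_deriv_mul_of_test hq (hφ.contDiff_one.mul hφ.contDiff_one)
    hφ.2.mul_left
  have hdsq : ∀ x, deriv (fun y => φ y * φ y) x = 2 * (deriv φ x * φ x) := fun x => by
    have h := (hφ.differentiable x).hasDerivAt
    exact (h.mul h).deriv.trans (by ring)
  have hnorm : ‖hφ.toH.1 0‖ ^ 2 = ∫ x, φ x * φ x := by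
    rw [← real_inner_self_eq_norm_sq]
    change inner ℝ _ hφ.memLp.toLp = _
    rw [← integral_mul_toLp]
    refine integral_congr_ae ?_
    filter_upwards [hφ.toH_D_zero] with x hx
    rw [H.D] at hx
    rw [hx]
  have hint : ∀ {η : ℝ → ℝ}, Continuous η → Integrable fun x => η x * φ x := fun hη =>
    (hη.mul hφc).integrable_of_hasCompactSupport hφ.2.mul_left
  have hlocal : hc.localForm s hφ.toH hφ.toH
      ≤ (∫ x, (b s x - deriv (a s) x) * deriv φ x * φ x) + ∫ x, c s x * φ x * φ x := by
    rw [hc.localForm_toH]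
    have e0 := hφ.toH_D_zero
    have e1 := hφ.toH_D_one
    refine add_le_add ?_ (le_of_eq (integral_congr_ae ?_))
    · have hd : ∫ x, hφ.toH.D 1 x * (-(φ x * deriv (a s) x) - a s x * deriv φ x + b s x * φ x)
          = ∫ x, ((b s x - deriv (a s) x) * deriv φ x * φ x - a s x * deriv φ x * deriv φ x) := by
        refine integral_congr_ae ?_
        filter_upwards [e1] with x hx
        rw [hx]
        ring
      rw [hd]
      have i1 : Integrable fun x => a s x * deriv φ x * deriv φ x :=
        ((hac.continuous.mul hdc).mul hdc).integrable_of_hasCompactSupport hφ.deriv.2.mul_left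
      -- The degenerate second order term enters as `-a (φ')²` and is dropped, by `a ≥ 0`.
      refine integral_mono ((hint (hqc.mul hdc)).sub i1) (hint (hqc.mul hdc)) fun x => ?_
      have h := mul_nonneg (hc.nonneg_a s x) (mul_self_nonneg (deriv φ x))
      change _ - a s x * deriv φ x * deriv φ x ≤ _
      linarith [mul_assoc (a s x) (deriv φ x) (deriv φ x)]
    · filter_upwards [e0] with x hx
      rw [hx]
  have hdrift : ∫ x, (b s x - deriv (a s) x) * deriv φ x * φ x ≤ K * ∫ x, φ x * φ x := by
    have e : ∫ x, (b s x - deriv (a s) x) * deriv (fun y => φ y * φ y) x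
        = 2 * ∫ x, (b s x - deriv (a s) x) * deriv φ x * φ x := by
      rw [← integral_const_mul]
      refine integral_congr_ae (ae_of_all _ fun x => ?_)
      change _ * deriv (fun y => φ y * φ y) x = _
      rw [hdsq]
      ring
    have e2 : -(2 * K) * ∫ x, φ x * φ x
        ≤ ∫ x, deriv (fun x => b s x - deriv (a s) x) x * (φ x * φ x) := by
      rw [← integral_const_mul]
      refine integral_mono ((hint hφc).const_mul _) ?_ fun x => ?_
      · have := hint (hq'c.mul hφc)
        simpa only [Pi.mul_apply, mul_assoc] using this
      · have h1 := abs_le.1 (hq' x)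
        exact mul_le_mul_of_nonneg_right h1.1 (mul_self_nonneg _)
    rw [e] at hparts
    linarith
  have hzero : ∫ x, c s x * φ x * φ x ≤ K * ∫ x, φ x * φ x := by
    rw [← integral_const_mul]
    refine integral_mono (hint (hcc.mul hφc)) ((hint hφc).const_mul _) fun x => ?_
    have h1 := abs_le.1 (hc.abs_c_le s x)
    have h := mul_le_mul_of_nonneg_right h1.2 (mul_self_nonneg (φ x))
    change c s x * φ x * φ x ≤ K * (φ x * φ x)
    linarith [mul_assoc (c s x) (φ x) (φ x)]
  rw [hnorm]
  linarith

/-- Both sides are continuous on `H¹`, so the inequality passes from the dense set of test functions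
to its closure. -/
theorem Coeffs.form_self_le {K : ℝ} {a b c : ℝ → ℝ → ℝ} {ν : Measure ℝ}
    (hc : Coeffs K a b c) (hν : IsLevyMeasure ν) (s : ℝ) (g : H 1) :
    hc.localForm s g g + levyForm hν g g ≤ 2 * K * ‖g.1 0‖ ^ 2 := by
  have h1 : Continuous fun g : H 1 => hc.localForm s g g :=
    Continuous.comp (g := fun p : H 1 × H 1 => hc.localForm s p.1 p.2) (f := fun g => (g, g))
      (hc.continuous_localForm s) (by fun_prop)
  have h2 : Continuous fun g : H 1 => levyForm hν g g :=
    Continuous.comp (g := fun p : H 1 × H 1 => levyForm hν p.1 p.2) (f := fun g => (g, g))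
      (continuous_levyForm hν) (by fun_prop)
  have h3 : Continuous fun g : H 1 => 2 * K * ‖g.1 0‖ ^ 2 :=
    continuous_const.mul ((H.continuous_coe 0).norm.pow 2)
  have hcl : IsClosed {g : H 1 | hc.localForm s g g + levyForm hν g g ≤ 2 * K * ‖g.1 0‖ ^ 2} :=
    isClosed_le (h1.add h2) h3
  have hsub : (range fun φ : {φ : ℝ → ℝ // IsTestFunction φ} => φ.2.toH)
      ⊆ {g : H 1 | hc.localForm s g g + levyForm hν g g ≤ 2 * K * ‖g.1 0‖ ^ 2} := by
    rintro _ ⟨φ, rfl⟩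
    rw [mem_ofPred_eq]
    exact hc.form_self_le_of_test hν s φ.2
  have hmem : g ∈ closure (range fun φ : {φ : ℝ → ℝ // IsTestFunction φ} => φ.2.toH) :=
    denseRange_toH g
  exact closure_minimal hsub hcl hmem

end

end LevyFD



namespace LevyFD

noncomputable section

open Filter Topology

/-! ### Uniqueness -/

/-- Weak continuity of curves in `H¹`. -/
def WeaklyContinuous (w : ℝ → H 1) : Prop := ∀ y : H 1, Continuous fun t => inner ℝ (w t) y

namespace WeaklyContinuous

variable {w : ℝ → H 1}

/-- Composition with a bounded operator preserves weak continuity, through the adjoint. -/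
theorem inner_comp (hw : WeaklyContinuous w) (S : H 1 →L[ℝ] L2) (y : L2) :
    Continuous fun t => inner ℝ (S (w t)) y := by
  simpa only [ContinuousLinearMap.adjoint_inner_right] using hw (ContinuousLinearMap.adjoint S y)

theorem inner_comp' (hw : WeaklyContinuous w) (S : H 1 →L[ℝ] L2) (y : L2) :
    Continuous fun t => inner ℝ y (S (w t)) := by
  simpa only [real_inner_comm] using hw.inner_comp S y

theorem levyForm_left (hw : WeaklyContinuous w) {ν : Measure ℝ} (hν : IsLevyMeasure ν) (g : H 1) :
    Continuous fun t => levyForm hν (w t) g :=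
  (hw.inner_comp' (H.proj 0) _).sub (hw.inner_comp' (H.proj 1) _)

theorem levyForm_right (hw : WeaklyContinuous w) {ν : Measure ℝ} (hν : IsLevyMeasure ν)
    (φ : H 1) : Continuous fun t => levyForm hν φ (w t) :=
  (hw.inner_comp ((farOp hν).comp (H.proj 0)) _).sub
    (hw.inner_comp ((nearOp hν).comp (H.proj 1)) _)

variable {K : ℝ} {a b c : ℝ → ℝ → ℝ}

theorem localForm_left (hw : WeaklyContinuous w) (hc : Coeffs K a b c) (s : ℝ) (g : H 1) :
    Continuous fun t => hc.localForm s (w t) g :=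
  ((hw.inner_comp ((mulCLM (hc.measurable_drift_apply s) (hc.abs_drift_le s)).comp (H.proj 0)) _).sub
    (hw.inner_comp ((mulCLM (hc.measurable_a_apply s) (hc.abs_a_le s)).comp (H.proj 1)) _)).add
    (hw.inner_comp ((mulCLM (hc.measurable_c_apply s) (hc.abs_c_le s)).comp (H.proj 0)) _)

/-- The coefficients are only measurable in time and `w` is only weakly continuous. Giving them
separate time variables yields a Carathéodory function, jointly measurable, which is then restricted
to the diagonal. -/
theorem stronglyMeasurable_localForm (hw : WeaklyContinuous w) (hc : Coeffs K a b c) (φ : H 1) :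
    StronglyMeasurable fun s => hc.localForm s φ (w s) := by
  have key : ∀ {q : ℝ → ℝ → ℝ} {C : ℝ} (_ : Measurable fun p : ℝ × ℝ => q p.1 p.2)
      (hq' : ∀ r, Measurable (q r)) (hC : ∀ r x, |q r x| ≤ C) (y : L2) (j : Fin 2),
      StronglyMeasurable fun s => inner ℝ (mulCLM (hq' s) (hC s) y) ((w s).1 j) := by
    intro q C hq hq' hC y j
    have h := stronglyMeasurable_uncurry_of_continuous_of_stronglyMeasurable
      (u := fun t s : ℝ => inner ℝ (mulCLM (hq' s) (hC s) y) ((w t).1 j))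
      (fun s => hw.inner_comp' (H.proj j) _)
      (fun t => measurable_inner_mulCLM hq hq' hC y ((w t).1 j))
    exact h.comp_measurable (measurable_id.prodMk measurable_id)
  exact ((key hc.measurable_drift hc.measurable_drift_apply hc.abs_drift_le _ 1).sub
    (key hc.measurable_a hc.measurable_a_apply hc.abs_a_le _ 1)).add
    (key hc.measurable_c hc.measurable_c_apply hc.abs_c_le _ 0)

end WeaklyContinuous

theorem intervalIntegrable_of_bounded {f : ℝ → ℝ} {C : ℝ} (hf : StronglyMeasurable f)
    (hC : ∀ s, |f s| ≤ C) (s t : ℝ) : IntervalIntegrable f volume s t :=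
  (intervalIntegrable_const (c := C)).mono_fun hf.aestronglyMeasurable
    (ae_of_all _ fun s => (hC s).trans (le_abs_self C))

/-- The homogeneous equation with zero initial value has only the zero solution. -/
theorem eq_zero_of_form_equation {T K : ℝ} (hT : 0 < T) {ν : Measure ℝ} {a b c : ℝ → ℝ → ℝ}
    (hc : Coeffs K a b c) (hν : IsLevyMeasure ν) {w : ℝ → H 1} (hw : WeaklyContinuous w) {M : ℝ}
    (hM : ∀ t, ‖w t‖ ≤ M)
    (heq : ∀ (φ : ℝ → ℝ) (hφ : IsTestFunction φ), ∀ t ∈ Icc 0 T,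
      inner ℝ ((w t).1 0) (hφ.toH.1 0)
        = ∫ s in (0 : ℝ)..t, (hc.localForm s hφ.toH (w s) + levyForm hν hφ.toH (w s)))
    {t : ℝ} (ht : t ∈ Icc 0 T) : (w t).1 0 = 0 := by
  have hM0 : 0 ≤ M := (norm_nonneg _).trans (hM 0)
  have hK : 0 ≤ K := hc.nonneg
  obtain ⟨C', hC'0, hC'⟩ := exists_abs_levyForm_le hν
  set B : ℝ → H 1 → H 1 → ℝ := fun s φ g => hc.localForm s φ g + levyForm hν φ g with hB
  obtain ⟨C, hC0, hC⟩ : ∃ C, 0 ≤ C ∧ ∀ s φ g, |B s φ g| ≤ C * (‖φ‖ * ‖g‖) := by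
    refine ⟨4 * K + C', by positivity, fun s φ g => (abs_add_le _ _).trans ?_⟩
    rw [add_mul]
    exact add_le_add (hc.abs_localForm_le s φ g) (hC' φ g)
  have hCM : ∀ s φ, |B s φ (w s)| ≤ C * (‖φ‖ * M) := fun s φ => (hC s φ _).trans (by
    have := hM s
    gcongr)
  have hmeas : ∀ φ, StronglyMeasurable fun s => B s φ (w s) := fun φ =>
    (hw.stronglyMeasurable_localForm hc φ).add (hw.levyForm_right hν φ).stronglyMeasurable
  have hint : ∀ φ s t, IntervalIntegrable (fun r => B r φ (w r)) volume s t := fun φ =>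
    intervalIntegrable_of_bounded (hmeas φ) fun s => hCM s φ
  -- Extending the equation by density to all of `H¹` permits testing with the values `w t` of the
  -- curve itself.
  have heq' : ∀ φ : H 1, ∀ t ∈ Icc 0 T,
      inner ℝ ((w t).1 0) (φ.1 0) = ∫ s in (0 : ℝ)..t, B s φ (w s) := by
    intro φ t ht
    have h1 : Continuous fun φ : H 1 => inner ℝ ((w t).1 0) (φ.1 0) :=
      continuous_const.inner (H.continuous_coe 0)
    have h2 : Continuous fun φ : H 1 => ∫ s in (0 : ℝ)..t, B s φ (w s) := by
      rw [continuous_iff_continuousAt]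
      intro φ₀
      refine intervalIntegral.continuousAt_of_dominated_interval
        (bound := fun _ => C * ((‖φ₀‖ + 1) * M))
        (Eventually.of_forall fun φ => (hmeas φ).aestronglyMeasurable) ?_
        intervalIntegrable_const (ae_of_all _ fun s _ => ?_)
      · filter_upwards [Metric.ball_mem_nhds φ₀ one_pos] with φ hφ
        refine ae_of_all _ fun s _ => (hCM s φ).trans ?_
        have h3 : ‖φ‖ ≤ ‖φ₀‖ + 1 := by
          have h4 := norm_le_norm_add_norm_sub' φ φ₀
          rw [mem_ball_iff_norm] at hφ
          linarith
        gcongr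
      · exact (Continuous.comp (g := fun p : H 1 × H 1 => B s p.1 p.2) (f := fun φ => (φ, w s))
          ((hc.continuous_localForm s).add (continuous_levyForm hν)) (by fun_prop)).continuousAt
    have hsub : (range fun φ : {φ : ℝ → ℝ // IsTestFunction φ} => φ.2.toH)
        ⊆ {φ : H 1 | inner ℝ ((w t).1 0) (φ.1 0) = ∫ s in (0 : ℝ)..t, B s φ (w s)} := by
      rintro _ ⟨φ, rfl⟩
      exact heq φ φ.2 t ht
    have hmem : φ ∈ closure (range fun φ : {φ : ℝ → ℝ // IsTestFunction φ} => φ.2.toH) :=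
      denseRange_toH φ
    exact closure_minimal hsub (isClosed_eq h1 h2) hmem
  -- The form evaluated at time `r` pairs `w r` with `w t` as test element. For fixed `r` it is
  -- continuous in `t` by weak continuity alone, which is what `energy_identity` requires.
  have energy : ∀ t ∈ Icc 0 T,
      IntervalIntegrable (fun r => B r (w r) (w r)) volume 0 t ∧
        ‖(w t).1 0‖ ^ 2 - ‖(w 0).1 0‖ ^ 2 = 2 * ∫ r in (0 : ℝ)..t, B r (w r) (w r) := by
    intro t ht
    refine energy_identity (F := fun t => ‖(w t).1 0‖ ^ 2) (B := fun r t => B r (w t) (w r))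
      (g := fun _ => C * (M * M)) (fun t _ => (hmeas (w t)).aestronglyMeasurable)
      (fun r _ => ((hw.localForm_left hc r _).add (hw.levyForm_left hν _)).continuousOn)
      (integrableOn_const (by simp)) (fun r _ t _ => (hCM r (w t)).trans ?_) ?_ ht
    · have := hM t
      gcongr
    · intro s hs t ht _
      have e1 : ∀ φ : H 1, inner ℝ ((w t).1 0) (φ.1 0) - inner ℝ ((w s).1 0) (φ.1 0)
          = ∫ r in s..t, B r φ (w r) := fun φ => by
        rw [heq' φ t ht, heq' φ s hs, intervalIntegral.integral_interval_sub_left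
          (hint _ _ _) (hint _ _ _)]
      rw [intervalIntegral.integral_add (hint _ _ _) (hint _ _ _), ← e1, ← e1,
        real_inner_self_eq_norm_sq, real_inner_self_eq_norm_sq, real_inner_comm]
      ring
  have h00 : ‖(w 0).1 0‖ ^ 2 = 0 := by
    rw [← real_inner_self_eq_norm_sq, heq' (w 0) 0 ⟨le_rfl, hT.le⟩,
      intervalIntegral.integral_same]
  have hF : ∀ t ∈ Icc 0 T, ‖(w t).1 0‖ ^ 2 = 2 * ∫ r in (0 : ℝ)..t, B r (w r) (w r) :=
    fun t ht => by rw [← (energy t ht).2, h00, sub_zero]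
  have hIT := (energy T ⟨hT.le, le_rfl⟩).1
  -- Weak continuity does not give continuity of the norm; the energy identity does, since it writes
  -- the squared norm as a primitive.
  have hcont : ContinuousOn (fun t => ‖(w t).1 0‖ ^ 2) (Icc 0 T) := by
    have h := intervalIntegral.continuousOn_primitive_interval (μ := volume)
      (f := fun r => B r (w r) (w r)) (a := 0) (b := T)
      (by rw [uIcc_of_le hT.le]; exact (intervalIntegrable_iff_integrableOn_Icc_of_le hT.le).1 hIT)
    rw [uIcc_of_le hT.le] at h
    exact (continuousOn_const.mul h).congr hF
  have hgron := gronwall_integral (T := T) (C := 0) (N := 4 * K)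
    (φ := fun t => ‖(w t).1 0‖ ^ 2) (by positivity) hcont (fun t ht => by
      have hle : ∫ r in (0 : ℝ)..t, B r (w r) (w r)
          ≤ ∫ r in (0 : ℝ)..t, 2 * K * ‖(w r).1 0‖ ^ 2 := by
        refine intervalIntegral.integral_mono_on ht.1 (energy t ht).1 ?_
          fun r _ => hc.form_self_le hν r (w r)
        refine ContinuousOn.intervalIntegrable ?_
        rw [uIcc_of_le ht.1]
        exact continuousOn_const.mul (hcont.mono (Icc_subset_Icc_right ht.2))
      rw [intervalIntegral.integral_const_mul] at hle
      simp only [hF t ht]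
      linarith) t ht
  rw [zero_mul] at hgron
  have h0 : ‖(w t).1 0‖ = 0 := by
    have := sq_nonneg ‖(w t).1 0‖
    exact pow_eq_zero_iff (two_ne_zero) |>.1 (le_antisymm hgron this)
  exact norm_eq_zero.1 h0

/-- Against each fixed element the curve is bounded on the compact interval; uniform boundedness
gives a bound in norm. -/
theorem exists_norm_le_of_weaklyContinuousOn {T : ℝ} {u : ℝ → H 1}
    (hu : ∀ y : H 1, ContinuousOn (fun t => inner ℝ (u t) y) (Icc 0 T)) :
    ∃ M, ∀ t ∈ Icc 0 T, ‖u t‖ ≤ M := by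
  obtain ⟨M, hM⟩ := banach_steinhaus (g := fun t : Icc (0 : ℝ) T => innerSL ℝ (u t))
    (fun y => by
      obtain ⟨M, hM⟩ := isCompact_Icc.exists_bound_of_continuousOn (hu y)
      exact ⟨M, fun t => hM t t.2⟩)
  refine ⟨M, fun t ht => ?_⟩
  simpa only [innerSL_apply_norm] using hM ⟨t, ht⟩

/-- A solution satisfies the equation in terms of the bilinear form. -/
theorem IsSolution.form_equation {m : ℕ} {T K : ℝ} {ν : Measure ℝ} {a b c : ℝ → ℝ → ℝ}
    {ψ : H m} {f : ℝ → H m} {u : ℝ → H 1} (hc : Coeffs K a b c) (hν : IsLevyMeasure ν)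
    (h : IsSolution T ν a b c ψ f u) {w : ℝ → H 1} (hw : WeaklyContinuous w)
    {M : ℝ} (hM : ∀ t, ‖w t‖ ≤ M) (huw : ∀ t ∈ Icc 0 T, w t = u t)
    {φ : ℝ → ℝ} (hφ : IsTestFunction φ) {t : ℝ} (ht : t ∈ Icc 0 T) :
    IntervalIntegrable (fun s => hc.localForm s hφ.toH (w s)) volume 0 t ∧
    inner ℝ ((w t).1 0) (hφ.toH.1 0)
      = (∫ x, ψ.D 0 x * φ x) + (∫ s in (0 : ℝ)..t, hc.localForm s hφ.toH (w s))
        + (∫ s in (0 : ℝ)..t, levyForm hν hφ.toH (w s))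
        + ∫ s in (0 : ℝ)..t, ∫ x, (f s).D 0 x * φ x := by
  have hK : 0 ≤ K := hc.nonneg
  have hu : ∀ s ∈ uIcc 0 t, w s = u s := fun s hs => by
    rw [uIcc_of_le ht.1] at hs
    exact huw s ⟨hs.1, hs.2.trans ht.2⟩
  have h1 : ∫ s in (0 : ℝ)..t, hc.localForm s hφ.toH (w s) = ∫ s in (0 : ℝ)..t,
      ((∫ x, (u s).D 1 x * (-(φ x * deriv (a s) x) - a s x * deriv φ x + b s x * φ x))
        + ∫ x, c s x * (u s).D 0 x * φ x) :=
    intervalIntegral.integral_congr fun s hs => by rw [hu s hs, hc.localForm_toH]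
  have h2 : ∫ s in (0 : ℝ)..t, levyForm hν hφ.toH (w s)
      = (∫ s in (0 : ℝ)..t, ∫ z in {z : ℝ | 1 < |z|},
          (∫ x, ((u s).D 0 (x + z) - (u s).D 0 x) * φ x) ∂ν)
        - ∫ s in (0 : ℝ)..t, ∫ z in {z : ℝ | |z| ≤ 1}, (∫ θ in (0 : ℝ)..1,
          (1 - θ) * z ^ 2 * ∫ x, (u s).D 1 (x + θ * z) * deriv φ x) ∂ν := by
    have c1 := hw.inner_comp ((farOp hν).comp (H.proj 0)) (hφ.toH.1 0)
    have c2 := hw.inner_comp ((nearOp hν).comp (H.proj 1)) (hφ.toH.1 1)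
    rw [show (∫ s in (0 : ℝ)..t, levyForm hν hφ.toH (w s)) = _ from
      intervalIntegral.integral_sub (c1.intervalIntegrable 0 t) (c2.intervalIntegrable 0 t)]
    congr 1
    · refine intervalIntegral.integral_congr fun s hs => ?_
      rw [← inner_farOp_toH hν hφ, ← hu s hs]
    · refine intervalIntegral.integral_congr fun s hs => ?_
      rw [← inner_nearOp_toH hν hφ, ← hu s hs]
  refine ⟨intervalIntegrable_of_bounded (hw.stronglyMeasurable_localForm hc _)
    (C := 4 * K * (‖hφ.toH‖ * M)) (fun s => (hc.abs_localForm_le _ _ _).trans ?_) _ _, ?_⟩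
  · have := hM s
    gcongr
  · have e := h.equation φ hφ t ht
    rw [h1, h2, huw t ht]
    have e0 : inner ℝ ((u t).1 0) (hφ.toH.1 0) = ∫ x, (u t).D 0 x * φ x :=
      (integral_mul_toLp _ hφ.memLp).symm
    rw [e0, e]
    ring

/-- The forcing and the initial value cancel in the difference, which solves the homogeneous
equation. Vanishing of its `L₂` component is enough, as pointwise values depend on that component
only. -/
theorem IsSolution.unique {m : ℕ} {T K : ℝ} (hT : 0 < T) {ν : Measure ℝ} {a b c : ℝ → ℝ → ℝ}
    {ψ : H m} {f : ℝ → H m} {u u' : ℝ → H 1} (hc : Coeffs K a b c) (hν : IsLevyMeasure ν)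
    (h : IsSolution T ν a b c ψ f u) (h' : IsSolution T ν a b c ψ f u') {t : ℝ}
    (ht : t ∈ Icc 0 T) : (u t).eval = (u' t).eval := by
  obtain ⟨M, hM⟩ := exists_norm_le_of_weaklyContinuousOn h.weaklyContinuous
  obtain ⟨M', hM'⟩ := exists_norm_le_of_weaklyContinuousOn h'.weaklyContinuous
  -- Freezing the curves outside `[0, T]` makes them weakly continuous and bounded on the whole line
  -- without changing the equation on `[0, T]`.
  let p : ℝ → ℝ := fun s => projIcc 0 T hT.le s
  have hp : ∀ s, p s ∈ Icc 0 T := fun s => (projIcc 0 T hT.le s).2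
  have hpc : Continuous p := continuous_subtype_val.comp continuous_projIcc
  have hpe : ∀ s ∈ Icc 0 T, p s = s := fun s hs => congrArg Subtype.val (projIcc_of_mem hT.le hs)
  let W : ℝ → H 1 := fun s => u (p s)
  let W' : ℝ → H 1 := fun s => u' (p s)
  have hW : WeaklyContinuous W := fun y => (h.weaklyContinuous y).comp_continuous hpc hp
  have hW' : WeaklyContinuous W' := fun y => (h'.weaklyContinuous y).comp_continuous hpc hp
  have hWW : WeaklyContinuous fun s => W s - W' s := fun y => by
    have := (hW y).sub (hW' y)
    simp only [inner_sub_left]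
    exact this
  have key : ((W t - W' t : H 1)).1 0 = 0 := by
    refine eq_zero_of_form_equation hT hc hν hWW (M := M + M')
      (fun s => (norm_sub_le _ _).trans (add_le_add (hM _ (hp s)) (hM' _ (hp s)))) ?_ ht
    intro φ hφ t ht
    obtain ⟨i1, e1⟩ := h.form_equation hc hν hW (fun s => hM _ (hp s))
      (fun s hs => congrArg u (hpe s hs)) hφ ht
    obtain ⟨i2, e2⟩ := h'.form_equation hc hν hW' (fun s => hM' _ (hp s))
      (fun s hs => congrArg u' (hpe s hs)) hφ ht
    have j1 := (hW.levyForm_right hν hφ.toH).intervalIntegrable (μ := volume) 0 t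
    have j2 := (hW'.levyForm_right hν hφ.toH).intervalIntegrable (μ := volume) 0 t
    have e0 : ((W t - W' t : H 1)).1 0 = (W t).1 0 - (W' t).1 0 := rfl
    simp only [hc.localForm_sub, levyForm_sub]
    rw [intervalIntegral.integral_add (i1.sub i2) (j1.sub j2),
      intervalIntegral.integral_sub i1 i2, intervalIntegral.integral_sub j1 j2, e0,
      inner_sub_left, e1, e2]
    ring
  have key' : (u t).1 0 - (u' t).1 0 = 0 := by
    simp only [W, W', hpe t ht] at key
    exact key
  rw [H.eval, H.eval]
  have : (u t).D 0 = (u' t).D 0 := by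
    funext x
    rw [H.D, H.D, sub_eq_zero.1 key']
  rw [this]

end

end LevyFD



namespace LevyFD

noncomputable section

open Filter Topology

/-! ### The error estimate -/

variable {m : ℕ} {K T : ℝ} {ν : Measure ℝ} {a b c : ℝ → ℝ → ℝ} {ψ : H m} {f : ℝ → H m}

theorem measurable_indicator_time
    (ha : Measurable fun p : Icc (0 : ℝ) T × ℝ => a p.1 p.2) :
    Measurable fun p : ℝ × ℝ => (Icc 0 T).indicator a p.1 p.2 := by
  have hs : MeasurableSet (Icc (0 : ℝ) T ×ˢ (univ : Set ℝ)) := measurableSet_Icc.prod .univ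
  refine measurable_of_restrict_of_restrict_compl hs ?_ ?_
  · have h : Measurable fun p : (Icc (0 : ℝ) T ×ˢ (univ : Set ℝ) : Set (ℝ × ℝ)) =>
        ((⟨p.1.1, p.2.1⟩, p.1.2) : Icc (0 : ℝ) T × ℝ) :=
      ((measurable_fst.comp measurable_subtype_coe).subtype_mk).prodMk
        (measurable_snd.comp measurable_subtype_coe)
    convert ha.comp h using 1
    funext p
    simp only [domRestrict_apply, Function.comp, indicator_of_mem p.2.1]
  · convert measurable_const (a := (0 : ℝ)) using 1
    funext p
    have hp : p.1.1 ∉ Icc 0 T := fun h => p.2 ⟨h, mem_univ _⟩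
    simp only [domRestrict_apply, indicator_of_notMem hp, Pi.zero_apply]

/-- The coefficients extended by zero outside the time interval. -/
theorem BoundedCoefficients.coeffs_indicator (h : BoundedCoefficients m K T a b c) (hT : 0 < T)
    (hm : 4 ≤ m) (ha : ∀ t ∈ Icc 0 T, ∀ x, 0 ≤ a t x) :
    Coeffs K ((Icc 0 T).indicator a) ((Icc 0 T).indicator b) ((Icc 0 T).indicator c) := by
  have hK : 0 ≤ K := (abs_nonneg _).trans (h.bound_c 0 ⟨le_rfl, hT.le⟩ 0 (Nat.zero_le m) 0)
  have hsmooth : ∀ (a : ℝ → ℝ → ℝ), (∀ t ∈ Icc 0 T, ContDiff ℝ 4 (a t)) →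
      ∀ t, ContDiff ℝ 4 ((Icc 0 T).indicator a t) := fun a ha t => by
    by_cases ht : t ∈ Icc 0 T
    · rw [indicator_of_mem ht]
      exact ha t ht
    · rw [indicator_of_notMem ht]
      exact contDiff_const
  have hbound : ∀ (a : ℝ → ℝ → ℝ), (∀ t ∈ Icc 0 T, ∀ j ≤ 4, ∀ x, |iteratedDeriv j (a t) x| ≤ K) →
      ∀ t, ∀ j ≤ 4, ∀ x, |iteratedDeriv j ((Icc 0 T).indicator a t) x| ≤ K :=
    fun a ha t j hj x => by
      by_cases ht : t ∈ Icc 0 T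
      · rw [indicator_of_mem ht]
        exact ha t ht j hj x
      · have e : iteratedDeriv j (0 : ℝ → ℝ) x = 0 := by simp
        rw [indicator_of_notMem ht, e, abs_zero]
        exact hK
  have hm' : (4 : WithTop ℕ∞) ≤ (m : ℕ) := by exact_mod_cast hm
  have hm2 : (4 : WithTop ℕ∞) ≤ (max m 2 : ℕ) := by exact_mod_cast hm.trans (le_max_left m 2)
  exact
    { measurable_a := measurable_indicator_time h.measurable_a
      measurable_b := measurable_indicator_time h.measurable_b
      measurable_c := measurable_indicator_time h.measurable_c
      contDiff_a := hsmooth a fun t ht => (h.contDiff_a t ht).of_le hm2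
      contDiff_b := hsmooth b fun t ht => (h.contDiff_b t ht).of_le hm'
      contDiff_c := hsmooth c fun t ht => (h.contDiff_c t ht).of_le hm'
      bound_a := hbound a fun t ht j hj => h.bound_a t ht j (hj.trans (hm.trans (le_max_left m 2)))
      bound_b := hbound b fun t ht j hj => h.bound_b t ht j (hj.trans hm)
      bound_c := hbound c fun t ht j hj => h.bound_c t ht j (hj.trans hm)
      nonneg_a := fun t x => by
        by_cases ht : t ∈ Icc 0 T
        · rw [indicator_of_mem ht]
          exact ha t ht x
        · rw [indicator_of_notMem ht]
          exact le_rfl }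

theorem uIcc_zero_subset {t : ℝ} (ht : t ∈ Icc 0 T) : uIcc 0 t ⊆ Icc 0 T := by
  rw [uIcc_of_le ht.1]
  exact Icc_subset_Icc_right ht.2

theorem IsSolution.indicator {u : ℝ → H 1} (h : IsSolution T ν a b c ψ f u) :
    IsSolution T ν ((Icc 0 T).indicator a) ((Icc 0 T).indicator b) ((Icc 0 T).indicator c) ψ f
      u where
  weaklyContinuous := h.weaklyContinuous
  equation φ hφ t ht := by
    rw [h.equation φ hφ t ht]
    congr 4
    refine intervalIntegral.integral_congr fun s hs => ?_
    simp only [indicator_of_mem (uIcc_zero_subset ht hs)]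

theorem IsGridSolution.indicator {h : ℝ} {v : ℝ → lp (fun _ : ℤ => ℝ) 2}
    (hv : IsGridSolution T ν a b c ψ f h v) :
    IsGridSolution T ν ((Icc 0 T).indicator a) ((Icc 0 T).indicator b) ((Icc 0 T).indicator c) ψ f
      h v where
  continuousOn := hv.continuousOn
  equation t ht k := by
    rw [hv.equation t ht k]
    congr 1
    refine intervalIntegral.integral_congr fun s hs => ?_
    simp only [indicator_of_mem (uIcc_zero_subset ht hs)]

/-- The given grid solution is level 0 of the dyadic family, and uniqueness identifies `u` with the
limit of the family; the bound on the distance between level 0 and the limit is the error estimate.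
-/
theorem error_estimate (hm : 4 ≤ m) (hT : 0 < T) (hν : IsLevyMeasure ν) (hc : Coeffs K a b c)
    (hf : MemLp f 2 (volume.restrict (Icc 0 T))) {h : ℝ} (hh : h ∈ meshSizes)
    {u : ℝ → H 1} (hu : IsSolution T ν a b c ψ f u) {v : ℝ → lp (fun _ : ℤ => ℝ) 2}
    (hv : IsGridSolution T ν a b c ψ f h v) {t : ℝ} (ht : t ∈ Icc 0 T) :
    (∀ k : ℤ, |(u t).eval (k * h) - v t k| ^ 2
      ≤ 2 * compConst K (mu0 ν) (mu2 ν) T * h ^ 2 * dataSq T ψ f) ∧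
    gridNormSq h (fun k => (u t).eval (k * h) - v t k)
      ≤ ENNReal.ofReal (2 * compConst K (mu0 ν) (mu2 ν) T * h ^ 2 * dataSq T ψ f) := by
  obtain ⟨V, hV, hV0, hx⟩ := exists_isDyadicCauchy hν hT.le hc hm hf hh
    (hv.isScheme hν hc hm hf hh)
  have heq : (u t).eval = dyadicLim h (fun j => V j t) := by
    rw [hu.unique hT hc hν (limitSolution_isSolution hν hc hm hf hh hV hx) ht,
      (limitSolution_spec hh (hx t ht)).2.2.1]
  obtain ⟨h1, h2⟩ := (hx t ht).error_bound hh
  simp only [hV0 t ht] at h1 h2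
  have e : 2 * (compConst K (mu0 ν) (mu2 ν) T * dataSq T ψ f) * h ^ 2
      = 2 * compConst K (mu0 ν) (mu2 ν) T * h ^ 2 * dataSq T ψ f := by ring
  rw [e] at h1 h2
  rw [heq]
  exact ⟨h1, h2⟩

theorem compConst_nonneg (K μ0 μ2 : ℝ) (hT : 0 ≤ T) : 0 ≤ compConst K μ0 μ2 T := by
  unfold compConst
  positivity

end

end LevyFD



theorem mainTheorem1 :
    ∃ N : ℕ → ℝ → ℝ → ℝ → ℝ → ℝ,
      ∀ (m : ℕ) (_ : 4 ≤ m) (K T : ℝ) (_ : 0 < T)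
        (ν : Measure ℝ) (_ : LevyFD.IsLevyMeasure ν)
        (a b c : ℝ → ℝ → ℝ) (_ : LevyFD.BoundedCoefficients m K T a b c)
        (_ : ∀ t ∈ Icc 0 T, ∀ x, 0 ≤ a t x)
        (ψ : LevyFD.H m) (f : ℝ → LevyFD.H m) (_ : MemLp f 2 (volume.restrict (Icc 0 T)))
        (h : ℝ) (_ : h ∈ LevyFD.meshSizes)
        (u : ℝ → LevyFD.H 1) (_ : LevyFD.IsSolution T ν a b c ψ f u)
        (v : ℝ → lp (fun _ : ℤ => ℝ) 2) (_ : LevyFD.IsGridSolution T ν a b c ψ f h v),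
        (⨆ t ∈ Icc 0 T, ⨆ k : ℤ,
            ENNReal.ofReal (|(u t).eval (k * h) - v t k| ^ 2))
          + (⨆ t ∈ Icc 0 T,
              LevyFD.gridNormSq h (fun k => (u t).eval (k * h) - v t k))
        ≤ ENNReal.ofReal
            (N m K (LevyFD.mu0 ν) (LevyFD.mu2 ν) T * h ^ 2 * LevyFD.dataSq T ψ f) := by
  -- Each of the two suprema is bounded with the constant `2 * compConst`.
  refine ⟨fun _ K μ0 μ2 T => 4 * LevyFD.compConst K μ0 μ2 T, ?_⟩
  intro m hm K T hT ν hν a b c habc ha ψ f hf h hh u hu v hv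
  have key := fun t (ht : t ∈ Icc 0 T) => LevyFD.error_estimate hm hT hν
    (habc.coeffs_indicator hT hm ha) hf hh hu.indicator hv.indicator ht
  set E := 2 * LevyFD.compConst K (LevyFD.mu0 ν) (LevyFD.mu2 ν) T * h ^ 2 * LevyFD.dataSq T ψ f
    with hE
  have hE0 : 0 ≤ E := by
    have h1 := LevyFD.compConst_nonneg K (LevyFD.mu0 ν) (LevyFD.mu2 ν) hT.le
    have h2 := LevyFD.dataSq_nonneg hT.le ψ f
    positivity
  have e : 4 * LevyFD.compConst K (LevyFD.mu0 ν) (LevyFD.mu2 ν) T * h ^ 2 * LevyFD.dataSq T ψ f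
      = E + E := by
    rw [hE]
    ring
  rw [e, ENNReal.ofReal_add hE0 hE0]
  exact add_le_add
    (iSup₂_le fun t ht => iSup_le fun k => ENNReal.ofReal_le_ofReal ((key t ht).1 k))
    (iSup₂_le fun t ht => (key t ht).2)
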